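/- Let $\sigma$ be a Borel probability measure on $\mathbb R$, absolutely continuous with respect to Lebesgue measure, with $\int|t|^p\,d\sigma(t)<\infty$ for all $p\in\mathbb Z_{\ge0}$, and let $s\in\mathbb R$. Put $$m_1(z|x)=k_2(z|x)=\mathrm{Ai}'(z+s+x),\qquad m_2(z|x)=k_1(z|x)=\mathrm{Ai}(z+s+x),$$ and let $K_{\sigma,s}$ be the integral operator on $L^2(0,\infty)$ with kernel $K_{\sigma,s}(z,w)=K_\sigma(z+s,w+s)$, where $(x-y)K_\sigma(x,y)=\int_{\mathbb R}(\mathrm{Ai}(x+t)\mathrm{Ai}'(y+t)-\mathrm{Ai}'(x+t)\mathrm{Ai}(y+t))\,d\sigma(t)$. Then the equations $(1-K_{\sigma,s})n_i(\cdot|x)=m_i(\cdot|x)$ and $(1-K_{\sigma,s})\ell_j(\cdot|y)=k_j(\cdot|y)$ are uniquely solvable in $L^2(0,\infty)$ for $i,j\in\{1,2\}$, $x,y\in\mathbb R$; the solutions are extended to all real $z$ by the integral equations themselves, e.g. $n_i(z|x)=m_i(z|x)+\int_0^\infty K_{\sigma,s}(z,w)n_i(w|x)\,dw$. Let $\mathcal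 H_2=L^2(\mathbb R,\sigma)\oplus L^2(\mathbb R,\sigma)$. Operators on functions $\mathbb R\to\mathbb C^2$ are of the form $(Tf)(x)=D(x)f(x)+\int T_0(x,y)f(y)\,d\sigma(y)$ with a multiplication part $D$ and a $2\times2$ matrix kernel $T_0$; kernels are evaluated pointwise, and a kernel is called Hilbert–Schmidt if it and all its sections are square integrable. A family $T(z)$ is analytic on $\Omega$ if $D$ and $T_0$ are pointwise analytic in $z\in\Omega$ and $T_0$ is Hilbert–Schmidt for each $z\in\Omega$. For $z\in\mathbb C\setminus[0,\infty)$ let $X(z)=1+X_0(z)$, where $X_0(z)$ has the kernel $$X_0^{ij}(z|x,y)=(-1)^{j+1}\int_0^\infty n_i(w|x)k_j(w|y)\frac{dw}{w-z}.$$ **(a)** $X$ is the unique solution of the following Hilbert boundary value problem: $X$ is analytic on $\mathbb C\setminus[0,\infty)$; its kernel has continuous Hilbert–Schmidt boundary values $X_\pm$ on $(0,\infty)$ from the upper and lower half planes, with $X_+=X_-G$, where $G-1$ has the kernel $2\pi i(-1)^{j+1}m_i(z|x)k_j(z|y)$; for some $f_1,f_2\in L^2(\sigma)$ the kernel $X_0^{ij}(z|x,y)+(-1)^{j+1}f_i(x)k_j(0|y)\ln(-z)$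 is, near $z=0$, bounded by a constant times a power of $(1+|x|)(1+|y|)$; and for each $r>0$, on $|z|\ge r$, $X_0$ is bounded by $c\,(1+|z|)^{-1}$ times such a power. Moreover $X(z)$ has a two-sided inverse, of the form $1+{}$Hilbert–Schmidt, namely the operator with kernel part $-(-1)^{j+1}\int_0^\infty m_i(w|x)\ell_j(w|y)\frac{dw}{w-z}$. **(b)** Let $M(z)=(m_1(z|\cdot),m_2(z|\cdot))^\top$, and let $N(z)=(n_1(z|\cdot),n_2(z|\cdot))^\top$ for $z\in[0,\infty)$ and $N(z)=X(z)M(z)$ for $z\notin[0,\infty)$. For real $z$ both columns lie in $\mathcal H_2$, and $N(z)=X_\pm(z)M(z)$ for $z>0$, with either boundary value. **(c)** Let $A_1=\begin{pmatrix}0&1\\0&0\end{pmatrix}$ and let $A_2$ be multiplication by $\begin{pmatrix}0&s+x\\1&0\end{pmatrix}$. Let $A_0$ be the sum of multiplication by $\begin{pmatrix}0&s+x\\1&0\end{pmatrix}$ and the integral operator with kernel $$\begin{pmatrix}\int_0^\infty n_2(w|x)k_1(w|y)\,dw&-\int_0^\infty\big(n_2(w|x)k_2(w|y)+n_1(w|x)k_1(w|y)\big)dw\\0&-\int_0^\infty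 n_2(w|x)k_1(w|y)\,dw\end{pmatrix},$$ and let $A_{-1}$ be the integral operator with kernel entries $(-1)^jn_i(0|x)\ell_j(0|y)$. The kernels of $A_0$ and $A_{-1}$ are Hilbert–Schmidt. The operator $$Y(z)=X_z(z)X(z)^{-1}+X(z)(zA_1+A_2)X(z)^{-1},\qquad z\in\mathbb C\setminus[0,\infty),$$ extends analytically to $\mathbb C\setminus\{0\}$, and $Y(z)=A(z):=zA_1+A_0+\frac1zA_{-1}$. Moreover $A_{-1}^2=0$ and $\operatorname{tr}_{\mathcal H_2}A_{-1}=0$. **(d)** With $A(z)$ as in (c) and $B(z)=zA_1+A_0$, the Lax pair $$\frac{\partial N}{\partial z}(z)=A(z)N(z)\quad(z\ne0),\qquad\frac{\partial N}{\partial s}(z)=B(z)N(z)$$ holds, pointwise in $x$, for all real $z$ ($z\neq 0$ in the first equation). If in addition $\int e^{R\sqrt{|t|}}\,d\sigma(t)<\infty$ for all $R>0$, then $M(z),N(z)\in\mathcal H_2$ for all $z\in\mathbb C$, and the first equation holds for all $z\in\mathbb C\setminus\{0\}$ with complex derivative $\partial_z$, the second for all $z\in\mathbb C$. -/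

import Mathlib

open MeasureTheory Filter Topology Set Matrix

noncomputable section

namespace AiryLax

/-- The Airy function, as the entire function
`Ai(z) = (2πi)⁻¹ ∫ exp(t³/3 - z t) dt` over the upward vertical line `t = 1 + iy`. -/
def Ai (z : ℂ) : ℂ :=
  (1 / (2 * (Real.pi : ℂ))) *
    ∫ y : ℝ, Complex.exp ((1 + y * Complex.I) ^ 3 / 3 - z * (1 + y * Complex.I))

/-- The derivative `Ai'` of the Airy function. -/
def Ai' (z : ℂ) : ℂ := deriv Ai z

/-- `m₁(z|x) = Ai'(z+s+x)` and `m₂(z|x) = Ai(z+s+x)`; the indices `1, 2` are `0, 1 : Fin 2`. -/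
def m (s : ℝ) (i : Fin 2) (z : ℂ) (x : ℝ) : ℂ := ![Ai' (z + s + x), Ai (z + s + x)] i

/-- `k₁(z|y) = Ai(z+s+y)` and `k₂(z|y) = Ai'(z+s+y)`. -/
def k (s : ℝ) (j : Fin 2) (z : ℂ) (y : ℝ) : ℂ := ![Ai (z + s + y), Ai' (z + s + y)] j

/-- The signs in the row `[K₁, -K₂]`. -/
def sgn (j : Fin 2) : ℂ := ![1, -1] j

/-! ### The scalar operator on `L²(0, ∞)` -/

/-- The kernel `K_σ`:
`(x - y) K_σ(x,y) = ∫ (Ai(x+t) Ai'(y+t) - Ai'(x+t) Ai(y+t)) dσ(t)`,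
with its continuous extension to the diagonal. -/
def airyK (σ : Measure ℝ) (x y : ℝ) : ℂ :=
  if x = y then ∫ t : ℝ, (Ai' (x + t) ^ 2 - (x + t) * Ai (x + t) ^ 2) ∂σ
  else (∫ t : ℝ, (Ai (x + t) * Ai' (y + t) - Ai' (x + t) * Ai (y + t)) ∂σ) / (x - y)

/-- The shifted kernel `K_{σ,s}(z,w) = K_σ(z+s, w+s)`. -/
def airyKs (σ : Measure ℝ) (s z w : ℝ) : ℂ := airyK σ (z + s) (w + s)

/-- `f ∈ L²(0,∞)` solves `(1 - K_{σ,s}) f = g` on `L²(0,∞)`. -/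
def SolvesEq (σ : Measure ℝ) (s : ℝ) (g f : ℝ → ℂ) : Prop :=
  MemLp f 2 (volume.restrict (Ioi 0)) ∧
    ∀ᵐ z ∂(volume.restrict (Ioi (0 : ℝ))), f z - ∫ w in Ioi (0 : ℝ), airyKs σ s z w * f w = g z

open Classical in
/-- A representative of the `L²(0,∞)` solution of `(1 - K_{σ,s}) f = g`. -/
def someSol (σ : Measure ℝ) (s : ℝ) (g : ℝ → ℂ) : ℝ → ℂ :=
  if h : ∃ f, SolvesEq σ s g f then h.choose else 0

/-- The representative of `(1 - K_{σ,s})⁻¹ g` singled out by requiring the integral equation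
at every point: `z ↦ g(z) + ∫₀^∞ K_{σ,s}(z,w) f(w) dw`, where `f` is the `L²` solution. -/
def resolve (σ : Measure ℝ) (s : ℝ) (g : ℝ → ℂ) (z : ℝ) : ℂ :=
  g z + ∫ w in Ioi (0 : ℝ), airyKs σ s z w * someSol σ s g w

/-- `h` is the unique solution of `(1 - K_{σ,s}) h = g` in `L²(0,∞)`, and satisfies this
equation at every real point. -/
def IsTheSolution (σ : Measure ℝ) (s : ℝ) (g h : ℝ → ℂ) : Prop :=
  SolvesEq σ s g h ∧
  (∀ z : ℝ, h z - ∫ w in Ioi (0 : ℝ), airyKs σ s z w * h w = g z) ∧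
  ∀ f, SolvesEq σ s g f → f =ᵐ[volume.restrict (Ioi (0 : ℝ))] h

/-- `n_i(·|x) = (1 - K_{σ,s})⁻¹ m_i(·|x)`. -/
def n (σ : Measure ℝ) (s : ℝ) (i : Fin 2) (z : ℝ) (x : ℝ) : ℂ :=
  resolve σ s (fun w : ℝ => m s i w x) z

/-- `ℓ_j(·|y) = (1 - K_{σ,s})⁻¹ k_j(·|y)`. -/
def ell (σ : Measure ℝ) (s : ℝ) (j : Fin 2) (z : ℝ) (y : ℝ) : ℂ :=
  resolve σ s (fun w : ℝ => k s j w y) z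

/-! ### Operators on `L²(σ) ⊕ L²(σ)` -/

/-- `2 × 2` matrix kernels. -/
abbrev Ker := ℝ → ℝ → Matrix (Fin 2) (Fin 2) ℂ

/-- Integral operators with distributional kernel `D(x) δ(x-y) / σ'(y) + K(x,y)` with respect
to `σ`, recorded as the pair `(D, K)`: multiplication by `D` plus the integral operator with
kernel `K`. -/
abbrev KerOp := (ℝ → Matrix (Fin 2) (Fin 2) ℂ) × Ker

/-- The identity plus the integral operator with kernel `K`. -/
def onePlus (K : Ker) : KerOp := (fun _ => 1, K)

/-- Composition of operators, i.e. `(S ∘ T)(x,y) = ∫ S(x,t) T(t,y) dσ(t)`. -/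
def comp (σ : Measure ℝ) (S T : KerOp) : KerOp :=
  (fun x => S.1 x * T.1 x,
   fun x y => S.1 x * T.2 x y + S.2 x y * T.1 y +
     Matrix.of fun i j => ∫ t, (S.2 x t * T.2 t y) i j ∂σ)

/-- The action of an operator on a vector function. -/
def apply (σ : Measure ℝ) (T : KerOp) (f : ℝ → Fin 2 → ℂ) : ℝ → Fin 2 → ℂ :=
  fun x i => (T.1 x *ᵥ f x) i + ∫ y, (T.2 x y *ᵥ f y) i ∂σ

/-- The trace of an integral operator: the integral of its kernel over the diagonal. -/
def trace (σ : Measure ℝ) (K : Ker) : ℂ := ∑ i, ∫ x, K x x i i ∂σ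

/-- Hilbert-Schmidt kernels: square integrable with respect to `σ ⊗ σ`. Kernels are evaluated
pointwise, so each section is required to be square integrable as well. -/
def IsHS (σ : Measure ℝ) (K : Ker) : Prop :=
  ∀ i j, MemLp (fun p : ℝ × ℝ => K p.1 p.2 i j) 2 (σ.prod σ) ∧
    (∀ x, MemLp (fun y => K x y i j) 2 σ) ∧ ∀ y, MemLp (fun x => K x y i j) 2 σ

/-- Analyticity on `Ω` of an operator family: the kernels (the smooth and the diagonal part) are
pointwise analytic in `z ∈ Ω`, and for each `z ∈ Ω` the smooth part is Hilbert-Schmidt. -/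
def IsAnalyticFamily (σ : Measure ℝ) (Ω : Set ℂ) (T : ℂ → KerOp) : Prop :=
  (∀ x i j, AnalyticOnNhd ℂ (fun z => (T z).1 x i j) Ω) ∧
  (∀ x y i j, AnalyticOnNhd ℂ (fun z => (T z).2 x y i j) Ω) ∧
  ∀ z ∈ Ω, IsHS σ (T z).2

/-! ### The Hilbert boundary value problem -/

/-- The contour `[0, ∞) ⊂ ℂ`. -/
def cut : Set ℂ := {z | 0 ≤ z.re ∧ z.im = 0}

/-- `G(z) - 1`, with entries `2πi M_i(z) ⊗ (±K_j(z))`. -/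
def G₀ (s : ℝ) (z : ℝ) : Ker := fun x y =>
  Matrix.of fun i j => 2 * Real.pi * Complex.I * (sgn j * m s i z x * k s j z y)

/-- `Xb` is the kernel of the boundary value at `z`, from the side `U`, of the family `X₀`. -/
def IsBoundaryValue (X₀ : ℂ → Ker) (U : Set ℂ) (z : ℝ) (Xb : Ker) : Prop :=
  ∀ x y i j, Tendsto (fun l => X₀ l x y i j) (𝓝[U] (z : ℂ)) (𝓝 (Xb x y i j))

/-- The upper (`+`) side of the contour. -/
def upper : Set ℂ := {z | 0 < z.im}

/-- The lower (`-`) side of the contour. -/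
def lower : Set ℂ := {z | z.im < 0}

/-- `X(z) = 1 + X₀(z)` solves the operator-valued Hilbert boundary value problem with jump `G`
on `(0, ∞)`. -/
structure SolvesHilbertProblem (σ : Measure ℝ) (s : ℝ) (X₀ : ℂ → Ker) : Prop where
  /-- `X` is analytic off the contour. -/
  analytic : IsAnalyticFamily σ cutᶜ (fun z => onePlus (X₀ z))
  /-- `X` has continuous boundary values on `(0, ∞)`, with `X₊ = X₋ G`. -/
  jump : ∃ Xp Xm : ℝ → Ker,
    (∀ x y i j, ContinuousOn (fun z => Xp z x y i j) (Ioi 0) ∧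
      ContinuousOn (fun z => Xm z x y i j) (Ioi 0)) ∧
    ∀ z : ℝ, 0 < z → IsHS σ (Xp z) ∧ IsHS σ (Xm z) ∧
      IsBoundaryValue X₀ upper z (Xp z) ∧ IsBoundaryValue X₀ lower z (Xm z) ∧
      onePlus (Xp z) = comp σ (onePlus (Xm z)) (onePlus (G₀ s z))
  /-- Logarithmic behaviour at the origin; `log (-z)` is a branch of the logarithm
  on `ℂ ∖ [0, ∞)`. -/
  origin : ∃ f : Fin 2 → ℝ → ℂ, (∀ i, MemLp (f i) 2 σ) ∧ ∃ ε > (0 : ℝ), ∃ (c : ℝ) (a : ℕ),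
    ∀ z ∈ cutᶜ, ‖z‖ < ε → ∀ x y i j,
      ‖X₀ z x y i j + sgn j * f i x * k s j 0 y * Complex.log (-z)‖ ≤
        c * (1 + |x|) ^ a * (1 + |y|) ^ a
  /-- Normalization at infinity. -/
  infinity : ∀ r > (0 : ℝ), ∃ (c : ℝ) (a : ℕ), ∀ z ∈ cutᶜ, r ≤ ‖z‖ → ∀ x y i j,
    ‖X₀ z x y i j‖ ≤ c / (1 + ‖z‖) * (1 + |x|) ^ a * (1 + |y|) ^ a

/-- The kernel of `X(z) - 1`:
`X(z) = 1 + ∫₀^∞ [N_i(w) ⊗ (±K_j(w))] dw / (w - z)`. -/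
def X₀ (σ : Measure ℝ) (s : ℝ) (z : ℂ) : Ker := fun x y =>
  Matrix.of fun i j => ∫ w in Ioi (0 : ℝ), sgn j * n σ s i w x * k s j w y / (w - z)

/-- `X(z)`. -/
def X (σ : Measure ℝ) (s : ℝ) (z : ℂ) : KerOp := onePlus (X₀ σ s z)

/-- `X_z(z)`: the integral operator whose kernel is the `z`-derivative of the kernel
of `X(z)`. -/
def Xz (σ : Measure ℝ) (s : ℝ) (z : ℂ) : KerOp :=
  (0, fun x y => Matrix.of fun i j => deriv (fun l => X₀ σ s l x y i j) z)

/-- The kernel of `X(z)⁻¹ - 1`: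
`X(z)⁻¹ = 1 - ∫₀^∞ [M_i(w) ⊗ (±L_j(w))] dw / (w - z)`. -/
def Xinv₀ (σ : Measure ℝ) (s : ℝ) (z : ℂ) : Ker := fun x y =>
  Matrix.of fun i j => -∫ w in Ioi (0 : ℝ), sgn j * m s i w x * ell σ s j w y / (w - z)

/-- `X(z)⁻¹`. -/
def Xinv (σ : Measure ℝ) (s : ℝ) (z : ℂ) : KerOp := onePlus (Xinv₀ σ s z)

/-! ### The Lax pair -/

/-- `A₁`. -/
def A₁ : KerOp := (fun _ => !![0, 1; 0, 0], 0)

/-- `A₂`, so that `M_z = (z A₁ + A₂) M`. -/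
def A₂ (s : ℝ) : KerOp := (fun x => !![0, (s : ℂ) + x; 1, 0], 0)

/-- `A₀`. -/
def A₀ (σ : Measure ℝ) (s : ℝ) : KerOp :=
  (fun x => !![0, (s : ℂ) + x; 1, 0],
   fun x y =>
    !![∫ w in Ioi (0 : ℝ), n σ s 1 w x * k s 0 w y,
       -∫ w in Ioi (0 : ℝ), (n σ s 1 w x * k s 1 w y + n σ s 0 w x * k s 0 w y);
       0,
       -∫ w in Ioi (0 : ℝ), n σ s 1 w x * k s 0 w y])

/-- `A₋₁`, with entries `(-1)^j N_i(0) ⊗ L_j(0)`, `j = 1, 2`. -/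
def Am₁ (σ : Measure ℝ) (s : ℝ) : KerOp :=
  (0, fun x y => Matrix.of fun i j => -sgn j * n σ s i 0 x * ell σ s j 0 y)

/-- `A(z) = z A₁ + A₀ + A₋₁ / z`. -/
def A (σ : Measure ℝ) (s : ℝ) (z : ℂ) : KerOp := z • A₁ + A₀ σ s + z⁻¹ • Am₁ σ s

/-- `B(z) = z A₁ + A₀`. -/
def B (σ : Measure ℝ) (s : ℝ) (z : ℂ) : KerOp := z • A₁ + A₀ σ s

/-- `Y = X_z X⁻¹ + X (z A₁ + A₂) X⁻¹`. -/
def Y (σ : Measure ℝ) (s : ℝ) (z : ℂ) : KerOp :=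
  comp σ (Xz σ s z) (Xinv σ s z) +
    comp σ (X σ s z) (comp σ (z • A₁ + A₂ s) (Xinv σ s z))

/-- The column `M(z) = [m₁(z|·), m₂(z|·)]ᵀ`. -/
def M (s : ℝ) (z : ℂ) : ℝ → Fin 2 → ℂ := fun x i => m s i z x

open Classical in
/-- The column `N(z)`: it is `[n₁(z|·), n₂(z|·)]ᵀ` for `z ∈ [0, ∞)`, and `X(z) M(z)` off
this half-line. -/
def N (σ : Measure ℝ) (s : ℝ) (z : ℂ) : ℝ → Fin 2 → ℂ :=
  if z ∈ cut then fun x i => n σ s i z.re x else apply σ (X σ s z) (M s z)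

end AiryLax

end

open AiryLax

/-! ### Airy derivatives as contour integrals. -/

noncomputable section
namespace AiryLax

/-! Since `m s i` is `airyD (1 - i)` and `k s j` is `airyD j`, everything can be phrased with the
vectors `airyL2 d c`, that is Ai⁽ᵈ⁾(· + c) in L²(0,∞). Integrating the Wronskian form of the kernel
once shows that K = K_{σ,s} is the superposition, over t distributed by σ and u > 0, of the rank one
operators f ↦ ⟨Ai(·+s+t+u), f⟩ Ai(·+s+t+u) (`kerOp`, `Admissible.sub_mul_kerVal`).

Solvability. K is a norm-convergent integral of rank one operators, hence compact, and ⟨f, Kf⟩ is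
the σ-average of the L² mass on (s+t, ∞) of the Airy transform of f. That transform is a contraction
from L²(0,∞) to L²(ℝ) (`eLpNorm_airyTransform_le`) and extends to an entire function, so Kf = f
would make it vanish on a half line, hence identically, and force f = 0 (`eq_zero_of_kerOp_eq`). The
Fredholm alternative gives the resolvent R = (1 - K)⁻¹.

Three relations for K. The superposition depends on s, t, u only through s + t + u, so
differentiating in s collapses the u-integral: ∂ₛK = -∫ Ai⊗Ai dσ. For the same reason (∂_z + ∂_w)K
is the same boundary term. The Airy equation makes the commutator of multiplication by the variable
with K equal to ∫ (Ai⊗Ai' - Ai'⊗Ai) dσ. Conjugation with R turns these into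
`Admissible.hasDerivAt_resFun_param`, `Admissible.resFun_one`, `Admissible.mul_resFun` and
`Admissible.mul_resKer`; the second carries an additional term n(0|x) R K(·,0), the contribution of
the end point 0 of the half line. The s-derivative together with the multiplication formula is the
second Lax equation; the additional term, after multiplication by z, is the action of `Am₁`, which
gives the first (`Admissible.apply_B`, `Admissible.apply_A`).

The Hilbert problem. The entries of X - 1 and X⁻¹ - 1 are Cauchy transforms of products of a
resolvent function and an Airy function. The commutator relation, tested against quotients by w - l,
yields `integral_cKer_right_inverse`, `integral_cKer_left_inverse` and X M = N
(`Admissible.integral_cKer_mul`). Two integrations by parts replace 1/(w - l) by (w - l) log(w - l)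
- (w - l), which is continuous up to the contour from either side; this gives boundary values, the
Plemelj jump and the logarithm at 0 (`cauchy_eq_cauchySide`, `cauchySide_sub`). If D is the
difference of two solutions, D X⁻¹ has no jump, has a singularity weaker than a pole at 0 and
vanishes at infinity, so Morera and Liouville give D = 0 (`SolvesHilbertProblem.eq_X₀`).
Differentiating the Cauchy transforms and applying the relations above entrywise gives X_z + X (z A₁
+ A₂) = A X (`Xz_add_eq`), and composing with X⁻¹ gives Y = A.

Convergence. Airy derivatives decay faster than every power to the right, grow polynomially to the
left on the real axis, and like exp(R√|t|) when shifted by a bounded complex number. `Admissible`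
isolates the points where the σ-integrals converge, so that the real and the complex form of the Lax
pair have one proof. -/

/-- The integrand of the `n`-th derivative of the Airy function along the line `c + iy`. -/
def airyIntegrand (n : ℕ) (c : ℝ) (z : ℂ) (y : ℝ) : ℂ :=
  (-((c : ℂ) + y * Complex.I)) ^ n *
    Complex.exp (((c : ℂ) + y * Complex.I) ^ 3 / 3 - z * ((c : ℂ) + y * Complex.I))

/-- The `n`-th derivative of the Airy function. -/
def airyD (n : ℕ) (z : ℂ) : ℂ :=
  (1 / (2 * (Real.pi : ℂ))) * ∫ y : ℝ, airyIntegrand n 1 z y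

lemma airyD_zero : airyD 0 = Ai := by
  ext z; simp [airyD, Ai, airyIntegrand]

lemma continuous_airyIntegrand (n : ℕ) (c : ℝ) (z : ℂ) : Continuous (airyIntegrand n c z) := by
  unfold airyIntegrand; fun_prop

/-- With t = c + iy, Re(t³/3 - zt) = c³/3 - cy² - c Re z + y Im z. Half of the Gaussian weight cy²
survives; one quarter pays for |t|ⁿ, through vⁿ/n! ≤ eᵛ with v = √c |t|, and one quarter for y Im z.
The dependence on c stays explicit because c is later chosen in terms of z. -/
lemma norm_airyIntegrand_le (n : ℕ) {c : ℝ} (hc : 0 < c) (z : ℂ) (y : ℝ) :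
    ‖airyIntegrand n c z y‖ ≤ n.factorial * (√c)⁻¹ ^ n *
      Real.exp (√c * c + 1 + c ^ 3 / 3 - c * z.re + z.im ^ 2 / c) * Real.exp (-(c / 2) * y ^ 2) := by
  have hd : 0 < √c := Real.sqrt_pos.mpr hc
  have hdd : √c * √c = c := Real.mul_self_sqrt hc.le
  unfold airyIntegrand
  rw [norm_mul, norm_pow, norm_neg, Complex.norm_exp]
  have hre : (((c : ℂ) + y * Complex.I) ^ 3 / 3 - z * ((c : ℂ) + y * Complex.I)).re
      = c ^ 3 / 3 - c * y ^ 2 - c * z.re + y * z.im := by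
    have : ((c : ℂ) + y * Complex.I) ^ 3 / 3 - z * ((c : ℂ) + y * Complex.I)
       = ((c ^ 3 / 3 - c * y ^ 2 - c * z.re + y * z.im : ℝ) : ℂ)
        + ((c ^ 2 * y - y ^ 3 / 3 - c * z.im - y * z.re : ℝ) : ℂ) * Complex.I := by
      conv_lhs => rw [← Complex.re_add_im z]
      push_cast
      have h2 : Complex.I ^ 2 = -1 := Complex.I_sq
      have h3 : Complex.I ^ 3 = -Complex.I := Complex.I_pow_three
      ring_nf
      rw [h2, h3]; ring
    rw [this, Complex.add_re, Complex.ofReal_re, Complex.re_ofReal_mul]; simp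
  rw [hre]
  set v := √c * ‖(c : ℂ) + y * Complex.I‖ with hv
  have hn : ‖(c : ℂ) + y * Complex.I‖ ≤ c + |y| := by
    refine (norm_add_le _ _).trans ?_
    simp [abs_of_pos hc]
  have h1 : ‖(c : ℂ) + y * Complex.I‖ ^ n ≤ n.factorial * (√c)⁻¹ ^ n * Real.exp v := by
    have := Real.pow_div_factorial_le_exp v (by positivity) n
    rw [div_le_iff₀ (by positivity)] at this
    calc ‖(c : ℂ) + y * Complex.I‖ ^ n = (√c)⁻¹ ^ n * v ^ n := by
          rw [hv, mul_pow, ← mul_assoc, ← mul_pow, inv_mul_cancel₀ hd.ne', one_pow, one_mul]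
      _ ≤ (√c)⁻¹ ^ n * (Real.exp v * n.factorial) := by gcongr
      _ = _ := by ring
  calc _ ≤ (n.factorial * (√c)⁻¹ ^ n * Real.exp v) *
        Real.exp (c ^ 3 / 3 - c * y ^ 2 - c * z.re + y * z.im) := by gcongr
    _ = n.factorial * (√c)⁻¹ ^ n * Real.exp (v + (c ^ 3 / 3 - c * y ^ 2 - c * z.re + y * z.im)) := by
        rw [Real.exp_add v]; ring
    _ ≤ n.factorial * (√c)⁻¹ ^ n * Real.exp ((√c * c + 1 + c ^ 3 / 3 - c * z.re + z.im ^ 2 / c)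
          + (-(c / 2) * y ^ 2)) := by
        refine mul_le_mul_of_nonneg_left (Real.exp_le_exp.mpr ?_) (by positivity)
        have hv' : v ≤ √c * (c + |y|) := by rw [hv]; gcongr
        have e1 : √c * |y| ≤ c * y ^ 2 / 4 + 1 := by
          have := sq_nonneg (√c * |y| / 2 - 1)
          have h4 : (√c * |y|) ^ 2 = c * y ^ 2 := by rw [mul_pow, sq_abs, Real.sq_sqrt hc.le]
          nlinarith
        have e2 : y * z.im ≤ c * y ^ 2 / 4 + z.im ^ 2 / c := by
          have h5 : z.im ^ 2 / c = (z.im / √c) ^ 2 := by rw [div_pow, Real.sq_sqrt hc.le]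
          have h6 : y * z.im = (√c * y) * (z.im / √c) := by field_simp
          have h7 : c * y ^ 2 = (√c * y) ^ 2 := by rw [mul_pow, Real.sq_sqrt hc.le]
          rw [h5, h6, h7]
          nlinarith [sq_nonneg (√c * y / 2 - z.im / √c)]
        nlinarith
    _ = _ := by rw [Real.exp_add]; ring

/-- Serves as the dominating function when the contour integral is differentiated in z or in c. -/
lemma norm_airyIntegrand_le_of_mem (n : ℕ) {a b c ρ : ℝ} (ha : 0 < a) (hac : a ≤ c) (hcb : c ≤ b)
    {z : ℂ} (hz : ‖z‖ ≤ ρ) (y : ℝ) :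
    ‖airyIntegrand n c z y‖ ≤ n.factorial * (√a)⁻¹ ^ n *
      Real.exp (√b * b + 1 + b ^ 3 / 3 + b * ρ + ρ ^ 2 / a) * Real.exp (-(a / 2) * y ^ 2) := by
  have hc : 0 < c := ha.trans_le hac
  have hb : 0 < b := hc.trans_le hcb
  have hρ : 0 ≤ ρ := (norm_nonneg z).trans hz
  have h1 : -z.re ≤ ρ := (neg_le_abs _).trans ((Complex.abs_re_le_norm z).trans hz)
  have h2 : z.im ^ 2 ≤ ρ ^ 2 := by
    rw [← sq_abs]; gcongr; exact (Complex.abs_im_le_norm z).trans hz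
  refine (norm_airyIntegrand_le n hc z y).trans ?_
  have hsa : 0 < √a := Real.sqrt_pos.mpr ha
  have h3 : -(c * z.re) ≤ b * ρ := by
    calc -(c * z.re) = c * (-z.re) := by ring
      _ ≤ c * ρ := by gcongr
      _ ≤ b * ρ := by gcongr
  have h4 : z.im ^ 2 / c ≤ ρ ^ 2 / a := by gcongr
  have h5 : √c * c ≤ √b * b := by gcongr
  have h6 : c ^ 3 / 3 ≤ b ^ 3 / 3 := by gcongr
  gcongr
  linarith

lemma integrable_airyIntegrand (n : ℕ) {c : ℝ} (hc : 0 < c) (z : ℂ) :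
    Integrable (airyIntegrand n c z) := by
  refine Integrable.mono' ((integrable_exp_neg_mul_sq (b := c / 2) (by positivity)).const_mul
    (n.factorial * (√c)⁻¹ ^ n *
      Real.exp (√c * c + 1 + c ^ 3 / 3 - c * z.re + z.im ^ 2 / c)))
    (continuous_airyIntegrand n c z).aestronglyMeasurable (Eventually.of_forall fun y => ?_)
  exact norm_airyIntegrand_le n hc z y

lemma hasDerivAt_integral_airyIntegrand (n : ℕ) {c : ℝ} (hc : 0 < c) (z : ℂ) :
    HasDerivAt (fun z => ∫ y, airyIntegrand n c z y) (∫ y, airyIntegrand (n + 1) c z y) z := by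
  refine (hasDerivAt_integral_of_dominated_loc_of_deriv_le (μ := volume) (s := Metric.ball z 1)
    (F := airyIntegrand n c) (F' := airyIntegrand (n + 1) c)
    (bound := fun y => (n + 1).factorial * (√c)⁻¹ ^ (n + 1) *
      Real.exp (√c * c + 1 + c ^ 3 / 3 + c * (‖z‖ + 1) + (‖z‖ + 1) ^ 2 / c) *
        Real.exp (-(c / 2) * y ^ 2)) (Metric.ball_mem_nhds z one_pos) ?_
    (integrable_airyIntegrand n hc z) ?_ ?_ ?_ ?_).2
  · exact Eventually.of_forall fun z => (continuous_airyIntegrand n c z).aestronglyMeasurable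
  · exact (continuous_airyIntegrand (n + 1) c z).aestronglyMeasurable
  · refine Eventually.of_forall fun y w hw => norm_airyIntegrand_le_of_mem (n + 1) hc le_rfl le_rfl ?_ y
    have := norm_sub_norm_le w z
    rw [Metric.mem_ball, dist_eq_norm] at hw
    linarith
  · exact (integrable_exp_neg_mul_sq (b := c / 2) (by positivity)).const_mul _
  · refine Eventually.of_forall fun y w _ => ?_
    unfold airyIntegrand
    have h : HasDerivAt (fun z : ℂ => ((c : ℂ) + y * Complex.I) ^ 3 / 3 - z * ((c : ℂ) + y * Complex.I))
        (-(((c : ℂ) + y * Complex.I))) w := by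
      simpa using ((hasDerivAt_id w).mul_const ((c : ℂ) + y * Complex.I)).const_sub
        (((c : ℂ) + y * Complex.I) ^ 3 / 3)
    refine ((h.cexp).const_mul ((-((c : ℂ) + y * Complex.I)) ^ n)).congr_deriv ?_
    rw [pow_succ]; ring

lemma hasDerivAt_airyD (n : ℕ) (z : ℂ) : HasDerivAt (airyD n) (airyD (n + 1) z) z :=
  (hasDerivAt_integral_airyIntegrand n one_pos z).const_mul _

lemma airyD_one : airyD 1 = Ai' := by
  ext z; rw [Ai', ← airyD_zero, (hasDerivAt_airyD 0 z).deriv]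

lemma differentiable_airyD (n : ℕ) : Differentiable ℂ (airyD n) :=
  fun z => (hasDerivAt_airyD n z).differentiableAt

lemma continuous_airyD (n : ℕ) : Continuous (airyD n) := (differentiable_airyD n).continuous

lemma hasDerivAt_cubic_exp (z t : ℂ) :
    HasDerivAt (fun t : ℂ => Complex.exp (t ^ 3 / 3 - z * t))
      ((t ^ 2 - z) * Complex.exp (t ^ 3 / 3 - z * t)) t := by
  have h : HasDerivAt (fun t : ℂ => t ^ 3 / 3 - z * t) (t ^ 2 - z) t := by
    refine (((hasDerivAt_pow 3 t).div_const 3).sub ((hasDerivAt_id t).const_mul z)).congr_deriv ?_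
    simp
  exact h.cexp.congr_deriv (by ring)

/-- The Airy equation for the contour integrals. -/
lemma integral_airyIntegrand_two {c : ℝ} (hc : 0 < c) (z : ℂ) :
    ∫ y, airyIntegrand 2 c z y = z * ∫ y, airyIntegrand 0 c z y := by
  have hi : Integrable (fun y => Complex.I * (airyIntegrand 2 c z y - z * airyIntegrand 0 c z y)) :=
    ((integrable_airyIntegrand 2 hc z).sub ((integrable_airyIntegrand 0 hc z).const_mul z)).const_mul _
  have hd : ∀ y : ℝ, HasDerivAt (airyIntegrand 0 c z)
      (Complex.I * (airyIntegrand 2 c z y - z * airyIntegrand 0 c z y)) y := by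
    intro y
    have h1 : HasDerivAt (fun y : ℝ => (c : ℂ) + y * Complex.I) Complex.I y := by
      simpa using ((Complex.ofRealCLM.hasDerivAt (x := y)).mul_const Complex.I).const_add (c : ℂ)
    have := HasDerivAt.comp y (hasDerivAt_cubic_exp z ((c : ℂ) + y * Complex.I)) h1
    unfold airyIntegrand
    simp only [pow_zero, one_mul]
    exact this.congr_deriv (by ring)
  have := integral_eq_zero_of_hasDerivAt_of_integrable hd hi (integrable_airyIntegrand 0 hc z)
  rw [integral_const_mul, integral_sub (integrable_airyIntegrand 2 hc z)
    ((integrable_airyIntegrand 0 hc z).const_mul z), integral_const_mul] at this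
  simpa [sub_eq_zero] using this

lemma airyD_two (z : ℂ) : airyD 2 z = z * airyD 0 z := by
  unfold airyD; rw [integral_airyIntegrand_two one_pos]; ring

/-- The c-derivative is the integral of (t² - z) exp(t³/3 - zt), zero by
`integral_airyIntegrand_two`. This replaces Cauchy's theorem for the shift of the contour. -/
lemma hasDerivAt_integral_airyIntegrand_contour {c : ℝ} (hc : 0 < c) (z : ℂ) :
    HasDerivAt (fun c : ℝ => ∫ y, airyIntegrand 0 c z y) 0 c := by
  have key := (hasDerivAt_integral_of_dominated_loc_of_deriv_le (μ := volume)
    (s := Ioo (c / 2) (c + 1)) (x₀ := c)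
    (F := fun c : ℝ => airyIntegrand 0 c z)
    (F' := fun c : ℝ => fun y => airyIntegrand 2 c z y - z * airyIntegrand 0 c z y)
    (bound := fun y => (Nat.factorial 2 * (√(c / 2))⁻¹ ^ 2 *
      Real.exp (√(c + 1) * (c + 1) + 1 + (c + 1) ^ 3 / 3 + (c + 1) * ‖z‖ + ‖z‖ ^ 2 / (c / 2)) *
        Real.exp (-(c / 2 / 2) * y ^ 2)) + ‖z‖ * (Nat.factorial 0 * (√(c / 2))⁻¹ ^ 0 *
      Real.exp (√(c + 1) * (c + 1) + 1 + (c + 1) ^ 3 / 3 + (c + 1) * ‖z‖ + ‖z‖ ^ 2 / (c / 2)) *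
        Real.exp (-(c / 2 / 2) * y ^ 2)))
    (Ioo_mem_nhds (by linarith) (by linarith))
    (Eventually.of_forall fun c => (continuous_airyIntegrand 0 c z).aestronglyMeasurable)
    (integrable_airyIntegrand 0 hc z) ?_ ?_ ?_ ?_).2
  · refine key.congr_deriv ?_
    rw [integral_sub (integrable_airyIntegrand 2 hc z)
      ((integrable_airyIntegrand 0 hc z).const_mul z), integral_const_mul,
      integral_airyIntegrand_two hc, sub_self]
  · exact ((continuous_airyIntegrand 2 c z).sub
      ((continuous_airyIntegrand 0 c z).const_smul z)).aestronglyMeasurable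
  · refine Eventually.of_forall fun y w hw => (norm_sub_le _ _).trans ?_
    rw [norm_mul]
    gcongr
    · exact norm_airyIntegrand_le_of_mem 2 (by positivity) hw.1.le hw.2.le le_rfl y
    · exact norm_airyIntegrand_le_of_mem 0 (by positivity) hw.1.le hw.2.le le_rfl y
  · exact ((integrable_exp_neg_mul_sq (b := c / 2 / 2) (by positivity)).const_mul _).add
      (((integrable_exp_neg_mul_sq (b := c / 2 / 2) (by positivity)).const_mul _).const_mul _)
  · refine Eventually.of_forall fun y w _ => ?_
    have h1 : HasDerivAt (fun c : ℝ => (c : ℂ) + y * Complex.I) 1 w := by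
      simpa using (Complex.ofRealCLM.hasDerivAt (x := w)).add_const (y * Complex.I : ℂ)
    have := HasDerivAt.comp w (hasDerivAt_cubic_exp z ((w : ℂ) + y * Complex.I)) h1
    unfold airyIntegrand
    simp only [pow_zero, one_mul]
    exact this.congr_deriv (by ring)

/-- The contour of integration can be shifted. -/
lemma airyD_eq_integral (n : ℕ) {c : ℝ} (hc : 0 < c) (z : ℂ) :
    airyD n z = (1 / (2 * (Real.pi : ℂ))) * ∫ y : ℝ, airyIntegrand n c z y := by
  have h0 : ∀ z, ∫ y : ℝ, airyIntegrand 0 c z y = ∫ y : ℝ, airyIntegrand 0 1 z y := by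
    intro z
    have hd : DifferentiableOn ℝ (fun c : ℝ => ∫ y, airyIntegrand 0 c z y) (Ioi 0) := fun c hc =>
      (hasDerivAt_integral_airyIntegrand_contour hc z).differentiableAt.differentiableWithinAt
    exact isOpen_Ioi.is_const_of_deriv_eq_zero isPreconnected_Ioi hd
      (fun c hc => (hasDerivAt_integral_airyIntegrand_contour hc z).deriv) hc
      (mem_Ioi.mpr (one_pos (α := ℝ)))
  have : ∀ n, (fun z => ∫ y : ℝ, airyIntegrand n c z y) = fun z => ∫ y : ℝ, airyIntegrand n 1 z y := by
    intro n
    induction n with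
    | zero => exact funext h0
    | succ n ih =>
      ext z
      rw [← (hasDerivAt_integral_airyIntegrand n hc z).deriv, ih,
        (hasDerivAt_integral_airyIntegrand n one_pos z).deriv]
  unfold airyD; rw [congrFun (this n) z]

/-- The parameter c is free: c = 1 gives exponential decay to the right, c = 1/|x| polynomial growth
to the left along the real axis, c = |x|^(-1/2) the bound exp(R√|x|) when a bounded complex number
is added. The Gaussian integral contributes at most 1/√c, hence the exponent n + 1. -/
lemma norm_airyD_le (n : ℕ) {c : ℝ} (hc : 0 < c) (z : ℂ) :
    ‖airyD n z‖ ≤ n.factorial * (√c)⁻¹ ^ (n + 1) *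
      Real.exp (√c * c + 1 + c ^ 3 / 3 - c * z.re + z.im ^ 2 / c) := by
  have hd : 0 < √c := Real.sqrt_pos.mpr hc
  rw [airyD_eq_integral n hc, norm_mul]
  have h1 := norm_integral_le_of_norm_le
    ((integrable_exp_neg_mul_sq (b := c / 2) (by positivity)).const_mul (n.factorial * (√c)⁻¹ ^ n *
      Real.exp (√c * c + 1 + c ^ 3 / 3 - c * z.re + z.im ^ 2 / c)))
    (Eventually.of_forall fun y => norm_airyIntegrand_le n hc z y)
  rw [integral_const_mul, integral_gaussian] at h1
  have h2 : ‖(1 / (2 * (Real.pi : ℂ)))‖ = 1 / (2 * Real.pi) := by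
    simp [abs_of_pos Real.pi_pos]
  rw [h2]
  have h3 : 1 / (2 * Real.pi) * √(Real.pi / (c / 2)) ≤ (√c)⁻¹ := by
    have : √(Real.pi / (c / 2)) = √(2 * Real.pi) * (√c)⁻¹ := by
      rw [← Real.sqrt_inv, ← Real.sqrt_mul (by positivity)]; congr 1; field_simp
    rw [this, ← mul_assoc]
    have h4 : √(2 * Real.pi) ≤ 2 * Real.pi := by
      rw [Real.sqrt_le_left (by positivity)]
      nlinarith [Real.pi_gt_three]
    have : 1 / (2 * Real.pi) * √(2 * Real.pi) ≤ 1 := by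
      rw [div_mul_eq_mul_div, one_mul, div_le_one (by positivity)]; exact h4
    calc _ ≤ 1 * (√c)⁻¹ := by gcongr
      _ = _ := one_mul _
  calc _ ≤ 1 / (2 * Real.pi) * (n.factorial * (√c)⁻¹ ^ n *
      Real.exp (√c * c + 1 + c ^ 3 / 3 - c * z.re + z.im ^ 2 / c) * √(Real.pi / (c / 2))) := by gcongr
    _ = n.factorial * (√c)⁻¹ ^ n *
      Real.exp (√c * c + 1 + c ^ 3 / 3 - c * z.re + z.im ^ 2 / c) *
        (1 / (2 * Real.pi) * √(Real.pi / (c / 2))) := by ring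
    _ ≤ n.factorial * (√c)⁻¹ ^ n *
      Real.exp (√c * c + 1 + c ^ 3 / 3 - c * z.re + z.im ^ 2 / c) * (√c)⁻¹ := by gcongr
    _ = _ := by rw [pow_succ]; ring

lemma airyIntegrand_conj (n : ℕ) (c : ℝ) (z : ℂ) (y : ℝ) :
    (starRingEnd ℂ) (airyIntegrand n c z y) = airyIntegrand n c ((starRingEnd ℂ) z) (-y) := by
  unfold airyIntegrand
  simp [← Complex.exp_conj, map_ofNat]

/-- Reflection y ↦ -y of the contour. It makes `airyL2` real, which links the bilinear pairing to
the inner product in `inner_airyL2`. -/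
lemma airyD_conj (n : ℕ) (z : ℂ) : (starRingEnd ℂ) (airyD n z) = airyD n ((starRingEnd ℂ) z) := by
  unfold airyD
  rw [map_mul, ← integral_conj]
  simp_rw [airyIntegrand_conj]
  rw [integral_neg_eq_self (fun y => airyIntegrand n 1 ((starRingEnd ℂ) z) y)]
  simp [map_ofNat]

end AiryLax
end

/-! ### Growth of Airy derivatives and admissible points. -/

noncomputable section
namespace AiryLax

lemma norm_airyD_le_exp_neg (n : ℕ) (ρ : ℝ) : ∃ C : ℝ, 0 ≤ C ∧ ∀ (v : ℂ) (x : ℝ), ‖v‖ ≤ ρ →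
    ‖airyD n (x + v)‖ ≤ C * Real.exp (-x) := by
  refine ⟨n.factorial * Real.exp (1 + 1 + 1 / 3 + ρ + ρ ^ 2), by positivity, fun v x hv => ?_⟩
  have h := norm_airyD_le n one_pos (x + v)
  refine h.trans ?_
  have h1 : -v.re ≤ ρ := (neg_le_abs _).trans ((Complex.abs_re_le_norm v).trans hv)
  have h2 : v.im ^ 2 ≤ ρ ^ 2 := by
    rw [← sq_abs]; gcongr; exact (Complex.abs_im_le_norm v).trans hv
  rw [mul_assoc _ _ (Real.exp (-x)), ← Real.exp_add]
  simp only [Real.sqrt_one, inv_one, one_pow, mul_one, Complex.add_re, Complex.ofReal_re,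
    Complex.add_im, Complex.ofReal_im, zero_add, div_one, one_mul]
  refine mul_le_mul_of_nonneg_left (Real.exp_le_exp.mpr ?_) (by positivity)
  linarith

/-- For x < -1 the contour passes through c = 1/|x|: then exp(-cx) = e, and only the power (√c)⁻¹ ^
(n + 1) grows. -/
lemma norm_airyD_ofReal_le_pow (n : ℕ) : ∃ C : ℝ, 0 ≤ C ∧ ∀ x : ℝ,
    ‖airyD n x‖ ≤ C * (1 + |x|) ^ (n + 1) := by
  obtain ⟨C, hC, h⟩ := norm_airyD_le_exp_neg n 0
  refine ⟨C * Real.exp 1 + n.factorial * Real.exp (10 / 3), by positivity, fun x => ?_⟩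
  have h1 : (1 : ℝ) ≤ (1 + |x|) ^ (n + 1) := one_le_pow₀ (by linarith [abs_nonneg x])
  rw [add_mul]
  rcases le_or_gt (-1) x with hx | hx
  · have := h 0 x (by simp)
    rw [add_zero] at this
    calc ‖airyD n x‖ ≤ C * Real.exp 1 * 1 := by
          rw [mul_one]; refine this.trans ?_; gcongr; linarith
      _ ≤ C * Real.exp 1 * (1 + |x|) ^ (n + 1) := by gcongr
      _ ≤ _ := le_add_of_nonneg_right (by positivity)
  · have hx0 : 1 < |x| := by rw [abs_of_neg (by linarith)]; linarith
    have hx1 : |x| = -x := abs_of_neg (by linarith)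
    have hp : 0 < |x|⁻¹ := by positivity
    have hle : |x|⁻¹ ≤ 1 := inv_le_one_of_one_le₀ hx0.le
    have := norm_airyD_le n hp x
    refine this.trans (le_trans ?_ (le_add_of_nonneg_left (by positivity)))
    have e1 : √|x|⁻¹ ≤ 1 := by exact Real.sqrt_le_one.mpr hle
    have e2 : (√|x|⁻¹)⁻¹ ≤ 1 + |x| := by
      rw [Real.sqrt_inv, inv_inv]
      rw [Real.sqrt_le_left (by positivity)]; nlinarith
    have e3 : |x|⁻¹ ^ 3 ≤ 1 := pow_le_one₀ hp.le hle
    have e4 : |x|⁻¹ * x = -1 := by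
      have : x ≠ 0 := by rintro rfl; simp at hx0; linarith
      rw [hx1]; field_simp
    have e5 : √|x|⁻¹ * |x|⁻¹ ≤ 1 := mul_le_one₀ e1 hp.le hle
    rw [Complex.ofReal_re, Complex.ofReal_im, e4]
    calc _ ≤ n.factorial * (1 + |x|) ^ (n + 1) * Real.exp (10 / 3) := by
          refine mul_le_mul (by gcongr) (Real.exp_le_exp.mpr ?_) (by positivity) (by positivity)
          simp only [ne_eq, OfNat.ofNat_ne_zero, not_false_eq_true, zero_pow, zero_div]
          linarith
      _ = _ := by ring

/-- Polynomial control in the shift, arbitrary polynomial decay to the right. -/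
lemma norm_airyD_shift_le (n N : ℕ) : ∃ C : ℝ, ∃ a : ℕ, 0 ≤ C ∧ ∀ c z : ℝ, 0 ≤ z →
    ‖airyD n (z + c)‖ ≤ C * (1 + |c|) ^ a / (1 + z) ^ N := by
  obtain ⟨C₁, hC₁, h₁⟩ := norm_airyD_le_exp_neg n 0
  obtain ⟨C₂, hC₂, h₂⟩ := norm_airyD_ofReal_le_pow n
  refine ⟨C₁ * N.factorial * Real.exp 1 + C₂, N + (n + 1), by positivity, fun c z hz => ?_⟩
  rw [le_div_iff₀ (by positivity)]
  have hc1 : (1 : ℝ) ≤ (1 + |c|) ^ (n + 1) := one_le_pow₀ (by linarith [abs_nonneg c])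
  have hcc : ((z : ℂ) + c) = ((z + c : ℝ) : ℂ) := by push_cast; rfl
  rw [hcc]
  rcases le_or_gt 0 (z + c) with h | h
  · have e1 : 1 + z ≤ (1 + |c|) * (1 + (z + c)) := by
      have := neg_abs_le c
      nlinarith [abs_nonneg c, mul_nonneg (abs_nonneg c) h]
    have e2 := Real.pow_div_factorial_le_exp (1 + (z + c)) (by linarith) N
    rw [div_le_iff₀ (by positivity)] at e2
    have e3 := h₁ 0 (z + c) (by simp)
    rw [add_zero] at e3
    calc ‖airyD n (z + c : ℝ)‖ * (1 + z) ^ N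
        ≤ (C₁ * Real.exp (-(z + c))) * ((1 + |c|) * (1 + (z + c))) ^ N := by gcongr
      _ = (1 + |c|) ^ N * C₁ * Real.exp (-(z + c)) * (1 + (z + c)) ^ N := by rw [mul_pow]; ring
      _ ≤ (1 + |c|) ^ N * C₁ * Real.exp (-(z + c)) * (Real.exp (1 + (z + c)) * N.factorial) := by
          gcongr
      _ = (1 + |c|) ^ N * C₁ * N.factorial * Real.exp 1 := by
          rw [Real.exp_add, Real.exp_neg]; field_simp
      _ ≤ (1 + |c|) ^ N * C₁ * N.factorial * Real.exp 1 * (1 + |c|) ^ (n + 1) :=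
          le_mul_of_one_le_right (by positivity) hc1
      _ = (C₁ * N.factorial * Real.exp 1) * (1 + |c|) ^ (N + (n + 1)) := by rw [pow_add]; ring
      _ ≤ _ := by gcongr; linarith
  -- If z + c < 0 then z ≤ |c|, so the decay in z is paid for by powers of 1 + |c|.
  · have e1 : |z + c| ≤ |c| := by
      rw [abs_of_neg h, abs_of_neg (by linarith)]; linarith
    have e2 : z ≤ |c| := by rw [abs_of_neg (by linarith)]; linarith
    calc ‖airyD n (z + c : ℝ)‖ * (1 + z) ^ N
        ≤ (C₂ * (1 + |c|) ^ (n + 1)) * (1 + |c|) ^ N := by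
          gcongr
          exact (h₂ _).trans (by gcongr)
      _ = C₂ * (1 + |c|) ^ (N + (n + 1)) := by rw [pow_add]; ring
      _ ≤ _ := by gcongr; linarith [show 0 ≤ C₁ * N.factorial * Real.exp 1 by positivity]

/-- For x = t + u < -1 the choice c = |x|^(-1/2) balances -cx = √|x| against (Im z)²/c ≤ ρ²√|x|. As
u ≥ 0, |x| ≤ |t| in that range, so the bound depends on t alone. -/
lemma norm_airyD_le_exp_sqrt (n : ℕ) (ρ : ℝ) : ∃ C R : ℝ, 0 ≤ C ∧ 0 ≤ R ∧ ∀ (z : ℂ) (t u : ℝ),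
    ‖z‖ ≤ ρ → 0 ≤ u → ‖airyD n (z + t + u)‖ ≤ C * Real.exp (R * √|t|) := by
  obtain ⟨C₁, hC₁, h₁⟩ := norm_airyD_le_exp_neg n ρ
  refine ⟨C₁ * Real.exp 1 + n.factorial * (n + 1).factorial * Real.exp (7 / 3 + |ρ|), 2 + ρ ^ 2,
    by positivity, by positivity, fun z t u hz hu => ?_⟩
  have hρ : 0 ≤ ρ := (norm_nonneg z).trans hz
  rw [add_mul]
  have hzz : z + t + u = ((t + u : ℝ) : ℂ) + z := by push_cast; ring
  rw [hzz]
  set x := t + u with hx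
  rcases le_or_gt (-1) x with hx1 | hx1
  · refine le_trans ?_ (le_add_of_nonneg_right (by positivity))
    have h0 : 1 ≤ Real.exp ((2 + ρ ^ 2) * √|t|) := Real.one_le_exp (by positivity)
    calc _ ≤ C₁ * Real.exp (-x) := h₁ z x hz
      _ ≤ C₁ * Real.exp 1 := by gcongr; linarith
      _ ≤ _ := le_mul_of_one_le_right (by positivity) h0
  · refine le_trans ?_ (le_add_of_nonneg_left (by positivity))
    have hxt : |x| ≤ |t| := by
      rw [abs_of_neg (by linarith), abs_of_neg (by linarith)]; linarith
    set v := √|x| with hv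
    have hxa : |x| = -x := abs_of_neg (by linarith)
    have hv1 : 1 ≤ v := by rw [hv, Real.one_le_sqrt, hxa]; linarith
    have hvv : v * v = -x := by rw [hv, Real.mul_self_sqrt (abs_nonneg x), hxa]
    have hvt : v ≤ √|t| := Real.sqrt_le_sqrt hxt
    have hv0 : 0 < v := by linarith
    have hp : 0 < v⁻¹ := by positivity
    have hle : v⁻¹ ≤ 1 := inv_le_one_of_one_le₀ hv1
    have h := norm_airyD_le n hp (x + z)
    refine h.trans ?_
    have e1 : √v⁻¹ ≤ 1 := by exact Real.sqrt_le_one.mpr hle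
    have e2 : (√v⁻¹)⁻¹ ≤ v := by
      rw [Real.sqrt_inv, inv_inv, Real.sqrt_le_left hv0.le]; nlinarith
    have e3 : v⁻¹ ^ 3 ≤ 1 := pow_le_one₀ hp.le hle
    have e4 : v⁻¹ * x = -v := by
      have : x = -(v * v) := by linarith
      rw [this]; field_simp
    have e5 : √v⁻¹ * v⁻¹ ≤ 1 := mul_le_one₀ e1 hp.le hle
    have h1 : -z.re ≤ ρ := (neg_le_abs _).trans ((Complex.abs_re_le_norm z).trans hz)
    have h2 : z.im ^ 2 ≤ ρ ^ 2 := by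
      rw [← sq_abs]; gcongr; exact (Complex.abs_im_le_norm z).trans hz
    have e6 : -(v⁻¹ * z.re) ≤ ρ := by
      calc -(v⁻¹ * z.re) = v⁻¹ * (-z.re) := by ring
        _ ≤ v⁻¹ * ρ := by gcongr
        _ ≤ 1 * ρ := by gcongr
        _ = ρ := one_mul _
    have e7 : z.im ^ 2 / v⁻¹ ≤ ρ ^ 2 * v := by
      rw [div_inv_eq_mul]; gcongr
    have e8 : v ^ (n + 1) ≤ (n + 1).factorial * Real.exp v := by
      have := Real.pow_div_factorial_le_exp v hv0.le (n + 1)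
      rw [div_le_iff₀ (by positivity)] at this
      linarith
    simp only [Complex.add_re, Complex.ofReal_re, Complex.add_im, Complex.ofReal_im, zero_add]
    calc _ ≤ n.factorial * ((n + 1).factorial * Real.exp v) *
          Real.exp (7 / 3 + |ρ| + (1 + ρ ^ 2) * v) := by
          have e9 : (√v⁻¹)⁻¹ ^ (n + 1) ≤ (n + 1).factorial * Real.exp v :=
            le_trans (by gcongr) e8
          refine mul_le_mul (by gcongr) (Real.exp_le_exp.mpr ?_) (by positivity) (by positivity)
          have := le_abs_self ρ
          rw [mul_add, e4]
          nlinarith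
      _ = n.factorial * (n + 1).factorial * Real.exp (7 / 3 + |ρ|) *
          Real.exp ((2 + ρ ^ 2) * v) := by
          rw [Real.exp_add (7 / 3 + |ρ|)]
          have : Real.exp ((2 + ρ ^ 2) * v) = Real.exp v * Real.exp ((1 + ρ ^ 2) * v) := by
            rw [← Real.exp_add]; congr 1; ring
          rw [this]; ring
      _ ≤ _ := by gcongr

/-- The points of `Z`, a set invariant under real translations, at which all the integrals over
`σ` converge. -/
structure Admissible (σ : Measure ℝ) (Z : Set ℂ) : Prop where
  shift : ∀ z ∈ Z, ∀ r : ℝ, z + r ∈ Z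
  real : ∀ r : ℝ, (r : ℂ) ∈ Z
  weight : ∀ (n : ℕ) (ρ : ℝ), ∃ ω : ℝ → ℝ, Continuous ω ∧ (∀ t, 1 ≤ ω t) ∧
    (∀ p : ℕ, Integrable (fun t => ω t ^ 2 * (1 + |t|) ^ p) σ) ∧
    ∀ z ∈ Z, ‖z‖ ≤ ρ → ∀ t u : ℝ, 0 ≤ u → ‖airyD n (z + t + u)‖ ≤ ω t

/-- All polynomial moments are finite. -/
def FiniteMoments (σ : Measure ℝ) : Prop := ∀ p : ℕ, Integrable (fun t : ℝ => (1 + |t|) ^ p) σ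

variable {σ : Measure ℝ}

lemma FiniteMoments.of_integrable [IsFiniteMeasure σ]
    (h : ∀ p : ℕ, Integrable (fun t : ℝ => |t| ^ p) σ) : FiniteMoments σ := by
  intro p
  have : (fun t : ℝ => (1 + |t|) ^ p) =
      fun t => ∑ m ∈ Finset.range (p + 1), |t| ^ m * (p.choose m : ℝ) := by
    ext t
    rw [add_comm, add_pow]; simp
  rw [this]
  exact integrable_finsetSum _ fun m _ => (h m).mul_const _

lemma FiniteMoments.admissible (h : FiniteMoments σ) :
    Admissible σ (range (fun x : ℝ => (x : ℂ))) := by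
  refine ⟨?_, fun r => ⟨r, rfl⟩, fun n ρ => ?_⟩
  · rintro _ ⟨x, rfl⟩ r
    exact ⟨x + r, by push_cast; rfl⟩
  · obtain ⟨C, a, hC, hb⟩ := norm_airyD_shift_le n 0
    refine ⟨fun t => (1 + C * (1 + |ρ|) ^ a) * (1 + |t|) ^ a, by fun_prop, fun t => ?_, fun p => ?_, ?_⟩
    · have : (1 : ℝ) ≤ (1 + |t|) ^ a := one_le_pow₀ (by linarith [abs_nonneg t])
      have : (1 : ℝ) ≤ 1 + C * (1 + |ρ|) ^ a := by
        linarith [show 0 ≤ C * (1 + |ρ|) ^ a by positivity]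
      nlinarith
    · convert (h (2 * a + p)).const_mul ((1 + C * (1 + |ρ|) ^ a) ^ 2) using 2 with t
      rw [mul_pow, pow_add, pow_mul']; ring
    · rintro _ ⟨x, rfl⟩ hx t u hu
      have e : ((x : ℂ) + t + u) = u + (x + t : ℝ) := by push_cast; ring
      simp only [Complex.norm_real, Real.norm_eq_abs] at hx
      rw [e]
      have := hb (x + t) u hu
      rw [pow_zero, div_one] at this
      refine this.trans ?_
      have h1 : 1 + |x + t| ≤ (1 + |ρ|) * (1 + |t|) := by
        have := abs_add_le x t
        have := le_abs_self ρ
        nlinarith [abs_nonneg t, abs_nonneg ρ, mul_nonneg (abs_nonneg ρ) (abs_nonneg t)]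
      calc C * (1 + |x + t|) ^ a ≤ C * ((1 + |ρ|) * (1 + |t|)) ^ a := by gcongr
        _ = C * (1 + |ρ|) ^ a * (1 + |t|) ^ a := by rw [mul_pow]; ring
        _ ≤ _ := mul_le_mul_of_nonneg_right (by linarith) (by positivity)

lemma FiniteMoments.admissible_univ (h : FiniteMoments σ)
    (he : ∀ R : ℝ, Integrable (fun t : ℝ => Real.exp (R * √|t|)) σ) : Admissible σ univ := by
  refine ⟨fun _ _ _ => mem_univ _, fun _ => mem_univ _, fun n ρ => ?_⟩
  obtain ⟨C, R, hC, hR, hb⟩ := norm_airyD_le_exp_sqrt n ρ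
  refine ⟨fun t => (1 + C) * Real.exp (R * √|t|), by fun_prop, fun t => ?_, fun p => ?_, ?_⟩
  · have : 1 ≤ Real.exp (R * √|t|) := Real.one_le_exp (by positivity)
    nlinarith
  -- By xy ≤ x² + y² with x = exp(2R√|t|) and y = (1+|t|)ᵖ; hence the exponents 4R and 2p.
  · refine Integrable.mono' (((he (4 * R)).add (h (2 * p))).const_mul ((1 + C) ^ 2))
      (by fun_prop) (Eventually.of_forall fun t => ?_)
    have e1 : Real.exp (4 * R * √|t|) = (Real.exp (R * √|t|) ^ 2) ^ 2 := by
      rw [← pow_mul, ← Real.exp_nat_mul]; congr 1; push_cast; ring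
    rw [Real.norm_of_nonneg (by positivity)]
    simp only [Pi.add_apply]
    rw [mul_pow, mul_assoc, e1, pow_mul']
    gcongr
    nlinarith [sq_nonneg (Real.exp (R * √|t|) ^ 2 - (1 + |t|) ^ p), sq_nonneg (Real.exp (R * √|t|) ^ 2),
      sq_nonneg ((1 + |t|) ^ p)]
  · intro z _ hz t u hu
    exact (hb z t u hz hu).trans (mul_le_mul_of_nonneg_right (by linarith) (by positivity))

end AiryLax
end

/-! ### The space L²(0,∞), shifted Airy vectors and the bilinear pairing. -/

noncomputable section
namespace AiryLax

/-- Lebesgue measure on `(0, ∞)`. -/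
abbrev halfLine : Measure ℝ := volume.restrict (Ioi 0)

/-- The Hilbert space `L²(0, ∞)`. -/
abbrev HalfL2 := Lp ℂ 2 halfLine

lemma integrable_one_add_inv_sq : Integrable (fun z : ℝ => ((1 + z) ^ 2)⁻¹) halfLine := by
  have := integrableOn_add_rpow_Ioi_of_lt (a := -2) (c := 0) (m := 1) (by norm_num) (by norm_num)
  refine this.congr_fun (fun x hx => ?_) measurableSet_Ioi
  have hx' : (0 : ℝ) < x := hx
  simp only
  rw [Real.rpow_neg (by linarith), ← Real.rpow_natCast, add_comm]; norm_num

lemma memLp_one_add_inv : MemLp (fun z : ℝ => ((1 + z)⁻¹ : ℝ)) 2 halfLine := by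
  rw [memLp_two_iff_integrable_sq (by fun_prop)]
  convert integrable_one_add_inv_sq using 2 with z
  rw [inv_pow]

lemma ae_halfLine {p : ℝ → Prop} (h : ∀ z, 0 < z → p z) : ∀ᵐ z ∂halfLine, p z :=
  (ae_restrict_mem measurableSet_Ioi).mono h

lemma memLp_halfLine {f : ℝ → ℂ} {M : ℝ} (hf : AEStronglyMeasurable f halfLine)
    (h : ∀ z, 0 < z → ‖f z‖ ≤ M * (1 + z)⁻¹) : MemLp f 2 halfLine :=
  (memLp_one_add_inv.const_mul M).of_le_mul (c := 1) hf (ae_halfLine fun z hz => by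
    rw [one_mul]; exact (h z hz).trans (le_abs_self _))

/-- The `L²` norm of `(1 + z)⁻¹` on `(0, ∞)`. -/
def invNorm : ℝ := ‖memLp_one_add_inv.toLp‖

lemma invNorm_nonneg : 0 ≤ invNorm := norm_nonneg _

lemma norm_halfL2_le {f : HalfL2} {M : ℝ} (h : ∀ᵐ z ∂halfLine, ‖f z‖ ≤ M * (1 + z)⁻¹) :
    ‖f‖ ≤ M * invNorm := by
  refine Lp.norm_le_mul_norm_of_ae_le_mul ?_
  filter_upwards [h, memLp_one_add_inv.coeFn_toLp, ae_halfLine (fun z hz => hz)] with z h1 h2 h3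
  rw [h2, Real.norm_of_nonneg (inv_nonneg.mpr (by linarith))]; exact h1

lemma norm_toLp_halfLine_le {f : ℝ → ℂ} {M : ℝ} (hf : MemLp f 2 halfLine)
    (h : ∀ z, 0 < z → ‖f z‖ ≤ M * (1 + z)⁻¹) : ‖hf.toLp‖ ≤ M * invNorm := by
  refine norm_halfL2_le ?_
  filter_upwards [hf.coeFn_toLp, ae_halfLine (fun z hz => hz)] with z h2 h3
  rw [h2]; exact h z h3

/-- Decay of order N + 1 in z + u is split: (1+u)⁻ᴺ makes integrals over u converge, (1+z)⁻¹ is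
square integrable in z. -/
lemma norm_airyD_shift_le_inv (n N : ℕ) : ∃ C : ℝ, ∃ a : ℕ, 0 ≤ C ∧ ∀ c u z : ℝ, 0 ≤ u → 0 ≤ z →
    ‖airyD n (z + (c + u : ℝ))‖ ≤ C * (1 + |c|) ^ a / (1 + u) ^ N * (1 + z)⁻¹ := by
  obtain ⟨C, a, hC, h⟩ := norm_airyD_shift_le n (N + 1)
  refine ⟨C, a, hC, fun c u z hu hz => ?_⟩
  have e : (z : ℂ) + (c + u : ℝ) = ((z + u : ℝ) : ℂ) + c := by push_cast; ring
  rw [e]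
  refine (h c (z + u) (by linarith)).trans ?_
  rw [← div_eq_mul_inv, div_div]
  gcongr
  rw [pow_succ]
  gcongr <;> linarith

lemma memLp_airyD (n : ℕ) (c : ℝ) : MemLp (fun w : ℝ => airyD n (w + c)) 2 halfLine := by
  obtain ⟨C, a, hC, h⟩ := norm_airyD_shift_le_inv n 0
  refine memLp_halfLine (M := C * (1 + |c|) ^ a) ?_ fun z hz => ?_
  · exact ((continuous_airyD n).comp (by fun_prop)).aestronglyMeasurable
  · simpa using h c 0 z le_rfl hz.le

/-- `w ↦ Ai⁽ⁿ⁾(w + c)` as an element of `L²(0, ∞)`. -/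
def airyL2 (n : ℕ) (c : ℝ) : HalfL2 := (memLp_airyD n c).toLp

lemma coeFn_airyL2 (n : ℕ) (c : ℝ) : airyL2 n c =ᵐ[halfLine] fun w : ℝ => airyD n (w + c) :=
  (memLp_airyD n c).coeFn_toLp

lemma norm_airyL2_le (n N : ℕ) : ∃ C : ℝ, ∃ a : ℕ, 0 ≤ C ∧ ∀ c u : ℝ, 0 ≤ u →
    ‖airyL2 n (c + u)‖ ≤ C * (1 + |c|) ^ a / (1 + u) ^ N := by
  obtain ⟨C, a, hC, h⟩ := norm_airyD_shift_le_inv n N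
  refine ⟨C * invNorm, a, mul_nonneg hC invNorm_nonneg, fun c u hu => ?_⟩
  refine (norm_toLp_halfLine_le (memLp_airyD n (c + u)) (fun z hz => h c u z hu hz.le)).trans
    (le_of_eq (by ring))

lemma norm_taylor_le {f f' f'' : ℝ → ℂ} {B r : ℝ} (hf : ∀ x, HasDerivAt f (f' x) x)
    (hf' : ∀ x, HasDerivAt f' (f'' x) x) (hB : ∀ x, |x| ≤ |r| → ‖f'' x‖ ≤ B) :
    ‖f r - f 0 - r * f' 0‖ ≤ B * |r| * |r| := by
  set s := Metric.closedBall (0 : ℝ) |r|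
  have hs : Convex ℝ s := convex_closedBall _ _
  have h0 : (0 : ℝ) ∈ s := Metric.mem_closedBall_self (abs_nonneg r)
  have hr : r ∈ s := by simp [s]
  have hB0 : 0 ≤ B := (norm_nonneg _).trans (hB 0 (by simp))
  have h1 : ∀ x ∈ s, ‖f' x - f' 0‖ ≤ B * |r| := by
    intro x hx
    have := hs.norm_image_sub_le_of_norm_hasDerivWithin_le (f := f') (f' := f'')
      (fun y _ => (hf' y).hasDerivWithinAt) (fun y hy => hB y (by simpa [s] using hy)) h0 hx
    refine this.trans ?_
    have : |x| ≤ |r| := by simpa [s] using hx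
    rw [sub_zero, Real.norm_eq_abs]; gcongr
  have := hs.norm_image_sub_le_of_norm_hasDerivWithin_le
    (f := fun x : ℝ => f x - f 0 - x * f' 0) (f' := fun x => f' x - f' 0)
      (fun y _ => by
        have h2 : HasDerivAt (fun x : ℝ => (x : ℂ) * f' 0) (f' 0) y := by
          simpa using (Complex.ofRealCLM.hasDerivAt (x := y)).mul_const (f' 0)
        exact (((hf y).sub_const (f 0)).sub h2).hasDerivWithinAt) h1 h0 hr
  simpa using this

lemma hasDerivAt_airyD_ofReal (n : ℕ) (z : ℂ) (r : ℝ) :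
    HasDerivAt (fun r : ℝ => airyD n (z + r)) (airyD (n + 1) (z + r)) r := by
  have h1 : HasDerivAt (fun r : ℝ => z + (r : ℂ)) 1 r := by
    simpa using (Complex.ofRealCLM.hasDerivAt (x := r)).const_add z
  exact (HasDerivAt.comp r (hasDerivAt_airyD n (z + r)) h1).congr_deriv (mul_one _)

/-- The second order Taylor remainder is bounded pointwise by a multiple of h²(1+z)⁻¹, so the
difference quotients converge in L² and not only pointwise. -/
lemma hasDerivAt_airyL2 (n : ℕ) (c : ℝ) : HasDerivAt (airyL2 n) (airyL2 (n + 1) c) c := by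
  obtain ⟨C, a, hC, hb⟩ := norm_airyD_shift_le_inv (n + 2) 0
  rw [hasDerivAt_iff_isLittleO_nhds_zero]
  have : (fun h : ℝ => airyL2 n (c + h) - airyL2 n c - h • airyL2 (n + 1) c) =O[𝓝 0]
      fun h : ℝ => h ^ 2 := by
    refine Asymptotics.IsBigO.of_bound (C * (2 + |c|) ^ a * invNorm) ?_
    filter_upwards [Metric.ball_mem_nhds (0 : ℝ) one_pos] with h hh
    have hh1 : |h| ≤ 1 := by simpa using (Metric.mem_ball.mp hh).le
    have : ‖airyL2 n (c + h) - airyL2 n c - h • airyL2 (n + 1) c‖ ≤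
        (C * (2 + |c|) ^ a * |h| * |h|) * invNorm := by
      refine norm_halfL2_le ?_
      filter_upwards [coeFn_airyL2 n (c + h), coeFn_airyL2 n c, coeFn_airyL2 (n + 1) c,
        Lp.coeFn_sub (airyL2 n (c + h) - airyL2 n c) (h • airyL2 (n + 1) c),
        Lp.coeFn_sub (airyL2 n (c + h)) (airyL2 n c), Lp.coeFn_smul h (airyL2 (n + 1) c),
        ae_halfLine (fun z hz => hz)] with z h1 h2 h3 h4 h5 h6 hz
      rw [h4, Pi.sub_apply, h5, Pi.sub_apply, h6, Pi.smul_apply, h1, h2, h3]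
      have key := norm_taylor_le (B := C * (2 + |c|) ^ a * (1 + z)⁻¹) (r := h)
        (f := fun r : ℝ => airyD n ((z + c) + r)) (hasDerivAt_airyD_ofReal n (z + c))
        (hasDerivAt_airyD_ofReal (n + 1) (z + c)) (fun x hx => by
          have := hb (c + x) 0 z le_rfl hz.le
          simp only [pow_zero, div_one, add_zero] at this
          have e : ((z : ℂ) + c + x) = z + (c + x : ℝ) := by push_cast; ring
          rw [e]
          refine this.trans ?_
          have : |c + x| ≤ |c| + 1 := (abs_add_le c x).trans (by linarith)
          have : 0 ≤ (1 + z)⁻¹ := by positivity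
          have h7 : (1 + |c + x|) ^ a ≤ (2 + |c|) ^ a :=
            pow_le_pow_left₀ (by positivity) (by linarith) a
          gcongr)
      have e : ((z : ℂ) + (c + h : ℝ)) = z + c + h := by push_cast; ring
      rw [e]
      simp only [Complex.ofReal_zero, add_zero] at key
      rw [Complex.real_smul]
      refine key.trans (le_of_eq (by ring))
    refine this.trans (le_of_eq ?_)
    rw [Real.norm_eq_abs, abs_pow]; ring
  exact this.trans_isLittleO (by
    simpa using Asymptotics.isLittleO_pow_id (𝕜 := ℝ) (n := 2) (by norm_num))

lemma continuous_airyL2 (n : ℕ) : Continuous (airyL2 n) :=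
  continuous_iff_continuousAt.mpr fun c => (hasDerivAt_airyL2 n c).continuousAt

/-! ### The bilinear pairing -/

/-- The bilinear pairing `∫₀^∞ f g`. -/
def pair : HalfL2 →L[ℂ] HalfL2 →L[ℂ] ℂ :=
  (ContinuousLinearMap.mul ℂ ℂ).lpPairing halfLine 2 2

lemma pair_apply (f g : HalfL2) : pair f g = ∫ z in Ioi (0 : ℝ), f z * g z :=
  (ContinuousLinearMap.mul ℂ ℂ).lpPairing_eq_integral f g

lemma pair_eq {f g : HalfL2} {f₁ g₁ : ℝ → ℂ} (hf : f =ᵐ[halfLine] f₁) (hg : g =ᵐ[halfLine] g₁) :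
    pair f g = ∫ z in Ioi (0 : ℝ), f₁ z * g₁ z := by
  rw [pair_apply]
  exact integral_congr_ae (by filter_upwards [hf, hg] with z h1 h2; rw [h1, h2])

lemma pair_comm (f g : HalfL2) : pair f g = pair g f := by
  simp only [pair_apply, mul_comm]

lemma norm_pair_le (f g : HalfL2) : ‖pair f g‖ ≤ ‖pair‖ * ‖f‖ * ‖g‖ := pair.le_opNorm₂ f g

lemma pair_star (f g : HalfL2) : pair (star f) g = inner ℂ f g := by
  rw [L2.inner_def, pair_apply]
  refine integral_congr_ae ?_
  filter_upwards [Lp.coeFn_star f] with z hz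
  rw [hz, RCLike.inner_apply, mul_comm]; rfl

lemma eq_zero_of_pair {f : HalfL2} (h : ∀ g, pair f g = 0) : f = 0 := by
  have := pair_star f f
  rwa [pair_comm, h, eq_comm, inner_self_eq_zero] at this

lemma pair_airyL2 (n : ℕ) (c : ℝ) (f : HalfL2) :
    pair (airyL2 n c) f = ∫ z in Ioi (0 : ℝ), airyD n (z + c) * f z :=
  pair_eq (coeFn_airyL2 n c) (ae_eq_refl _)

/-- Bochner integrals in `L²(0, ∞)` can be computed pointwise. -/
lemma coeFn_integral_halfL2 {T : Type*} [MeasurableSpace T] {μ : Measure T} [SFinite μ]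
    {φ : T → ℝ → ℂ} {Φ : T → HalfL2} {h : T → ℝ}
    (hφ : AEStronglyMeasurable (Function.uncurry φ) (μ.prod halfLine))
    (hΦ : ∀ τ, Φ τ =ᵐ[halfLine] φ τ) (hΦm : AEStronglyMeasurable Φ μ) (hh : Integrable h μ)
    (hb : ∀ᵐ τ ∂μ, ∀ z, 0 < z → ‖φ τ z‖ ≤ h τ * (1 + z)⁻¹) :
    Integrable Φ μ ∧ ((∫ τ, Φ τ ∂μ : HalfL2) : ℝ → ℂ) =ᵐ[halfLine] fun z => ∫ τ, φ τ z ∂μ := by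
  have hint : Integrable Φ μ := by
    refine Integrable.mono' (hh.mul_const invNorm) hΦm ?_
    filter_upwards [hb] with τ hτ
    refine norm_halfL2_le ?_
    filter_upwards [hΦ τ, ae_halfLine fun z hz => hz] with z h1 h2
    rw [h1]; exact hτ z h2
  refine ⟨hint, ?_⟩
  have hψm : AEStronglyMeasurable (fun z => ∫ τ, φ τ z ∂μ) halfLine :=
    (hφ.prod_swap).integral_prod_right'
  have hψ : MemLp (fun z => ∫ τ, φ τ z ∂μ) 2 halfLine := by
    refine memLp_halfLine (M := ∫ τ, h τ ∂μ) hψm fun z hz => ?_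
    rw [← integral_mul_const]
    refine norm_integral_le_of_norm_le (hh.mul_const _) ?_
    filter_upwards [hb] with τ hτ
    exact hτ z hz
  -- Elements of L² with equal pairings against every g coincide; the Bochner integral commutes with
  -- the pairing, and Fubini exchanges the two integrals.
  have key : (∫ τ, Φ τ ∂μ) = hψ.toLp := by
    rw [← sub_eq_zero]
    refine eq_zero_of_pair fun g => ?_
    rw [map_sub, _root_.sub_apply, sub_eq_zero]
    have h1 : pair (∫ τ, Φ τ ∂μ) g = ∫ τ, pair (Φ τ) g ∂μ :=
      ((pair.flip g).integral_comp_comm hint).symm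
    rw [h1, pair_eq hψ.coeFn_toLp (ae_eq_refl g)]
    have h2 : ∀ τ, pair (Φ τ) g = ∫ z in Ioi (0 : ℝ), φ τ z * g z := fun τ =>
      pair_eq (hΦ τ) (ae_eq_refl g)
    simp_rw [h2, ← integral_mul_const]
    refine integral_integral_swap ?_
    have hgi : Integrable (fun z => (1 + z)⁻¹ * ‖g z‖) halfLine :=
      memLp_one_add_inv.integrable_mul (Lp.memLp g).norm
    refine Integrable.mono' (hh.mul_prod hgi) ?_ ?_
    · exact hφ.mul (Lp.aestronglyMeasurable g).comp_snd
    · have h3 : ∀ᵐ p : T × ℝ ∂(μ.prod halfLine), ∀ z, 0 < z → ‖φ p.1 z‖ ≤ h p.1 * (1 + z)⁻¹ :=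
        Measure.quasiMeasurePreserving_fst.ae hb
      have h4 : ∀ᵐ p : T × ℝ ∂(μ.prod halfLine), 0 < p.2 :=
        Measure.quasiMeasurePreserving_snd.ae (ae_halfLine fun z hz => hz)
      filter_upwards [h3, h4] with p hp1 hp2
      simp only [Function.uncurry, norm_mul]
      rw [← mul_assoc]
      gcongr
      exact hp1 _ hp2
  rw [key]
  exact hψ.coeFn_toLp

end AiryLax
end

/-! ### The Airy transform is a contraction. -/

noncomputable section
namespace AiryLax

open FourierTransform SchwartzMap in
/-- On `L¹ ∩ L²` the `L²` Fourier transform is given by the Fourier integral. -/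
lemma fourier_toLp_two {g : ℝ → ℂ} (h1 : Integrable g) (h2 : MemLp g 2) :
    ((𝓕 (h2.toLp g : Lp ℂ 2 (volume : Measure ℝ)) : Lp ℂ 2 (volume : Measure ℝ)) : ℝ → ℂ)
      =ᵐ[volume] 𝓕 g := by
  have hcont : Continuous (𝓕 g) := by
    exact VectorFourier.fourierIntegral_continuous Real.continuous_fourierChar
      (by simp only [innerₗ_apply_apply]; fun_prop) h1
  -- Both sides are tested against smooth compactly supported φ. The L² transform agrees with that
  -- of tempered distributions, so the transform can be moved to φ and then back to g.
  refine ae_eq_of_integral_contDiff_smul_eq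
    ((Lp.memLp _).locallyIntegrable (by norm_num)) hcont.locallyIntegrable fun φ hφ hc => ?_
  let Φ : 𝓢(ℝ, ℂ) := HasCompactSupport.toSchwartzMap (f := fun x => (φ x : ℂ))
    (hc.comp_left (g := fun x : ℝ => (x : ℂ)) (by simp)) (Complex.ofRealCLM.contDiff.comp hφ)
  have e1 := congrArg (fun T : TemperedDistribution ℝ ℂ => T Φ)
    (Lp.fourier_toTemperedDistribution_eq (h2.toLp g : Lp ℂ 2 (volume : Measure ℝ)))
  simp only [TemperedDistribution.fourier_apply, Lp.toTemperedDistribution_apply] at e1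
  have e2 : ∫ x, (𝓕 Φ) x • (h2.toLp g : Lp ℂ 2 (volume : Measure ℝ)) x = ∫ x, (𝓕 Φ) x • g x :=
    integral_congr_ae (by filter_upwards [h2.coeFn_toLp] with x hx; rw [hx])
  have e3 : ∫ x, (𝓕 Φ) x • g x = ∫ x, Φ x • (𝓕 g) x := by
    have := VectorFourier.integral_fourierIntegral_smul_eq_flip (μ := volume) (ν := volume)
      (L := innerₗ ℝ) (f := (Φ : ℝ → ℂ)) (g := g) Real.continuous_fourierChar
      (by simp only [innerₗ_apply_apply]; fun_prop) Φ.integrable h1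
    rw [flip_innerₗ] at this
    exact this
  have e4 : ∀ f : ℝ → ℂ, ∫ x, φ x • f x = ∫ x, Φ x • f x := fun f =>
    integral_congr_ae (Eventually.of_forall fun x => (Complex.real_smul : φ x • f x = _))
  rw [e4, e4, ← e1, e2, e3]

open FourierTransform in
lemma eLpNorm_fourier {g : ℝ → ℂ} (h1 : Integrable g) (h2 : MemLp g 2) :
    eLpNorm (𝓕 g) 2 = eLpNorm g 2 := by
  rw [← eLpNorm_congr_ae (fourier_toLp_two h1 h2), ← eLpNorm_congr_ae h2.coeFn_toLp]
  have := Lp.norm_fourier_eq (h2.toLp g : Lp ℂ 2 (volume : Measure ℝ))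
  rw [Lp.norm_def, Lp.norm_def, ENNReal.toReal_eq_toReal_iff' (Lp.eLpNorm_ne_top _)
    (Lp.eLpNorm_ne_top _)] at this
  exact this

/-- The damped, zero-extended function `e^{-cx} f(x)`. -/
def damped (c : ℝ) (f : HalfL2) : ℝ → ℂ :=
  (Ioi (0 : ℝ)).indicator fun x => Complex.exp (-(c * x : ℝ)) * f x

lemma norm_exp_neg_ofReal (x : ℝ) : ‖Complex.exp (-(x : ℝ))‖ = Real.exp (-x) := by
  rw [Complex.norm_exp]; simp

lemma memLp_exp_neg {c : ℝ} (hc : 0 < c) :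
    MemLp (fun x : ℝ => Complex.exp (-(c * x : ℝ))) 2 halfLine := by
  have hm : AEStronglyMeasurable (fun x : ℝ => Complex.exp (-(c * x : ℝ))) halfLine :=
    Continuous.aestronglyMeasurable (by fun_prop)
  rw [memLp_two_iff_integrable_sq_norm hm]
  have := exp_neg_integrableOn_Ioi 0 (b := 2 * c) (by positivity)
  refine this.congr (Eventually.of_forall fun x => ?_)
  simp only
  rw [norm_exp_neg_ofReal, ← Real.exp_nat_mul]; congr 1; push_cast; ring

lemma eLpNorm_damped_le {c : ℝ} (hc : 0 < c) (f : HalfL2) :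
    eLpNorm (damped c f) 2 ≤ eLpNorm f 2 halfLine := by
  rw [damped, eLpNorm_indicator_eq_eLpNorm_restrict measurableSet_Ioi]
  refine eLpNorm_mono_ae (ae_halfLine fun x hx => ?_)
  rw [norm_mul, norm_exp_neg_ofReal]
  exact mul_le_of_le_one_left (norm_nonneg _) (Real.exp_le_one_iff.mpr (by nlinarith))

lemma aestronglyMeasurable_damped (c : ℝ) (f : HalfL2) :
    AEStronglyMeasurable (damped c f) volume := by
  unfold damped
  rw [aestronglyMeasurable_indicator_iff measurableSet_Ioi]
  exact (Continuous.aestronglyMeasurable (by fun_prop)).mul (Lp.aestronglyMeasurable f)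

lemma memLp_damped {c : ℝ} (hc : 0 < c) (f : HalfL2) : MemLp (damped c f) 2 :=
  ⟨aestronglyMeasurable_damped c f, (eLpNorm_damped_le hc f).trans_lt (Lp.eLpNorm_lt_top f)⟩

lemma integrable_damped {c : ℝ} (hc : 0 < c) (f : HalfL2) : Integrable (damped c f) := by
  rw [damped, integrable_indicator_iff measurableSet_Ioi]
  exact (memLp_exp_neg hc).integrable_mul (Lp.memLp f)

/-- The Fourier multiplier of the Airy transform on the line `c + iy`. -/
def airyMultiplier (c η : ℝ) : ℂ := Complex.exp (((c : ℂ) + (2 * Real.pi * η : ℝ) * Complex.I) ^ 3 / 3)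

lemma norm_airyMultiplier (c η : ℝ) :
    ‖airyMultiplier c η‖ = Real.exp (c ^ 3 / 3) * Real.exp (-(c * (2 * Real.pi) ^ 2) * η ^ 2) := by
  rw [airyMultiplier, Complex.norm_exp, ← Real.exp_add]
  congr 1
  have : (((c : ℂ) + (2 * Real.pi * η : ℝ) * Complex.I) ^ 3 / 3) =
      ((c ^ 3 / 3 - c * (2 * Real.pi * η) ^ 2 : ℝ) : ℂ) +
        ((c ^ 2 * (2 * Real.pi * η) - (2 * Real.pi * η) ^ 3 / 3 : ℝ) : ℂ) * Complex.I := by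
    push_cast
    have h2 : Complex.I ^ 2 = -1 := Complex.I_sq
    have h3 : Complex.I ^ 3 = -Complex.I := Complex.I_pow_three
    ring_nf
    rw [h2, h3]; ring
  rw [this, Complex.add_re, Complex.ofReal_re, Complex.re_ofReal_mul]
  simp; ring

open FourierTransform in
/-- The Airy transform as a Fourier multiplier. -/
lemma airyTransform_eq_fourier {c : ℝ} (hc : 0 < c) (f : HalfL2) (v : ℝ) :
    Complex.exp (c * v : ℝ) * pair (airyL2 0 v) f =
      𝓕 (fun η => airyMultiplier c η * 𝓕 (damped c f) η) v := by
  -- The substitution y = 2πη turns the contour integral into a Fourier integral. The real part c of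
  -- the contour produces the damping exp(-cx), which makes Fubini applicable, while exp(cv) on the
  -- left cancels the corresponding factor in v.
  have hker : ∀ x : ℝ, Complex.exp (c * v : ℝ) * airyD 0 (x + v) =
      ∫ η : ℝ, airyMultiplier c η * Complex.exp (-(c * x : ℝ)) *
        Complex.exp (↑(-2 * Real.pi * x * η) * Complex.I) *
        Complex.exp (↑(-2 * Real.pi * η * v) * Complex.I) := by
    intro x
    have := Measure.integral_comp_mul_left (fun y => airyIntegrand 0 c (x + v) y) (2 * Real.pi)
    rw [airyD_eq_integral 0 hc, mul_left_comm, ← integral_const_mul]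
    have e2 : (1 / (2 * (Real.pi : ℂ))) = (|(2 * Real.pi)⁻¹| : ℝ) := by
      rw [abs_of_pos (by positivity)]; push_cast; rw [one_div]
    have := Measure.integral_comp_mul_left
      (fun y => Complex.exp (c * v : ℝ) * airyIntegrand 0 c (x + v) y) (2 * Real.pi)
    rw [e2, ← Complex.real_smul, ← this]
    refine integral_congr_ae (Eventually.of_forall fun η => ?_)
    simp only [airyIntegrand, airyMultiplier, pow_zero, one_mul]
    rw [← Complex.exp_add, ← Complex.exp_add, ← Complex.exp_add, ← Complex.exp_add]
    congr 1
    push_cast; ring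
  have hfour : ∀ η, 𝓕 (damped c f) η = ∫ x in Ioi (0 : ℝ),
      Complex.exp (↑(-2 * Real.pi * x * η) * Complex.I) * (Complex.exp (-(c * x : ℝ)) * f x) := by
    intro η
    rw [Real.fourier_real_eq_integral_exp_smul, damped, ← integral_indicator measurableSet_Ioi]
    congr 1; ext x
    by_cases hx : x ∈ Ioi (0 : ℝ) <;> simp [hx]
  rw [pair_airyL2, ← integral_const_mul, Real.fourier_real_eq_integral_exp_smul]
  simp_rw [hfour, ← mul_assoc, hker, ← integral_mul_const, smul_eq_mul, ← integral_const_mul]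
  rw [integral_integral_swap]
  · refine integral_congr_ae (Eventually.of_forall fun η => ?_)
    simp only
    refine integral_congr_ae (Eventually.of_forall fun x => ?_)
    simp only; ring
  · have h1 : Integrable (fun x => Complex.exp (-(c * x : ℝ)) * f x) halfLine :=
      (memLp_exp_neg hc).integrable_mul (Lp.memLp f)
    have h2 : Integrable (fun η => Real.exp (c ^ 3 / 3) *
        Real.exp (-(c * (2 * Real.pi) ^ 2) * η ^ 2)) :=
      (integrable_exp_neg_mul_sq (by positivity)).const_mul _
    refine Integrable.mono' (h1.norm.mul_prod h2) ?_ (Eventually.of_forall fun p => ?_)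
    · refine AEStronglyMeasurable.mul ?_ (Lp.aestronglyMeasurable f).comp_fst
      refine Continuous.aestronglyMeasurable ?_
      unfold airyMultiplier; fun_prop
    · simp only [Function.uncurry]
      rw [norm_mul, norm_mul, norm_mul, norm_mul, norm_mul, Complex.norm_exp_ofReal_mul_I,
        Complex.norm_exp_ofReal_mul_I, norm_airyMultiplier]
      refine le_of_eq ?_
      ring

-- Plancherel twice, around multiplication by `airyMultiplier`, whose modulus is at most exp(c³/3).
open FourierTransform in
lemma eLpNorm_exp_mul_airyTransform_le {c : ℝ} (hc : 0 < c) (f : HalfL2) :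
    eLpNorm (fun v : ℝ => Complex.exp (c * v : ℝ) * pair (airyL2 0 v) f) 2 ≤
      ENNReal.ofReal (Real.exp (c ^ 3 / 3)) * eLpNorm f 2 halfLine := by
  have hcont : Continuous (𝓕 (damped c f)) :=
    VectorFourier.fourierIntegral_continuous Real.continuous_fourierChar
      (by simp only [innerₗ_apply_apply]; fun_prop) (integrable_damped hc f)
  set h := fun η => airyMultiplier c η * 𝓕 (damped c f) η with hh
  have hhc : Continuous h := by unfold h airyMultiplier; fun_prop
  have hle : ∀ η, ‖h η‖ ≤ Real.exp (c ^ 3 / 3) * ‖𝓕 (damped c f) η‖ := fun η => by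
    rw [hh, norm_mul, norm_airyMultiplier]
    gcongr
    exact mul_le_of_le_one_right (by positivity) (Real.exp_le_one_iff.mpr (by
      have : 0 ≤ c * (2 * Real.pi) ^ 2 * η ^ 2 := by positivity
      linarith))
  have hn : eLpNorm h 2 ≤ ENNReal.ofReal (Real.exp (c ^ 3 / 3)) * eLpNorm (𝓕 (damped c f)) 2 :=
    eLpNorm_le_mul_eLpNorm_of_ae_le_mul (Eventually.of_forall hle) 2
  rw [eLpNorm_fourier (integrable_damped hc f) (memLp_damped hc f)] at hn
  have hh2 : MemLp h 2 := ⟨hhc.aestronglyMeasurable, hn.trans_lt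
    (ENNReal.mul_lt_top ENNReal.ofReal_lt_top (memLp_damped hc f).2)⟩
  have hh1 : Integrable h := by
    have h2 : Integrable (fun η => Real.exp (c ^ 3 / 3) *
        Real.exp (-(c * (2 * Real.pi) ^ 2) * η ^ 2) * (∫ x, ‖damped c f x‖)) :=
      ((integrable_exp_neg_mul_sq (by positivity)).const_mul _).mul_const _
    refine Integrable.mono' h2 hhc.aestronglyMeasurable (Eventually.of_forall fun η => ?_)
    rw [hh, norm_mul, norm_airyMultiplier]
    gcongr
    exact VectorFourier.norm_fourierIntegral_le_integral_norm _ _ _ _ _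
  have e : (fun v : ℝ => Complex.exp (c * v : ℝ) * pair (airyL2 0 v) f) = 𝓕 h :=
    funext fun v => airyTransform_eq_fourier hc f v
  rw [e, eLpNorm_fourier hh1 hh2]
  refine hn.trans ?_
  gcongr
  exact eLpNorm_damped_le hc f

lemma continuous_airyTransform (f : HalfL2) : Continuous fun v => pair (airyL2 0 v) f :=
  (pair.flip f).continuous.comp (continuous_airyL2 0)

/-- The Airy transform is a contraction `L²(0, ∞) → L²(ℝ)`. -/
lemma eLpNorm_airyTransform_le (f : HalfL2) :
    eLpNorm (fun v : ℝ => pair (airyL2 0 v) f) 2 ≤ eLpNorm f 2 halfLine := by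
  have hc : ∀ n : ℕ, (0 : ℝ) < 1 / ((n : ℝ) + 1) := fun n => Nat.one_div_pos_of_nat
  have hlim : Tendsto (fun n : ℕ => 1 / ((n : ℝ) + 1)) atTop (𝓝 0) :=
    tendsto_one_div_add_atTop_nhds_zero_nat
  -- Fatou along c = 1/(n+1) → 0, where the constants exp(c³/3) tend to 1.
  have h1 := Lp.eLpNorm_lim_le_liminf_eLpNorm (p := 2) (μ := (volume : Measure ℝ))
    (f := fun (n : ℕ) (v : ℝ) => Complex.exp ((1 / ((n : ℝ) + 1)) * v : ℝ) * pair (airyL2 0 v) f)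
    (fun n => Continuous.aestronglyMeasurable
      ((by fun_prop : Continuous fun v : ℝ => Complex.exp ((1 / ((n : ℝ) + 1)) * v : ℝ)).mul
        (continuous_airyTransform f)))
    (fun v => pair (airyL2 0 v) f) (Eventually.of_forall fun v => ?_)
  · refine h1.trans ((liminf_le_liminf (Eventually.of_forall fun n =>
      eLpNorm_exp_mul_airyTransform_le (hc n) f)).trans (le_of_eq ?_))
    refine Tendsto.liminf_eq ?_
    have h2 : Tendsto (fun n : ℕ => ENNReal.ofReal (Real.exp ((1 / ((n : ℝ) + 1)) ^ 3 / 3)))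
        atTop (𝓝 1) := by
      have : Tendsto (fun x : ℝ => ENNReal.ofReal (Real.exp (x ^ 3 / 3))) (𝓝 0) (𝓝 1) := by
        have h3 : Continuous fun x : ℝ => ENNReal.ofReal (Real.exp (x ^ 3 / 3)) :=
        ENNReal.continuous_ofReal.comp (by fun_prop)
        simpa using h3.tendsto 0
      exact this.comp hlim
    simpa using ENNReal.Tendsto.mul_const (b := eLpNorm f 2 halfLine) h2 (Or.inl one_ne_zero)
  · have h3 : Tendsto (fun x : ℝ => Complex.exp (x * v : ℝ) * pair (airyL2 0 v) f) (𝓝 0)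
        (𝓝 (pair (airyL2 0 v) f)) := by
      have : Continuous fun x : ℝ => Complex.exp (x * v : ℝ) * pair (airyL2 0 v) f := by fun_prop
      simpa using this.tendsto 0
    exact h3.comp hlim

lemma memLp_airyTransform (f : HalfL2) : MemLp (fun v : ℝ => pair (airyL2 0 v) f) 2 :=
  ⟨(continuous_airyTransform f).aestronglyMeasurable,
    (eLpNorm_airyTransform_le f).trans_lt (Lp.eLpNorm_lt_top f)⟩

lemma integrable_normSq_airyTransform (f : HalfL2) :
    Integrable (fun v : ℝ => ‖pair (airyL2 0 v) f‖ ^ 2) :=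
  (memLp_two_iff_integrable_sq_norm (memLp_airyTransform f).1).mp (memLp_airyTransform f)

lemma integral_normSq_airyTransform_le (f : HalfL2) :
    ∫ v : ℝ, ‖pair (airyL2 0 v) f‖ ^ 2 ≤ ‖f‖ ^ 2 := by
  have h1 := ENNReal.toReal_mono (Lp.eLpNorm_ne_top f) (eLpNorm_airyTransform_le f)
  rw [← Lp.norm_def, (memLp_airyTransform f).eLpNorm_eq_integral_rpow_norm (by norm_num)
    (by norm_num), ENNReal.toReal_ofReal (by positivity)] at h1
  simp only [ENNReal.toReal_ofNat, Real.rpow_ofNat] at h1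
  have h0 : 0 ≤ ∫ v : ℝ, ‖pair (airyL2 0 v) f‖ ^ 2 := integral_nonneg fun v => by positivity
  calc _ = ((∫ v : ℝ, ‖pair (airyL2 0 v) f‖ ^ 2) ^ ((2 : ℝ)⁻¹)) ^ 2 := by
        rw [← Real.rpow_natCast, ← Real.rpow_mul h0]; norm_num
    _ ≤ _ := by gcongr

end AiryLax
end

/-! ### Integrals over σ and the half line; the kernel and its derivatives. -/

noncomputable section
namespace AiryLax

section Tail

variable {V : Type*} [NormedAddCommGroup V] [NormedSpace ℝ V] {σ : Measure ℝ}

/-- Locally uniform integrability of `(t, u) ↦ F (s + t + u)` over `σ ⊗ du`, `u > 0`. -/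
def TailBound (σ : Measure ℝ) (F : ℝ → V) : Prop :=
  ∀ ρ : ℝ, ∃ h : ℝ → ℝ, Integrable h σ ∧ ∀ s t u : ℝ, |s| ≤ ρ → 0 ≤ u →
    ‖F (s + t + u)‖ ≤ h t * ((1 + u) ^ 2)⁻¹

lemma ae_prod_halfLine [SFinite σ] {p : ℝ × ℝ → Prop} (h : ∀ t u, 0 < u → p (t, u)) :
    ∀ᵐ q ∂(σ.prod halfLine), p q := by
  have : ∀ᵐ q : ℝ × ℝ ∂(σ.prod halfLine), 0 < q.2 :=
    Measure.quasiMeasurePreserving_snd.ae (ae_halfLine fun z hz => hz)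
  filter_upwards [this] with q hq using h q.1 q.2 hq

lemma integrable_prod_halfLine [SFinite σ] {G : ℝ × ℝ → V} {h : ℝ → ℝ} (hG : Continuous G)
    (hh : Integrable h σ) (hb : ∀ t u, 0 < u → ‖G (t, u)‖ ≤ h t * ((1 + u) ^ 2)⁻¹) :
    Integrable G (σ.prod halfLine) := by
  have := hG.aestronglyMeasurable (μ := σ.prod halfLine)
  exact Integrable.mono' (hh.mul_prod integrable_one_add_inv_sq) this (ae_prod_halfLine hb)

lemma TailBound.integrable [SFinite σ] {F : ℝ → V} (hF : TailBound σ F) (hc : Continuous F) (s : ℝ) :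
    Integrable (fun p : ℝ × ℝ => F (s + p.1 + p.2)) (σ.prod halfLine) := by
  obtain ⟨h, hh, hb⟩ := hF |s|
  exact integrable_prod_halfLine (by fun_prop) hh fun t u hu => hb s t u le_rfl hu.le

lemma TailBound.integrable_boundary {F : ℝ → V} (hF : TailBound σ F)
    (hc : Continuous F) (s : ℝ) : Integrable (fun t : ℝ => F (s + t)) σ := by
  obtain ⟨h, hh, hb⟩ := hF |s|
  have hm : Continuous fun t => F (s + t) := by fun_prop
  refine Integrable.mono' hh hm.aestronglyMeasurable (Eventually.of_forall fun t => ?_)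
  simpa using hb s t 0 le_rfl le_rfl

variable [CompleteSpace V]

/-- Fundamental theorem of calculus in u for fixed t: only u = 0 contributes, since F vanishes as u
→ ∞. -/
lemma TailBound.integral_deriv [SFinite σ] {F F' : ℝ → V} (hF : TailBound σ F) (hF' : TailBound σ F')
    (hd : ∀ c, HasDerivAt F (F' c) c) (hc' : Continuous F') (s : ℝ) :
    ∫ p, F' (s + p.1 + p.2) ∂(σ.prod halfLine) = -∫ t, F (s + t) ∂σ := by
  rw [integral_prod _ (hF'.integrable hc' s), ← integral_neg]
  refine integral_congr_ae (Eventually.of_forall fun t => ?_)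
  simp only
  obtain ⟨h, hh, hb⟩ := hF |s|
  obtain ⟨h', hh', hb'⟩ := hF' |s|
  have hlim : Tendsto (fun u => F (s + t + u)) atTop (𝓝 0) := by
    refine squeeze_zero_norm' (a := fun u : ℝ => h t * ((1 + u) ^ 2)⁻¹) ?_ ?_
    · filter_upwards [eventually_ge_atTop 0] with u hu using hb s t u le_rfl hu
    · have : Tendsto (fun u : ℝ => (1 + u) ^ 2) atTop atTop :=
        (tendsto_pow_atTop two_ne_zero).comp (tendsto_atTop_add_const_left _ _ tendsto_id)
      simpa using this.inv_tendsto_atTop.const_mul (h t)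
  have hint : IntegrableOn (fun u => F' (s + t + u)) (Ioi 0) := by
    have hcu : Continuous fun u => F' (s + t + u) := by fun_prop
    exact Integrable.mono' (integrable_one_add_inv_sq.const_mul (h' t)) hcu.aestronglyMeasurable
      (ae_halfLine fun u hu => hb' s t u le_rfl hu.le)
  rw [integral_Ioi_of_hasDerivAt_of_tendsto' (f := fun u => F (s + t + u)) (m := 0) (fun u _ => ?_)
    hint hlim]
  · simp
  · simpa using (hd (s + t + u)).comp_const_add (s + t) u

/-- An s-derivative of F(s+t+u) is also a u-derivative, so the double integral collapses to its
boundary term. -/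
lemma TailBound.hasDerivAt [SFinite σ] {F F' : ℝ → V} (hF : TailBound σ F) (hF' : TailBound σ F')
    (hd : ∀ c, HasDerivAt F (F' c) c) (hc' : Continuous F') (s : ℝ) :
    HasDerivAt (fun s => ∫ p, F (s + p.1 + p.2) ∂(σ.prod halfLine)) (-∫ t, F (s + t) ∂σ) s := by
  have hc : Continuous F := continuous_iff_continuousAt.mpr fun c => (hd c).continuousAt
  rw [← hF.integral_deriv hF' hd hc']
  obtain ⟨h, hh, hb⟩ := hF' (|s| + 1)
  refine (hasDerivAt_integral_of_dominated_loc_of_deriv_le (μ := σ.prod halfLine)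
    (s := Metric.ball s 1) (F := fun (s : ℝ) (p : ℝ × ℝ) => F (s + p.1 + p.2))
    (F' := fun (s : ℝ) (p : ℝ × ℝ) => F' (s + p.1 + p.2))
    (bound := fun p => h p.1 * ((1 + p.2) ^ 2)⁻¹) (Metric.ball_mem_nhds s one_pos)
    (Eventually.of_forall fun r => (hF.integrable hc r).1) (hF.integrable hc s)
    (hF'.integrable hc' s).1 ?_ (hh.mul_prod integrable_one_add_inv_sq) ?_).2
  · refine ae_prod_halfLine fun t u hu r hr => hb r t u ?_ hu.le
    rw [Metric.mem_ball, Real.dist_eq] at hr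
    have := abs_add_le (r - s) s
    rw [sub_add_cancel] at this; linarith
  · refine Eventually.of_forall fun p r _ => ?_
    have e : (fun r => F (r + p.1 + p.2)) = fun r => F (r + (p.1 + p.2)) := by
      ext r; rw [add_assoc]
    rw [e, add_assoc]
    exact (hd _).comp_add_const r (p.1 + p.2)

end Tail

variable {σ : Measure ℝ} [IsProbabilityMeasure σ] {Z : Set ℂ}

lemma one_add_abs_add_le {s ρ : ℝ} (hs : |s| ≤ ρ) (t : ℝ) : 1 + |s + t| ≤ (1 + ρ) * (1 + |t|) := by
  have h1 := abs_add_le s t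
  have h2 : 0 ≤ ρ := (abs_nonneg s).trans hs
  nlinarith [abs_nonneg t, mul_nonneg h2 (abs_nonneg t)]

/-- The basic joint bound for products of shifted Airy functions. -/
lemma Admissible.bound (hZ : Admissible σ Z) (n m N : ℕ) (ρ : ℝ) :
    ∃ h : ℝ → ℝ, Integrable h σ ∧ (∀ t, 0 ≤ h t) ∧ ∀ z ∈ Z, ‖z‖ ≤ ρ → ∀ s t u w : ℝ, |s| ≤ ρ → 0 ≤ u →
      0 ≤ w → ‖airyD n (z + (s + t + u : ℝ))‖ * ‖airyD m (w + (s + t + u : ℝ))‖ ≤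
        h t * ((1 + u) ^ 2)⁻¹ * ((1 + w) ^ N)⁻¹ := by
  obtain ⟨ω, hωc, hω1, hωi, hω⟩ := hZ.weight n (ρ + ρ)
  obtain ⟨C, a, hC, hb⟩ := norm_airyD_shift_le m (N + 2)
  rcases lt_or_ge ρ 0 with hρ | hρ
  · exact ⟨0, integrable_zero _ _ _, fun _ => le_rfl, fun z _ hz => absurd ((norm_nonneg z).trans hz) (not_le.mpr hρ)⟩
  have h0 : ∀ t, 0 ≤ ω t := fun t => zero_le_one.trans (hω1 t)
  refine ⟨fun t => C * (1 + ρ) ^ a * (ω t * (1 + |t|) ^ a), ?_, fun t => ?_, ?_⟩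
  · refine Integrable.const_mul ?_ _
    refine Integrable.mono' (hωi a) (by fun_prop) (Eventually.of_forall fun t => ?_)
    rw [Real.norm_of_nonneg (mul_nonneg (h0 t) (by positivity))]
    gcongr
    nlinarith [hω1 t]
  · have := h0 t; positivity
  · intro z hz hzρ s t u w hs hu hw
    have e1 : ‖airyD n (z + (s + t + u : ℝ))‖ ≤ ω t := by
      have e : z + (s + t + u : ℝ) = (z + s) + t + u := by push_cast; ring
      rw [e]
      refine hω _ (hZ.shift z hz s) ((norm_add_le _ _).trans ?_) t u hu
      rw [Complex.norm_real, Real.norm_eq_abs]; linarith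
    have e2 : ‖airyD m (w + (s + t + u : ℝ))‖ ≤ C * ((1 + ρ) * (1 + |t|)) ^ a *
        ((1 + u) ^ 2)⁻¹ * ((1 + w) ^ N)⁻¹ := by
      have e : (w : ℂ) + (s + t + u : ℝ) = ((w + u : ℝ) : ℂ) + (s + t : ℝ) := by push_cast; ring
      rw [e]
      refine (hb (s + t) (w + u) (by linarith)).trans ?_
      rw [div_eq_mul_inv, mul_assoc (C * _), ← mul_inv]
      gcongr
      · exact one_add_abs_add_le hs t
      · rw [pow_add, mul_comm]; gcongr <;> linarith
    calc _ ≤ ω t * (C * ((1 + ρ) * (1 + |t|)) ^ a * ((1 + u) ^ 2)⁻¹ * ((1 + w) ^ N)⁻¹) :=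
          mul_le_mul e1 e2 (norm_nonneg _) (h0 t)
      _ = _ := by rw [mul_pow]; ring

lemma Admissible.bound_airyL2 (hZ : Admissible σ Z) (n m : ℕ) (ρ : ℝ) :
    ∃ h : ℝ → ℝ, Integrable h σ ∧ (∀ t, 0 ≤ h t) ∧ ∀ z ∈ Z, ‖z‖ ≤ ρ → ∀ s t u : ℝ, |s| ≤ ρ → 0 ≤ u →
      ‖airyD n (z + (s + t + u : ℝ)) • airyL2 m (s + t + u)‖ ≤ h t * ((1 + u) ^ 2)⁻¹ := by
  obtain ⟨h, hh, h0, hb⟩ := hZ.bound n m 1 ρ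
  refine ⟨fun t => h t * invNorm, hh.mul_const _, fun t => mul_nonneg (h0 t) invNorm_nonneg,
    fun z hz hzρ s t u hs hu => ?_⟩
  have : ‖airyD n (z + (s + t + u : ℝ)) • airyL2 m (s + t + u)‖ ≤
      (h t * ((1 + u) ^ 2)⁻¹) * invNorm := by
    refine norm_halfL2_le ?_
    filter_upwards [Lp.coeFn_smul (airyD n (z + (s + t + u : ℝ))) (airyL2 m (s + t + u)),
      coeFn_airyL2 m (s + t + u), ae_halfLine fun w hw => hw] with w h1 h2 h3
    rw [h1, Pi.smul_apply, h2, norm_smul]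
    simpa using hb z hz hzρ s t u w hs hu h3.le
  refine this.trans (le_of_eq (by ring))

lemma continuous_airyD_smul_airyL2 (n m : ℕ) (z : ℂ) :
    Continuous fun c : ℝ => airyD n (z + c) • airyL2 m c :=
  ((continuous_airyD n).comp (by fun_prop)).smul (continuous_airyL2 m)

lemma Admissible.tailBound_smul (hZ : Admissible σ Z) (n m : ℕ) {z : ℂ} (hz : z ∈ Z) :
    TailBound σ fun c : ℝ => airyD n (z + c) • airyL2 m c := by
  intro ρ
  obtain ⟨h, hh, h0, hb⟩ := hZ.bound_airyL2 n m (max ρ ‖z‖)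
  exact ⟨h, hh, fun s t u hs hu => hb z hz (le_max_right _ _) s t u (hs.trans (le_max_left _ _)) hu⟩

/-- The row `w ↦ ∫∫ Ai⁽ⁿ⁾(z+s+t+u) Ai⁽ᵐ⁾(w+s+t+u) du dσ(t)` of a kernel, in `L²(0, ∞)`. -/
def kerRow (σ : Measure ℝ) (n m : ℕ) (s : ℝ) (z : ℂ) : HalfL2 :=
  ∫ p : ℝ × ℝ, airyD n (z + (s + p.1 + p.2 : ℝ)) • airyL2 m (s + p.1 + p.2) ∂(σ.prod halfLine)

/-- The kernel `∫∫ Ai⁽ⁿ⁾(z+s+t+u) Ai⁽ᵐ⁾(w+s+t+u) du dσ(t)`. -/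
def kerVal (σ : Measure ℝ) (n m : ℕ) (s : ℝ) (z w : ℂ) : ℂ :=
  ∫ p : ℝ × ℝ, airyD n (z + (s + p.1 + p.2 : ℝ)) * airyD m (w + (s + p.1 + p.2 : ℝ))
    ∂(σ.prod halfLine)

lemma Admissible.integrable_smul (hZ : Admissible σ Z) (n m : ℕ) {z : ℂ} (hz : z ∈ Z) (s : ℝ) :
    Integrable (fun p : ℝ × ℝ => airyD n (z + (s + p.1 + p.2 : ℝ)) • airyL2 m (s + p.1 + p.2))
      (σ.prod halfLine) :=
  (hZ.tailBound_smul n m hz).integrable (continuous_airyD_smul_airyL2 n m z) s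

lemma Admissible.pair_kerRow (hZ : Admissible σ Z) (n m : ℕ) {z : ℂ} (hz : z ∈ Z) (s : ℝ)
    (f : HalfL2) : pair (kerRow σ n m s z) f =
      ∫ p : ℝ × ℝ, airyD n (z + (s + p.1 + p.2 : ℝ)) * pair (airyL2 m (s + p.1 + p.2)) f
        ∂(σ.prod halfLine) := by
  have := ((pair.flip f).integral_comp_comm (hZ.integrable_smul n m hz s)).symm
  rw [kerRow]; simpa using this

lemma Admissible.coeFn_kerRow (hZ : Admissible σ Z) (n m : ℕ) {z : ℂ} (hz : z ∈ Z) (s : ℝ) :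
    kerRow σ n m s z =ᵐ[halfLine] fun w : ℝ => kerVal σ n m s z w := by
  obtain ⟨h, hh, h0, hb⟩ := hZ.bound n m 1 (max |s| ‖z‖)
  refine (coeFn_integral_halfL2 (μ := σ.prod halfLine)
    (φ := fun p w => airyD n (z + (s + p.1 + p.2 : ℝ)) * airyD m (w + (s + p.1 + p.2 : ℝ)))
    (h := fun p => h p.1 * ((1 + p.2) ^ 2)⁻¹) ?_ (fun p => ?_)
    (hZ.integrable_smul n m hz s).1 (hh.mul_prod integrable_one_add_inv_sq) ?_).2
  · refine Continuous.aestronglyMeasurable ?_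
    have := continuous_airyD n
    have := continuous_airyD m
    simp only [Function.uncurry_def]
    fun_prop
  · filter_upwards [Lp.coeFn_smul (airyD n (z + (s + p.1 + p.2 : ℝ))) (airyL2 m (s + p.1 + p.2)),
      coeFn_airyL2 m (s + p.1 + p.2)] with w h1 h2
    rw [h1, Pi.smul_apply, h2, smul_eq_mul]
  · refine ae_prod_halfLine fun t u hu w hw => ?_
    rw [norm_mul]
    simpa using hb z hz (le_max_right _ _) s t u w (le_max_left _ _) hu.le hw.le

lemma Admissible.hasDerivAt_kerRow (hZ : Admissible σ Z) (n m : ℕ) {z : ℂ} (hz : z ∈ Z) (s : ℝ)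
    (r : ℝ) : HasDerivAt (fun r : ℝ => kerRow σ n m s (z + r)) (kerRow σ (n + 1) m s (z + r)) r := by
  obtain ⟨h, hh, h0, hb⟩ := hZ.bound_airyL2 (n + 1) m (max |s| (‖z‖ + (|r| + 1)))
  refine (hasDerivAt_integral_of_dominated_loc_of_deriv_le (μ := σ.prod halfLine)
    (s := Metric.ball r 1)
    (F := fun (r : ℝ) (p : ℝ × ℝ) =>
      airyD n (z + r + (s + p.1 + p.2 : ℝ)) • airyL2 m (s + p.1 + p.2))
    (F' := fun (r : ℝ) (p : ℝ × ℝ) =>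
      airyD (n + 1) (z + r + (s + p.1 + p.2 : ℝ)) • airyL2 m (s + p.1 + p.2))
    (bound := fun p => h p.1 * ((1 + p.2) ^ 2)⁻¹) (Metric.ball_mem_nhds r one_pos)
    (Eventually.of_forall fun r => (hZ.integrable_smul n m (hZ.shift z hz r) s).1)
    (hZ.integrable_smul n m (hZ.shift z hz r) s)
    (hZ.integrable_smul (n + 1) m (hZ.shift z hz r) s).1 ?_
    (hh.mul_prod integrable_one_add_inv_sq) ?_).2
  · refine ae_prod_halfLine fun t u hu q hq => ?_
    refine hb _ (hZ.shift z hz q) (le_trans ?_ (le_max_right _ _)) s t u (le_max_left _ _) hu.le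
    refine (norm_add_le _ _).trans ?_
    rw [Metric.mem_ball, Real.dist_eq] at hq
    have := abs_add_le (q - r) r
    rw [sub_add_cancel] at this
    rw [Complex.norm_real, Real.norm_eq_abs]; linarith
  · refine Eventually.of_forall fun p q _ => ?_
    have := hasDerivAt_airyD_ofReal n (z + (s + p.1 + p.2 : ℝ)) q
    have e : ∀ q : ℝ, z + q + (s + p.1 + p.2 : ℝ) = z + (s + p.1 + p.2 : ℝ) + q := fun q => by ring
    simp only [e]
    exact this.smul_const _

lemma Admissible.integrable_boundary (hZ : Admissible σ Z) (n m : ℕ) {z : ℂ} (hz : z ∈ Z) (s : ℝ) :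
    Integrable (fun t : ℝ => airyD n (z + (s + t : ℝ)) • airyL2 m (s + t)) σ :=
  (hZ.tailBound_smul n m hz).integrable_boundary (continuous_airyD_smul_airyL2 n m z) s

lemma hasDerivAt_airyD_smul_airyL2 (z : ℂ) (c : ℝ) :
    HasDerivAt (fun c : ℝ => airyD 0 (z + c) • airyL2 0 c)
      (airyD 1 (z + c) • airyL2 0 c + airyD 0 (z + c) • airyL2 1 c) c := by
  rw [add_comm]
  exact (hasDerivAt_airyD_ofReal 0 z c).smul (hasDerivAt_airyL2 0 c)

lemma TailBound.add {V : Type*} [NormedAddCommGroup V] [NormedSpace ℝ V]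
    {F G : ℝ → V} (hF : TailBound σ F) (hG : TailBound σ G) :
    TailBound σ (fun c => F c + G c) := by
  intro ρ
  obtain ⟨h, hh, hb⟩ := hF ρ
  obtain ⟨h', hh', hb'⟩ := hG ρ
  refine ⟨fun t => h t + h' t, hh.add hh', fun s t u hs hu => (norm_add_le _ _).trans ?_⟩
  rw [add_mul]
  exact add_le_add (hb s t u hs hu) (hb' s t u hs hu)

/-- `TailBound.hasDerivAt` for F = Ai⊗Ai. That the s-derivative of the kernel is a σ-superposition
of rank one terms is what keeps the s-equation closed. -/
lemma Admissible.hasDerivAt_kerRow_param (hZ : Admissible σ Z) {z : ℂ} (hz : z ∈ Z) (s : ℝ) :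
    HasDerivAt (fun s : ℝ => kerRow σ 0 0 s z)
      (-∫ t, airyD 0 (z + (s + t : ℝ)) • airyL2 0 (s + t) ∂σ) s :=
  (hZ.tailBound_smul 0 0 hz).hasDerivAt
    ((hZ.tailBound_smul 1 0 hz).add (hZ.tailBound_smul 0 1 hz))
    (hasDerivAt_airyD_smul_airyL2 z)
    ((continuous_airyD_smul_airyL2 1 0 z).add (continuous_airyD_smul_airyL2 0 1 z)) s

/-- ∂_z + ∂_w acts on the integrand as ∂_u, leaving the boundary term at u = 0. This trades a
derivative in z for one in w, which can then be integrated by parts. -/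
lemma Admissible.kerRow_one_zero (hZ : Admissible σ Z) {z : ℂ} (hz : z ∈ Z) (s : ℝ) :
    kerRow σ 1 0 s z =
      -(∫ t, airyD 0 (z + (s + t : ℝ)) • airyL2 0 (s + t) ∂σ) - kerRow σ 0 1 s z := by
  have := (hZ.tailBound_smul 0 0 hz).integral_deriv
    ((hZ.tailBound_smul 1 0 hz).add (hZ.tailBound_smul 0 1 hz))
    (hasDerivAt_airyD_smul_airyL2 z)
    ((continuous_airyD_smul_airyL2 1 0 z).add (continuous_airyD_smul_airyL2 0 1 z)) s
  rw [← this, integral_add (hZ.integrable_smul 1 0 hz s) (hZ.integrable_smul 0 1 hz s)]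
  exact (add_sub_cancel_right _ _).symm

/-! ### Scalar kernels -/

lemma Admissible.tailBound_mul (hZ : Admissible σ Z) (n m : ℕ) {z : ℂ} (hz : z ∈ Z) {w : ℝ}
    (hw : 0 ≤ w) : TailBound σ fun c : ℝ => airyD n (z + c) * airyD m (w + c) := by
  intro ρ
  obtain ⟨h, hh, h0, hb⟩ := hZ.bound n m 0 (max ρ ‖z‖)
  refine ⟨h, hh, fun s t u hs hu => ?_⟩
  have := hb z hz (le_max_right _ _) s t u w (hs.trans (le_max_left _ _)) hu hw
  rw [norm_mul]
  simpa using this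

lemma continuous_airyD_mul (n m : ℕ) (z w : ℂ) :
    Continuous fun c : ℝ => airyD n (z + c) * airyD m (w + c) :=
  ((continuous_airyD n).comp (by fun_prop)).mul ((continuous_airyD m).comp (by fun_prop))

/-- The Christoffel–Darboux type formula for the kernel. -/
lemma Admissible.sub_mul_kerVal (hZ : Admissible σ Z) {z : ℂ} (hz : z ∈ Z) {w : ℝ} (hw : 0 ≤ w)
    (s : ℝ) : (z - w) * kerVal σ 0 0 s z w =
      ∫ t, (airyD 0 (z + (s + t : ℝ)) * airyD 1 (w + (s + t : ℝ)) -
        airyD 1 (z + (s + t : ℝ)) * airyD 0 (w + (s + t : ℝ))) ∂σ := by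
  have hF : TailBound σ fun c : ℝ => airyD 0 (z + c) * airyD 1 (w + c) -
      airyD 1 (z + c) * airyD 0 (w + c) := by
    intro ρ
    obtain ⟨h, hh, hb⟩ := hZ.tailBound_mul 0 1 hz hw ρ
    obtain ⟨h', hh', hb'⟩ := hZ.tailBound_mul 1 0 hz hw ρ
    refine ⟨fun t => h t + h' t, hh.add hh', fun s t u hs hu => (norm_sub_le _ _).trans ?_⟩
    rw [add_mul]
    exact add_le_add (hb s t u hs hu) (hb' s t u hs hu)
  have hF' : TailBound σ fun c : ℝ => (w - z) * (airyD 0 (z + c) * airyD 0 (w + c)) := by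
    intro ρ
    obtain ⟨h, hh, hb⟩ := hZ.tailBound_mul 0 0 hz hw ρ
    refine ⟨fun t => ‖(w - z : ℂ)‖ * h t, hh.const_mul _, fun s t u hs hu => ?_⟩
    rw [norm_mul, mul_assoc]
    gcongr
    exact hb s t u hs hu
  -- By the Airy equation the Wronskian-type expression has derivative (w - z) Ai(z+c) Ai(w+c), so
  -- the u-integral of the product is explicit.
  have hd : ∀ c : ℝ, HasDerivAt (fun c : ℝ => airyD 0 (z + c) * airyD 1 (w + c) -
      airyD 1 (z + c) * airyD 0 (w + c)) ((w - z) * (airyD 0 (z + c) * airyD 0 (w + c))) c := by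
    intro c
    refine (((hasDerivAt_airyD_ofReal 0 z c).mul (hasDerivAt_airyD_ofReal 1 w c)).sub
      ((hasDerivAt_airyD_ofReal 1 z c).mul (hasDerivAt_airyD_ofReal 0 w c))).congr_deriv ?_
    simp only [zero_add, one_add_one_eq_two, airyD_two]; ring
  have := hF.integral_deriv hF' hd ((continuous_airyD_mul 0 0 z w).const_smul (w - z : ℂ)) s
  rw [integral_const_mul] at this
  rw [kerVal, ← neg_sub, neg_mul, this, neg_neg]

end AiryLax
end

/-! ### Holomorphic parameter integrals. -/

noncomputable section
namespace AiryLax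

/-- Holomorphic dependence of an integral on a parameter, under local domination. -/
lemma differentiableOn_integral {X : Type*} [MeasurableSpace X] {μ : Measure X} {U : Set ℂ}
    (hU : IsOpen U) {F : ℂ → X → ℂ} (hm : ∀ z ∈ U, AEStronglyMeasurable (F z) μ)
    (hd : ∀ᵐ x ∂μ, DifferentiableOn ℂ (fun z => F z x) U)
    (hb : ∀ z₀ ∈ U, ∃ ε > 0, ∃ g : X → ℝ, Integrable g μ ∧
      ∀ᵐ x ∂μ, ∀ z ∈ U, ‖z - z₀‖ ≤ ε → ‖F z x‖ ≤ g x) :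
    DifferentiableOn ℂ (fun z => ∫ x, F z x ∂μ) U := by
  intro z₀ hz₀
  obtain ⟨ε₁, hε₁, g, hg, hgb⟩ := hb z₀ hz₀
  obtain ⟨ε₂, hε₂, hball⟩ := Metric.isOpen_iff.mp hU z₀ hz₀
  set ε := min ε₁ ε₂ / 4 with hε
  have hε0 : 0 < ε := by positivity
  have hε4 : 4 * ε ≤ ε₁ := by rw [hε]; linarith [min_le_left ε₁ ε₂]
  have hε5 : 4 * ε ≤ ε₂ := by rw [hε]; linarith [min_le_right ε₁ ε₂]
  have hsub : ∀ z, ‖z - z₀‖ < 4 * ε → z ∈ U := fun z hz =>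
    hball (by rw [Metric.mem_ball, dist_eq_norm]; linarith)
  have hae : ∀ᵐ x ∂μ, ∀ z, ‖z - z₀‖ < 4 * ε → ‖F z x‖ ≤ g x := by
    filter_upwards [hgb] with x hx z hz using hx z (hsub z hz) (by linarith)
  have hderiv : ∀ᵐ x ∂μ, ∀ z ∈ Metric.ball z₀ ε,
      HasDerivAt (fun z => F z x) (deriv (fun z => F z x) z) z := by
    filter_upwards [hd] with x hx z hz
    have hz' : ‖z - z₀‖ < ε := by rwa [Metric.mem_ball, dist_eq_norm] at hz
    exact (hx.differentiableAt (hU.mem_nhds (hsub z (by linarith)))).hasDerivAt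
  have key := hasDerivAt_integral_of_dominated_loc_of_deriv_le (μ := μ) (x₀ := z₀)
    (s := Metric.ball z₀ ε) (F := F) (F' := fun z x => deriv (fun z => F z x) z)
    (bound := fun x => g x / ε) (Metric.ball_mem_nhds z₀ hε0) ?_ ?_ ?_ ?_ (hg.div_const ε) hderiv
  · exact key.2.differentiableAt.differentiableWithinAt
  · filter_upwards [hU.mem_nhds hz₀] with z hz using hm z hz
  · refine hg.mono' (hm z₀ hz₀) ?_
    filter_upwards [hae] with x hx using hx z₀ (by simp [hε0])
  -- The derivative is measurable as a pointwise limit of difference quotients along a sequence of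
  -- steps tending to 0.
  · have hlim : Tendsto (fun n : ℕ => (ε / 2) * (1 / ((n : ℝ) + 1))) atTop (𝓝 0) := by
      simpa using tendsto_one_div_add_atTop_nhds_zero_nat.const_mul (ε / 2)
    have hpos : ∀ n : ℕ, 0 < (ε / 2) * (1 / ((n : ℝ) + 1)) := fun n => by positivity
    have hle : ∀ n : ℕ, (ε / 2) * (1 / ((n : ℝ) + 1)) ≤ ε / 2 := fun n => by
      refine mul_le_of_le_one_right (by positivity) ?_
      rw [div_le_one (by positivity)]; linarith [Nat.cast_nonneg (α := ℝ) n]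
    refine aestronglyMeasurable_of_tendsto_ae atTop
      (f := fun (n : ℕ) x => (((ε / 2) * (1 / ((n : ℝ) + 1)) : ℝ) : ℂ)⁻¹ *
        (F (z₀ + ((ε / 2) * (1 / ((n : ℝ) + 1)) : ℝ)) x - F z₀ x)) (fun n => ?_) ?_
    · refine ((hm _ (hsub _ ?_)).sub (hm z₀ hz₀)).const_mul _
      rw [add_sub_cancel_left, Complex.norm_real, Real.norm_of_nonneg (hpos n).le]
      linarith [hle n]
    · filter_upwards [hderiv] with x hx
      have h1 := hasDerivAt_iff_tendsto_slope_zero.mp (hx z₀ (Metric.mem_ball_self hε0))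
      have h2 : Tendsto (fun n : ℕ => (((ε / 2) * (1 / ((n : ℝ) + 1)) : ℝ) : ℂ)) atTop (𝓝[≠] 0) := by
        refine tendsto_nhdsWithin_iff.mpr ⟨?_, Eventually.of_forall fun n => ?_⟩
        · exact_mod_cast (Complex.continuous_ofReal.tendsto 0).comp hlim
        · exact Complex.ofReal_ne_zero.mpr (hpos n).ne'
      exact h1.comp h2
  -- Cauchy's estimate on a circle of radius ε bounds the derivative by g/ε, so no domination of
  -- derivatives has to be assumed.
  · filter_upwards [hae, hd] with x hx hdx z hz
    have hz' : ‖z - z₀‖ < ε := by rwa [Metric.mem_ball, dist_eq_norm] at hz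
    refine Complex.norm_deriv_le_of_forall_mem_sphere_norm_le hε0 ?_ fun w hw => hx w ?_
    · refine (hdx.mono ?_).diffContOnCl (s := Metric.ball z ε)
      rw [closure_ball z hε0.ne']
      intro w hw
      rw [Metric.mem_closedBall, dist_eq_norm] at hw
      refine hsub w ?_
      calc ‖w - z₀‖ = ‖(w - z) + (z - z₀)‖ := by rw [sub_add_sub_cancel]
        _ ≤ _ := norm_add_le _ _
        _ < _ := by linarith
    · rw [mem_sphere_iff_norm] at hw
      calc ‖w - z₀‖ = ‖(w - z) + (z - z₀)‖ := by rw [sub_add_sub_cancel]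
        _ ≤ _ := norm_add_le _ _
        _ < _ := by linarith

/-! ### The operator `K` -/

/-- The rank one operators `f ↦ ⟨Ai⁽ⁿ⁾(·+c), f⟩ Ai⁽ᵐ⁾(·+c)`. -/
def airyTensor (n m : ℕ) (c : ℝ) : HalfL2 →L[ℂ] HalfL2 :=
  ContinuousLinearMap.smulRightL ℂ HalfL2 HalfL2 (pair (airyL2 n c)) (airyL2 m c)

lemma airyTensor_apply (n m : ℕ) (c : ℝ) (f : HalfL2) :
    airyTensor n m c f = pair (airyL2 n c) f • airyL2 m c := rfl

lemma norm_airyTensor_le (n m : ℕ) (c : ℝ) :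
    ‖airyTensor n m c‖ ≤ ‖pair‖ * ‖airyL2 n c‖ * ‖airyL2 m c‖ := by
  refine (ContinuousLinearMap.opNorm_le_bound _ (by positivity) fun f => ?_)
  rw [airyTensor_apply, norm_smul]
  calc _ ≤ (‖pair‖ * ‖airyL2 n c‖ * ‖f‖) * ‖airyL2 m c‖ := by gcongr; exact norm_pair_le _ _
    _ = _ := by ring

lemma hasDerivAt_airyTensor (n m : ℕ) (c : ℝ) :
    HasDerivAt (airyTensor n m) (airyTensor n (m + 1) c + airyTensor (n + 1) m c) c := by
  have h1 : HasDerivAt (fun c => pair (airyL2 n c)) (pair (airyL2 (n + 1) c)) c :=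
    (pair.restrictScalars ℝ).hasFDerivAt.comp_hasDerivAt c (hasDerivAt_airyL2 n c)
  have := (((ContinuousLinearMap.smulRightL ℂ HalfL2 HalfL2).bilinearRestrictScalars ℝ)).hasDerivAt_of_bilinear
    (fun _ => h1) (fun _ => hasDerivAt_airyL2 m c)
  exact this

variable {σ : Measure ℝ} [IsProbabilityMeasure σ] {Z : Set ℂ}

lemma tailBound_airyTensor (hσ : FiniteMoments σ) (n m : ℕ) : TailBound σ (airyTensor n m) := by
  intro ρ
  rcases lt_or_ge ρ 0 with hρ | hρ
  · exact ⟨0, integrable_zero _ _ _, fun s _ _ hs => absurd ((abs_nonneg s).trans hs) (not_le.mpr hρ)⟩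
  obtain ⟨C, a, hC, hb⟩ := norm_airyL2_le n 2
  obtain ⟨C', a', hC', hb'⟩ := norm_airyL2_le m 0
  refine ⟨fun t => ‖pair‖ * C * C' * (1 + ρ) ^ (a + a') * (1 + |t|) ^ (a + a'),
    (hσ (a + a')).const_mul _, fun s t u hs hu => (norm_airyTensor_le n m _).trans ?_⟩
  calc _ ≤ ‖pair‖ * (C * ((1 + ρ) * (1 + |t|)) ^ a / (1 + u) ^ 2) *
        (C' * ((1 + ρ) * (1 + |t|)) ^ a') := by
        have h1 := one_add_abs_add_le hs t
        gcongr
        · exact (hb (s + t) u hu).trans (by gcongr)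
        · refine (hb' (s + t) u hu).trans ?_
          rw [pow_zero, div_one]; gcongr
    _ = _ := by beta_reduce; rw [mul_pow, mul_pow, pow_add, pow_add, div_eq_mul_inv]; ring

/-- The operator `K_{σ,s}` on `L²(0, ∞)`. -/
def kerOp (σ : Measure ℝ) (s : ℝ) : HalfL2 →L[ℂ] HalfL2 :=
  ∫ p : ℝ × ℝ, airyTensor 0 0 (s + p.1 + p.2) ∂(σ.prod halfLine)

lemma continuous_airyTensor (n m : ℕ) : Continuous (airyTensor n m) :=
  continuous_iff_continuousAt.mpr fun c => (hasDerivAt_airyTensor n m c).continuousAt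

lemma integrable_airyTensor (hσ : FiniteMoments σ) (s : ℝ) :
    Integrable (fun p : ℝ × ℝ => airyTensor 0 0 (s + p.1 + p.2)) (σ.prod halfLine) :=
  (tailBound_airyTensor hσ 0 0).integrable (continuous_airyTensor 0 0) s

lemma hasDerivAt_kerOp (hσ : FiniteMoments σ) (s : ℝ) :
    HasDerivAt (kerOp σ) (-∫ t, airyTensor 0 0 (s + t) ∂σ) s :=
  (tailBound_airyTensor hσ 0 0).hasDerivAt
    ((tailBound_airyTensor hσ 0 1).add (tailBound_airyTensor hσ 1 0))
    (hasDerivAt_airyTensor 0 0) ((continuous_airyTensor 0 1).add (continuous_airyTensor 1 0)) s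

lemma integrable_airyTensor_apply (hσ : FiniteMoments σ) (s : ℝ) (f : HalfL2) :
    Integrable (fun p : ℝ × ℝ => pair (airyL2 0 (s + p.1 + p.2)) f • airyL2 0 (s + p.1 + p.2))
      (σ.prod halfLine) :=
  (ContinuousLinearMap.apply ℂ HalfL2 f).integrable_comp (integrable_airyTensor hσ s)

lemma kerOp_apply (hσ : FiniteMoments σ) (s : ℝ) (f : HalfL2) :
    kerOp σ s f =
      ∫ p : ℝ × ℝ, pair (airyL2 0 (s + p.1 + p.2)) f • airyL2 0 (s + p.1 + p.2) ∂(σ.prod halfLine) :=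
  ((ContinuousLinearMap.apply ℂ HalfL2 f).integral_comp_comm (integrable_airyTensor hσ s)).symm

lemma coeFn_kerOp (hσ : FiniteMoments σ) (s : ℝ) (f : HalfL2) :
    kerOp σ s f =ᵐ[halfLine] fun w : ℝ => pair (kerRow σ 0 0 s w) f := by
  obtain ⟨C, a, hC, hb⟩ := norm_airyL2_le 0 0
  obtain ⟨C', a', hC', hb'⟩ := norm_airyD_shift_le_inv 0 2
  rw [kerOp_apply hσ]
  have key := (coeFn_integral_halfL2 (μ := σ.prod halfLine)
    (φ := fun p w => pair (airyL2 0 (s + p.1 + p.2)) f * airyD 0 (w + (s + p.1 + p.2 : ℝ)))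
    (Φ := fun p => pair (airyL2 0 (s + p.1 + p.2)) f • airyL2 0 (s + p.1 + p.2))
    (h := fun p => (‖pair‖ * C * C' * (1 + |s|) ^ (a + a') * ‖f‖) * (1 + |p.1|) ^ (a + a') *
      ((1 + p.2) ^ 2)⁻¹) ?_ (fun p => ?_)
    (integrable_airyTensor_apply hσ s f).1
    (((hσ (a + a')).const_mul _).mul_prod integrable_one_add_inv_sq) ?_).2
  · filter_upwards [key] with w hw
    rw [hw, hσ.admissible.pair_kerRow 0 0 (hσ.admissible.real w)]
    simp only [mul_comm]
  · refine Continuous.aestronglyMeasurable ?_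
    have := continuous_airyD 0
    have := continuous_airyTransform f
    simp only [Function.uncurry_def]
    have h3 : Continuous fun x : (ℝ × ℝ) × ℝ => pair (airyL2 0 (s + x.1.1 + x.1.2)) f :=
      (continuous_airyTransform f).comp (by fun_prop)
    exact h3.mul ((continuous_airyD 0).comp (by fun_prop))
  · filter_upwards [Lp.coeFn_smul (pair (airyL2 0 (s + p.1 + p.2)) f) (airyL2 0 (s + p.1 + p.2)),
      coeFn_airyL2 0 (s + p.1 + p.2)] with w h1 h2
    rw [h1, Pi.smul_apply, h2, smul_eq_mul]
  · refine ae_prod_halfLine fun t u hu w hw => ?_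
    rw [norm_mul]
    have h1 := one_add_abs_add_le (le_refl |s|) t
    have h2 := hb (s + t) u hu.le
    have h3 := hb' (s + t) u w hu.le hw.le
    rw [pow_zero, div_one] at h2
    calc _ ≤ (‖pair‖ * (C * ((1 + |s|) * (1 + |t|)) ^ a) * ‖f‖) *
          (C' * ((1 + |s|) * (1 + |t|)) ^ a' / (1 + u) ^ 2 * (1 + w)⁻¹) := by
          gcongr
          · refine (norm_pair_le _ _).trans ?_
            gcongr
            exact h2.trans (by gcongr)
          · exact h3.trans (by gcongr)
      _ = _ := by rw [mul_pow, mul_pow, pow_add, pow_add, div_eq_mul_inv]; ring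

lemma pair_kerOp (hσ : FiniteMoments σ) (s : ℝ) (f g : HalfL2) :
    pair (kerOp σ s f) g = pair f (kerOp σ s g) := by
  have h1 : ∀ f g : HalfL2, pair (kerOp σ s f) g =
      ∫ p : ℝ × ℝ, pair (airyL2 0 (s + p.1 + p.2)) f * pair (airyL2 0 (s + p.1 + p.2)) g
        ∂(σ.prod halfLine) := by
    intro f g
    have := ((pair.flip g).integral_comp_comm (integrable_airyTensor_apply hσ s f)).symm
    rw [kerOp_apply hσ]
    simpa using this
  rw [pair_comm f, h1, h1]
  simp only [mul_comm]

/-- A functional separating the integral from the subspace is bounded above on a subspace, hence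
zero on it, hence zero on the integral, which contradicts the separation. -/
lemma integral_mem_of_isClosed {T V : Type*} [MeasurableSpace T] {μ : Measure T}
    [NormedAddCommGroup V] [NormedSpace ℝ V] [NormedSpace ℂ V] [IsScalarTower ℝ ℂ V]
    [CompleteSpace V] {S : Submodule ℂ V} (hS : IsClosed (S : Set V)) {F : T → V}
    (hF : Integrable F μ) (hmem : ∀ τ, F τ ∈ S) : ∫ τ, F τ ∂μ ∈ S := by
  by_contra hx
  obtain ⟨f, u, h1, h2⟩ := geometric_hahn_banach_closed_point (s := (S : Set V))
    (S.restrictScalars ℝ).convex hS hx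
  have hu : 0 < u := by simpa using h1 0 S.zero_mem
  have h3 : ∀ a ∈ S, f a = 0 := by
    intro a ha
    by_contra hne
    have h4 := h1 ((2 * u / f a) • a) ((S.restrictScalars ℝ).smul_mem _ ha)
    rw [map_smul, smul_eq_mul, div_mul_cancel₀ _ hne] at h4
    linarith
  rw [← f.integral_comp_comm hF] at h2
  simp only [h3 _ (hmem _), integral_zero] at h2
  linarith

/-- Rank one operators are compact, compact operators form a closed subspace, and the defining
integral converges in operator norm. -/
lemma isCompactOperator_kerOp (hσ : FiniteMoments σ) (s : ℝ) : IsCompactOperator (kerOp σ s) := by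
  have hclosed : IsClosed (compactOperator (RingHom.id ℂ) HalfL2 HalfL2 : Set (HalfL2 →L[ℂ] HalfL2)) :=
    isClosed_setOfPred_isCompactOperator
  have hmem : ∀ c, airyTensor 0 0 c ∈ compactOperator (RingHom.id ℂ) HalfL2 HalfL2 := by
    intro c
    have h1 : IsCompactOperator (pair (airyL2 0 c)) :=
      isCompactOperator_of_locallyCompactSpace_dom (pair (airyL2 0 c))
    exact h1.clm_comp (ContinuousLinearMap.toSpanSingleton ℂ (airyL2 0 c))
  exact integral_mem_of_isClosed hclosed (integrable_airyTensor hσ s) fun p => hmem _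

/-! ### Invertibility of `1 - K` -/

lemma inner_airyL2 (n : ℕ) (c : ℝ) (f : HalfL2) :
    inner ℂ f (airyL2 n c) = (starRingEnd ℂ) (pair (airyL2 n c) f) := by
  have : star (airyL2 n c) = airyL2 n c := by
    refine Lp.ext ?_
    filter_upwards [Lp.coeFn_star (airyL2 n c), coeFn_airyL2 n c] with w h1 h2
    rw [h1, Pi.star_apply, h2]
    have := airyD_conj n (w + c)
    simpa using this
  rw [← inner_conj_symm, ← pair_star, this]

/-- Each rank one operator has the quadratic form |⟨Ai(·+c), f⟩|², so that of K is the squared mass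
of the Airy transform on the half lines (s+t, ∞), averaged over t. -/
lemma inner_kerOp (hσ : FiniteMoments σ) (s : ℝ) (f : HalfL2) :
    inner ℂ f (kerOp σ s f) =
      ((∫ p : ℝ × ℝ, ‖pair (airyL2 0 (s + p.1 + p.2)) f‖ ^ 2 ∂(σ.prod halfLine) : ℝ) : ℂ) := by
  rw [kerOp_apply hσ, ← integral_inner (integrable_airyTensor_apply hσ s f), ← integral_complex_ofReal]
  refine integral_congr_ae (Eventually.of_forall fun p => ?_)
  simp only
  rw [inner_smul_right, inner_airyL2, Complex.mul_conj, Complex.normSq_eq_norm_sq]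

lemma integrable_normSq_prod (hσ : FiniteMoments σ) (s : ℝ) (f : HalfL2) :
    Integrable (fun p : ℝ × ℝ => ‖pair (airyL2 0 (s + p.1 + p.2)) f‖ ^ 2) (σ.prod halfLine) := by
  have := (integrable_airyTensor_apply hσ s f).const_inner (𝕜 := ℂ) f
  refine this.norm.congr (Eventually.of_forall fun p => ?_)
  simp only
  rw [inner_smul_right, inner_airyL2, Complex.mul_conj, Complex.norm_real, Complex.normSq_eq_norm_sq,
    Real.norm_of_nonneg (by positivity)]

/-- Exponential decay of Ai(z + v), locally uniform in complex v, gives the domination. Analyticity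
is needed for the identity theorem in `eq_zero_of_kerOp_eq`. -/
lemma differentiable_airyTransform (f : HalfL2) :
    Differentiable ℂ fun v : ℂ => ∫ z in Ioi (0 : ℝ), airyD 0 (z + v) * f z := by
  rw [← differentiableOn_univ]
  refine differentiableOn_integral isOpen_univ (fun v _ => ?_) (Eventually.of_forall fun z => ?_) ?_
  · exact (Continuous.aestronglyMeasurable ((continuous_airyD 0).comp (by fun_prop))).mul
      (Lp.aestronglyMeasurable f)
  · refine Differentiable.differentiableOn ?_
    exact ((differentiable_airyD 0).comp (by fun_prop)).mul_const _
  · intro v₀ _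
    obtain ⟨C, hC, hb⟩ := norm_airyD_le_exp_neg 0 (‖v₀‖ + 1)
    refine ⟨1, one_pos, fun z => C * ‖Complex.exp (-(1 * z : ℝ)) * f z‖, ?_, ?_⟩
    · exact (((memLp_exp_neg one_pos).integrable_mul (Lp.memLp f)).norm).const_mul C
    · refine Eventually.of_forall fun z v _ hv => ?_
      beta_reduce
      rw [norm_mul, norm_mul, ← mul_assoc, norm_exp_neg_ofReal, one_mul]
      gcongr
      refine hb v z ?_
      have := norm_sub_norm_le v v₀
      linarith

/-- `1` is not an eigenvalue of `K`. -/
lemma eq_zero_of_kerOp_eq (hσ : FiniteMoments σ) (s : ℝ) {f : HalfL2} (hf : kerOp σ s f = f) :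
    f = 0 := by
  set g : ℝ → ℝ := fun v => ‖pair (airyL2 0 v) f‖ ^ 2 with hg
  have hgc : Continuous g := ((continuous_airyTransform f).norm).pow 2
  have hgi : Integrable g := integrable_normSq_airyTransform f
  have hg0 : ∀ v, 0 ≤ g v := fun v => by positivity
  have hJ : ∫ v, g v ≤ ‖f‖ ^ 2 := integral_normSq_airyTransform_le f
  -- Kf = f says that the σ-average of the tail masses on (s+t, ∞) equals ‖f‖², while each tail mass
  -- is at most ‖f‖².
  have hT : ∫ p : ℝ × ℝ, g (s + p.1 + p.2) ∂(σ.prod halfLine) = ‖f‖ ^ 2 := by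
    have h1 := inner_kerOp hσ s f
    rw [hf, inner_self_eq_norm_sq_to_K] at h1
    refine Complex.ofReal_injective (h1.symm.trans ?_)
    push_cast; rfl
  have hint := integrable_normSq_prod hσ s f
  have hI : ∀ c, ∫ u in Ioi (0 : ℝ), g (c + u) = ∫ v in Ioi c, g v := by
    intro c
    have := (measurePreserving_add_left (volume : Measure ℝ) c).setIntegral_preimage_emb
      (measurableEmbedding_addLeft c) g (Ioi c)
    simpa using this
  have hIle : ∀ c, ∫ v in Ioi c, g v ≤ ‖f‖ ^ 2 := fun c =>
    (setIntegral_le_integral hgi (Eventually.of_forall hg0)).trans hJ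
  rw [integral_prod _ hint] at hT
  replace hT : ∫ t, (∫ v in Ioi (s + t), g v) ∂σ = ‖f‖ ^ 2 := by
    rw [← hT]; exact integral_congr_ae (Eventually.of_forall fun t => (hI (s + t)).symm)
  have hint1 : Integrable (fun t => ∫ v in Ioi (s + t), g v) σ := by
    have := hint.integral_prod_left
    refine this.congr (Eventually.of_forall fun t => ?_)
    exact hI (s + t)
  have hzero : ∫ t, (‖f‖ ^ 2 - ∫ v in Ioi (s + t), g v) ∂σ = 0 := by
    rw [integral_sub (integrable_const _) hint1, hT]; simp
  rw [integral_eq_zero_iff_of_nonneg (fun t => sub_nonneg.mpr (hIle (s + t)))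
    ((integrable_const _).sub hint1)] at hzero
  -- The nonnegative deficits have average zero, so the deficit vanishes for some t, and the Airy
  -- transform of f vanishes to the left of s + t.
  obtain ⟨t, ht⟩ := hzero.exists
  simp only [Pi.zero_apply, sub_eq_zero] at ht
  have hIic : ∫ v in Iic (s + t), g v = 0 := by
    have h1 := intervalIntegral.integral_Iic_add_Ioi (b := s + t) hgi.integrableOn hgi.integrableOn
    have h2 : 0 ≤ ∫ v in Iic (s + t), g v := integral_nonneg hg0
    linarith
  have hae : ∀ v, v < s + t → g v = 0 := by
    rw [integral_eq_zero_iff_of_nonneg hg0 hgi.integrableOn] at hIic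
    have h1 : g =ᵐ[volume.restrict (Iio (s + t))] 0 :=
      ae_restrict_of_ae_restrict_of_subset Iio_subset_Iic_self hIic
    have := MeasureTheory.Measure.eqOn_open_of_ae_eq h1 isOpen_Iio hgc.continuousOn continuousOn_const
    exact fun v hv => this hv
  set F : ℂ → ℂ := fun v => ∫ z in Ioi (0 : ℝ), airyD 0 (z + v) * f z with hF
  have hFr : ∀ v : ℝ, F v = pair (airyL2 0 v) f := fun v => (pair_airyL2 0 v f).symm
  -- The identity theorem extends the vanishing from a sequence accumulating at s + t - 1 to the
  -- whole plane; `ht` then gives ‖f‖² = 0.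
  have hFz : F = fun _ => 0 := by
    refine AnalyticOnNhd.eq_of_frequently_eq (z₀ := ((s + t - 1 : ℝ) : ℂ))
      ((differentiable_airyTransform f).differentiableOn.analyticOnNhd isOpen_univ)
      analyticOnNhd_const ?_
    have h2 : Tendsto (fun n : ℕ => ((s + t - 1 - 1 / ((n : ℝ) + 1) : ℝ) : ℂ)) atTop
        (𝓝[≠] ((s + t - 1 : ℝ) : ℂ)) := by
      refine tendsto_nhdsWithin_iff.mpr ⟨?_, Eventually.of_forall fun n => ?_⟩
      · refine (Complex.continuous_ofReal.tendsto _).comp ?_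
        simpa using tendsto_one_div_add_atTop_nhds_zero_nat.const_sub (s + t - 1)
      · have : (0 : ℝ) < 1 / ((n : ℝ) + 1) := by positivity
        simp only [mem_compl_iff, mem_singleton_iff, Complex.ofReal_inj]
        linarith
    refine h2.frequently (Frequently.of_forall fun n => ?_)
    have : (0 : ℝ) < 1 / ((n : ℝ) + 1) := by positivity
    have h3 := hae (s + t - 1 - 1 / ((n : ℝ) + 1)) (by linarith)
    rw [hFr]
    simpa [hg] using h3
  have hgz : ∀ v, g v = 0 := fun v => by
    rw [hg]; simp only; rw [← hFr, hFz]; simp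
  have : ‖f‖ ^ 2 = 0 := by rw [ht]; simp [hgz]
  simpa using this

/-- Fredholm alternative for the compact operator K at the spectral value 1. -/
lemma isUnit_one_sub_kerOp (hσ : FiniteMoments σ) (s : ℝ) : IsUnit (1 - kerOp σ s) := by
  rcases (isCompactOperator_kerOp hσ s).hasEigenvalue_or_mem_resolventSet (μ := 1) one_ne_zero with h | h
  · obtain ⟨f, hf⟩ := h.exists_hasEigenvector
    refine absurd (eq_zero_of_kerOp_eq hσ s (f := f) ?_) hf.2
    have := hf.apply_eq_smul
    simpa using this
  · simpa [spectrum.mem_resolventSet_iff] using h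

/-- The operator `(1 - K_{σ,s})⁻¹`. -/
def resOp (σ : Measure ℝ) (s : ℝ) : HalfL2 →L[ℂ] HalfL2 := Ring.inverse (1 - kerOp σ s)

lemma resOp_sub (hσ : FiniteMoments σ) (s : ℝ) (f : HalfL2) :
    resOp σ s (f - kerOp σ s f) = f := by
  have := Ring.inverse_mul_cancel _ (isUnit_one_sub_kerOp hσ s)
  exact congrArg (fun T : HalfL2 →L[ℂ] HalfL2 => T f) this

lemma sub_resOp (hσ : FiniteMoments σ) (s : ℝ) (f : HalfL2) :
    resOp σ s f - kerOp σ s (resOp σ s f) = f := by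
  have := Ring.mul_inverse_cancel _ (isUnit_one_sub_kerOp hσ s)
  exact congrArg (fun T : HalfL2 →L[ℂ] HalfL2 => T f) this

lemma pair_resOp (hσ : FiniteMoments σ) (s : ℝ) (f g : HalfL2) :
    pair (resOp σ s f) g = pair f (resOp σ s g) := by
  conv_lhs => rw [← sub_resOp hσ s g]
  conv_rhs => rw [← sub_resOp hσ s f]
  simp only [map_sub, _root_.sub_apply, pair_kerOp hσ]

/-- Derivative of inversion, R' = R K' R, with K' from `hasDerivAt_kerOp`. -/
lemma hasDerivAt_resOp (hσ : FiniteMoments σ) (s : ℝ) :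
    HasDerivAt (resOp σ) (resOp σ s * (-∫ t, airyTensor 0 0 (s + t) ∂σ) * resOp σ s) s := by
  obtain ⟨x, hx⟩ := isUnit_one_sub_kerOp hσ s
  have h1 := (hasFDerivAt_ringInverse (𝕜 := ℂ) x).restrictScalars ℝ
  rw [hx] at h1
  have h2 := h1.comp_hasDerivAt s ((hasDerivAt_kerOp hσ s).const_sub 1)
  have h3 : ((x⁻¹ : (HalfL2 →L[ℂ] HalfL2)ˣ) : HalfL2 →L[ℂ] HalfL2) = resOp σ s := by
    rw [resOp, ← hx, Ring.inverse_unit]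
  refine h2.congr_deriv ?_
  simp [h3]

end AiryLax
end

/-! ### Resolvent functions and their continuation in z. -/

noncomputable section
namespace AiryLax

set_option linter.unusedSectionVars false

variable {σ : Measure ℝ} [IsProbabilityMeasure σ] {Z : Set ℂ}

/-- Continuous functions of polynomial growth. -/
def PolyGrowth (φ : ℝ → ℂ) : Prop :=
  Continuous φ ∧ ∃ (C : ℝ) (a : ℕ), 0 ≤ C ∧ ∀ t, ‖φ t‖ ≤ C * (1 + |t|) ^ a

lemma one_le_one_add_abs_pow (t : ℝ) (a : ℕ) : (1 : ℝ) ≤ (1 + |t|) ^ a :=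
  one_le_pow₀ (by linarith [abs_nonneg t])

lemma one_add_abs_add_le' (s t : ℝ) (a : ℕ) :
    (1 + |s + t|) ^ a ≤ (1 + |s|) ^ a * (1 + |t|) ^ a := by
  rw [← mul_pow]
  exact pow_le_pow_left₀ (by positivity) (one_add_abs_add_le le_rfl t) a

lemma norm_airyL2_add_le (d : ℕ) (s : ℝ) : ∃ (C : ℝ) (a : ℕ), 0 ≤ C ∧ ∀ x : ℝ,
    ‖airyL2 d (s + x)‖ ≤ C * (1 + |x|) ^ a := by
  obtain ⟨C, a, hC, hb⟩ := norm_airyL2_le d 0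
  refine ⟨C * (1 + |s|) ^ a, a, by positivity, fun x => ?_⟩
  have := hb (s + x) 0 le_rfl
  simp only [add_zero, one_pow, div_one] at this
  refine this.trans ?_
  rw [mul_assoc]
  gcongr
  exact one_add_abs_add_le' s x a

lemma polyGrowth_clm (T : HalfL2 →L[ℂ] ℂ)
    (d : ℕ) (s : ℝ) : PolyGrowth fun t => T (airyL2 d (s + t)) := by
  obtain ⟨C, a, hC, hb⟩ := norm_airyL2_add_le d s
  refine ⟨T.continuous.comp ((continuous_airyL2 d).comp (by fun_prop)), ‖T‖ * C, a, by positivity,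
    fun t => (T.le_opNorm _).trans ?_⟩
  rw [mul_assoc]; gcongr; exact hb t

lemma polyGrowth_airyD (d : ℕ) (s : ℝ) : PolyGrowth fun t => airyD d ((s + t : ℝ) : ℂ) := by
  obtain ⟨C, a, hC, hb⟩ := norm_airyD_shift_le d 0
  refine ⟨(continuous_airyD d).comp (by fun_prop), C * (1 + |s|) ^ a, a, by positivity, fun t => ?_⟩
  have := hb (s + t) 0 le_rfl
  simp only [Complex.ofReal_zero, zero_add, pow_zero, div_one] at this
  refine this.trans ?_
  rw [mul_assoc]
  gcongr
  exact one_add_abs_add_le' s t a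

/-- Superpositions `∫ φ(t) Ai⁽ᵉ⁾(·+s+t) dσ(t)` in `L²(0, ∞)`. -/
def airySum (σ : Measure ℝ) (s : ℝ) (e : ℕ) (φ : ℝ → ℂ) : HalfL2 :=
  ∫ t, φ t • airyL2 e (s + t) ∂σ

lemma integrable_airySum (hσ : FiniteMoments σ) (s : ℝ) (e : ℕ) {φ : ℝ → ℂ} (hφ : PolyGrowth φ) :
    Integrable (fun t => φ t • airyL2 e (s + t)) σ ∧
      airySum σ s e φ =ᵐ[halfLine] fun w : ℝ => ∫ t, φ t * airyD e (w + (s + t : ℝ)) ∂σ := by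
  obtain ⟨hc, C, a, hC, hb⟩ := hφ
  obtain ⟨C', a', hC', hb'⟩ := norm_airyD_shift_le_inv e 0
  refine coeFn_integral_halfL2 (φ := fun t w => φ t * airyD e (w + (s + t : ℝ)))
    (h := fun t => C * C' * (1 + |s|) ^ a' * (1 + |t|) ^ (a + a')) ?_ (fun t => ?_) ?_
    ((hσ (a + a')).const_mul _) (Eventually.of_forall fun t w hw => ?_)
  · refine Continuous.aestronglyMeasurable ?_
    simp only [Function.uncurry_def]
    exact (hc.comp continuous_fst).mul ((continuous_airyD e).comp (by fun_prop))
  · filter_upwards [Lp.coeFn_smul (φ t) (airyL2 e (s + t)), coeFn_airyL2 e (s + t)] with w h1 h2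
    rw [h1, Pi.smul_apply, h2, smul_eq_mul]
  · exact (hc.smul ((continuous_airyL2 e).comp (by fun_prop))).aestronglyMeasurable
  · rw [norm_mul]
    have h2 := hb' (s + t) 0 w le_rfl hw.le
    simp only [pow_zero, div_one, add_zero] at h2
    calc _ ≤ (C * (1 + |t|) ^ a) * (C' * ((1 + |s|) ^ a' * (1 + |t|) ^ a') * (1 + w)⁻¹) := by
          gcongr
          · exact hb t
          · refine h2.trans ?_
            gcongr
            exact one_add_abs_add_le' s t a'
      _ = _ := by rw [pow_add]; ring

lemma clm_airySum (hσ : FiniteMoments σ) (s : ℝ) (e : ℕ) {φ : ℝ → ℂ} (hφ : PolyGrowth φ)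
    (T : HalfL2 →L[ℂ] ℂ) : T (airySum σ s e φ) = ∫ t, φ t * T (airyL2 e (s + t)) ∂σ := by
  rw [airySum, ← T.integral_comp_comm (integrable_airySum hσ s e hφ).1]
  simp

/-! ### Resolvent functions -/

/-- The vector `(1 - K)⁻¹ Ai⁽ᵈ⁾(·+s+x)` in `L²(0, ∞)`. -/
def resVec (σ : Measure ℝ) (d : ℕ) (s x : ℝ) : HalfL2 := resOp σ s (airyL2 d (s + x))

/-- The `n`-th derivative of the continuation to `ℂ` of `(1 - K)⁻¹ Ai⁽ᵈ⁾(·+s+x)`. -/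
def resFun (σ : Measure ℝ) (n d : ℕ) (s : ℝ) (z : ℂ) (x : ℝ) : ℂ :=
  airyD (d + n) (z + (s + x : ℝ)) + pair (kerRow σ n 0 s z) (resVec σ d s x)

/-- The pairings `⟨(1 - K)⁻¹ Ai⁽ᵈ⁾(·+s+x), Ai⁽ᵉ⁾(·+s+y)⟩`. -/
def resPair (σ : Measure ℝ) (d e : ℕ) (s x y : ℝ) : ℂ := pair (resVec σ d s x) (airyL2 e (s + y))

lemma polyGrowth_resPair (d e : ℕ) (s x : ℝ) : PolyGrowth (resPair σ d e s x) :=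
  polyGrowth_clm (pair (resVec σ d s x)) e s

/-- The continuation of `(1 - K)⁻¹ K(·, 0)`. -/
def resKer (σ : Measure ℝ) (s : ℝ) (z : ℂ) : ℂ :=
  kerVal σ 0 0 s z 0 + pair (kerRow σ 0 0 s z) (resOp σ s (kerRow σ 0 0 s 0))

/-- The device behind the resolvent identities: an element of L² is recognized as R G by exhibiting
its integral equation on the half line, and pairing with `kerRow` then carries the identity to all
admissible z. -/
lemma eq_resOp_of_eq (hσ : FiniteMoments σ) (s : ℝ) {F G : HalfL2} {f g : ℝ → ℂ}
    (hF : F =ᵐ[halfLine] f) (hG : G =ᵐ[halfLine] g)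
    (h : ∀ w : ℝ, 0 < w → f w = g w + pair (kerRow σ 0 0 s w) F) : F = resOp σ s G := by
  have : G = F - kerOp σ s F := by
    refine Lp.ext ?_
    filter_upwards [hF, hG, coeFn_kerOp hσ s F, Lp.coeFn_sub F (kerOp σ s F),
      ae_halfLine fun w hw => hw] with w h1 h2 h3 h4 h5
    rw [h4, Pi.sub_apply, h1, h2, h3, h w h5, add_sub_cancel_right]
  rw [this, resOp_sub hσ]

lemma coeFn_resOp (hσ : FiniteMoments σ) (s : ℝ) {G : HalfL2} {g : ℝ → ℂ}
    (hG : G =ᵐ[halfLine] g) :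
    resOp σ s G =ᵐ[halfLine] fun w : ℝ => g w + pair (kerRow σ 0 0 s w) (resOp σ s G) := by
  have h0 : resOp σ s G = G + kerOp σ s (resOp σ s G) := by
    nth_rewrite 1 [← sub_add_cancel (resOp σ s G) (kerOp σ s (resOp σ s G)), sub_resOp hσ]; rfl
  have h1 := Lp.coeFn_add G (kerOp σ s (resOp σ s G))
  rw [← h0] at h1
  filter_upwards [h1, hG, coeFn_kerOp hσ s (resOp σ s G)] with w h2 h3 h4
  rw [h2, Pi.add_apply, h3, h4]

lemma coeFn_resVec (hσ : FiniteMoments σ) (d : ℕ) (s x : ℝ) :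
    resVec σ d s x =ᵐ[halfLine] fun w : ℝ => resFun σ 0 d s w x := by
  filter_upwards [coeFn_resOp hσ s (coeFn_airyL2 d (s + x))] with w hw
  rw [resVec, hw]; rfl

/-- The rows decay to every order because the Airy argument w + s + t + u grows with w; this is what
allows multiplication by w inside L². -/
lemma norm_kerRow_le (hσ : FiniteMoments σ) (n N : ℕ) (s : ℝ) : ∃ C : ℝ, 0 ≤ C ∧ ∀ w : ℝ, 0 ≤ w →
    ‖kerRow σ n 0 s w‖ ≤ C * ((1 + w) ^ N)⁻¹ := by
  obtain ⟨C, a, hC, hb⟩ := norm_airyD_shift_le n (N + 2)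
  obtain ⟨C', a', hC', hb'⟩ := norm_airyL2_le 0 0
  set g : ℝ × ℝ → ℝ := fun p => (C * C' * (1 + |s|) ^ (a + a') * (1 + |p.1|) ^ (a + a')) *
    ((1 + p.2) ^ 2)⁻¹ with hg
  have hgi : Integrable g (σ.prod halfLine) :=
    ((hσ (a + a')).const_mul (C * C' * (1 + |s|) ^ (a + a'))).mul_prod integrable_one_add_inv_sq
  refine ⟨|∫ p, g p ∂(σ.prod halfLine)|, by positivity, fun w hw => ?_⟩
  have : ‖kerRow σ n 0 s w‖ ≤ ∫ p, g p * ((1 + w) ^ N)⁻¹ ∂(σ.prod halfLine) := by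
    refine norm_integral_le_of_norm_le (hgi.mul_const _) (ae_prod_halfLine fun t u hu => ?_)
    rw [norm_smul]
    have e : (w : ℂ) + (s + t + u : ℝ) = ((w + u : ℝ) : ℂ) + (s + t : ℝ) := by push_cast; ring
    have h1 := hb (s + t) (w + u) (by linarith)
    have h2 := hb' (s + t) u hu.le
    rw [pow_zero, div_one] at h2
    rw [← e] at h1
    calc _ ≤ (C * ((1 + |s|) ^ a * (1 + |t|) ^ a) / ((1 + u) ^ 2 * (1 + w) ^ N)) *
          (C' * ((1 + |s|) ^ a' * (1 + |t|) ^ a')) := by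
          gcongr
          · refine h1.trans ?_
            gcongr
            · exact one_add_abs_add_le' s t a
            · rw [pow_add, mul_comm]; gcongr <;> linarith
          · refine h2.trans ?_
            gcongr
            exact one_add_abs_add_le' s t a'
      _ = _ := by
          simp only [hg]
          rw [pow_add, pow_add, div_eq_mul_inv, mul_inv]; ring
  refine this.trans ?_
  rw [integral_mul_const]
  gcongr
  exact le_abs_self _

lemma norm_clm_resVec_le (d : ℕ) (s : ℝ) : ∃ (C : ℝ) (a : ℕ), 0 ≤ C ∧ ∀ x : ℝ,
    ‖resVec σ d s x‖ ≤ C * (1 + |x|) ^ a := by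
  obtain ⟨C, a, hC, hb⟩ := norm_airyL2_add_le d s
  refine ⟨‖resOp σ s‖ * C, a, by positivity, fun x => ((resOp σ s).le_opNorm _).trans ?_⟩
  rw [mul_assoc]; gcongr; exact hb x

lemma norm_resFun_le (hσ : FiniteMoments σ) (n d N : ℕ) (s : ℝ) : ∃ (C : ℝ) (a : ℕ), 0 ≤ C ∧
    ∀ x w : ℝ, 0 ≤ w → ‖resFun σ n d s w x‖ ≤ C * (1 + |x|) ^ a * ((1 + w) ^ N)⁻¹ := by
  obtain ⟨C₁, a₁, hC₁, h₁⟩ := norm_airyD_shift_le (d + n) N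
  obtain ⟨C₂, a₂, hC₂, h₂⟩ := norm_clm_resVec_le (σ := σ) d s
  obtain ⟨C₃, hC₃, h₃⟩ := norm_kerRow_le hσ n N s
  refine ⟨C₁ * (1 + |s|) ^ a₁ + ‖pair‖ * C₃ * C₂, a₁ + a₂, by positivity, fun x w hw => ?_⟩
  have e1 : (1 + |x|) ^ a₁ ≤ (1 + |x|) ^ (a₁ + a₂) :=
    pow_le_pow_right₀ (by linarith [abs_nonneg x]) (by omega)
  have e2 : (1 + |x|) ^ a₂ ≤ (1 + |x|) ^ (a₁ + a₂) :=
    pow_le_pow_right₀ (by linarith [abs_nonneg x]) (by omega)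
  calc _ ≤ C₁ * ((1 + |s|) ^ a₁ * (1 + |x|) ^ a₁) / (1 + w) ^ N +
        ‖pair‖ * (C₃ * ((1 + w) ^ N)⁻¹) * (C₂ * (1 + |x|) ^ a₂) := by
        refine (norm_add_le _ _).trans (add_le_add ?_ ?_)
        · refine (h₁ (s + x) w hw).trans ?_
          gcongr; exact one_add_abs_add_le' s x a₁
        · refine (norm_pair_le _ _).trans ?_
          gcongr
          · exact h₃ w hw
          · exact h₂ x
    _ ≤ C₁ * ((1 + |s|) ^ a₁ * (1 + |x|) ^ (a₁ + a₂)) / (1 + w) ^ N +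
        ‖pair‖ * (C₃ * ((1 + w) ^ N)⁻¹) * (C₂ * (1 + |x|) ^ (a₁ + a₂)) := by gcongr
    _ = _ := by rw [div_eq_mul_inv]; ring

lemma Admissible.hasDerivAt_resFun (hZ : Admissible σ Z) (n d : ℕ) {z : ℂ} (hz : z ∈ Z) (s x r : ℝ) :
    HasDerivAt (fun r : ℝ => resFun σ n d s (z + r) x) (resFun σ (n + 1) d s (z + r) x) r := by
  have h1 := hasDerivAt_airyD_ofReal (d + n) (z + (s + x : ℝ)) r
  have h2 : HasDerivAt (fun r : ℝ => pair (kerRow σ n 0 s (z + r)) (resVec σ d s x))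
      (pair (kerRow σ (n + 1) 0 s (z + r)) (resVec σ d s x)) r :=
    ((pair.flip (resVec σ d s x)).restrictScalars ℝ).hasFDerivAt.comp_hasDerivAt r
      (hZ.hasDerivAt_kerRow n 0 hz s r)
  have e : ∀ r : ℝ, z + r + (s + x : ℝ) = z + (s + x : ℝ) + r := fun r => by ring
  simp only [resFun, e]
  exact h1.add h2

lemma hasDerivAt_resFun_ofReal (hσ : FiniteMoments σ) (n d : ℕ) (s x r : ℝ) :
    HasDerivAt (fun r : ℝ => resFun σ n d s r x) (resFun σ (n + 1) d s r x) r := by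
  have := hσ.admissible.hasDerivAt_resFun n d (hσ.admissible.real 0) s x r
  simpa using this

lemma continuous_kerRow_ofReal (hσ : FiniteMoments σ) (n : ℕ) (s : ℝ) :
    Continuous fun w : ℝ => kerRow σ n 0 s w := by
  refine continuous_iff_continuousAt.mpr fun r => ?_
  have := (hσ.admissible.hasDerivAt_kerRow n 0 (hσ.admissible.real 0) s r).continuousAt
  simpa using this

lemma continuous_resVec (d : ℕ) (s : ℝ) : Continuous fun x => resVec σ d s x :=
  (resOp σ s).continuous.comp ((continuous_airyL2 d).comp (by fun_prop))

lemma continuous_resFun (hσ : FiniteMoments σ) (n d : ℕ) (s : ℝ) :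
    Continuous fun p : ℝ × ℝ => resFun σ n d s p.1 p.2 := by
  have h1 : Continuous fun p : ℝ × ℝ => kerRow σ n 0 s p.1 :=
    (continuous_kerRow_ofReal hσ n s).comp continuous_fst
  have h2 : Continuous fun p : ℝ × ℝ => resVec σ d s p.2 :=
    (continuous_resVec d s).comp continuous_snd
  have h3 : Continuous fun p : ℝ × ℝ => pair (kerRow σ n 0 s p.1) :=
    pair.continuous.comp h1
  have h4 : Continuous fun p : ℝ × ℝ => pair (kerRow σ n 0 s p.1) (resVec σ d s p.2) :=
    h3.clm_apply h2
  have h5 : Continuous fun p : ℝ × ℝ => airyD (d + n) (p.1 + (s + p.2 : ℝ)) :=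
    (continuous_airyD (d + n)).comp (by fun_prop)
  exact h5.add h4

lemma continuous_resFun_left (hσ : FiniteMoments σ) (n d : ℕ) (s x : ℝ) :
    Continuous fun w : ℝ => resFun σ n d s w x := by
  have h := continuous_resFun hσ n d s
  generalize resFun σ n d s = f at h ⊢
  exact h.comp (by fun_prop : Continuous fun w : ℝ => (w, x))

lemma memLp_resFun (hσ : FiniteMoments σ) (n d : ℕ) (s x : ℝ) :
    MemLp (fun w : ℝ => resFun σ n d s w x) 2 halfLine := by
  obtain ⟨C, a, hC, hb⟩ := norm_resFun_le hσ n d 1 s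
  refine memLp_halfLine (M := C * (1 + |x|) ^ a)
    (continuous_resFun_left hσ n d s x).aestronglyMeasurable fun w hw => ?_
  have := hb x w hw.le
  rwa [pow_one] at this

/-- The resolvent of a superposition is the superposition of the resolvents. -/
lemma Admissible.integral_mul_resFun (hZ : Admissible σ Z) (hσ : FiniteMoments σ) (e : ℕ) (s : ℝ)
    {φ : ℝ → ℂ} (hφ : PolyGrowth φ) {z : ℂ} (hz : z ∈ Z) :
    Integrable (fun t => φ t * airyD e (z + (s + t : ℝ))) σ ∧
    Integrable (fun t => φ t * resFun σ 0 e s z t) σ ∧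
    ∫ t, φ t * resFun σ 0 e s z t ∂σ = (∫ t, φ t * airyD e (z + (s + t : ℝ)) ∂σ) +
      pair (kerRow σ 0 0 s z) (resOp σ s (airySum σ s e φ)) := by
  set T : HalfL2 →L[ℂ] ℂ := (pair (kerRow σ 0 0 s z)).comp (resOp σ s) with hT
  have h1 := clm_airySum hσ s e hφ T
  have h2 : Integrable (fun t => φ t * T (airyL2 e (s + t))) σ := by
    simpa using T.integrable_comp (integrable_airySum hσ s e hφ).1
  have h3 : Integrable (fun t => φ t * airyD e (z + (s + t : ℝ))) σ := by
    obtain ⟨hc, C, a, hC, hb⟩ := hφ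
    obtain ⟨ω, hωc, hω1, hωi, hω⟩ := hZ.weight e ‖z + s‖
    refine Integrable.mono' ((hωi a).const_mul C) ?_ (Eventually.of_forall fun t => ?_)
    · exact (hc.mul ((continuous_airyD e).comp (by fun_prop))).aestronglyMeasurable
    · have h4 := hω (z + s) (hZ.shift z hz s) le_rfl t 0 le_rfl
      have e1 : z + s + t + (0 : ℝ) = z + (s + t : ℝ) := by push_cast; ring
      rw [e1] at h4
      rw [norm_mul]
      calc _ ≤ (C * (1 + |t|) ^ a) * ω t := mul_le_mul (hb t) h4 (norm_nonneg _) (by positivity)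
        _ ≤ (C * (1 + |t|) ^ a) * ω t ^ 2 := by
          gcongr
          nlinarith [hω1 t]
        _ = _ := by ring
  have h5 : ∀ t, φ t * resFun σ 0 e s z t =
      φ t * airyD e (z + (s + t : ℝ)) + φ t * T (airyL2 e (s + t)) := fun t => by
    rw [← mul_add]; rfl
  refine ⟨h3, ?_, ?_⟩
  · simp_rw [h5]; exact h3.add h2
  · simp_rw [h5]
    rw [integral_add h3 h2, ← h1]; rfl

end AiryLax
end

/-! ### Derivatives of resolvent functions in z and in s. -/

noncomputable section
namespace AiryLax

variable {σ : Measure ℝ} [IsProbabilityMeasure σ] {Z : Set ℂ}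

set_option linter.unusedSectionVars false

lemma pair_airyL2_resVec (d e : ℕ) (s x t : ℝ) :
    pair (airyL2 e (s + t)) (resVec σ d s x) = resPair σ d e s x t := pair_comm _ _

lemma tendsto_one_add_pow_inv : Tendsto (fun w : ℝ => ((1 + w) ^ 1)⁻¹) atTop (𝓝 0) := by
  simp only [pow_one]
  exact tendsto_inv_atTop_zero.comp (tendsto_atTop_add_const_left _ _ tendsto_id)

/-- Integration by parts against an Airy function. -/
lemma pair_airyL2_one_resVec (hσ : FiniteMoments σ) (d : ℕ) (s x c : ℝ) :
    pair (airyL2 1 c) (resVec σ d s x) = -(airyD 0 c * resFun σ 0 d s 0 x) -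
      pair (airyL2 0 c) (memLp_resFun hσ 1 d s x).toLp := by
  rw [pair_eq (coeFn_airyL2 1 c) (coeFn_resVec hσ d s x),
    pair_eq (coeFn_airyL2 0 c) (memLp_resFun hσ 1 d s x).coeFn_toLp]
  have hd := fun w : ℝ => hasDerivAt_resFun_ofReal hσ 0 d s x w
  have ha : ∀ w : ℝ, HasDerivAt (fun r : ℝ => airyD 0 (r + c)) (airyD 1 (w + c)) w := fun w => by
    have := hasDerivAt_airyD_ofReal 0 (c : ℂ) w
    simpa [add_comm] using this
  have hint : ∀ n m : ℕ, IntegrableOn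
      ((fun w : ℝ => airyD n (w + c)) * fun w : ℝ => resFun σ m d s w x) (Ioi 0) := fun n m =>
    (memLp_airyD n c).integrable_mul (memLp_resFun hσ m d s x)
  have h0 : Tendsto ((fun w : ℝ => airyD 0 (w + c)) * fun w : ℝ => resFun σ 0 d s w x) (𝓝[>] 0)
      (𝓝 (airyD 0 c * resFun σ 0 d s 0 x)) := by
    have h1 := (ha 0).continuousAt.tendsto
    have h2 := (hd 0).continuousAt.tendsto
    simp only [Complex.ofReal_zero, zero_add] at h1 h2
    exact (h1.mul h2).mono_left nhdsWithin_le_nhds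
  have hinf : Tendsto ((fun w : ℝ => airyD 0 (w + c)) * fun w : ℝ => resFun σ 0 d s w x) atTop
      (𝓝 0) := by
    obtain ⟨C, a, hC, hb⟩ := norm_resFun_le hσ 0 d 1 s
    obtain ⟨C', a', hC', hb'⟩ := norm_airyD_shift_le 0 0
    have h1 : Tendsto (fun w : ℝ => C' * (1 + |c|) ^ a' * (C * (1 + |x|) ^ a * ((1 + w) ^ 1)⁻¹))
        atTop (𝓝 0) := by
      simpa using (tendsto_one_add_pow_inv.const_mul (C * (1 + |x|) ^ a)).const_mul
        (C' * (1 + |c|) ^ a')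
    refine squeeze_zero_norm' ((eventually_ge_atTop 0).mono fun w hw => ?_) h1
    rw [Pi.mul_apply, norm_mul]
    gcongr
    · simpa using hb' c w hw
    · exact hb x w hw
  have := integral_Ioi_mul_deriv_eq_deriv_mul (a := (0 : ℝ)) (fun w _ => ha w) (fun w _ => hd w)
    (hint 0 1) (hint 1 0) h0 hinf
  rw [this]
  ring

lemma kerVal_comm (n m : ℕ) (s : ℝ) (z w : ℂ) : kerVal σ n m s z w = kerVal σ m n s w z := by
  simp only [kerVal, mul_comm]

/-- Differentiation of the integral equation. The z-derivative of the kernel is moved to the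
variable w by `Admissible.kerRow_one_zero`, and from there to the solution by parts. The
σ-superposition and the boundary value at w = 0 join the inhomogeneity, so the derivative solves an
equation of the same kind. -/
lemma Admissible.resFun_one_eq (hZ : Admissible σ Z) (hσ : FiniteMoments σ) (d : ℕ) (s x : ℝ)
    {z : ℂ} (hz : z ∈ Z) :
    resFun σ 1 d s z x = airyD (d + 1) (z + (s + x : ℝ)) -
      (∫ t, resPair σ d 0 s x t * airyD 0 (z + (s + t : ℝ)) ∂σ) +
      resFun σ 0 d s 0 x * kerVal σ 0 0 s z 0 +
      pair (kerRow σ 0 0 s z) (memLp_resFun hσ 1 d s x).toLp := by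
  set P' := (memLp_resFun hσ 1 d s x).toLp with hP'
  have h1 : pair (kerRow σ 0 1 s z) (resVec σ d s x) =
      -(resFun σ 0 d s 0 x * kerVal σ 0 0 s z 0) - pair (kerRow σ 0 0 s z) P' := by
    rw [hZ.pair_kerRow 0 1 hz, hZ.pair_kerRow 0 0 hz, kerVal, ← integral_const_mul, ← integral_neg,
      ← integral_sub]
    · refine integral_congr_ae (Eventually.of_forall fun p => ?_)
      simp only [zero_add]
      rw [pair_airyL2_one_resVec hσ]
      ring
    · have := ((hZ.tailBound_mul 0 0 hz (w := 0) le_rfl).integrable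
        (continuous_airyD_mul 0 0 z (0 : ℝ)) s)
      rw [Complex.ofReal_zero] at this
      exact (this.const_mul _).neg
    · have := (pair.flip P').integrable_comp (hZ.integrable_smul 0 0 hz s)
      simpa using this
  have h2 : pair (∫ t, airyD 0 (z + (s + t : ℝ)) • airyL2 0 (s + t) ∂σ) (resVec σ d s x) =
      ∫ t, resPair σ d 0 s x t * airyD 0 (z + (s + t : ℝ)) ∂σ := by
    have := ((pair.flip (resVec σ d s x)).integral_comp_comm (hZ.integrable_boundary 0 0 hz s))
    simp only [ContinuousLinearMap.flip_apply] at this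
    rw [← this]
    refine integral_congr_ae (Eventually.of_forall fun t => ?_)
    simp only [map_smul, _root_.smul_apply, smul_eq_mul]
    rw [pair_airyL2_resVec, mul_comm]
  rw [resFun, hZ.kerRow_one_zero hz]
  simp only [map_sub, map_neg, _root_.sub_apply, _root_.neg_apply]
  rw [h1, h2]
  ring

/-- The derivative of a resolvent function in its spectral variable. -/
lemma Admissible.resFun_one (hZ : Admissible σ Z) (hσ : FiniteMoments σ) (d : ℕ) (s x : ℝ)
    {z : ℂ} (hz : z ∈ Z) :
    resFun σ 1 d s z x = resFun σ 0 (d + 1) s z x -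
      (∫ t, resPair σ d 0 s x t * resFun σ 0 0 s z t ∂σ) +
      resFun σ 0 d s 0 x * resKer σ s z := by
  set P' := (memLp_resFun hσ 1 d s x).toLp with hP'
  have hφ := polyGrowth_resPair (σ := σ) d 0 s x
  -- On the half line `Admissible.resFun_one_eq` is an integral equation for the derivative, which
  -- is therefore R of its inhomogeneity; substituting this for `P'` gives the formula at every
  -- admissible z.
  have h1 : P' = resOp σ s (airyL2 (d + 1) (s + x) - airySum σ s 0 (resPair σ d 0 s x) +
      resFun σ 0 d s 0 x • kerRow σ 0 0 s 0) := by
    refine eq_resOp_of_eq hσ s (memLp_resFun hσ 1 d s x).coeFn_toLp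
      (g := fun w : ℝ => airyD (d + 1) (w + (s + x : ℝ)) -
        (∫ t, resPair σ d 0 s x t * airyD 0 (w + (s + t : ℝ)) ∂σ) +
        resFun σ 0 d s 0 x * kerVal σ 0 0 s w 0) ?_
      (fun w hw => hσ.admissible.resFun_one_eq hσ d s x (hσ.admissible.real w))
    have h0 : (0 : ℂ) ∈ range ((↑) : ℝ → ℂ) := ⟨0, by simp⟩
    filter_upwards [Lp.coeFn_add (airyL2 (d + 1) (s + x) - airySum σ s 0 (resPair σ d 0 s x))
      (resFun σ 0 d s 0 x • kerRow σ 0 0 s 0),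
      Lp.coeFn_sub (airyL2 (d + 1) (s + x)) (airySum σ s 0 (resPair σ d 0 s x)),
      Lp.coeFn_smul (resFun σ 0 d s 0 x) (kerRow σ 0 0 s 0), coeFn_airyL2 (d + 1) (s + x),
      (integrable_airySum hσ s 0 hφ).2, hσ.admissible.coeFn_kerRow 0 0 h0 s]
      with w e1 e2 e3 e4 e5 e6
    rw [e1, Pi.add_apply, e2, Pi.sub_apply, e3, Pi.smul_apply, e4, e5, e6, smul_eq_mul,
      kerVal_comm]
  rw [hZ.resFun_one_eq hσ d s x hz, (hZ.integral_mul_resFun hσ 0 s hφ hz).2.2, ← hP', h1]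
  simp only [map_add, map_sub, map_smul, smul_eq_mul, resKer]
  simp only [resFun, resVec, add_zero]
  ring

/-- The derivative of a resolvent function in the parameter `s`. -/
lemma Admissible.hasDerivAt_resFun_param (hZ : Admissible σ Z) (hσ : FiniteMoments σ) (d : ℕ)
    (s x : ℝ) {z : ℂ} (hz : z ∈ Z) :
    HasDerivAt (fun s => resFun σ 0 d s z x) (resFun σ 0 (d + 1) s z x -
      ∫ t, resPair σ d 0 s x t * resFun σ 0 0 s z t ∂σ) s := by
  have hφ := polyGrowth_resPair (σ := σ) d 0 s x
  have ha : HasDerivAt (fun s : ℝ => airyL2 d (s + x)) (airyL2 (d + 1) (s + x)) s :=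
    (hasDerivAt_airyL2 d (s + x)).comp_add_const s x
  have hb : HasDerivAt (fun s : ℝ => airyD d (z + (s + x : ℝ))) (airyD (d + 1) (z + (s + x : ℝ))) s := by
    have := (hasDerivAt_airyD_ofReal d z (s + x)).comp_add_const s x
    exact this
  -- Product rule for R applied to the shifted Airy vector. Each rank one operator in K', applied to
  -- the resolvent vector, contributes a coefficient `resPair` times an Airy vector, so R'
  -- contributes -R of an `airySum`.
  have hv : HasDerivAt (fun s : ℝ => resVec σ d s x)
      (-resOp σ s (airySum σ s 0 (resPair σ d 0 s x)) + resVec σ (d + 1) s x) s := by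
    have h := ((ContinuousLinearMap.id ℂ (HalfL2 →L[ℂ] HalfL2)).bilinearRestrictScalars
      ℝ).hasDerivAt_of_bilinear (fun _ => hasDerivAt_resOp hσ s) (fun _ => ha)
    refine h.congr_deriv ?_
    change resVec σ (d + 1) s x + (resOp σ s * (-∫ t, airyTensor 0 0 (s + t) ∂σ) * resOp σ s)
      (airyL2 d (s + x)) = _
    rw [add_comm]
    congr 1
    simp only [mul_neg, neg_mul, _root_.neg_apply, mul_apply_eq_comp]
    congr 2
    have h1 : Integrable (fun t => airyTensor 0 0 (s + t)) σ :=
      (tailBound_airyTensor hσ 0 0).integrable_boundary (continuous_airyTensor 0 0) s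
    have h2 := (ContinuousLinearMap.apply ℂ HalfL2 (resVec σ d s x)).integral_comp_comm h1
    refine h2.symm.trans ?_
    refine integral_congr_ae (Eventually.of_forall fun t => ?_)
    change pair (airyL2 0 (s + t)) (resVec σ d s x) • airyL2 0 (s + t) = _
    rw [pair_airyL2_resVec]
  have hk := hZ.hasDerivAt_kerRow_param hz s
  have hp := (pair.bilinearRestrictScalars ℝ).hasDerivAt_of_bilinear (fun _ => hk) (fun _ => hv)
  have h2 : pair (∫ t, airyD 0 (z + (s + t : ℝ)) • airyL2 0 (s + t) ∂σ) (resVec σ d s x) =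
      ∫ t, resPair σ d 0 s x t * airyD 0 (z + (s + t : ℝ)) ∂σ := by
    have := ((pair.flip (resVec σ d s x)).integral_comp_comm (hZ.integrable_boundary 0 0 hz s))
    simp only [ContinuousLinearMap.flip_apply] at this
    rw [← this]
    refine integral_congr_ae (Eventually.of_forall fun t => ?_)
    simp only [map_smul, _root_.smul_apply, smul_eq_mul]
    rw [pair_airyL2_resVec, mul_comm]
  refine (hb.add hp).congr_deriv ?_
  change _ + (pair (kerRow σ 0 0 s z) _ + pair (-∫ t, _ ∂σ) (resVec σ d s x)) = _
  rw [(hZ.integral_mul_resFun hσ 0 s hφ hz).2.2]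
  simp only [map_add, map_neg, _root_.neg_apply]
  rw [h2, resFun]
  ring

end AiryLax
end

/-! ### Multiplication by the spectral variable. -/

noncomputable section
namespace AiryLax

variable {σ : Measure ℝ} [IsProbabilityMeasure σ] {Z : Set ℂ}

set_option linter.unusedSectionVars false

lemma Admissible.coeFn_boundary (hZ : Admissible σ Z) (n m : ℕ) {z : ℂ} (hz : z ∈ Z) (s : ℝ) :
    ((∫ t, airyD n (z + (s + t : ℝ)) • airyL2 m (s + t) ∂σ : HalfL2) : ℝ → ℂ) =ᵐ[halfLine]
      fun w : ℝ => ∫ t, airyD n (z + (s + t : ℝ)) * airyD m (w + (s + t : ℝ)) ∂σ := by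
  obtain ⟨h, hh, h0, hb⟩ := hZ.bound n m 1 (max |s| ‖z‖)
  refine (coeFn_integral_halfL2
    (φ := fun t w => airyD n (z + (s + t : ℝ)) * airyD m (w + (s + t : ℝ)))
    (h := h) ?_ (fun t => ?_) (hZ.integrable_boundary n m hz s).1 hh
    (Eventually.of_forall fun t w hw => ?_)).2
  · refine Continuous.aestronglyMeasurable ?_
    simp only [Function.uncurry_def]
    exact ((continuous_airyD n).comp (by fun_prop)).mul ((continuous_airyD m).comp (by fun_prop))
  · filter_upwards [Lp.coeFn_smul (airyD n (z + (s + t : ℝ))) (airyL2 m (s + t)),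
      coeFn_airyL2 m (s + t)] with w h1 h2
    rw [h1, Pi.smul_apply, h2, smul_eq_mul]
  · have := hb z hz (le_max_right _ _) s t 0 w (le_max_left _ _) le_rfl hw.le
    rw [norm_mul]
    simpa using this

lemma Admissible.integrable_boundary_mul (hZ : Admissible σ Z) (n m : ℕ) {z : ℂ} (hz : z ∈ Z)
    {w : ℝ} (hw : 0 ≤ w) (s : ℝ) :
    Integrable (fun t => airyD n (z + (s + t : ℝ)) * airyD m (w + (s + t : ℝ))) σ :=
  (hZ.tailBound_mul n m hz hw).integrable_boundary (continuous_airyD_mul n m z w) s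

/-- `∫ (z - w) K(z, w) f(w) dw` as a boundary term. -/
lemma Admissible.pair_boundary (hZ : Admissible σ Z) {z : ℂ} (hz : z ∈ Z) (s : ℝ) (F : HalfL2) :
    (∫ t, pair (airyL2 1 (s + t)) F * airyD 0 (z + (s + t : ℝ)) ∂σ) -
        ∫ t, pair (airyL2 0 (s + t)) F * airyD 1 (z + (s + t : ℝ)) ∂σ =
      ∫ w in Ioi (0 : ℝ), (z - w) * kerVal σ 0 0 s z w * F w := by
  have e : ∀ n m : ℕ, ∫ t, pair (airyL2 m (s + t)) F * airyD n (z + (s + t : ℝ)) ∂σ =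
      pair (∫ t, airyD n (z + (s + t : ℝ)) • airyL2 m (s + t) ∂σ) F := by
    intro n m
    have := ((pair.flip F).integral_comp_comm (hZ.integrable_boundary n m hz s))
    simp only [ContinuousLinearMap.flip_apply] at this
    rw [← this]
    refine integral_congr_ae (Eventually.of_forall fun t => ?_)
    simp only [map_smul, _root_.smul_apply, smul_eq_mul]
    rw [mul_comm]
  rw [e, e, ← _root_.sub_apply, ← map_sub]
  refine pair_eq ?_ (ae_eq_refl _)
  filter_upwards [Lp.coeFn_sub (∫ t, airyD 0 (z + (s + t : ℝ)) • airyL2 1 (s + t) ∂σ : HalfL2)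
    (∫ t, airyD 1 (z + (s + t : ℝ)) • airyL2 0 (s + t) ∂σ : HalfL2),
    hZ.coeFn_boundary 0 1 hz s, hZ.coeFn_boundary 1 0 hz s, ae_halfLine fun w hw => hw]
    with w h1 h2 h3 h4
  rw [h1, Pi.sub_apply, h2, h3, hZ.sub_mul_kerVal hz h4.le, integral_sub]
  · exact hZ.integrable_boundary_mul 0 1 hz h4.le s
  · exact hZ.integrable_boundary_mul 1 0 hz h4.le s

/-- By `Admissible.sub_mul_kerVal`, (z - w) K(z,w) is a σ-superposition of Airy products; z
therefore passes through K onto F at the cost of that superposition. -/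
lemma Admissible.mul_pair_kerRow (hZ : Admissible σ Z) {z : ℂ} (hz : z ∈ Z) (s : ℝ)
    {F XF : HalfL2} (hX : XF =ᵐ[halfLine] fun w : ℝ => w * F w) :
    z * pair (kerRow σ 0 0 s z) F = pair (kerRow σ 0 0 s z) XF +
      ((∫ t, pair (airyL2 1 (s + t)) F * airyD 0 (z + (s + t : ℝ)) ∂σ) -
        ∫ t, pair (airyL2 0 (s + t)) F * airyD 1 (z + (s + t : ℝ)) ∂σ) := by
  rw [hZ.pair_boundary hz, ← smul_eq_mul, ← _root_.smul_apply, ← map_smul, ← sub_eq_iff_eq_add',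
    pair_apply, pair_apply, ← integral_sub]
  · refine integral_congr_ae ?_
    filter_upwards [hX, hZ.coeFn_kerRow 0 0 hz s, Lp.coeFn_smul z (kerRow σ 0 0 s z)]
      with w h2 h3 h4
    rw [h2, h4, Pi.smul_apply, h3, smul_eq_mul]
    ring
  · exact (Lp.memLp _).integrable_mul (Lp.memLp _)
  · exact (Lp.memLp _).integrable_mul (Lp.memLp _)

/-- Multiplication by the spectral variable, on the range of the resolvent. -/
lemma Admissible.mul_pair_resOp (hZ : Admissible σ Z) (hσ : FiniteMoments σ) {z : ℂ} (hz : z ∈ Z)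
    (s : ℝ) {G XG : HalfL2} {g : ℝ → ℂ} (hG : G =ᵐ[halfLine] g)
    (hXG : XG =ᵐ[halfLine] fun w : ℝ => w * g w) :
    z * pair (kerRow σ 0 0 s z) (resOp σ s G) = pair (kerRow σ 0 0 s z) (resOp σ s XG) +
      ((∫ t, pair (airyL2 1 (s + t)) (resOp σ s G) * resFun σ 0 0 s z t ∂σ) -
        ∫ t, pair (airyL2 0 (s + t)) (resOp σ s G) * resFun σ 0 1 s z t ∂σ) := by
  set F := resOp σ s G with hF
  have h1 : PolyGrowth fun t => pair (airyL2 1 (s + t)) F := by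
    simpa only [pair_comm] using polyGrowth_clm (pair F) 1 s
  have h0 : PolyGrowth fun t => pair (airyL2 0 (s + t)) F := by
    simpa only [pair_comm] using polyGrowth_clm (pair F) 0 s
  have hFc := coeFn_resOp hσ s hG
  rw [← hF] at hFc
  -- R G differs from G by K R G, whose decay is that of the rows of the kernel. Hence w R G is in
  -- L² as soon as w G is, and no domain question arises for the unbounded multiplication.
  have hm : MemLp (fun w : ℝ => w * pair (kerRow σ 0 0 s w) F) 2 halfLine := by
    obtain ⟨C, hC, hb⟩ := norm_kerRow_le hσ 0 2 s
    refine memLp_halfLine (M := ‖pair‖ * C * ‖F‖) ?_ fun w hw => ?_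
    · have hc : Continuous fun w : ℝ => pair (kerRow σ 0 0 s w) F :=
        (pair.flip F).continuous.comp (continuous_kerRow_ofReal hσ 0 s)
      exact (Complex.continuous_ofReal.mul hc).aestronglyMeasurable
    · rw [norm_mul, Complex.norm_real, Real.norm_of_nonneg hw.le]
      have h3 : w * ((1 + w) ^ 2)⁻¹ ≤ (1 + w)⁻¹ := by
        rw [pow_two, mul_inv, ← mul_assoc]
        refine mul_le_of_le_one_left (by positivity) ?_
        rw [← div_eq_mul_inv, div_le_one (by linarith)]; linarith
      calc _ ≤ w * (‖pair‖ * (C * ((1 + w) ^ 2)⁻¹) * ‖F‖) := by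
            gcongr
            refine (norm_pair_le _ _).trans ?_
            gcongr
            exact hb w hw.le
        _ = ‖pair‖ * C * ‖F‖ * (w * ((1 + w) ^ 2)⁻¹) := by ring
        _ ≤ _ := by gcongr
  set XF := XG + hm.toLp with hXFdef
  have hXF : XF =ᵐ[halfLine] fun w : ℝ => w * F w := by
    filter_upwards [Lp.coeFn_add XG hm.toLp, hXG, hm.coeFn_toLp, hFc] with w e1 e2 e3 e4
    rw [e1, Pi.add_apply, e2, e3, e4, mul_add]
  -- wF satisfies the integral equation whose inhomogeneity is wG plus the commutator term, hence it
  -- is R of that sum.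
  have hres : XF = resOp σ s (XG + (airySum σ s 0 (fun t => pair (airyL2 1 (s + t)) F) -
      airySum σ s 1 (fun t => pair (airyL2 0 (s + t)) F))) := by
    refine eq_resOp_of_eq hσ s (f := fun w : ℝ => w * g w + w * pair (kerRow σ 0 0 s w) F)
      (g := fun w : ℝ => w * g w +
        ((∫ t, pair (airyL2 1 (s + t)) F * airyD 0 (w + (s + t : ℝ)) ∂σ) -
        ∫ t, pair (airyL2 0 (s + t)) F * airyD 1 (w + (s + t : ℝ)) ∂σ)) ?_ ?_ fun w hw => ?_
    · filter_upwards [hXF, hFc] with w e1 e2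
      rw [e1, e2, mul_add]
    · filter_upwards [Lp.coeFn_add XG (airySum σ s 0 (fun t => pair (airyL2 1 (s + t)) F) -
          airySum σ s 1 (fun t => pair (airyL2 0 (s + t)) F)), hXG,
        Lp.coeFn_sub (airySum σ s 0 (fun t => pair (airyL2 1 (s + t)) F))
          (airySum σ s 1 (fun t => pair (airyL2 0 (s + t)) F)),
        (integrable_airySum hσ s 0 h1).2, (integrable_airySum hσ s 1 h0).2] with w e1 e2 e3 e4 e5
      rw [e1, Pi.add_apply, e2, e3, Pi.sub_apply, e4, e5]
    · rw [hσ.admissible.mul_pair_kerRow (hσ.admissible.real w) s hXF]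
      ring
  rw [hZ.mul_pair_kerRow hz s hXF, (hZ.integral_mul_resFun hσ 0 s h1 hz).2.2,
    (hZ.integral_mul_resFun hσ 1 s h0 hz).2.2, hres]
  simp only [map_add, map_sub]
  ring

/-- Multiplication by the spectral variable for the resolvent of an Airy function. -/
lemma Admissible.mul_resFun (hZ : Admissible σ Z) (hσ : FiniteMoments σ) {z : ℂ} (hz : z ∈ Z)
    (s x : ℝ) : z * resFun σ 0 0 s z x = resFun σ 0 2 s z x - (s + x) * resFun σ 0 0 s z x +
      ((∫ t, resPair σ 0 1 s x t * resFun σ 0 0 s z t ∂σ) -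
        ∫ t, resPair σ 0 0 s x t * resFun σ 0 1 s z t ∂σ) := by
  -- The Airy equation in the form w Ai(w + c) = Ai''(w + c) - c Ai(w + c).
  have hXG : (airyL2 2 (s + x) - ((s + x : ℝ) : ℂ) • airyL2 0 (s + x) : HalfL2) =ᵐ[halfLine]
      fun w : ℝ => w * airyD 0 (w + (s + x : ℝ)) := by
    filter_upwards [Lp.coeFn_sub (airyL2 2 (s + x)) (((s + x : ℝ) : ℂ) • airyL2 0 (s + x)),
      Lp.coeFn_smul ((s + x : ℝ) : ℂ) (airyL2 0 (s + x)), coeFn_airyL2 2 (s + x),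
      coeFn_airyL2 0 (s + x)] with w h1 h2 h3 h4
    rw [h1, Pi.sub_apply, h2, Pi.smul_apply, h3, h4, airyD_two, smul_eq_mul]
    ring
  have := hZ.mul_pair_resOp hσ hz s (coeFn_airyL2 0 (s + x)) hXG
  have e : ∀ d t, pair (airyL2 d (s + t)) (resOp σ s (airyL2 0 (s + x))) = resPair σ 0 d s x t :=
    fun d t => pair_airyL2_resVec 0 d s x t
  simp only [e, map_sub, map_smul, smul_eq_mul] at this
  rw [resFun, mul_add, resVec, this]
  simp only [resFun, resVec, add_zero, airyD_two]
  push_cast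
  ring

/-- Multiplication by the spectral variable for the resolvent of the kernel. -/
lemma Admissible.mul_resKer (hZ : Admissible σ Z) (hσ : FiniteMoments σ) {z : ℂ} (hz : z ∈ Z)
    (s : ℝ) : z * resKer σ s z = (∫ t, resFun σ 0 1 s 0 t * resFun σ 0 0 s z t ∂σ) -
        ∫ t, resFun σ 0 0 s 0 t * resFun σ 0 1 s z t ∂σ := by
  have h0 : (0 : ℂ) ∈ range ((↑) : ℝ → ℂ) := ⟨0, by simp⟩
  have hφ := fun d => polyGrowth_airyD d s
  have hsub : ∀ {Z : Set ℂ} (hZ : Admissible σ Z) {z : ℂ} (hz : z ∈ Z), z * kerVal σ 0 0 s z 0 =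
      (∫ t, airyD 1 (s + t : ℝ) * airyD 0 (z + (s + t : ℝ)) ∂σ) -
      ∫ t, airyD 0 (s + t : ℝ) * airyD 1 (z + (s + t : ℝ)) ∂σ := by
    intro Z hZ z hz
    have := hZ.sub_mul_kerVal hz (w := 0) le_rfl s
    rw [Complex.ofReal_zero, sub_zero] at this
    rw [this, ← integral_sub (hZ.integral_mul_resFun hσ 0 s (hφ 1) hz).1
      (hZ.integral_mul_resFun hσ 1 s (hφ 0) hz).1]
    refine integral_congr_ae (Eventually.of_forall fun t => ?_)
    simp only [zero_add]
    ring
  have hXG : (airySum σ s 0 (fun t => airyD 1 (s + t : ℝ)) -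
      airySum σ s 1 (fun t => airyD 0 (s + t : ℝ)) : HalfL2) =ᵐ[halfLine]
      fun w : ℝ => w * kerVal σ 0 0 s w 0 := by
    filter_upwards [Lp.coeFn_sub (airySum σ s 0 (fun t => airyD 1 (s + t : ℝ)))
      (airySum σ s 1 (fun t => airyD 0 (s + t : ℝ))), (integrable_airySum hσ s 0 (hφ 1)).2,
      (integrable_airySum hσ s 1 (hφ 0)).2] with w h1 h2 h3
    rw [h1, Pi.sub_apply, h2, h3, hsub hσ.admissible (hσ.admissible.real w)]
  have hG : kerRow σ 0 0 s 0 =ᵐ[halfLine] fun w : ℝ => kerVal σ 0 0 s w 0 := by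
    filter_upwards [hσ.admissible.coeFn_kerRow 0 0 h0 s] with w hw
    rw [hw, kerVal_comm]
  have key := hZ.mul_pair_resOp hσ hz s hG hXG
  -- Symmetry of R turns the pairing with R K(·,0) into the value at 0 of K R Ai⁽ᵈ⁾, that is, of the
  -- resolvent function without its Airy part.
  have ha : ∀ d t, pair (airyL2 d (s + t)) (resOp σ s (kerRow σ 0 0 s 0)) =
      resFun σ 0 d s 0 t - airyD d (s + t : ℝ) := by
    intro d t
    rw [← pair_resOp hσ, pair_comm, resFun, zero_add, add_zero, add_sub_cancel_left]; rfl
  have hb : ∀ d, PolyGrowth fun t => pair (airyL2 d (s + t)) (resOp σ s (kerRow σ 0 0 s 0)) :=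
    fun d => by simpa only [pair_comm] using polyGrowth_clm (pair (resOp σ s (kerRow σ 0 0 s 0))) d s
  have hsplit : ∀ d e, ∫ t, resFun σ 0 d s 0 t * resFun σ 0 e s z t ∂σ =
      (∫ t, pair (airyL2 d (s + t)) (resOp σ s (kerRow σ 0 0 s 0)) * resFun σ 0 e s z t ∂σ) +
      ∫ t, airyD d (s + t : ℝ) * resFun σ 0 e s z t ∂σ := by
    intro d e
    rw [← integral_add (hZ.integral_mul_resFun hσ e s (hb d) hz).2.1
      (hZ.integral_mul_resFun hσ e s (hφ d) hz).2.1]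
    refine integral_congr_ae (Eventually.of_forall fun t => ?_)
    simp only [ha]
    ring
  rw [hsplit, hsplit, resKer, mul_add, key, hsub hZ hz, (hZ.integral_mul_resFun hσ 0 s (hφ 1) hz).2.2,
    (hZ.integral_mul_resFun hσ 1 s (hφ 0) hz).2.2]
  simp only [map_sub]
  ring

end AiryLax
end

noncomputable section
namespace AiryLax

variable {σ : Measure ℝ} [IsProbabilityMeasure σ] {Z : Set ℂ}

set_option linter.unusedSectionVars false

/-! ### The solutions of the integral equations -/

lemma m_eq (s : ℝ) (i : Fin 2) (z : ℂ) (x : ℝ) : m s i z x = airyD (1 - i) (z + (s + x : ℝ)) := by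
  fin_cases i <;> simp [m, airyD_zero, airyD_one, add_assoc]

lemma k_eq (s : ℝ) (j : Fin 2) (z : ℂ) (y : ℝ) : k s j z y = airyD j (z + (s + y : ℝ)) := by
  fin_cases j <;> simp [k, airyD_zero, airyD_one, add_assoc]

lemma airyKs_eq (hσ : FiniteMoments σ) (s : ℝ) {z w : ℝ} (hw : 0 ≤ w) (h : z ≠ w) :
    airyKs σ s z w = kerVal σ 0 0 s z w := by
  have h1 : (z : ℂ) - w ≠ 0 := sub_ne_zero.mpr (by exact_mod_cast h)
  have h2 := hσ.admissible.sub_mul_kerVal (hσ.admissible.real z) hw s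
  have h3 : z + s ≠ w + s := fun h' => h (by linarith)
  rw [airyKs, airyK, if_neg h3, div_eq_iff (by push_cast; rwa [add_sub_add_right_eq_sub])]
  push_cast
  rw [add_sub_add_right_eq_sub, mul_comm, h2, airyD_zero, airyD_one]
  simp only [Complex.ofReal_add, add_assoc]

lemma integral_airyKs (hσ : FiniteMoments σ) (s z : ℝ) {f : ℝ → ℂ} (hf : MemLp f 2 halfLine) :
    ∫ w in Ioi (0 : ℝ), airyKs σ s z w * f w = pair (kerRow σ 0 0 s z) hf.toLp := by
  rw [pair_eq (hσ.admissible.coeFn_kerRow 0 0 (hσ.admissible.real z) s) hf.coeFn_toLp]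
  -- The point w = z is null, so the value assigned to the kernel on the diagonal never matters.
  have h1 : ∀ᵐ w ∂halfLine, w ≠ z :=
    ae_restrict_of_ae (by simp [ae_iff])
  refine integral_congr_ae ?_
  filter_upwards [h1, ae_halfLine fun w hw => hw] with w hw hw'
  rw [airyKs_eq hσ s hw'.le hw.symm]

lemma solvesEq_resFun (hσ : FiniteMoments σ) (d : ℕ) (s x z : ℝ) :
    resFun σ 0 d s z x - ∫ w in Ioi (0 : ℝ), airyKs σ s z w * resFun σ 0 d s w x =
      airyD d (z + (s + x : ℝ)) := by
  have h : (memLp_resFun hσ 0 d s x).toLp = resVec σ d s x :=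
    Lp.ext ((memLp_resFun hσ 0 d s x).coeFn_toLp.trans (coeFn_resVec hσ d s x).symm)
  rw [integral_airyKs hσ s z (memLp_resFun hσ 0 d s x), h, resFun, add_sub_cancel_right, add_zero]

lemma toLp_eq_resVec (hσ : FiniteMoments σ) (d : ℕ) (s x : ℝ) {f : ℝ → ℂ}
    (hf : SolvesEq σ s (fun w : ℝ => airyD d (w + (s + x : ℝ))) f) :
    hf.1.toLp = resVec σ d s x := by
  refine eq_resOp_of_eq hσ s (f := fun w : ℝ => airyD d (w + (s + x : ℝ)) +
    pair (kerRow σ 0 0 s w) hf.1.toLp) ?_ (coeFn_airyL2 d (s + x)) fun w hw => rfl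
  filter_upwards [hf.1.coeFn_toLp, hf.2] with w h1 h2
  rw [h1, ← h2, integral_airyKs hσ s w hf.1, sub_add_cancel]

/-- The class chosen by `someSol` is the only solution in L², and the integral equation fixes the
representative at every point, so the choice disappears. -/
lemma resolve_eq (hσ : FiniteMoments σ) (d : ℕ) (s x z : ℝ) :
    resolve σ s (fun w : ℝ => airyD d (w + (s + x : ℝ))) z = resFun σ 0 d s z x := by
  have hex : ∃ f, SolvesEq σ s (fun w : ℝ => airyD d (w + (s + x : ℝ))) f :=
    ⟨_, memLp_resFun hσ 0 d s x, Eventually.of_forall fun z => solvesEq_resFun hσ d s x z⟩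
  have h1 : SolvesEq σ s (fun w : ℝ => airyD d (w + (s + x : ℝ)))
      (someSol σ s (fun w : ℝ => airyD d (w + (s + x : ℝ)))) := by
    rw [someSol, dif_pos hex]; exact hex.choose_spec
  rw [resolve, integral_airyKs hσ s z h1.1, toLp_eq_resVec hσ d s x h1]
  rfl

lemma isTheSolution_resolve (hσ : FiniteMoments σ) (d : ℕ) (s x : ℝ) :
    IsTheSolution σ s (fun w : ℝ => airyD d (w + (s + x : ℝ))) (fun w => resFun σ 0 d s w x) := by
  refine ⟨⟨memLp_resFun hσ 0 d s x, Eventually.of_forall fun z => solvesEq_resFun hσ d s x z⟩,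
    solvesEq_resFun hσ d s x, fun f hf => ?_⟩
  have := toLp_eq_resVec hσ d s x hf
  exact hf.1.coeFn_toLp.symm.trans (this ▸ coeFn_resVec hσ d s x)

lemma n_eq (hσ : FiniteMoments σ) (s : ℝ) (i : Fin 2) (z x : ℝ) :
    n σ s i z x = resFun σ 0 (1 - i) s z x := by
  simp only [n, m_eq, resolve_eq hσ]

lemma ell_eq (hσ : FiniteMoments σ) (s : ℝ) (j : Fin 2) (z y : ℝ) :
    ell σ s j z y = resFun σ 0 j s z y := by
  simp only [ell, k_eq, resolve_eq hσ]

/-! ### Integral operators with kernels of polynomial growth -/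

lemma PolyGrowth.memLp (hσ : FiniteMoments σ) {φ : ℝ → ℂ} (hφ : PolyGrowth φ) : MemLp φ 2 σ := by
  obtain ⟨hc, C, a, hC, hb⟩ := hφ
  rw [memLp_two_iff_integrable_sq_norm hc.aestronglyMeasurable]
  refine Integrable.mono' ((hσ (a + a)).const_mul (C ^ 2)) (by fun_prop)
    (Eventually.of_forall fun t => ?_)
  rw [Real.norm_of_nonneg (by positivity)]
  calc _ ≤ (C * (1 + |t|) ^ a) ^ 2 := by gcongr; exact hb t
    _ = _ := by rw [pow_add]; ring

lemma Admissible.memLp_airyD (hZ : Admissible σ Z) (d : ℕ) (s : ℝ) {z : ℂ} (hz : z ∈ Z) :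
    MemLp (fun t : ℝ => airyD d (z + (s + t : ℝ))) 2 σ := by
  obtain ⟨ω, hωc, hω1, hωi, hω⟩ := hZ.weight d ‖z + s‖
  have hc : Continuous fun t : ℝ => airyD d (z + (s + t : ℝ)) :=
    (continuous_airyD d).comp (by fun_prop)
  rw [memLp_two_iff_integrable_sq_norm hc.aestronglyMeasurable]
  have h0 := hωi 0
  simp only [pow_zero, mul_one] at h0
  refine Integrable.mono' h0 (hc.norm.pow 2).aestronglyMeasurable (Eventually.of_forall fun t => ?_)
  rw [Real.norm_of_nonneg (by positivity)]
  have h4 := hω (z + s) (hZ.shift z hz s) le_rfl t 0 le_rfl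
  have e1 : z + s + t + (0 : ℝ) = z + (s + t : ℝ) := by push_cast; ring
  rw [e1] at h4
  gcongr

lemma Admissible.memLp_resFun (hZ : Admissible σ Z) (hσ : FiniteMoments σ) (d : ℕ) (s : ℝ) {z : ℂ}
    (hz : z ∈ Z) : MemLp (fun t : ℝ => resFun σ 0 d s z t) 2 σ :=
  (hZ.memLp_airyD (d + 0) s hz).add (PolyGrowth.memLp hσ
    (polyGrowth_clm ((pair (kerRow σ 0 0 s z)).comp (resOp σ s)) d s))

end AiryLax
end

noncomputable section
namespace AiryLax

/-! ### One-sided branches of the logarithm -/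

/-- The logarithm on the closed half plane `0 ≤ ε Im ζ`, for `ε = ±1`. -/
def lgSide (ε : ℝ) (ζ : ℂ) : ℂ := Complex.log (-(ε * Complex.I) * ζ) + ε * (Real.pi / 2) * Complex.I

/-- The antiderivative `ζ log ζ - ζ` of the logarithm on the closed half plane `0 ≤ ε Im ζ`. -/
def gSide (ε : ℝ) (ζ : ℂ) : ℂ := ζ * lgSide ε ζ - ζ

lemma lgSide_eq_log {ε : ℝ} (hε : ε = 1 ∨ ε = -1) {ζ : ℂ} (h : ζ ∈ Complex.slitPlane)
    (h0 : 0 ≤ ε * ζ.im) : lgSide ε ζ = Complex.log ζ := by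
  have hζ := Complex.slitPlane_ne_zero h
  have hpi := Real.pi_pos
  have harg : ζ.arg ≠ Real.pi := Complex.mem_slitPlane_iff_arg.mp h |>.1
  rcases hε with rfl | rfl
  · have h1 : 0 ≤ ζ.arg := Complex.arg_nonneg_iff.mpr (by simpa using h0)
    have h2 := Complex.arg_le_pi ζ
    rw [lgSide, Complex.ofReal_one, one_mul, Complex.log_mul_eq_add_log_iff (by simp) hζ |>.mpr,
      Complex.log_neg_I]
    · ring
    · rw [Complex.arg_neg_I]; constructor <;> linarith
  · have h1 : ζ.arg ≤ 0 := by
      rcases (show ζ.im ≤ 0 by linarith).lt_or_eq with h1 | h1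
      · exact (Complex.arg_neg_iff.mpr h1).le
      · rcases h with h | h
        · exact (Complex.arg_eq_zero_iff.mpr ⟨h.le, h1⟩).le
        · exact absurd h1 h
    have h2 := Complex.neg_pi_lt_arg ζ
    rw [lgSide, Complex.ofReal_neg, Complex.ofReal_one, neg_one_mul, neg_neg,
      Complex.log_mul_eq_add_log_iff (by simp) hζ |>.mpr, Complex.log_I]
    · ring
    · rw [Complex.arg_I]; constructor <;> linarith

/-- The rotation by -εi carries the closed half plane without 0 into the slit plane, whereas the
principal branch itself jumps along the negative axis. -/
lemma continuousOn_lgSide {ε : ℝ} (hε : ε = 1 ∨ ε = -1) :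
    ContinuousOn (lgSide ε) {ζ | ζ ≠ 0 ∧ 0 ≤ ε * ζ.im} := by
  refine ContinuousOn.add (ContinuousOn.clog (by fun_prop) fun ζ hζ => ?_) continuousOn_const
  have hre : (-(ε * Complex.I) * ζ).re = ε * ζ.im := by simp
  have him : (-(ε * Complex.I) * ζ).im = -(ε * ζ.re) := by simp
  rw [Complex.mem_slitPlane_iff, hre, him]
  rcases hζ.2.lt_or_eq with h | h
  · exact Or.inl h
  · right
    have hε0 : ε ≠ 0 := by rcases hε with rfl | rfl <;> norm_num
    have h1 : ζ.im = 0 := by simpa [hε0] using h.symm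
    have h2 : ζ.re ≠ 0 := fun h2 => hζ.1 (Complex.ext h2 h1)
    exact neg_ne_zero.mpr (mul_ne_zero hε0 h2)

/-- The constant 6 covers π for the argument and π/2 for the rotation. -/
lemma norm_lgSide_le {ε : ℝ} (hε : ε = 1 ∨ ε = -1) (ζ : ℂ) :
    ‖lgSide ε ζ‖ ≤ |Real.log ‖ζ‖| + 6 := by
  have h1 : ‖-(ε * Complex.I) * ζ‖ = ‖ζ‖ := by rcases hε with rfl | rfl <;> simp
  have h2 : ‖(ε * (Real.pi / 2) * Complex.I : ℂ)‖ = Real.pi / 2 := by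
    rcases hε with rfl | rfl <;> simp [abs_of_pos Real.pi_pos]
  have h3 : ‖Complex.log (-(ε * Complex.I) * ζ)‖ ≤ |Real.log ‖ζ‖| + Real.pi := by
    refine (Complex.norm_le_abs_re_add_abs_im _).trans ?_
    rw [Complex.log_re, Complex.log_im, h1]
    gcongr
    exact Complex.abs_arg_le_pi _
  have := Real.pi_lt_four
  refine (norm_add_le _ _).trans ?_
  rw [h2]
  have := Real.pi_lt_d2
  linarith

lemma mul_abs_log_le {x : ℝ} (hx : 0 ≤ x) : x * |Real.log x| ≤ 1 + x ^ 2 := by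
  rcases hx.eq_or_lt with rfl | hx
  · simp
  have h1 := Real.log_le_sub_one_of_pos hx
  have h2 := Real.log_le_sub_one_of_pos (inv_pos.mpr hx)
  rw [Real.log_inv] at h2
  have h3 : x * x⁻¹ = 1 := mul_inv_cancel₀ hx.ne'
  rcases abs_cases (Real.log x) with ⟨h, _⟩ | ⟨h, _⟩ <;> rw [h] <;> nlinarith

lemma norm_mul_lgSide_le {ε : ℝ} (hε : ε = 1 ∨ ε = -1) (ζ : ℂ) :
    ‖ζ‖ * ‖lgSide ε ζ‖ ≤ 10 * (1 + ‖ζ‖) ^ 2 := by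
  have h1 := mul_le_mul_of_nonneg_left (norm_lgSide_le hε ζ) (norm_nonneg ζ)
  have h2 := mul_abs_log_le (norm_nonneg ζ)
  nlinarith [norm_nonneg ζ]

lemma norm_lgSide_le_div {ε : ℝ} (hε : ε = 1 ∨ ε = -1) {ζ : ℂ} {r : ℝ} (hr : 0 < r) (h : r ≤ ‖ζ‖) :
    ‖lgSide ε ζ‖ ≤ 10 * (1 + ‖ζ‖) ^ 2 / r := by
  rw [le_div_iff₀ hr, mul_comm]
  exact (mul_le_mul_of_nonneg_right h (norm_nonneg _)).trans (norm_mul_lgSide_le hε ζ)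

lemma norm_gSide_le {ε : ℝ} (hε : ε = 1 ∨ ε = -1) (ζ : ℂ) : ‖gSide ε ζ‖ ≤ 11 * (1 + ‖ζ‖) ^ 2 := by
  have h1 := norm_mul_lgSide_le hε ζ
  have h2 : ‖gSide ε ζ‖ ≤ ‖ζ‖ * ‖lgSide ε ζ‖ + ‖ζ‖ :=
    (norm_sub_le _ _).trans (by rw [norm_mul])
  nlinarith [norm_nonneg ζ]

lemma measurable_lgSide (ε : ℝ) : Measurable (lgSide ε) := by
  unfold lgSide
  exact (Complex.measurable_log.comp (by fun_prop)).add measurable_const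

lemma measurable_gSide (ε : ℝ) : Measurable (gSide ε) := by
  unfold gSide
  exact (measurable_id.mul (measurable_lgSide ε)).sub measurable_id

/-- The factor ζ removes the logarithmic singularity, so this antiderivative is continuous on the
whole closed half plane, including 0. -/
lemma continuousOn_gSide {ε : ℝ} (hε : ε = 1 ∨ ε = -1) :
    ContinuousOn (gSide ε) {ζ | 0 ≤ ε * ζ.im} := by
  intro ζ hζ
  by_cases h0 : ζ = 0
  · subst h0
    refine ContinuousAt.continuousWithinAt ?_
    have h1 : Tendsto (fun ζ : ℂ => |‖ζ‖ * Real.log ‖ζ‖| + 7 * ‖ζ‖) (𝓝 0) (𝓝 0) := by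
      have : Continuous fun ζ : ℂ => |‖ζ‖ * Real.log ‖ζ‖| + 7 * ‖ζ‖ :=
        ((Real.continuous_mul_log.comp continuous_norm).abs).add (by fun_prop)
      simpa using this.tendsto 0
    have h2 : gSide ε 0 = 0 := by simp [gSide]
    rw [ContinuousAt, h2]
    refine squeeze_zero_norm (fun ζ => ?_) h1
    have h3 := mul_le_mul_of_nonneg_left (norm_lgSide_le hε ζ) (norm_nonneg ζ)
    have h4 : ‖gSide ε ζ‖ ≤ ‖ζ‖ * ‖lgSide ε ζ‖ + ‖ζ‖ :=
      (norm_sub_le _ _).trans (by rw [norm_mul])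
    rw [abs_mul, abs_of_nonneg (norm_nonneg ζ)]
    linarith
  · have h1 : ContinuousWithinAt (lgSide ε) {ζ | 0 ≤ ε * ζ.im} ζ := by
      have h2 := continuousOn_lgSide hε ζ ⟨h0, hζ⟩
      refine h2.mono_of_mem_nhdsWithin ?_
      filter_upwards [self_mem_nhdsWithin, mem_nhdsWithin_of_mem_nhds (isOpen_ne.mem_nhds h0)]
        with w hw hw' using ⟨hw', hw⟩
    exact (continuousWithinAt_id.mul h1).sub continuousWithinAt_id

lemma lgSide_neg {ε : ℝ} (hε : ε = 1 ∨ ε = -1) {ρ : ℝ} (hρ : 0 < ρ) :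
    lgSide ε (-ρ) = Real.log ρ + ε * Real.pi * Complex.I := by
  rw [lgSide, show (-(ε * Complex.I) * -ρ : ℂ) = ρ * (ε * Complex.I) by ring]
  rcases hε with rfl | rfl
  · rw [Complex.log_ofReal_mul hρ (by simp)]
    simp only [Complex.ofReal_one, one_mul, Complex.log_I]; ring
  · rw [Complex.log_ofReal_mul hρ (by simp)]
    simp only [Complex.ofReal_neg, Complex.ofReal_one, neg_mul, one_mul, Complex.log_neg_I]; ring

lemma lgSide_pos {ε : ℝ} (hε : ε = 1 ∨ ε = -1) {ρ : ℝ} (hρ : 0 < ρ) :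
    lgSide ε ρ = Real.log ρ := by
  rw [lgSide_eq_log hε (by simp [hρ]) (by simp), Complex.ofReal_log hρ.le]

lemma gSide_sub_of_nonneg {ρ : ℝ} (hρ : 0 ≤ ρ) : gSide (-1) ρ - gSide 1 ρ = 0 := by
  rcases hρ.eq_or_lt with rfl | hρ
  · simp [gSide]
  · rw [gSide, gSide, lgSide_pos (Or.inl rfl) hρ, lgSide_pos (Or.inr rfl) hρ, sub_self]

lemma gSide_sub_of_neg {ρ : ℝ} (hρ : 0 < ρ) :
    gSide (-1) (-ρ) - gSide 1 (-ρ) = 2 * Real.pi * Complex.I * ρ := by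
  rw [gSide, gSide, lgSide_neg (Or.inl rfl) hρ, lgSide_neg (Or.inr rfl) hρ]
  push_cast
  ring

/-! ### The cut plane -/

lemma mem_cut {z : ℂ} : z ∈ cut ↔ ∃ r : ℝ, 0 ≤ r ∧ (r : ℂ) = z := by
  constructor
  · rintro ⟨h1, h2⟩
    exact ⟨z.re, h1, Complex.ext (by simp) (by simp [h2])⟩
  · rintro ⟨r, hr, rfl⟩
    exact ⟨by simpa using hr, by simp⟩

lemma isClosed_cut : IsClosed cut :=
  (isClosed_le continuous_const Complex.continuous_re).inter
    (isClosed_eq Complex.continuous_im continuous_const)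

lemma sub_mem_slitPlane {l : ℂ} (hl : l ∈ cutᶜ) {w : ℝ} (hw : 0 ≤ w) :
    (w : ℂ) - l ∈ Complex.slitPlane := by
  rw [Complex.mem_slitPlane_iff]
  by_contra h
  push Not at h
  refine hl ⟨?_, ?_⟩
  · have := h.1; simp at this; linarith
  · have := h.2; simpa using this

lemma exists_dist_cut {l : ℂ} (hl : l ∈ cutᶜ) :
    ∃ δ > 0, ∀ l', ‖l' - l‖ ≤ δ → ∀ w : ℝ, 0 ≤ w → δ ≤ ‖(w : ℂ) - l'‖ := by
  obtain ⟨ε, hε, hb⟩ := Metric.isOpen_iff.mp isClosed_cut.isOpen_compl l hl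
  refine ⟨ε / 2, by positivity, fun l' h w hw => ?_⟩
  by_contra! h2
  refine hb (a := (w : ℂ)) ?_ (mem_cut.mpr ⟨w, hw, rfl⟩)
  rw [Metric.mem_ball, dist_eq_norm]
  calc ‖(w : ℂ) - l‖ = ‖((w : ℂ) - l') + (l' - l)‖ := by ring_nf
    _ ≤ _ := norm_add_le _ _
    _ < ε := by linarith

lemma mem_compl_cut_of_im {l : ℂ} (h : l.im ≠ 0) : l ∈ cutᶜ := fun h' => h h'.2

lemma exists_side (l : ℂ) : ∃ ε : ℝ, (ε = 1 ∨ ε = -1) ∧ ε * l.im ≤ 0 := by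
  rcases le_total l.im 0 with h | h
  · exact ⟨1, Or.inl rfl, by linarith⟩
  · exact ⟨-1, Or.inr rfl, by linarith⟩

/-! ### Cauchy transforms on the half line -/

/-- The Cauchy transform on the half line. -/
def cauchy (f : ℝ → ℂ) (l : ℂ) : ℂ := ∫ w in Ioi (0 : ℝ), f w / (w - l)

/-- A `C²` function decaying with its derivatives on the half line. -/
structure Decay (N : ℕ) (f f' f'' : ℝ → ℂ) (B : ℝ) : Prop where
  deriv : ∀ w, HasDerivAt f (f' w) w
  deriv₂ : ∀ w, HasDerivAt f' (f'' w) w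
  cont : Continuous f''
  bound : ∀ w, 0 ≤ w → ‖f w‖ ≤ B * ((1 + w) ^ N)⁻¹
  bound₁ : ∀ w, 0 ≤ w → ‖f' w‖ ≤ B * ((1 + w) ^ N)⁻¹
  bound₂ : ∀ w, 0 ≤ w → ‖f'' w‖ ≤ B * ((1 + w) ^ N)⁻¹

/-- The continuation of the Cauchy transform to the closed half plane `ε Im l ≤ 0`. -/
def cauchySide (ε : ℝ) (f f' f'' : ℝ → ℂ) (l : ℂ) : ℂ :=
  -(f 0 * lgSide ε (-l)) + f' 0 * gSide ε (-l) + ∫ w in Ioi (0 : ℝ), f'' w * gSide ε (w - l)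

/-- `∫₀^∞ (1 + w)⁻² dw`. -/
def invSqInt : ℝ := ∫ w in Ioi (0 : ℝ), ((1 + w) ^ 2)⁻¹

lemma invSqInt_nonneg : 0 ≤ invSqInt :=
  setIntegral_nonneg measurableSet_Ioi fun w _ => by positivity

lemma integrable_of_norm_le {f : ℝ → ℂ} {B : ℝ} (hf : AEStronglyMeasurable f halfLine)
    (h : ∀ w, 0 < w → ‖f w‖ ≤ B * ((1 + w) ^ 2)⁻¹) : Integrable f halfLine :=
  (integrable_one_add_inv_sq.const_mul B).mono' hf (ae_halfLine h)

lemma norm_integral_le_invSqInt {f : ℝ → ℂ} {B : ℝ}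
    (h : ∀ w, 0 < w → ‖f w‖ ≤ B * ((1 + w) ^ 2)⁻¹) :
    ‖∫ w in Ioi (0 : ℝ), f w‖ ≤ B * invSqInt := by
  rw [invSqInt, ← integral_const_mul]
  exact norm_integral_le_of_norm_le (integrable_one_add_inv_sq.const_mul B) (ae_halfLine h)

lemma one_add_inv_pow_le {w : ℝ} (hw : 0 ≤ w) {M N : ℕ} (h : M ≤ N) :
    ((1 + w) ^ N)⁻¹ ≤ ((1 + w) ^ M)⁻¹ :=
  inv_anti₀ (by positivity) (pow_le_pow_right₀ (by linarith) h)

lemma one_add_norm_sub_le {w : ℝ} (hw : 0 ≤ w) (l : ℂ) :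
    1 + ‖(w : ℂ) - l‖ ≤ (1 + w) * (1 + ‖l‖) := by
  have := norm_sub_le (w : ℂ) l
  rw [Complex.norm_real, Real.norm_of_nonneg hw] at this
  nlinarith [norm_nonneg l, mul_nonneg hw (norm_nonneg l)]

section Decay

variable {N : ℕ} {f f' f'' : ℝ → ℂ} {B : ℝ}

lemma Decay.nonneg (h : Decay N f f' f'' B) : 0 ≤ B := by
  have := (norm_nonneg _).trans (h.bound 0 le_rfl)
  simpa using this

lemma Decay.continuous (h : Decay N f f' f'' B) : Continuous f :=
  continuous_iff_continuousAt.mpr fun w => (h.deriv w).continuousAt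

lemma Decay.continuous₁ (h : Decay N f f' f'' B) : Continuous f' :=
  continuous_iff_continuousAt.mpr fun w => (h.deriv₂ w).continuousAt

lemma norm_mul_gSide_le (h : Decay 4 f f' f'' B) {ε : ℝ} (hε : ε = 1 ∨ ε = -1) (l : ℂ) {w : ℝ}
    (hw : 0 ≤ w) : ‖f'' w * gSide ε (w - l)‖ ≤ 11 * B * (1 + ‖l‖) ^ 2 * ((1 + w) ^ 2)⁻¹ := by
  have hB := h.nonneg
  rw [norm_mul]
  have hw1 : (1 + w) ^ 2 ≠ 0 := by positivity
  calc _ ≤ (B * ((1 + w) ^ 4)⁻¹) * (11 * ((1 + w) * (1 + ‖l‖)) ^ 2) := by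
        gcongr
        · exact h.bound₂ w hw
        · refine (norm_gSide_le hε _).trans ?_
          gcongr
          exact one_add_norm_sub_le hw l
    _ = 11 * B * (1 + ‖l‖) ^ 2 * ((1 + w) ^ 2)⁻¹ * ((1 + w) ^ 2 * ((1 + w) ^ 2)⁻¹) := by
        rw [show (1 + w) ^ 4 = (1 + w) ^ 2 * (1 + w) ^ 2 by ring, mul_inv]; ring
    _ = _ := by rw [mul_inv_cancel₀ hw1, mul_one]

lemma aestronglyMeasurable_mul_gSide (h : Decay N f f' f'' B) (ε : ℝ) (l : ℂ) :
    AEStronglyMeasurable (fun w : ℝ => f'' w * gSide ε (w - l)) halfLine :=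
  (h.cont.measurable.mul ((measurable_gSide ε).comp
    (by fun_prop : Measurable fun w : ℝ => (w : ℂ) - l))).aestronglyMeasurable

lemma norm_div_sub_le {φ : ℝ → ℂ} {C : ℝ} (hC : 0 ≤ C) {δ : ℝ} (hδ : 0 < δ) {l : ℂ} {w : ℝ} (hw : 0 ≤ w)
    (hφ : ‖φ w‖ ≤ C * ((1 + w) ^ N)⁻¹) (hN : 2 ≤ N) (hl : δ ≤ ‖(w : ℂ) - l‖) :
    ‖φ w / (w - l)‖ ≤ C / δ * ((1 + w) ^ 2)⁻¹ := by
  rw [norm_div, div_mul_eq_mul_div]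
  gcongr
  exact hφ.trans (mul_le_mul_of_nonneg_left (one_add_inv_pow_le hw hN) hC)

lemma measurable_div_sub {φ : ℝ → ℂ} (hφ : Continuous φ) (l : ℂ) :
    AEStronglyMeasurable (fun w : ℝ => φ w / (w - l)) halfLine :=
  (hφ.measurable.div (by fun_prop)).aestronglyMeasurable

lemma integrable_div_sub {φ : ℝ → ℂ} (hc : Continuous φ) {C : ℝ} (hN : 2 ≤ N)
    (hφ : ∀ w, 0 ≤ w → ‖φ w‖ ≤ C * ((1 + w) ^ N)⁻¹) {l : ℂ} (hl : l ∈ cutᶜ) :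
    Integrable (fun w : ℝ => φ w / (w - l)) halfLine := by
  obtain ⟨δ, hδ, hd⟩ := exists_dist_cut hl
  have hC : 0 ≤ C := by simpa using (norm_nonneg _).trans (hφ 0 le_rfl)
  exact integrable_of_norm_le (measurable_div_sub hc l) fun w hw =>
    norm_div_sub_le hC hδ hw.le (hφ w hw.le) hN (hd l (by simpa using hδ.le) w hw.le)

lemma tendsto_one_add_pow_inv_two (c : ℝ) :
    Tendsto (fun w : ℝ => c * ((1 + w) ^ 2)⁻¹) atTop (𝓝 0) := by
  have h : Tendsto (fun w : ℝ => ((1 + w) ^ 2)⁻¹) atTop (𝓝 0) :=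
    tendsto_inv_atTop_zero.comp ((tendsto_pow_atTop two_ne_zero).comp
      (tendsto_atTop_add_const_left _ _ tendsto_id))
  simpa using h.const_mul c

/-- The Cauchy transform, integrated by parts twice. -/
lemma cauchy_eq_cauchySide (h : Decay 4 f f' f'' B) {ε : ℝ} (hε : ε = 1 ∨ ε = -1) {l : ℂ}
    (hl : l ∈ cutᶜ) (h0 : ε * l.im ≤ 0) : cauchy f l = cauchySide ε f f' f'' l := by
  have hB := h.nonneg
  obtain ⟨δ, hδ, hd⟩ := exists_dist_cut hl
  have hd' := hd l (by simpa using hδ.le)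
  have hlog : ∀ w : ℝ, 0 ≤ w → lgSide ε (w - l) = Complex.log (w - l) := fun w hw =>
    lgSide_eq_log hε (sub_mem_slitPlane hl hw) (by simp; linarith)
  -- Boundary terms of two integrations by parts: log(w - l) is an antiderivative of 1/(w - l), and
  -- `gSide` one of the logarithm.
  set H : ℝ → ℂ := fun w => f w * Complex.log (w - l) -
    f' w * ((w - l) * Complex.log (w - l) - (w - l)) with hH
  have hL : ∀ w : ℝ, 0 ≤ w → HasDerivAt (fun w : ℝ => Complex.log (w - l)) (1 / (w - l)) w := by
    intro w hw
    have h1 : HasDerivAt (fun w : ℝ => (w : ℂ) - l) 1 w :=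
      (Complex.ofRealCLM.hasDerivAt (x := w)).sub_const l
    exact h1.clog_real (sub_mem_slitPlane hl hw)
  have hderiv : ∀ w : ℝ, 0 ≤ w → HasDerivAt H (f w / (w - l) - f'' w * gSide ε (w - l)) w := by
    intro w hw
    have hne : (w : ℂ) - l ≠ 0 := Complex.slitPlane_ne_zero (sub_mem_slitPlane hl hw)
    have h1 : HasDerivAt (fun w : ℝ => (w : ℂ) - l) 1 w :=
      (Complex.ofRealCLM.hasDerivAt (x := w)).sub_const l
    have h2 := ((h.deriv w).mul (hL w hw)).sub
      ((h.deriv₂ w).mul ((h1.mul (hL w hw)).sub h1))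
    refine h2.congr_deriv ?_
    simp only [Pi.mul_apply, Pi.sub_apply]
    rw [gSide, hlog w hw]
    field_simp
    ring
  have hi1 : Integrable (fun w : ℝ => f w / (w - l)) halfLine :=
    integrable_div_sub h.continuous (by norm_num) h.bound hl
  have hi2 : Integrable (fun w : ℝ => f'' w * gSide ε (w - l)) halfLine :=
    integrable_of_norm_le (aestronglyMeasurable_mul_gSide h ε l) fun w hw =>
      norm_mul_gSide_le h hε l hw.le
  have hlim : Tendsto H atTop (𝓝 0) := by
    refine squeeze_zero_norm' ((eventually_ge_atTop 0).mono fun w hw => ?_)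
      (tendsto_one_add_pow_inv_two (B * (1 + ‖l‖) ^ 2 * (10 / δ + 11)))
    have hw1 : (1 + w) ^ 2 ≠ 0 := by positivity
    have e1 : ‖Complex.log (w - l)‖ ≤ 10 * ((1 + w) * (1 + ‖l‖)) ^ 2 / δ := by
      rw [← hlog w hw]
      refine (norm_lgSide_le_div hε hδ (hd' w hw)).trans ?_
      gcongr
      exact one_add_norm_sub_le hw l
    have e2 : ‖(w - l) * Complex.log (w - l) - (w - l)‖ ≤ 11 * ((1 + w) * (1 + ‖l‖)) ^ 2 := by
      rw [← hlog w hw]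
      refine (norm_gSide_le hε _).trans ?_
      gcongr
      exact one_add_norm_sub_le hw l
    calc ‖H w‖ ≤ ‖f w‖ * ‖Complex.log (w - l)‖ +
          ‖f' w‖ * ‖(w - l) * Complex.log (w - l) - (w - l)‖ := by
          refine (norm_sub_le _ _).trans ?_
          rw [norm_mul, norm_mul]
      _ ≤ (B * ((1 + w) ^ 4)⁻¹) * (10 * ((1 + w) * (1 + ‖l‖)) ^ 2 / δ) +
          (B * ((1 + w) ^ 4)⁻¹) * (11 * ((1 + w) * (1 + ‖l‖)) ^ 2) := by
          gcongr
          · exact h.bound w hw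
          · exact h.bound₁ w hw
      _ = B * (1 + ‖l‖) ^ 2 * (10 / δ + 11) * ((1 + w) ^ 2)⁻¹ * ((1 + w) ^ 2 * ((1 + w) ^ 2)⁻¹) := by
          rw [show (1 + w) ^ 4 = (1 + w) ^ 2 * (1 + w) ^ 2 by ring, mul_inv]; ring
      _ = _ := by rw [mul_inv_cancel₀ hw1, mul_one]
  have key := integral_Ioi_of_hasDerivAt_of_tendsto (hderiv 0 le_rfl).continuousAt.continuousWithinAt
    (fun w (hw : w ∈ Ioi (0 : ℝ)) => hderiv w (le_of_lt hw)) (hi1.sub hi2) hlim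
  have hl0 := hlog 0 le_rfl
  rw [integral_sub hi1 hi2, sub_eq_iff_eq_add] at key
  rw [cauchy, key, cauchySide]
  simp only [hH, Complex.ofReal_zero, zero_sub] at hl0 ⊢
  rw [gSide, hl0]
  ring

/-- After the integrations by parts f'' is integrated against a function continuous up to the
contour, with locally uniform domination, so no principal value is needed. The origin is excluded
because of the term f(0) log(-l). -/
lemma continuousOn_cauchySide (h : Decay 4 f f' f'' B) {ε : ℝ} (hε : ε = 1 ∨ ε = -1) :
    ContinuousOn (cauchySide ε f f' f'') {l | l ≠ 0 ∧ ε * l.im ≤ 0} := by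
  have hneg : ContinuousOn (fun l : ℂ => -l) {l | l ≠ 0 ∧ ε * l.im ≤ 0} := by fun_prop
  refine ContinuousOn.add (ContinuousOn.add ?_ ?_) ?_
  · refine (continuousOn_const.mul ((continuousOn_lgSide hε).comp hneg fun l hl => ?_)).neg
    exact ⟨neg_ne_zero.mpr hl.1, by simpa using hl.2⟩
  · refine continuousOn_const.mul ((continuousOn_gSide hε).comp hneg fun l hl => ?_)
    simpa using hl.2
  · intro l₀ hl₀
    refine continuousWithinAt_of_dominated
      (bound := fun w => 11 * B * (1 + (‖l₀‖ + 1)) ^ 2 * ((1 + w) ^ 2)⁻¹)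
      (Eventually.of_forall fun l => aestronglyMeasurable_mul_gSide h ε l) ?_
      (integrable_one_add_inv_sq.const_mul _) ?_
    · filter_upwards [mem_nhdsWithin_of_mem_nhds (Metric.ball_mem_nhds l₀ one_pos)] with l hl
      refine ae_halfLine fun w hw => (norm_mul_gSide_le h hε l hw.le).trans ?_
      have hB := h.nonneg
      have : ‖l‖ ≤ ‖l₀‖ + 1 := by
        rw [Metric.mem_ball, dist_eq_norm] at hl
        have := norm_sub_norm_le l l₀
        linarith
      gcongr
    · refine ae_halfLine fun w hw => continuousWithinAt_const.mul ?_
      have hmem : ∀ l ∈ {l : ℂ | l ≠ 0 ∧ ε * l.im ≤ 0}, (w : ℂ) - l ∈ {ζ : ℂ | 0 ≤ ε * ζ.im} := by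
        intro l hl
        have := hl.2
        simpa using this
      have h1 : ContinuousOn (fun l : ℂ => (w : ℂ) - l) {l : ℂ | l ≠ 0 ∧ ε * l.im ≤ 0} := by
        fun_prop
      exact (continuousOn_gSide hε).comp h1 hmem l₀ hl₀

/-- The Plemelj formula. -/
lemma cauchySide_sub (h : Decay 4 f f' f'' B) {z : ℝ} (hz : 0 < z) :
    cauchySide (-1) f f' f'' z - cauchySide 1 f f' f'' z = 2 * Real.pi * Complex.I * f z := by
  have hi : ∀ {ε : ℝ}, ε = 1 ∨ ε = -1 →
      Integrable (fun w : ℝ => f'' w * gSide ε (w - z)) halfLine := fun {ε} hε =>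
    integrable_of_norm_le (aestronglyMeasurable_mul_gSide h ε z) fun w hw =>
      norm_mul_gSide_le h hε z hw.le
  -- The jump of `gSide` lives on w < z, where it equals 2πi(z - w). The integral of f''(w)(z - w)
  -- over (0, z) is the Taylor remainder f(z) - f(0) - z f'(0), and the explicit terms of
  -- `cauchySide` restore the Taylor polynomial.
  have h1 : (∫ w in Ioi (0 : ℝ), f'' w * gSide (-1) (w - z)) -
      ∫ w in Ioi (0 : ℝ), f'' w * gSide 1 (w - z) =
      2 * Real.pi * Complex.I * ∫ w in (0 : ℝ)..z, f'' w * (z - w) := by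
    rw [← integral_sub (hi (Or.inr rfl)) (hi (Or.inl rfl)),
      intervalIntegral.integral_of_le hz.le, integral_Ioc_eq_integral_Ioo, ← integral_const_mul,
      ← integral_indicator measurableSet_Ioi, ← integral_indicator measurableSet_Ioo]
    refine integral_congr_ae (Eventually.of_forall fun w => ?_)
    by_cases hw : w ∈ Ioo 0 z
    · have hw0 : w ∈ Ioi (0 : ℝ) := hw.1
      simp only [indicator_of_mem hw, indicator_of_mem hw0]
      have := gSide_sub_of_neg (ρ := z - w) (by linarith [hw.2])
      rw [← mul_sub, show (w : ℂ) - z = -((z - w : ℝ) : ℂ) by push_cast; ring, this]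
      push_cast; ring
    · rw [indicator_of_notMem hw]
      by_cases hw0 : w ∈ Ioi (0 : ℝ)
      · have hw1 : z ≤ w := by by_contra! h'; exact hw ⟨hw0, h'⟩
        have := gSide_sub_of_nonneg (ρ := w - z) (by linarith)
        rw [indicator_of_mem hw0, ← mul_sub, ← Complex.ofReal_sub, this, mul_zero]
      · rw [indicator_of_notMem hw0]
  have h2 : ∫ w in (0 : ℝ)..z, f'' w * (z - w) = f z - f 0 - z * f' 0 := by
    have hd : ∀ w : ℝ, HasDerivAt (fun w : ℝ => f' w * (z - w) + f w) (f'' w * (z - w)) w := by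
      intro w
      have h3 : HasDerivAt (fun w : ℝ => (z : ℂ) - w) (-1) w :=
        (Complex.ofRealCLM.hasDerivAt (x := w)).const_sub (z : ℂ)
      refine (((h.deriv₂ w).mul h3).add (h.deriv w)).congr_deriv ?_
      ring
    rw [intervalIntegral.integral_eq_sub_of_hasDerivAt (fun w _ => hd w)]
    · simp only [Complex.ofReal_zero]; ring
    · exact (h.cont.mul (by fun_prop)).intervalIntegrable _ _
  have h3 := gSide_sub_of_neg hz
  have h4 : lgSide (-1) (-z) - lgSide 1 (-z) = -(2 * Real.pi * Complex.I) := by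
    rw [lgSide_neg (Or.inl rfl) hz, lgSide_neg (Or.inr rfl) hz]; push_cast; ring
  rw [h2] at h1
  rw [cauchySide, cauchySide]
  linear_combination h1 + f' 0 * h3 - f 0 * h4

lemma norm_cauchySide_add_le (h : Decay 4 f f' f'' B) {ε : ℝ} (hε : ε = 1 ∨ ε = -1) (l : ℂ) :
    ‖cauchySide ε f f' f'' l + f 0 * lgSide ε (-l)‖ ≤ 11 * (1 + invSqInt) * B * (1 + ‖l‖) ^ 2 := by
  have hB := h.nonneg
  have h1 : ‖∫ w in Ioi (0 : ℝ), f'' w * gSide ε (w - l)‖ ≤ 11 * B * (1 + ‖l‖) ^ 2 * invSqInt :=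
    norm_integral_le_invSqInt fun w hw => norm_mul_gSide_le h hε l hw.le
  have h2 : ‖f' 0 * gSide ε (-l)‖ ≤ B * (11 * (1 + ‖l‖) ^ 2) := by
    rw [norm_mul]
    gcongr
    · simpa using h.bound₁ 0 le_rfl
    · simpa using norm_gSide_le hε (-l)
  calc _ = ‖f' 0 * gSide ε (-l) + ∫ w in Ioi (0 : ℝ), f'' w * gSide ε (w - l)‖ := by
        rw [cauchySide]; congr 1; ring
    _ ≤ _ := norm_add_le _ _
    _ ≤ _ := add_le_add h2 h1
    _ = _ := by ring

lemma norm_cauchySide_le (h : Decay 4 f f' f'' B) {ε : ℝ} (hε : ε = 1 ∨ ε = -1) {r : ℝ} (hr : 0 < r)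
    {l : ℂ} (hl : r ≤ ‖l‖) :
    ‖cauchySide ε f f' f'' l‖ ≤ 11 * (1 + invSqInt + 1 / r) * B * (1 + ‖l‖) ^ 2 := by
  have hB := h.nonneg
  have h1 := norm_cauchySide_add_le h hε l
  have h2 : ‖f 0 * lgSide ε (-l)‖ ≤ B * (10 * (1 + ‖l‖) ^ 2 / r) := by
    rw [norm_mul]
    gcongr
    · simpa using h.bound 0 le_rfl
    · simpa using norm_lgSide_le_div hε hr (ζ := -l) (by simpa using hl)
  calc _ = ‖(cauchySide ε f f' f'' l + f 0 * lgSide ε (-l)) - f 0 * lgSide ε (-l)‖ := by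
        rw [add_sub_cancel_right]
    _ ≤ _ := norm_sub_le _ _
    _ ≤ 11 * (1 + invSqInt) * B * (1 + ‖l‖) ^ 2 + B * (11 * (1 + ‖l‖) ^ 2 / r) := by
        refine add_le_add h1 (h2.trans ?_)
        gcongr; norm_num
    _ = _ := by ring

lemma norm_cauchy_add_le (h : Decay 4 f f' f'' B) {l : ℂ} (hl : l ∈ cutᶜ) :
    ‖cauchy f l + f 0 * Complex.log (-l)‖ ≤ 11 * (1 + invSqInt) * B * (1 + ‖l‖) ^ 2 := by
  obtain ⟨ε, hε, h0⟩ := exists_side l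
  have h1 : (-l) ∈ Complex.slitPlane := by simpa using sub_mem_slitPlane hl (w := 0) le_rfl
  rw [cauchy_eq_cauchySide h hε hl h0, ← lgSide_eq_log hε h1 (by simpa using h0)]
  exact norm_cauchySide_add_le h hε l

/-- The decay of Cauchy transforms at infinity. -/
lemma norm_cauchy_le {r : ℝ} (hr : 0 < r) : ∃ c : ℝ, 0 ≤ c ∧ ∀ {f f' f'' : ℝ → ℂ} {B : ℝ},
    Decay 7 f f' f'' B → ∀ l ∈ cutᶜ, r ≤ ‖l‖ → ‖cauchy f l‖ ≤ c * B / (1 + ‖l‖) := by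
  set J := invSqInt
  have hJ : 0 ≤ J := invSqInt_nonneg
  set κ := 1 + 1 / r with hκ
  have hκ1 : 1 ≤ κ := by have : 0 < 1 / r := by positivity
                         linarith
  refine ⟨κ * J + κ ^ 2 * J + κ ^ 3 * J + κ ^ 3 * (11 * (1 + J + 1 / r) * 13), by positivity,
    fun {f f' f'' B} h l hl hlr => ?_⟩
  have hB := h.nonneg
  have hl0 : l ≠ 0 := by rintro rfl; simp at hlr; linarith
  have hln : 0 < ‖l‖ := norm_pos_iff.mpr hl0
  have hp : ∀ (m : ℕ), m ≤ 3 → ∀ {φ : ℝ → ℂ}, (∀ w, 0 ≤ w → ‖φ w‖ ≤ B * ((1 + w) ^ 7)⁻¹) → ∀ w : ℝ,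
      0 ≤ w → ‖(w : ℂ) ^ m * φ w‖ ≤ B * ((1 + w) ^ 4)⁻¹ := by
    intro m hm φ hφ w hw
    have hw1 : (1 + w) ^ 3 ≠ 0 := by positivity
    have e : (w : ℝ) ^ m ≤ (1 + w) ^ 3 :=
      (pow_le_pow_left₀ hw (by linarith) m).trans (pow_le_pow_right₀ (by linarith) hm)
    rw [norm_mul, norm_pow, Complex.norm_real, Real.norm_of_nonneg hw]
    calc _ ≤ (1 + w) ^ 3 * (B * ((1 + w) ^ 7)⁻¹) := by gcongr; exact hφ w hw
      _ = B * ((1 + w) ^ 4)⁻¹ * ((1 + w) ^ 3 * ((1 + w) ^ 3)⁻¹) := by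
          rw [show (1 + w) ^ 7 = (1 + w) ^ 3 * (1 + w) ^ 4 by ring, mul_inv]; ring
      _ = _ := by rw [mul_inv_cancel₀ hw1, mul_one]
  have hc := h.continuous
  -- Three powers of w are absorbed by the decay, 7 = 4 + 3; the constant 13 = 6 + 6 + 1 counts the
  -- terms in the second derivative of w³f.
  have hdec : Decay 4 (fun w : ℝ => (w : ℂ) ^ 3 * f w)
      (fun w : ℝ => 3 * ((w : ℂ) ^ 2 * f w) + (w : ℂ) ^ 3 * f' w)
      (fun w : ℝ => 6 * ((w : ℂ) ^ 1 * f w) + 6 * ((w : ℂ) ^ 2 * f' w) + (w : ℂ) ^ 3 * f'' w)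
      (13 * B) := by
    have hpow : ∀ (m : ℕ) (w : ℝ), HasDerivAt (fun w : ℝ => (w : ℂ) ^ (m + 1))
        ((m + 1) * (w : ℂ) ^ m) w := fun m w => by
      have h1 : HasDerivAt (fun w : ℝ => (w : ℂ)) 1 w := Complex.ofRealCLM.hasDerivAt (x := w)
      refine (h1.pow (m + 1)).congr_deriv ?_
      simp
    have hc1 := h.continuous₁
    have hc2 := h.cont
    have hbd : ∀ {a : ℝ} {w : ℝ}, 0 ≤ w → a ≤ 13 → a * (B * ((1 + w) ^ 4)⁻¹) ≤
        13 * B * ((1 + w) ^ 4)⁻¹ := fun {a w} hw ha => by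
      rw [mul_assoc]; gcongr
    refine ⟨fun w => ?_, fun w => ?_, by fun_prop, fun w hw => ?_, fun w hw => ?_, fun w hw => ?_⟩
    · refine ((hpow 2 w).mul (h.deriv w)).congr_deriv ?_
      push_cast; ring
    · refine ((((hpow 1 w).mul (h.deriv w)).const_mul 3).add
        ((hpow 2 w).mul (h.deriv₂ w))).congr_deriv ?_
      push_cast; ring
    · have := hp 3 le_rfl h.bound w hw
      refine this.trans ((one_mul _).symm.le.trans (hbd hw (by norm_num)))
    · refine (norm_add_le _ _).trans ?_
      rw [norm_mul, RCLike.norm_ofNat]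
      have h1 := hp 2 (by norm_num) h.bound w hw
      have h2 := hp 3 le_rfl h.bound₁ w hw
      refine le_trans ?_ (hbd (a := 4) hw (by norm_num))
      linarith
    · refine (norm_add₃_le).trans ?_
      rw [norm_mul 6 ((w : ℂ) ^ 1 * f w), norm_mul 6 ((w : ℂ) ^ 2 * f' w), RCLike.norm_ofNat]
      have h1 := hp 1 (by norm_num) h.bound w hw
      have h2 := hp 2 (by norm_num) h.bound₁ w hw
      have h3 := hp 3 le_rfl h.bound₂ w hw
      refine le_trans ?_ (hbd (a := 13) hw le_rfl)
      linarith
  have hint : ∀ m : ℕ, m ≤ 3 → Integrable (fun w : ℝ => (w : ℂ) ^ m * f w) halfLine := fun m hm =>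
    integrable_of_norm_le (B := B) (by fun_prop) fun w hw => (hp m hm h.bound w hw.le).trans
      (mul_le_mul_of_nonneg_left (one_add_inv_pow_le hw.le (by norm_num)) hB)
  have hmom : ∀ m : ℕ, m ≤ 3 → ‖∫ w in Ioi (0 : ℝ), (w : ℂ) ^ m * f w‖ ≤ B * J := fun m hm =>
    norm_integral_le_invSqInt fun w hw => (hp m hm h.bound w hw.le).trans
      (mul_le_mul_of_nonneg_left (one_add_inv_pow_le hw.le (by norm_num)) hB)
  -- Expansion of 1/(w - l) in powers of 1/l with remainder of third order. The Cauchy transform of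
  -- w³f grows at most like (1 + ‖l‖)², so the remainder is still O(1/‖l‖).
  have hexp : cauchy f l = -(l⁻¹ * ∫ w in Ioi (0 : ℝ), (w : ℂ) ^ 0 * f w) -
      l⁻¹ ^ 2 * (∫ w in Ioi (0 : ℝ), (w : ℂ) ^ 1 * f w) -
      l⁻¹ ^ 3 * (∫ w in Ioi (0 : ℝ), (w : ℂ) ^ 2 * f w) +
      l⁻¹ ^ 3 * cauchy (fun w : ℝ => (w : ℂ) ^ 3 * f w) l := by
    have hi4 : Integrable (fun w : ℝ => (w : ℂ) ^ 3 * f w / (w - l)) halfLine :=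
      integrable_div_sub hdec.continuous (by norm_num) hdec.bound hl
    rw [cauchy, cauchy, ← integral_const_mul, ← integral_const_mul, ← integral_const_mul,
      ← integral_const_mul, ← integral_neg, ← integral_sub, ← integral_sub, ← integral_add]
    · refine integral_congr_ae (ae_halfLine fun w hw => ?_)
      have hne : (w : ℂ) - l ≠ 0 := Complex.slitPlane_ne_zero (sub_mem_slitPlane hl hw.le)
      simp only
      field_simp
      ring
    · exact ((((hint 0 (by norm_num)).const_mul _).neg).sub ((hint 1 (by norm_num)).const_mul _)).sub
        ((hint 2 (by norm_num)).const_mul _)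
    · exact hi4.const_mul _
    · exact (((hint 0 (by norm_num)).const_mul _).neg).sub ((hint 1 (by norm_num)).const_mul _)
    · exact (hint 2 (by norm_num)).const_mul _
    · exact ((hint 0 (by norm_num)).const_mul _).neg
    · exact (hint 1 (by norm_num)).const_mul _
  have h3 : ‖cauchy (fun w : ℝ => (w : ℂ) ^ 3 * f w) l‖ ≤
      11 * (1 + J + 1 / r) * (13 * B) * (1 + ‖l‖) ^ 2 := by
    obtain ⟨ε, hε, h0⟩ := exists_side l
    rw [cauchy_eq_cauchySide hdec hε hl h0]
    exact norm_cauchySide_le hdec hε hr hlr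
  have hinv : ‖l‖⁻¹ ≤ κ / (1 + ‖l‖) := by
    rw [inv_eq_one_div, div_le_div_iff₀ hln (by positivity), hκ, one_mul, add_mul, one_mul]
    have : 1 ≤ 1 / r * ‖l‖ := by rw [one_div, ← div_eq_inv_mul, one_le_div hr]; exact hlr
    linarith
  set L := 1 + ‖l‖ with hL
  have hL1 : 1 ≤ L := by linarith
  rw [hexp]
  calc _ ≤ ‖l‖⁻¹ * (B * J) + ‖l‖⁻¹ ^ 2 * (B * J) + ‖l‖⁻¹ ^ 3 * (B * J) +
        ‖l‖⁻¹ ^ 3 * (11 * (1 + J + 1 / r) * (13 * B) * L ^ 2) := by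
        refine (norm_add_le _ _).trans (add_le_add ((norm_sub_le _ _).trans
          (add_le_add ((norm_sub_le _ _).trans (add_le_add ?_ ?_)) ?_)) ?_)
        · rw [norm_neg, norm_mul, norm_inv]; gcongr; exact hmom 0 (by norm_num)
        · rw [norm_mul, norm_pow, norm_inv]; gcongr; exact hmom 1 (by norm_num)
        · rw [norm_mul, norm_pow, norm_inv]; gcongr; exact hmom 2 (by norm_num)
        · rw [norm_mul, norm_pow, norm_inv]; gcongr
    _ ≤ (κ / L) * (B * J) + (κ / L) ^ 2 * (B * J) + (κ / L) ^ 3 * (B * J) +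
        (κ / L) ^ 3 * (11 * (1 + J + 1 / r) * (13 * B) * L ^ 2) := by gcongr
    _ ≤ (κ / L) * (B * J) + (κ ^ 2 / L) * (B * J) + (κ ^ 3 / L) * (B * J) +
        (κ ^ 3 / L) * (11 * (1 + J + 1 / r) * (13 * B)) := by
        have e2 : (κ / L) ^ 2 ≤ κ ^ 2 / L := by
          rw [div_pow]; gcongr; exact le_self_pow₀ hL1 (by norm_num)
        have e3 : (κ / L) ^ 3 ≤ κ ^ 3 / L := by
          rw [div_pow]; gcongr; exact le_self_pow₀ hL1 (by norm_num)
        have e4 : (κ / L) ^ 3 * (11 * (1 + J + 1 / r) * (13 * B) * L ^ 2) =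
            (κ ^ 3 / L) * (11 * (1 + J + 1 / r) * (13 * B)) := by field_simp
        rw [e4]
        gcongr
    _ = _ := by ring

/-- The derivative of a Cauchy transform. -/
lemma hasDerivAt_cauchy {f f' : ℝ → ℂ} {B : ℝ} (hd : ∀ w, HasDerivAt f (f' w) w) (hc' : Continuous f')
    (hN : 2 ≤ N)
    (hb : ∀ w, 0 ≤ w → ‖f w‖ ≤ B * ((1 + w) ^ N)⁻¹) (hb' : ∀ w, 0 ≤ w → ‖f' w‖ ≤ B * ((1 + w) ^ N)⁻¹)
    {l : ℂ} (hl : l ∈ cutᶜ) : HasDerivAt (cauchy f) (-(f 0 / l) + cauchy f' l) l := by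
  obtain ⟨δ, hδ, hdist⟩ := exists_dist_cut hl
  have hB : 0 ≤ B := by simpa using (norm_nonneg _).trans (hb 0 le_rfl)
  have hc : Continuous f := continuous_iff_continuousAt.mpr fun w => (hd w).continuousAt
  have hne : ∀ w : ℝ, 0 ≤ w → (w : ℂ) - l ≠ 0 := fun w hw =>
    Complex.slitPlane_ne_zero (sub_mem_slitPlane hl hw)
  have h1 := hasDerivAt_integral_of_dominated_loc_of_deriv_le (μ := halfLine)
    (s := Metric.ball l δ) (F := fun l (w : ℝ) => f w / (w - l))
    (F' := fun l (w : ℝ) => f w / (w - l) ^ 2) (x₀ := l)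
    (bound := fun w => B / δ ^ 2 * ((1 + w) ^ 2)⁻¹) (Metric.ball_mem_nhds l hδ)
    (Eventually.of_forall fun l => measurable_div_sub hc l) (integrable_div_sub hc hN hb hl)
    (hc.measurable.div (by fun_prop)).aestronglyMeasurable
    (ae_halfLine fun w hw l' hl' => ?_) (integrable_one_add_inv_sq.const_mul _)
    (ae_halfLine fun w hw l' hl' => ?_)
  · refine h1.2.congr_deriv ?_
    have hi : Integrable (fun w : ℝ => f w / ((w : ℂ) - l) ^ 2) halfLine := h1.1
    have hi' := integrable_div_sub hc' hN hb' hl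
    -- Integration by parts moves the derivative in l to f and leaves a boundary term at w = 0.
    have hder : ∀ w : ℝ, 0 ≤ w → HasDerivAt (fun w : ℝ => f w / ((w : ℂ) - l))
        (f' w / (w - l) - f w / (w - l) ^ 2) w := by
      intro w hw
      have h2 : HasDerivAt (fun w : ℝ => (w : ℂ) - l) 1 w :=
        (Complex.ofRealCLM.hasDerivAt (x := w)).sub_const l
      refine ((hd w).div h2 (hne w hw)).congr_deriv ?_
      have := hne w hw
      field_simp
    have hlim : Tendsto (fun w : ℝ => f w / ((w : ℂ) - l)) atTop (𝓝 0) := by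
      refine squeeze_zero_norm' ((eventually_ge_atTop 0).mono fun w hw => ?_)
        (tendsto_one_add_pow_inv_two (B / δ))
      exact norm_div_sub_le hB hδ hw (hb w hw) hN (hdist l (by simpa using hδ.le) w hw)
    have key := integral_Ioi_of_hasDerivAt_of_tendsto (hder 0 le_rfl).continuousAt.continuousWithinAt
      (fun w (hw : w ∈ Ioi (0 : ℝ)) => hder w (le_of_lt hw)) (hi'.sub hi) hlim
    rw [integral_sub hi' hi] at key
    simp only [Complex.ofReal_zero, zero_sub, div_neg, neg_neg] at key
    rw [cauchy, ← key]
    ring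
  · rw [norm_div, norm_pow, div_mul_eq_mul_div]
    gcongr
    · exact (hb w hw.le).trans (mul_le_mul_of_nonneg_left (one_add_inv_pow_le hw.le hN) hB)
    · exact hdist l' (by rw [Metric.mem_ball, dist_eq_norm] at hl'; exact hl'.le) w hw.le
  · have hne' : (w : ℂ) - l' ≠ 0 := by
      have := hdist l' (by rw [Metric.mem_ball, dist_eq_norm] at hl'; exact hl'.le) w hw.le
      exact norm_pos_iff.mp (hδ.trans_le this)
    have h2 : HasDerivAt (fun l : ℂ => (w : ℂ) - l) (-1) l' := (hasDerivAt_id l').const_sub _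
    refine ((hasDerivAt_const l' (f w)).div h2 hne').congr_deriv ?_
    simp

end Decay

end AiryLax
end

noncomputable section
namespace AiryLax

/-! ### Families of decaying functions -/

/-- Successive derivatives `p 0, p 1, …` in the first variable, decaying on the half line, with
polynomial growth in the second variable. -/
structure DecayFamily (p : ℕ → ℝ → ℝ → ℂ) : Prop where
  deriv : ∀ n x w, HasDerivAt (fun w => p n w x) (p (n + 1) w x) w
  cont : ∀ n, Continuous fun q : ℝ × ℝ => p n q.1 q.2
  bound : ∀ n N, ∃ (C : ℝ) (a : ℕ), 0 ≤ C ∧ ∀ x w, 0 ≤ w →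
    ‖p n w x‖ ≤ C * (1 + |x|) ^ a * ((1 + w) ^ N)⁻¹

/-- The family of derivatives of the solution of `(1 - K) f = Ai⁽ᵈ⁾(·+s+x)`. -/
def resFam (σ : Measure ℝ) (s : ℝ) (d n : ℕ) (w x : ℝ) : ℂ := resFun σ n d s w x

/-- The family of derivatives of `Ai⁽ᵈ⁾(·+s+x)`. -/
def airyFam (s : ℝ) (d n : ℕ) (w x : ℝ) : ℂ := airyD (d + n) (w + (s + x : ℝ))

lemma decayFamily_resFam {σ : Measure ℝ} [IsProbabilityMeasure σ] (hσ : FiniteMoments σ) (s : ℝ)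
    (d : ℕ) : DecayFamily (resFam σ s d) :=
  ⟨fun n x w => hasDerivAt_resFun_ofReal hσ n d s x w, fun n => continuous_resFun hσ n d s,
    fun n N => norm_resFun_le hσ n d N s⟩

lemma decayFamily_airyFam (s : ℝ) (d : ℕ) : DecayFamily (airyFam s d) := by
  refine ⟨fun n x w => ?_, fun n => ?_, fun n N => ?_⟩
  · have h := hasDerivAt_airyD_ofReal (d + n) ((s + x : ℝ) : ℂ) w
    simp only [airyFam]
    simp_rw [add_comm _ (((s + x : ℝ) : ℂ))]
    exact h
  · exact (continuous_airyD (d + n)).comp (by fun_prop)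
  · obtain ⟨C, a, hC, hb⟩ := norm_airyD_shift_le (d + n) N
    refine ⟨C * (1 + |s|) ^ a, a, by positivity, fun x w hw => (hb (s + x) w hw).trans ?_⟩
    rw [div_eq_mul_inv, mul_assoc C ((1 + |s|) ^ a)]
    exact mul_le_mul_of_nonneg_right
      (mul_le_mul_of_nonneg_left (one_add_abs_add_le' s x a) hC) (by positivity)

section Family

variable {p q : ℕ → ℝ → ℝ → ℂ}

lemma DecayFamily.tail (hp : DecayFamily p) : DecayFamily fun n => p (n + 1) :=
  ⟨fun n => hp.deriv (n + 1), fun n => hp.cont (n + 1), fun n => hp.bound (n + 1)⟩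

lemma DecayFamily.continuous_left (hp : DecayFamily p) (n : ℕ) (x : ℝ) :
    Continuous fun w => p n w x := by
  have h := hp.cont n
  generalize p n = f at h ⊢
  exact h.comp (by fun_prop : Continuous fun w : ℝ => (w, x))

lemma DecayFamily.continuous_right (hp : DecayFamily p) (n : ℕ) (w : ℝ) :
    Continuous fun x => p n w x := by
  have h := hp.cont n
  generalize p n = f at h ⊢
  exact h.comp (by fun_prop : Continuous fun x : ℝ => (w, x))

lemma DecayFamily.bounds (hp : DecayFamily p) (N M : ℕ) : ∃ (C : ℝ) (a : ℕ), 0 ≤ C ∧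
    ∀ n < M, ∀ x w, 0 ≤ w → ‖p n w x‖ ≤ C * (1 + |x|) ^ a * ((1 + w) ^ N)⁻¹ := by
  induction M with
  | zero => exact ⟨0, 0, le_rfl, fun n hn => absurd hn (Nat.not_lt_zero n)⟩
  | succ M ih =>
    obtain ⟨C, a, hC, hb⟩ := ih
    obtain ⟨C', a', hC', hb'⟩ := hp.bound M N
    refine ⟨C + C', a + a', by positivity, fun n hn x w hw => ?_⟩
    rcases Nat.lt_succ_iff_lt_or_eq.mp hn with h | rfl
    · refine (hb n h x w hw).trans ?_
      gcongr
      · linarith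
      · linarith [abs_nonneg x]
      · omega
    · refine (hb' x w hw).trans ?_
      gcongr
      · linarith
      · linarith [abs_nonneg x]
      · omega

/-- The derivatives of a product, up to order two. -/
def prodFam (p q : ℕ → ℝ → ℝ → ℂ) (x y : ℝ) : Fin 3 → ℝ → ℂ :=
  ![fun w => p 0 w x * q 0 w y, fun w => p 1 w x * q 0 w y + p 0 w x * q 1 w y,
    fun w => p 2 w x * q 0 w y + 2 * (p 1 w x * q 1 w y) + p 0 w x * q 2 w y]

/-- Decay is taken from p alone, while q is merely bounded in w; the factor 4 = 1 + 2 + 1 counts the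
terms of the second derivative of a product. -/
lemma DecayFamily.decay (hp : DecayFamily p) (hq : DecayFamily q) (N : ℕ) : ∃ (C : ℝ) (a : ℕ),
    0 ≤ C ∧ ∀ x y, Decay N (prodFam p q x y 0) (prodFam p q x y 1) (prodFam p q x y 2)
      (C * (1 + |x|) ^ a * (1 + |y|) ^ a) := by
  obtain ⟨C, a, hC, hb⟩ := hp.bounds N 3
  obtain ⟨C', a', hC', hb'⟩ := hq.bounds 0 3
  refine ⟨4 * (C * C'), a + a', by positivity, fun x y => ?_⟩
  have hprod : ∀ i < 3, ∀ j < 3, ∀ w, 0 ≤ w → ‖p i w x * q j w y‖ ≤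
      C * C' * (1 + |x|) ^ (a + a') * (1 + |y|) ^ (a + a') * ((1 + w) ^ N)⁻¹ := by
    intro i hi j hj w hw
    have h1 := hb i hi x w hw
    have h2 := hb' j hj y w hw
    rw [pow_zero, inv_one, mul_one] at h2
    rw [norm_mul]
    calc _ ≤ (C * (1 + |x|) ^ a * ((1 + w) ^ N)⁻¹) * (C' * (1 + |y|) ^ a') := by gcongr
      _ ≤ (C * (1 + |x|) ^ (a + a') * ((1 + w) ^ N)⁻¹) * (C' * (1 + |y|) ^ (a + a')) := by
        gcongr
        · linarith [abs_nonneg x]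
        · omega
        · linarith [abs_nonneg y]
        · omega
      _ = _ := by ring
  have hc := fun n => hp.continuous_left n x
  have hc' := fun n => hq.continuous_left n y
  have hd := fun n => hp.deriv n x
  have hd' := fun n => hq.deriv n y
  refine ⟨fun w => ?_, fun w => ?_, ?_, fun w hw => ?_, fun w hw => ?_, fun w hw => ?_⟩
  · exact (hd 0 w).mul (hd' 0 w)
  · refine (((hd 1 w).mul (hd' 0 w)).add ((hd 0 w).mul (hd' 1 w))).congr_deriv ?_
    change _ = p 2 w x * q 0 w y + 2 * (p 1 w x * q 1 w y) + p 0 w x * q 2 w y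
    ring
  · exact ((((hc 2).mul (hc' 0)).add (((hc 1).mul (hc' 1)).const_mul 2)).add ((hc 0).mul (hc' 2)))
  · have h := hprod 0 (by norm_num) 0 (by norm_num) w hw
    change ‖p 0 w x * q 0 w y‖ ≤ _
    have := norm_nonneg (p 0 w x * q 0 w y)
    linarith
  · have h := hprod 1 (by norm_num) 0 (by norm_num) w hw
    have h' := hprod 0 (by norm_num) 1 (by norm_num) w hw
    change ‖p 1 w x * q 0 w y + p 0 w x * q 1 w y‖ ≤ _
    have := norm_nonneg (p 1 w x * q 0 w y)
    refine (norm_add_le _ _).trans ?_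
    linarith
  · have h := hprod 2 (by norm_num) 0 (by norm_num) w hw
    have h' := hprod 1 (by norm_num) 1 (by norm_num) w hw
    have h'' := hprod 0 (by norm_num) 2 (by norm_num) w hw
    change ‖p 2 w x * q 0 w y + 2 * (p 1 w x * q 1 w y) + p 0 w x * q 2 w y‖ ≤ _
    refine norm_add₃_le.trans ?_
    rw [norm_mul 2, RCLike.norm_ofNat]
    linarith

/-- The kernel `∫₀^∞ p(w|x) q(w|y) dw / (w - l)`. -/
def cKer (p q : ℕ → ℝ → ℝ → ℂ) (l : ℂ) (x y : ℝ) : ℂ := cauchy (prodFam p q x y 0) l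

/-- The continuation of `cKer` to the closed half plane `ε Im l ≤ 0`. -/
def cKerSide (p q : ℕ → ℝ → ℝ → ℂ) (ε : ℝ) (l : ℂ) (x y : ℝ) : ℂ :=
  cauchySide ε (prodFam p q x y 0) (prodFam p q x y 1) (prodFam p q x y 2) l

lemma cKer_eq_cKerSide (hp : DecayFamily p) (hq : DecayFamily q) {ε : ℝ} (hε : ε = 1 ∨ ε = -1)
    {l : ℂ} (hl : l ∈ cutᶜ) (h0 : ε * l.im ≤ 0) (x y : ℝ) :
    cKer p q l x y = cKerSide p q ε l x y := by
  obtain ⟨C, a, hC, hb⟩ := hp.decay hq 4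
  exact cauchy_eq_cauchySide (hb x y) hε hl h0

lemma continuousOn_cKerSide (hp : DecayFamily p) (hq : DecayFamily q) {ε : ℝ} (hε : ε = 1 ∨ ε = -1)
    (x y : ℝ) : ContinuousOn (fun l => cKerSide p q ε l x y) {l | l ≠ 0 ∧ ε * l.im ≤ 0} := by
  obtain ⟨C, a, hC, hb⟩ := hp.decay hq 4
  exact continuousOn_cauchySide (hb x y) hε

lemma cKerSide_sub (hp : DecayFamily p) (hq : DecayFamily q) {z : ℝ} (hz : 0 < z) (x y : ℝ) :
    cKerSide p q (-1) z x y - cKerSide p q 1 z x y = 2 * Real.pi * Complex.I * (p 0 z x * q 0 z y) := by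
  obtain ⟨C, a, hC, hb⟩ := hp.decay hq 4
  exact cauchySide_sub (hb x y) hz

lemma norm_cKer_le (hp : DecayFamily p) (hq : DecayFamily q) {r : ℝ} (hr : 0 < r) :
    ∃ (c : ℝ) (a : ℕ), 0 ≤ c ∧ ∀ l ∈ cutᶜ, r ≤ ‖l‖ → ∀ x y,
      ‖cKer p q l x y‖ ≤ c / (1 + ‖l‖) * (1 + |x|) ^ a * (1 + |y|) ^ a := by
  obtain ⟨C, a, hC, hb⟩ := hp.decay hq 7
  obtain ⟨c, hc, hb'⟩ := norm_cauchy_le hr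
  refine ⟨c * C, a, by positivity, fun l hl hlr x y => (hb' (hb x y) l hl hlr).trans (le_of_eq ?_)⟩
  ring

lemma norm_cKer_add_le (hp : DecayFamily p) (hq : DecayFamily q) :
    ∃ (c : ℝ) (a : ℕ), 0 ≤ c ∧ ∀ l ∈ cutᶜ, ‖l‖ < 1 → ∀ x y,
      ‖cKer p q l x y + p 0 0 x * q 0 0 y * Complex.log (-l)‖ ≤
        c * (1 + |x|) ^ a * (1 + |y|) ^ a := by
  obtain ⟨C, a, hC, hb⟩ := hp.decay hq 4
  have hJ := invSqInt_nonneg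
  refine ⟨11 * (1 + invSqInt) * C * 2 ^ 2, a, by positivity, fun l hl hlr x y =>
    (norm_cauchy_add_le (hb x y) hl).trans ?_⟩
  calc _ ≤ 11 * (1 + invSqInt) * (C * (1 + |x|) ^ a * (1 + |y|) ^ a) * 2 ^ 2 := by
        gcongr; linarith
    _ = _ := by ring

lemma norm_cKerSide_le (hp : DecayFamily p) (hq : DecayFamily q) {ε : ℝ} (hε : ε = 1 ∨ ε = -1)
    {l : ℂ} (hl : l ≠ 0) : ∃ (c : ℝ) (a : ℕ), 0 ≤ c ∧ ∀ x y,
      ‖cKerSide p q ε l x y‖ ≤ c * (1 + |x|) ^ a * (1 + |y|) ^ a := by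
  obtain ⟨C, a, hC, hb⟩ := hp.decay hq 4
  have hJ := invSqInt_nonneg
  refine ⟨11 * (1 + invSqInt + 1 / ‖l‖) * C * (1 + ‖l‖) ^ 2, a, by positivity, fun x y =>
    (norm_cauchySide_le (hb x y) hε (norm_pos_iff.mpr hl) le_rfl).trans (le_of_eq ?_)⟩
  ring

lemma continuous_prodFam (hp : DecayFamily p) (hq : DecayFamily q) (i : Fin 3) :
    Continuous fun t : (ℝ × ℝ) × ℝ => prodFam p q t.1.1 t.1.2 i t.2 := by
  have h1 : ∀ n, Continuous fun t : (ℝ × ℝ) × ℝ => p n t.2 t.1.1 := fun n => by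
    have h := hp.cont n
    generalize p n = f at h ⊢
    exact h.comp (by fun_prop : Continuous fun t : (ℝ × ℝ) × ℝ => (t.2, t.1.1))
  have h2 : ∀ n, Continuous fun t : (ℝ × ℝ) × ℝ => q n t.2 t.1.2 := fun n => by
    have h := hq.cont n
    generalize q n = f at h ⊢
    exact h.comp (by fun_prop : Continuous fun t : (ℝ × ℝ) × ℝ => (t.2, t.1.2))
  fin_cases i
  · exact (h1 0).mul (h2 0)
  · exact ((h1 1).mul (h2 0)).add ((h1 0).mul (h2 1))
  · exact (((h1 2).mul (h2 0)).add (((h1 1).mul (h2 1)).const_mul 2)).add ((h1 0).mul (h2 2))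

lemma measurable_cKer (hp : DecayFamily p) (hq : DecayFamily q) (l : ℂ) :
    Measurable fun t : ℝ × ℝ => cKer p q l t.1 t.2 := by
  have h : StronglyMeasurable fun t : (ℝ × ℝ) × ℝ => prodFam p q t.1.1 t.1.2 0 t.2 / (t.2 - l) :=
    ((continuous_prodFam hp hq 0).measurable.div (by fun_prop)).stronglyMeasurable
  exact (h.integral_prod_right (ν := halfLine)).measurable

lemma measurable_cKerSide (hp : DecayFamily p) (hq : DecayFamily q) (ε : ℝ) (l : ℂ) :
    Measurable fun t : ℝ × ℝ => cKerSide p q ε l t.1 t.2 := by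
  have h : StronglyMeasurable fun t : (ℝ × ℝ) × ℝ =>
      prodFam p q t.1.1 t.1.2 2 t.2 * gSide ε (t.2 - l) :=
    ((continuous_prodFam hp hq 2).measurable.mul
      ((measurable_gSide ε).comp (by fun_prop))).stronglyMeasurable
  have h0 : ∀ i, Measurable fun t : ℝ × ℝ => prodFam p q t.1 t.2 i 0 := fun i =>
    ((continuous_prodFam hp hq i).comp
      (by fun_prop : Continuous fun t : ℝ × ℝ => (t, (0 : ℝ)))).measurable
  exact (((h0 0).mul_const _).neg.add ((h0 1).mul_const _)).add
    (h.integral_prod_right (ν := halfLine)).measurable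

lemma integrable_cKer (hp : DecayFamily p) (hq : DecayFamily q) {l : ℂ} (hl : l ∈ cutᶜ) (x y : ℝ) :
    Integrable (fun w : ℝ => p 0 w x * q 0 w y / (w - l)) halfLine := by
  obtain ⟨C, a, hC, hb⟩ := hp.decay hq 4
  exact integrable_div_sub (hb x y).continuous (by norm_num) (hb x y).bound hl

lemma hasDerivAt_cKer (hp : DecayFamily p) (hq : DecayFamily q) {l : ℂ} (hl : l ∈ cutᶜ) (x y : ℝ) :
    HasDerivAt (fun l => cKer p q l x y) (-(p 0 0 x * q 0 0 y / l) +
      (cKer (fun n => p (n + 1)) q l x y + cKer p (fun n => q (n + 1)) l x y)) l := by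
  obtain ⟨C, a, hC, hb⟩ := hp.decay hq 4
  have h := hb x y
  refine (hasDerivAt_cauchy h.deriv h.continuous₁ (by norm_num) h.bound h.bound₁ hl).congr_deriv ?_
  congr 1
  simp only [cKer, cauchy]
  refine Eq.trans ?_
    (integral_add (integrable_cKer hp.tail hq hl x y) (integrable_cKer hp hq.tail hl x y))
  refine integral_congr_ae (Eventually.of_forall fun w => ?_)
  exact add_div _ _ _

lemma differentiableOn_cKer (hp : DecayFamily p) (hq : DecayFamily q) (x y : ℝ) :
    DifferentiableOn ℂ (fun l => cKer p q l x y) cutᶜ := fun _ hl =>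
  (hasDerivAt_cKer hp hq hl x y).differentiableAt.differentiableWithinAt

end Family

/-! ### Operators with kernels of polynomial growth -/

/-- Measurable functions of polynomial growth. -/
def PolyFun (σ : Measure ℝ) (φ : ℝ → ℂ) : Prop :=
  AEStronglyMeasurable φ σ ∧ ∃ (C : ℝ) (a : ℕ), 0 ≤ C ∧ ∀ t, ‖φ t‖ ≤ C * (1 + |t|) ^ a

/-- Measurable kernels of polynomial growth. -/
def PolyKer (κ : ℝ → ℝ → ℂ) : Prop :=
  Measurable (fun p : ℝ × ℝ => κ p.1 p.2) ∧ ∃ (C : ℝ) (a : ℕ), 0 ≤ C ∧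
    ∀ x y, ‖κ x y‖ ≤ C * (1 + |x|) ^ a * (1 + |y|) ^ a

section Poly

variable {σ : Measure ℝ} [IsProbabilityMeasure σ]

set_option linter.unusedSectionVars false

lemma PolyGrowth.polyFun {φ : ℝ → ℂ} (h : PolyGrowth φ) : PolyFun σ φ :=
  ⟨h.1.aestronglyMeasurable, h.2⟩

lemma PolyFun.mul {φ ψ : ℝ → ℂ} (hφ : PolyFun σ φ) (hψ : PolyFun σ ψ) :
    PolyFun σ fun t => φ t * ψ t := by
  obtain ⟨hm, C, a, hC, hb⟩ := hφ
  obtain ⟨hm', C', a', hC', hb'⟩ := hψ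
  refine ⟨hm.mul hm', C * C', a + a', by positivity, fun t => ?_⟩
  rw [norm_mul]
  calc _ ≤ (C * (1 + |t|) ^ a) * (C' * (1 + |t|) ^ a') := by
        gcongr
        · exact hb t
        · exact hb' t
    _ = _ := by rw [pow_add]; ring

lemma PolyFun.add {φ ψ : ℝ → ℂ} (hφ : PolyFun σ φ) (hψ : PolyFun σ ψ) :
    PolyFun σ fun t => φ t + ψ t := by
  obtain ⟨hm, C, a, hC, hb⟩ := hφ
  obtain ⟨hm', C', a', hC', hb'⟩ := hψ
  refine ⟨hm.add hm', C + C', a + a', by positivity, fun t => ?_⟩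
  refine (norm_add_le _ _).trans ?_
  rw [add_mul]
  refine add_le_add ((hb t).trans ?_) ((hb' t).trans ?_)
  · gcongr
    · linarith [abs_nonneg t]
    · omega
  · gcongr
    · linarith [abs_nonneg t]
    · omega

lemma PolyFun.memLp (hσ : FiniteMoments σ) {φ : ℝ → ℂ} (hφ : PolyFun σ φ) : MemLp φ 2 σ := by
  obtain ⟨hm, C, a, hC, hb⟩ := hφ
  rw [memLp_two_iff_integrable_sq_norm hm]
  refine Integrable.mono' ((hσ (a + a)).const_mul (C ^ 2)) (hm.norm.pow 2)
    (Eventually.of_forall fun t => ?_)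
  rw [Real.norm_of_nonneg (by positivity)]
  calc _ ≤ (C * (1 + |t|) ^ a) ^ 2 := by gcongr; exact hb t
    _ = _ := by rw [pow_add]; ring

lemma PolyFun.integrable (hσ : FiniteMoments σ) {φ : ℝ → ℂ} (hφ : PolyFun σ φ) :
    Integrable φ σ :=
  (hφ.memLp hσ).integrable (by norm_num)

lemma PolyFun.const_mul {φ : ℝ → ℂ} (hφ : PolyFun σ φ) (c : ℂ) : PolyFun σ fun t => c * φ t :=
  PolyFun.mul ⟨aestronglyMeasurable_const, ‖c‖, 0, norm_nonneg _, fun t => by simp⟩ hφ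

lemma PolyKer.left {κ : ℝ → ℝ → ℂ} (h : PolyKer κ) (x : ℝ) : PolyFun σ fun y => κ x y := by
  obtain ⟨hm, C, a, hC, hb⟩ := h
  exact ⟨(hm.comp measurable_prodMk_left).aestronglyMeasurable, C * (1 + |x|) ^ a, a, by positivity,
    hb x⟩

lemma PolyKer.right {κ : ℝ → ℝ → ℂ} (h : PolyKer κ) (y : ℝ) : PolyFun σ fun x => κ x y := by
  obtain ⟨hm, C, a, hC, hb⟩ := h
  refine ⟨(hm.comp measurable_prodMk_right).aestronglyMeasurable, C * (1 + |y|) ^ a, a,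
    by positivity, fun x => (hb x y).trans (le_of_eq (by ring))⟩

lemma PolyKer.mul {κ μ : ℝ → ℝ → ℂ} (hκ : PolyKer κ) (hμ : PolyKer μ) :
    PolyKer fun x y => κ x y * μ x y := by
  obtain ⟨hm, C, a, hC, hb⟩ := hκ
  obtain ⟨hm', C', a', hC', hb'⟩ := hμ
  refine ⟨hm.mul hm', C * C', a + a', by positivity, fun x y => ?_⟩
  rw [norm_mul]
  calc _ ≤ (C * (1 + |x|) ^ a * (1 + |y|) ^ a) * (C' * (1 + |x|) ^ a' * (1 + |y|) ^ a') := by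
        gcongr
        · exact hb x y
        · exact hb' x y
    _ = _ := by rw [pow_add, pow_add]; ring

lemma PolyKer.add {κ μ : ℝ → ℝ → ℂ} (hκ : PolyKer κ) (hμ : PolyKer μ) :
    PolyKer fun x y => κ x y + μ x y := by
  obtain ⟨hm, C, a, hC, hb⟩ := hκ
  obtain ⟨hm', C', a', hC', hb'⟩ := hμ
  refine ⟨hm.add hm', C + C', a + a', by positivity, fun x y => ?_⟩
  refine (norm_add_le _ _).trans ?_
  rw [add_mul, add_mul]
  refine add_le_add ((hb x y).trans ?_) ((hb' x y).trans ?_)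
  all_goals
    gcongr
    · linarith [abs_nonneg x]
    · omega
    · linarith [abs_nonneg y]
    · omega

lemma PolyKer.const (c : ℂ) : PolyKer fun _ _ => c :=
  ⟨measurable_const, ‖c‖, 0, norm_nonneg _, fun x y => by simp⟩

lemma PolyKer.const_mul {κ : ℝ → ℝ → ℂ} (hκ : PolyKer κ) (c : ℂ) : PolyKer fun x y => c * κ x y :=
  (PolyKer.const c).mul hκ

lemma PolyKer.fst {φ : ℝ → ℂ} (hφ : PolyGrowth φ) : PolyKer fun x _ => φ x := by
  obtain ⟨hc, C, a, hC, hb⟩ := hφ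
  refine ⟨hc.measurable.comp measurable_fst, C, a, hC, fun x y => (hb x).trans ?_⟩
  exact le_mul_of_one_le_right (by positivity) (one_le_one_add_abs_pow y a)

lemma PolyKer.snd {φ : ℝ → ℂ} (hφ : PolyGrowth φ) : PolyKer fun _ y => φ y := by
  obtain ⟨hc, C, a, hC, hb⟩ := hφ
  refine ⟨hc.measurable.comp measurable_snd, C, a, hC, fun x y => (hb y).trans ?_⟩
  gcongr
  exact le_mul_of_one_le_right hC (one_le_one_add_abs_pow x a)

lemma PolyKer.memLp (hσ : FiniteMoments σ) {κ : ℝ → ℝ → ℂ} (hκ : PolyKer κ) :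
    MemLp (fun p : ℝ × ℝ => κ p.1 p.2) 2 (σ.prod σ) := by
  obtain ⟨hm, C, a, hC, hb⟩ := hκ
  rw [memLp_two_iff_integrable_sq_norm hm.aestronglyMeasurable]
  refine Integrable.mono' (((hσ (a + a)).mul_prod (hσ (a + a))).const_mul (C ^ 2))
    (hm.norm.pow_const 2).aestronglyMeasurable (Eventually.of_forall fun p => ?_)
  rw [Real.norm_of_nonneg (by positivity)]
  calc _ ≤ (C * (1 + |p.1|) ^ a * (1 + |p.2|) ^ a) ^ 2 := by gcongr; exact hb p.1 p.2
    _ = _ := by rw [pow_add, pow_add]; ring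

lemma isHS_of_polyKer (hσ : FiniteMoments σ) {K : Ker} (h : ∀ i j, PolyKer fun x y => K x y i j) :
    IsHS σ K := fun i j =>
  ⟨(h i j).memLp hσ, fun x => ((h i j).left x).memLp hσ, fun y => ((h i j).right y).memLp hσ⟩

/-- Fubini under polynomial growth. Associativity of operator composition reduces to this scalar
statement. -/
lemma integral_mul_assoc (hσ : FiniteMoments σ) {φ ψ : ℝ → ℂ} {κ : ℝ → ℝ → ℂ} (hφ : PolyFun σ φ)
    (hκ : PolyKer κ) (hψ : PolyFun σ ψ) :
    PolyFun σ (fun v => ∫ t, φ t * κ t v ∂σ) ∧ PolyFun σ (fun t => ∫ v, κ t v * ψ v ∂σ) ∧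
    ∫ v, (∫ t, φ t * κ t v ∂σ) * ψ v ∂σ = ∫ t, φ t * ∫ v, κ t v * ψ v ∂σ ∂σ := by
  obtain ⟨hm, C, a, hC, hb⟩ := hφ
  obtain ⟨hmκ, Cκ, b, hCκ, hbκ⟩ := hκ
  obtain ⟨hm', C', a', hC', hb'⟩ := hψ
  have hm1 : AEStronglyMeasurable (fun p : ℝ × ℝ => φ p.1 * κ p.1 p.2) (σ.prod σ) :=
    hm.comp_fst.mul hmκ.aestronglyMeasurable
  have hm2 : AEStronglyMeasurable (fun p : ℝ × ℝ => κ p.1 p.2 * ψ p.2) (σ.prod σ) :=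
    hmκ.aestronglyMeasurable.mul hm'.comp_snd
  set I : ℕ → ℝ := fun n => ∫ t, (1 + |t|) ^ n ∂σ
  have hI : ∀ n, 0 ≤ I n := fun n => integral_nonneg fun t => by positivity
  refine ⟨⟨?_, C * Cκ * I (a + b), b, by have := hI (a + b); positivity, fun v => ?_⟩,
    ⟨hm2.integral_prod_right', C' * Cκ * I (b + a'), b, by have := hI (b + a'); positivity,
      fun t => ?_⟩, ?_⟩
  · have := (hm1.comp_quasiMeasurePreserving
      (Measure.measurePreserving_swap (μ := σ) (ν := σ)).quasiMeasurePreserving).integral_prod_right'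
    exact this
  · have h : ∀ t, ‖φ t * κ t v‖ ≤ C * Cκ * (1 + |v|) ^ b * (1 + |t|) ^ (a + b) := fun t => by
      rw [norm_mul]
      calc _ ≤ (C * (1 + |t|) ^ a) * (Cκ * (1 + |t|) ^ b * (1 + |v|) ^ b) := by
            gcongr
            · exact hb t
            · exact hbκ t v
        _ = _ := by rw [pow_add]; ring
    refine (norm_integral_le_of_norm_le ((hσ (a + b)).const_mul _)
      (Eventually.of_forall h)).trans (le_of_eq ?_)
    rw [integral_const_mul]; ring
  · have h : ∀ v, ‖κ t v * ψ v‖ ≤ C' * Cκ * (1 + |t|) ^ b * (1 + |v|) ^ (b + a') := fun v => by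
      rw [norm_mul]
      calc _ ≤ (Cκ * (1 + |t|) ^ b * (1 + |v|) ^ b) * (C' * (1 + |v|) ^ a') := by
            gcongr
            · exact hbκ t v
            · exact hb' v
        _ = _ := by rw [pow_add]; ring
    refine (norm_integral_le_of_norm_le ((hσ (b + a')).const_mul _)
      (Eventually.of_forall h)).trans (le_of_eq ?_)
    rw [integral_const_mul]; ring
  · have hint : Integrable (fun p : ℝ × ℝ => φ p.1 * κ p.1 p.2 * ψ p.2) (σ.prod σ) := by
      refine Integrable.mono' (((hσ (a + b)).mul_prod (hσ (b + a'))).const_mul (C * Cκ * C'))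
        (hm1.mul hm'.comp_snd) (Eventually.of_forall fun p => ?_)
      rw [norm_mul, norm_mul]
      calc _ ≤ (C * (1 + |p.1|) ^ a) * (Cκ * (1 + |p.1|) ^ b * (1 + |p.2|) ^ b) *
            (C' * (1 + |p.2|) ^ a') := by
            gcongr
            · exact hb p.1
            · exact hbκ p.1 p.2
            · exact hb' p.2
        _ = _ := by rw [pow_add, pow_add]; ring
    calc _ = ∫ v, ∫ t, φ t * κ t v * ψ v ∂σ ∂σ := by
          refine integral_congr_ae (Eventually.of_forall fun v => ?_)
          exact (integral_mul_const (ψ v) fun t => φ t * κ t v).symm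
      _ = ∫ t, ∫ v, φ t * κ t v * ψ v ∂σ ∂σ := (integral_integral_swap hint).symm
      _ = _ := by
          refine integral_congr_ae (Eventually.of_forall fun t => ?_)
          simp only [mul_assoc]
          exact integral_const_mul (φ t) fun v => κ t v * ψ v

end Poly

end AiryLax
end

noncomputable section
namespace AiryLax

/-! ### Composition of operators -/

/-- Entrywise integral of a matrix function. -/
def matInt (σ : Measure ℝ) (F : ℝ → Matrix (Fin 2) (Fin 2) ℂ) : Matrix (Fin 2) (Fin 2) ℂ :=
  Matrix.of fun i j => ∫ t, F t i j ∂σ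

/-- Entrywise integrable matrix functions. -/
def MatIntegrable (σ : Measure ℝ) (F : ℝ → Matrix (Fin 2) (Fin 2) ℂ) : Prop :=
  ∀ i j, Integrable (fun t => F t i j) σ

/-- Matrix functions with entries of polynomial growth. -/
def PolyMat (σ : Measure ℝ) (F : ℝ → Matrix (Fin 2) (Fin 2) ℂ) : Prop :=
  ∀ i j, PolyFun σ fun t => F t i j

/-- Operators with polynomially growing multiplication part and kernel. -/
structure PolyOp (T : KerOp) : Prop where
  diag : ∀ i j, PolyKer fun x _ => T.1 x i j
  ker : ∀ i j, PolyKer fun x y => T.2 x y i j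

section Comp

variable {σ : Measure ℝ} [IsProbabilityMeasure σ]

set_option linter.unusedSectionVars false

lemma comp_snd (S T : KerOp) (x y : ℝ) : (comp σ S T).2 x y =
    S.1 x * T.2 x y + S.2 x y * T.1 y + matInt σ fun t => S.2 x t * T.2 t y := rfl

lemma matInt_add {F G : ℝ → Matrix (Fin 2) (Fin 2) ℂ} (hF : MatIntegrable σ F)
    (hG : MatIntegrable σ G) : matInt σ (fun t => F t + G t) = matInt σ F + matInt σ G := by
  ext i j
  exact integral_add (hF i j) (hG i j)

lemma MatIntegrable.add {F G : ℝ → Matrix (Fin 2) (Fin 2) ℂ} (hF : MatIntegrable σ F)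
    (hG : MatIntegrable σ G) : MatIntegrable σ fun t => F t + G t :=
  fun i j => (hF i j).add (hG i j)

lemma matInt_const_mul (A : Matrix (Fin 2) (Fin 2) ℂ) {F : ℝ → Matrix (Fin 2) (Fin 2) ℂ}
    (hF : MatIntegrable σ F) : matInt σ (fun t => A * F t) = A * matInt σ F := by
  ext i j
  simp only [matInt, Matrix.mul_apply, Matrix.of_apply, Fin.sum_univ_two]
  rw [integral_add ((hF 0 j).const_mul _) ((hF 1 j).const_mul _), integral_const_mul,
    integral_const_mul]

lemma matInt_mul_const (A : Matrix (Fin 2) (Fin 2) ℂ) {F : ℝ → Matrix (Fin 2) (Fin 2) ℂ}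
    (hF : MatIntegrable σ F) : matInt σ (fun t => F t * A) = matInt σ F * A := by
  ext i j
  simp only [matInt, Matrix.mul_apply, Matrix.of_apply, Fin.sum_univ_two]
  rw [integral_add ((hF i 0).mul_const _) ((hF i 1).mul_const _), integral_mul_const,
    integral_mul_const]

lemma MatIntegrable.const_mul (A : Matrix (Fin 2) (Fin 2) ℂ) {F : ℝ → Matrix (Fin 2) (Fin 2) ℂ}
    (hF : MatIntegrable σ F) : MatIntegrable σ fun t => A * F t := fun i j => by
  simp only [Matrix.mul_apply, Fin.sum_univ_two]
  exact ((hF 0 j).const_mul _).add ((hF 1 j).const_mul _)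

lemma MatIntegrable.mul_const (A : Matrix (Fin 2) (Fin 2) ℂ) {F : ℝ → Matrix (Fin 2) (Fin 2) ℂ}
    (hF : MatIntegrable σ F) : MatIntegrable σ fun t => F t * A := fun i j => by
  simp only [Matrix.mul_apply, Fin.sum_univ_two]
  exact ((hF i 0).mul_const _).add ((hF i 1).mul_const _)

lemma PolyMat.integrable (hσ : FiniteMoments σ) {F : ℝ → Matrix (Fin 2) (Fin 2) ℂ}
    (hF : PolyMat σ F) : MatIntegrable σ F := fun i j => (hF i j).integrable hσ

lemma PolyMat.mul {F G : ℝ → Matrix (Fin 2) (Fin 2) ℂ} (hF : PolyMat σ F) (hG : PolyMat σ G) :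
    PolyMat σ fun t => F t * G t := fun i j => by
  simp only [Matrix.mul_apply, Fin.sum_univ_two]
  exact ((hF i 0).mul (hG 0 j)).add ((hF i 1).mul (hG 1 j))

lemma integral_add_four {f₁ f₂ f₃ f₄ : ℝ → ℂ} (h₁ : Integrable f₁ σ) (h₂ : Integrable f₂ σ)
    (h₃ : Integrable f₃ σ) (h₄ : Integrable f₄ σ) :
    ∫ t, ((f₁ t + f₂ t) + (f₃ t + f₄ t)) ∂σ =
      ((∫ t, f₁ t ∂σ) + ∫ t, f₂ t ∂σ) + ((∫ t, f₃ t ∂σ) + ∫ t, f₄ t ∂σ) :=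
  (integral_add (h₁.add h₂) (h₃.add h₄)).trans
    (congrArg₂ _ (integral_add h₁ h₂) (integral_add h₃ h₄))

lemma matInt_assoc (hσ : FiniteMoments σ) {S U : ℝ → Matrix (Fin 2) (Fin 2) ℂ}
    {T : ℝ → ℝ → Matrix (Fin 2) (Fin 2) ℂ} (hS : PolyMat σ S) (hU : PolyMat σ U)
    (hT : ∀ i j, PolyKer fun x y => T x y i j) :
    (PolyMat σ fun v => matInt σ fun t => S t * T t v) ∧
    (PolyMat σ fun t => matInt σ fun v => T t v * U v) ∧
    matInt σ (fun v => matInt σ (fun t => S t * T t v) * U v) =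
      matInt σ fun t => S t * matInt σ fun v => T t v * U v := by
  have key := fun i a b j => integral_mul_assoc hσ (hS i a) (hT a b) (hU b j)
  have e1 : ∀ v i j, (matInt σ fun t => S t * T t v) i j =
      (∫ t, S t i 0 * T t v 0 j ∂σ) + ∫ t, S t i 1 * T t v 1 j ∂σ := fun v i j => by
    simp only [matInt, Matrix.mul_apply, Matrix.of_apply, Fin.sum_univ_two]
    exact integral_add (((hS i 0).mul ((hT 0 j).right v)).integrable hσ)
      (((hS i 1).mul ((hT 1 j).right v)).integrable hσ)
  have e2 : ∀ t i j, (matInt σ fun v => T t v * U v) i j =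
      (∫ v, T t v i 0 * U v 0 j ∂σ) + ∫ v, T t v i 1 * U v 1 j ∂σ := fun t i j => by
    simp only [matInt, Matrix.mul_apply, Matrix.of_apply, Fin.sum_univ_two]
    exact integral_add ((((hT i 0).left t).mul (hU 0 j)).integrable hσ)
      ((((hT i 1).left t).mul (hU 1 j)).integrable hσ)
  have h1 : PolyMat σ fun v => matInt σ fun t => S t * T t v := fun i j => by
    simp only [e1]
    exact (key i 0 j j).1.add (key i 1 j j).1
  have h2 : PolyMat σ fun t => matInt σ fun v => T t v * U v := fun i j => by
    simp only [e2]
    exact (key i i 0 j).2.1.add (key i i 1 j).2.1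
  refine ⟨h1, h2, ?_⟩
  ext i j
  have f1 := fun a b => ((key i a b j).1.mul (hU b j)).integrable hσ
  have f2 := fun a b => ((hS i a).mul (key i a b j).2.1).integrable hσ
  calc _ = ∫ v, (((∫ t, S t i 0 * T t v 0 0 ∂σ) * U v 0 j + (∫ t, S t i 1 * T t v 1 0 ∂σ) * U v 0 j) +
        ((∫ t, S t i 0 * T t v 0 1 ∂σ) * U v 1 j + (∫ t, S t i 1 * T t v 1 1 ∂σ) * U v 1 j)) ∂σ := by
        simp only [matInt, Matrix.of_apply]
        refine integral_congr_ae (Eventually.of_forall fun v => ?_)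
        have a1 := e1 v i 0
        have a2 := e1 v i 1
        simp only [matInt, Matrix.of_apply] at a1 a2
        beta_reduce
        rw [Matrix.mul_apply, Fin.sum_univ_two, Matrix.of_apply, Matrix.of_apply, a1, a2]
        ring
    _ = ∫ t, ((S t i 0 * (∫ v, T t v 0 0 * U v 0 j ∂σ) + S t i 1 * (∫ v, T t v 1 0 * U v 0 j ∂σ)) +
        (S t i 0 * (∫ v, T t v 0 1 * U v 1 j ∂σ) + S t i 1 * (∫ v, T t v 1 1 * U v 1 j ∂σ))) ∂σ := by
        refine (integral_add_four (f1 0 0) (f1 1 0) (f1 0 1) (f1 1 1)).trans (Eq.trans ?_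
          (integral_add_four (f2 0 0) (f2 1 0) (f2 0 1) (f2 1 1)).symm)
        rw [(key i 0 0 j).2.2, (key i 1 0 j).2.2, (key i 0 1 j).2.2, (key i 1 1 j).2.2]
    _ = _ := by
        simp only [matInt, Matrix.of_apply]
        refine integral_congr_ae (Eventually.of_forall fun t => ?_)
        have a1 := e2 t 0 j
        have a2 := e2 t 1 j
        simp only [matInt, Matrix.of_apply] at a1 a2
        beta_reduce
        rw [Matrix.mul_apply, Fin.sum_univ_two, Matrix.of_apply, Matrix.of_apply, a1, a2]
        ring

/-- Of S only the rows need polynomial growth: in the uniqueness proof S is the difference of two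
solutions, for which just this is established. -/
lemma comp_assoc (hσ : FiniteMoments σ) {S T U : KerOp} (hS : ∀ x, PolyMat σ fun t => S.2 x t)
    (hT : PolyOp T) (hU : PolyOp U) : comp σ (comp σ S T) U = comp σ S (comp σ T U) := by
  refine Prod.ext (funext fun x => Matrix.mul_assoc _ _ _) (funext fun x => funext fun y => ?_)
  have hU' : PolyMat σ fun v => U.2 v y := fun i j => (hU.ker i j).right y
  have hT' : PolyMat σ fun v => T.2 v y := fun i j => (hT.ker i j).right y
  have hTx : PolyMat σ fun v => T.2 x v := fun i j => (hT.ker i j).left x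
  have hT1 : PolyMat σ T.1 := fun i j => (hT.diag i j).right 0
  obtain ⟨h1, h2, h3⟩ := matInt_assoc hσ (hS x) hU' hT.ker
  have e1 : (comp σ (comp σ S T) U).2 x y = S.1 x * T.1 x * U.2 x y +
      (S.1 x * T.2 x y + S.2 x y * T.1 y + matInt σ fun t => S.2 x t * T.2 t y) * U.1 y +
      matInt σ (fun t => (S.1 x * (T.2 x t * U.2 t y) + S.2 x t * (T.1 t * U.2 t y)) +
        (matInt σ fun v => S.2 x v * T.2 v t) * U.2 t y) := by
    rw [comp_snd, comp_snd]
    congr 2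
    funext t
    rw [comp_snd, add_mul, add_mul, Matrix.mul_assoc, Matrix.mul_assoc]
  have e2 : (comp σ S (comp σ T U)).2 x y = S.1 x * (T.1 x * U.2 x y + T.2 x y * U.1 y +
      matInt σ fun t => T.2 x t * U.2 t y) + S.2 x y * (T.1 y * U.1 y) +
      matInt σ (fun t => (S.2 x t * (T.1 t * U.2 t y) + S.2 x t * T.2 t y * U.1 y) +
        S.2 x t * (matInt σ fun v => T.2 t v * U.2 v y)) := by
    rw [comp_snd, comp_snd]
    congr 2
    funext t
    rw [comp_snd, mul_add, mul_add, Matrix.mul_assoc (S.2 x t) (T.2 t y)]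
  have i1 : MatIntegrable σ fun t => T.2 x t * U.2 t y := (hTx.mul hU').integrable hσ
  have i2 : MatIntegrable σ fun t => S.2 x t * (T.1 t * U.2 t y) :=
    ((hS x).mul (hT1.mul hU')).integrable hσ
  have i3 : MatIntegrable σ fun t => S.2 x t * T.2 t y := ((hS x).mul hT').integrable hσ
  rw [e1, e2, matInt_add (F := fun t => S.1 x * (T.2 x t * U.2 t y) + S.2 x t * (T.1 t * U.2 t y))
      ((i1.const_mul _).add i2) ((h1.mul hU').integrable hσ),
    matInt_add (F := fun t => S.1 x * (T.2 x t * U.2 t y)) (i1.const_mul _) i2,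
    matInt_const_mul _ i1,
    matInt_add (F := fun t => S.2 x t * (T.1 t * U.2 t y) + S.2 x t * T.2 t y * U.1 y)
      (i2.add (i3.mul_const _)) (((hS x).mul h2).integrable hσ),
    matInt_add (F := fun t => S.2 x t * (T.1 t * U.2 t y)) i2 (i3.mul_const _),
    matInt_mul_const _ i3, h3]
  noncomm_ring

lemma comp_one (S : KerOp) : comp σ S (onePlus 0) = S := by
  refine Prod.ext (funext fun x => Matrix.mul_one _) (funext fun x => funext fun y => ?_)
  rw [comp_snd]
  simp [onePlus, matInt]
  rfl

lemma PolyKer.comp (hσ : FiniteMoments σ) {κ μ : ℝ → ℝ → ℂ} (hκ : PolyKer κ) (hμ : PolyKer μ) :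
    PolyKer fun x y => ∫ t, κ x t * μ t y ∂σ := by
  obtain ⟨hm, C, a, hC, hb⟩ := hκ
  obtain ⟨hm', C', a', hC', hb'⟩ := hμ
  have h : StronglyMeasurable fun t : (ℝ × ℝ) × ℝ => κ t.1.1 t.2 * μ t.2 t.1.2 :=
    ((hm.comp (by fun_prop : Measurable fun t : (ℝ × ℝ) × ℝ => (t.1.1, t.2))).mul
      (hm'.comp (by fun_prop : Measurable fun t : (ℝ × ℝ) × ℝ => (t.2, t.1.2)))).stronglyMeasurable
  set I : ℝ := ∫ t, (1 + |t|) ^ (a + a') ∂σ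
  have hI : 0 ≤ I := integral_nonneg fun t => by positivity
  refine ⟨(h.integral_prod_right (ν := σ)).measurable, C * C' * I, a + a', by positivity,
    fun x y => ?_⟩
  have h1 : ∀ t, ‖κ x t * μ t y‖ ≤ C * C' * (1 + |x|) ^ (a + a') * (1 + |y|) ^ (a + a') *
      (1 + |t|) ^ (a + a') := fun t => by
    rw [norm_mul]
    calc _ ≤ (C * (1 + |x|) ^ a * (1 + |t|) ^ a) * (C' * (1 + |t|) ^ a' * (1 + |y|) ^ a') := by
          gcongr
          · exact hb x t
          · exact hb' t y
      _ ≤ (C * (1 + |x|) ^ (a + a') * (1 + |t|) ^ a) * (C' * (1 + |t|) ^ a' * (1 + |y|) ^ (a + a')) := by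
          gcongr
          · linarith [abs_nonneg x]
          · omega
          · linarith [abs_nonneg y]
          · omega
      _ = _ := by ring
  refine (norm_integral_le_of_norm_le ((hσ (a + a')).const_mul _)
    (Eventually.of_forall h1)).trans (le_of_eq ?_)
  rw [integral_const_mul]; ring

lemma polyOp_onePlus {K : Ker} (h : ∀ i j, PolyKer fun x y => K x y i j) : PolyOp (onePlus K) :=
  ⟨fun i j => PolyKer.const ((1 : Matrix (Fin 2) (Fin 2) ℂ) i j), h⟩

lemma PolyOp.comp (hσ : FiniteMoments σ) {S T : KerOp} (hS : PolyOp S) (hT : PolyOp T) :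
    PolyOp (comp σ S T) := by
  have hd : ∀ {R : KerOp}, PolyOp R → ∀ i j, PolyKer fun _ y => R.1 y i j := by
    intro R hR i j
    obtain ⟨hm, C, a, hC, hb⟩ := hR.diag i j
    refine ⟨hm.comp measurable_swap, C * (1 + |0|) ^ a, a, by positivity, fun x y => ?_⟩
    refine (hb y 0).trans ?_
    have h1 := one_le_one_add_abs_pow x a
    have h2 : 0 ≤ C * (1 + |(0 : ℝ)|) ^ a * (1 + |y|) ^ a := by positivity
    nlinarith
  constructor
  · intro i j
    change PolyKer fun x _ => (S.1 x * T.1 x) i j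
    simp only [Matrix.mul_apply, Fin.sum_univ_two]
    exact ((hS.diag i 0).mul (hT.diag 0 j)).add ((hS.diag i 1).mul (hT.diag 1 j))
  · intro i j
    have e : ∀ x y, (AiryLax.comp σ S T).2 x y i j = ((S.1 x i 0 * T.2 x y 0 j + S.1 x i 1 * T.2 x y 1 j) +
        (S.2 x y i 0 * T.1 y 0 j + S.2 x y i 1 * T.1 y 1 j)) +
        ((∫ t, S.2 x t i 0 * T.2 t y 0 j ∂σ) + ∫ t, S.2 x t i 1 * T.2 t y 1 j ∂σ) := by
      intro x y
      rw [comp_snd]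
      simp only [Matrix.add_apply, Matrix.mul_apply, Fin.sum_univ_two, matInt, Matrix.of_apply]
      rw [integral_add]
      · exact (((hS.ker i 0).left x).mul ((hT.ker 0 j).right y)).integrable hσ
      · exact (((hS.ker i 1).left x).mul ((hT.ker 1 j).right y)).integrable hσ
    simp only [e]
    exact ((((hS.diag i 0).mul (hT.ker 0 j)).add ((hS.diag i 1).mul (hT.ker 1 j))).add
      (((hS.ker i 0).mul (hd hT 0 j)).add ((hS.ker i 1).mul (hd hT 1 j)))).add
      (((hS.ker i 0).comp hσ (hT.ker 0 j)).add ((hS.ker i 1).comp hσ (hT.ker 1 j)))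

end Comp

end AiryLax
end

noncomputable section
namespace AiryLax

variable {σ : Measure ℝ} [IsProbabilityMeasure σ] {Z : Set ℂ}

set_option linter.unusedSectionVars false

/-! ### Quotients by `w - l` and commutator identities -/

lemma memLp_div_sub (F : HalfL2) {l : ℂ} (hl : l ∈ cutᶜ) :
    MemLp (fun w : ℝ => F w / (w - l)) 2 halfLine := by
  obtain ⟨δ, hδ, hd⟩ := exists_dist_cut hl
  refine (Lp.memLp F).of_le_mul (c := δ⁻¹) ?_ (ae_halfLine fun w hw => ?_)
  · exact ((Lp.aestronglyMeasurable F).aemeasurable.div (by fun_prop)).aestronglyMeasurable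
  · rw [norm_div, div_eq_inv_mul]
    gcongr
    exact hd l (by simpa using hδ.le) w hw.le

open Classical in
/-- Division by `w - l` in `L²(0, ∞)`. -/
def quot (l : ℂ) (F : HalfL2) : HalfL2 :=
  if h : MemLp (fun w : ℝ => F w / (w - l)) 2 halfLine then h.toLp else 0

lemma coeFn_quot {l : ℂ} (hl : l ∈ cutᶜ) (F : HalfL2) :
    quot l F =ᵐ[halfLine] fun w : ℝ => F w / (w - l) := by
  rw [quot, dif_pos (memLp_div_sub F hl)]
  exact (memLp_div_sub F hl).coeFn_toLp

lemma mul_quot {l : ℂ} (hl : l ∈ cutᶜ) (F : HalfL2) :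
    F =ᵐ[halfLine] fun w : ℝ => (w - l) * quot l F w := by
  filter_upwards [coeFn_quot hl F, ae_halfLine fun w hw => hw] with w h1 h2
  have hne : (w : ℂ) - l ≠ 0 := Complex.slitPlane_ne_zero (sub_mem_slitPlane hl h2.le)
  rw [h1, mul_div_cancel₀ _ hne]

/-- Multiplication by w - l is symmetric for the bilinear pairing. The formulation by almost
everywhere equalities avoids an unbounded operator on L². -/
lemma pair_mul_left {l : ℂ} {F F' Q Q' : HalfL2} (hF : F =ᵐ[halfLine] fun w : ℝ => (w - l) * Q w)
    (hF' : F' =ᵐ[halfLine] fun w : ℝ => (w - l) * Q' w) : pair F Q' = pair Q F' := by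
  rw [pair_eq hF (ae_eq_refl _), pair_eq (ae_eq_refl _) hF']
  refine integral_congr_ae (Eventually.of_forall fun w => ?_)
  simp only
  ring

/-- `Admissible.pair_boundary` with z - w written as (z - l) - (w - l). -/
lemma Admissible.boundary_quot (hZ : Admissible σ Z) {z : ℂ} (hz : z ∈ Z) (s : ℝ) {l : ℂ}
    {F Q : HalfL2} (hF : F =ᵐ[halfLine] fun w : ℝ => (w - l) * Q w) :
    (∫ t, pair (airyL2 1 (s + t)) Q * airyD 0 (z + (s + t : ℝ)) ∂σ) -
        ∫ t, pair (airyL2 0 (s + t)) Q * airyD 1 (z + (s + t : ℝ)) ∂σ =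
      (z - l) * pair (kerRow σ 0 0 s z) Q - pair (kerRow σ 0 0 s z) F := by
  rw [hZ.pair_boundary hz, pair_eq (hZ.coeFn_kerRow 0 0 hz s) hF,
    pair_eq (hZ.coeFn_kerRow 0 0 hz s) (ae_eq_refl _), ← integral_const_mul, ← integral_sub]
  · refine integral_congr_ae (Eventually.of_forall fun w => ?_)
    simp only
    ring
  · have : Integrable (fun w : ℝ => kerRow σ 0 0 s z w * Q w) halfLine :=
      (Lp.memLp _).integrable_mul (Lp.memLp _)
    exact (this.congr (by
      filter_upwards [hZ.coeFn_kerRow 0 0 hz s] with w h; rw [h])).const_mul _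
  · have : Integrable (fun w : ℝ => kerRow σ 0 0 s z w * F w) halfLine :=
      (Lp.memLp _).integrable_mul (Lp.memLp _)
    exact this.congr (by
      filter_upwards [hZ.coeFn_kerRow 0 0 hz s, hF] with w h h'; rw [h, h'])

/-- The commutator of the kernel with multiplication, in weak form. -/
lemma integral_pair_commutator (hσ : FiniteMoments σ) (s : ℝ) {l : ℂ} {F F' Q Q' : HalfL2}
    (hF : F =ᵐ[halfLine] fun w : ℝ => (w - l) * Q w)
    (hF' : F' =ᵐ[halfLine] fun w : ℝ => (w - l) * Q' w) :
    (∫ t, pair Q (airyL2 0 (s + t)) * pair Q' (airyL2 1 (s + t)) ∂σ) -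
      ∫ t, pair Q (airyL2 1 (s + t)) * pair Q' (airyL2 0 (s + t)) ∂σ =
      pair F (kerOp σ s Q') - pair (kerOp σ s Q) F' := by
  have hφ : ∀ d, PolyGrowth fun t => pair (airyL2 d (s + t)) Q' := fun d => by
    simpa only [pair_comm] using polyGrowth_clm (pair Q') d s
  set D := airySum σ s 0 (fun t => pair (airyL2 1 (s + t)) Q') -
    airySum σ s 1 (fun t => pair (airyL2 0 (s + t)) Q') with hD
  have hDc : D =ᵐ[halfLine] fun w : ℝ => (w - l) * kerOp σ s Q' w - kerOp σ s F' w := by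
    filter_upwards [Lp.coeFn_sub (airySum σ s 0 (fun t => pair (airyL2 1 (s + t)) Q'))
      (airySum σ s 1 (fun t => pair (airyL2 0 (s + t)) Q')), (integrable_airySum hσ s 0 (hφ 1)).2,
      (integrable_airySum hσ s 1 (hφ 0)).2, coeFn_kerOp hσ s Q', coeFn_kerOp hσ s F']
      with w h1 h2 h3 h4 h5
    rw [h1, Pi.sub_apply, h2, h3, h4, h5, hσ.admissible.boundary_quot (hσ.admissible.real w) s hF']
  have e1 : pair Q D = (∫ t, pair Q (airyL2 0 (s + t)) * pair Q' (airyL2 1 (s + t)) ∂σ) -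
      ∫ t, pair Q (airyL2 1 (s + t)) * pair Q' (airyL2 0 (s + t)) ∂σ := by
    rw [hD, map_sub, clm_airySum hσ s 0 (hφ 1), clm_airySum hσ s 1 (hφ 0)]
    congr 1 <;>
    · refine integral_congr_ae (Eventually.of_forall fun t => ?_)
      simp only
      rw [pair_comm _ Q', mul_comm]
  rw [← e1, pair_eq (ae_eq_refl Q) hDc, pair_kerOp hσ s Q F', pair_eq hF (ae_eq_refl _),
    pair_apply, ← integral_sub]
  · refine integral_congr_ae (Eventually.of_forall fun w => ?_)
    simp only
    ring
  · have : Integrable (fun w : ℝ => F w * kerOp σ s Q' w) halfLine :=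
      (Lp.memLp _).integrable_mul (Lp.memLp _)
    exact this.congr (by filter_upwards [hF] with w h; rw [h])
  · exact (Lp.memLp _).integrable_mul (Lp.memLp _)

lemma kerOp_resOp (hσ : FiniteMoments σ) (s : ℝ) (f : HalfL2) :
    kerOp σ s (resOp σ s f) = resOp σ s f - f := by
  have := sub_resOp hσ s f
  nth_rewrite 3 [← this]
  abel

lemma kerOp_resVec (hσ : FiniteMoments σ) (d : ℕ) (s x : ℝ) :
    kerOp σ s (resVec σ d s x) = resVec σ d s x - airyL2 d (s + x) :=
  kerOp_resOp hσ s _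

lemma cKer_res_airy (hσ : FiniteMoments σ) (s : ℝ) (d e : ℕ) {l : ℂ} (hl : l ∈ cutᶜ) (x y : ℝ) :
    cKer (resFam σ s d) (airyFam s e) l x y =
      pair (quot l (resVec σ d s x)) (airyL2 e (s + y)) := by
  have h : quot l (resVec σ d s x) =ᵐ[halfLine] fun w : ℝ => resFun σ 0 d s w x / (w - l) := by
    filter_upwards [coeFn_quot hl (resVec σ d s x), coeFn_resVec hσ d s x] with w h1 h2
    rw [h1, h2]
  rw [pair_eq h (coeFn_airyL2 e (s + y))]
  refine integral_congr_ae (Eventually.of_forall fun w => ?_)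
  simp only [prodFam, resFam, airyFam, Matrix.cons_val_zero, add_zero]
  ring

lemma cKer_airy_res (hσ : FiniteMoments σ) (s : ℝ) (d e : ℕ) {l : ℂ} (hl : l ∈ cutᶜ) (x y : ℝ) :
    cKer (airyFam s d) (resFam σ s e) l x y =
      pair (quot l (resVec σ e s y)) (airyL2 d (s + x)) := by
  rw [← cKer_res_airy hσ s e d hl]
  refine integral_congr_ae (Eventually.of_forall fun w => ?_)
  simp only [prodFam, Matrix.cons_val_zero]
  ring

lemma pair_quot_comm {l : ℂ} (hl : l ∈ cutᶜ) (F G : HalfL2) : pair (quot l F) G = pair (quot l G) F := by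
  rw [pair_comm, pair_mul_left (mul_quot hl G) (mul_quot hl F)]

/-- The kernel identity behind `X X⁻¹ = 1`. -/
lemma integral_cKer_right_inverse (hσ : FiniteMoments σ) (s : ℝ) (d e : ℕ) {l : ℂ} (hl : l ∈ cutᶜ)
    (x y : ℝ) :
    (∫ t, cKer (resFam σ s d) (airyFam s 0) l x t * cKer (airyFam s 1) (resFam σ s e) l t y ∂σ) -
      ∫ t, cKer (resFam σ s d) (airyFam s 1) l x t * cKer (airyFam s 0) (resFam σ s e) l t y ∂σ =
      cKer (resFam σ s d) (airyFam s e) l x y - cKer (airyFam s d) (resFam σ s e) l x y := by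
  simp only [cKer_res_airy hσ s _ _ hl, cKer_airy_res hσ s _ _ hl]
  -- After the commutator identity, K is moved by symmetry onto the resolvent vectors, where K R = R
  -- - 1; the terms without Airy vectors cancel by `pair_mul_left`.
  rw [integral_pair_commutator hσ s (mul_quot hl (resVec σ d s x)) (mul_quot hl (resVec σ e s y)),
    ← pair_kerOp hσ, pair_kerOp hσ s (quot _ _), kerOp_resVec hσ, kerOp_resVec hσ]
  simp only [map_sub, _root_.sub_apply]
  rw [pair_mul_left (mul_quot hl (resVec σ d s x)) (mul_quot hl (resVec σ e s y)),
    pair_comm (airyL2 d _)]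
  ring

lemma memLp_mul_pair_kerRow (hσ : FiniteMoments σ) (s : ℝ) (F : HalfL2) (l : ℂ) :
    MemLp (fun w : ℝ => (w - l) * pair (kerRow σ 0 0 s w) F) 2 halfLine := by
  obtain ⟨C, hC, hb⟩ := norm_kerRow_le hσ 0 2 s
  refine memLp_halfLine (M := (1 + ‖l‖) * (‖pair‖ * C * ‖F‖)) ?_ fun w hw => ?_
  · have hc : Continuous fun w : ℝ => pair (kerRow σ 0 0 s w) F :=
      (pair.flip F).continuous.comp (continuous_kerRow_ofReal hσ 0 s)
    exact (Continuous.mul (by fun_prop) hc).aestronglyMeasurable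
  · rw [norm_mul]
    have h3 : (1 + w) * ((1 + w) ^ 2)⁻¹ = (1 + w)⁻¹ := by
      have : 1 + w ≠ 0 := by positivity
      field_simp
    have h4 := one_add_norm_sub_le hw.le l
    calc _ ≤ ((1 + w) * (1 + ‖l‖)) * (‖pair‖ * (C * ((1 + w) ^ 2)⁻¹) * ‖F‖) := by
          gcongr
          · linarith
          · refine (norm_pair_le _ _).trans ?_
            gcongr
            exact hb w hw.le
      _ = (1 + ‖l‖) * (‖pair‖ * C * ‖F‖) * ((1 + w) * ((1 + w) ^ 2)⁻¹) := by ring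
      _ = _ := by rw [h3]

/-- For the left inverse R acts on a quotient q of G, and the commutator identity needs (w - l) R q
in L². It is G plus (w - l) K R q, and the rows of K decay fast enough. -/
lemma exists_mul_resOp_quot (hσ : FiniteMoments σ) (s : ℝ) {l : ℂ} (hl : l ∈ cutᶜ) (G : HalfL2) :
    ∃ F : HalfL2, F =ᵐ[halfLine] fun w : ℝ => (w - l) * resOp σ s (quot l G) w := by
  have hm := memLp_mul_pair_kerRow hσ s (resOp σ s (quot l G)) l
  refine ⟨G + hm.toLp, ?_⟩
  filter_upwards [Lp.coeFn_add G hm.toLp, hm.coeFn_toLp, mul_quot hl G,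
    coeFn_resOp hσ s (ae_eq_refl (quot l G))] with w h1 h2 h3 h4
  rw [h1, Pi.add_apply, h2, h4, mul_add, ← h3]

/-- The kernel identity behind `X⁻¹ X = 1`. -/
lemma integral_cKer_left_inverse (hσ : FiniteMoments σ) (s : ℝ) (d e : ℕ) {l : ℂ} (hl : l ∈ cutᶜ)
    (x y : ℝ) :
    (∫ t, cKer (airyFam s d) (resFam σ s 0) l x t * cKer (resFam σ s 1) (airyFam s e) l t y ∂σ) -
      ∫ t, cKer (airyFam s d) (resFam σ s 1) l x t * cKer (resFam σ s 0) (airyFam s e) l t y ∂σ =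
      cKer (resFam σ s d) (airyFam s e) l x y - cKer (airyFam s d) (resFam σ s e) l x y := by
  set q := quot l (airyL2 d (s + x)) with hq
  set q' := quot l (airyL2 e (s + y)) with hq'
  -- Division by w - l and R are both symmetric, so they can be moved to the Airy vector of the
  -- outer variable. The variable t of integration then enters through Ai⁽ᵏ⁾(·+s+t) alone, as the
  -- commutator identity requires.
  have e1 : ∀ (k : ℕ) (t : ℝ), cKer (airyFam s d) (resFam σ s k) l x t =
      pair (resOp σ s q) (airyL2 k (s + t)) := fun k t => by
    rw [cKer_airy_res hσ s d k hl, pair_quot_comm hl, pair_resOp hσ]; rfl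
  have e2 : ∀ (k : ℕ) (t : ℝ), cKer (resFam σ s k) (airyFam s e) l t y =
      pair (resOp σ s q') (airyL2 k (s + t)) := fun k t => by
    rw [cKer_res_airy hσ s k e hl, pair_quot_comm hl, pair_resOp hσ]; rfl
  obtain ⟨F, hF⟩ := exists_mul_resOp_quot hσ s hl (airyL2 d (s + x))
  obtain ⟨F', hF'⟩ := exists_mul_resOp_quot hσ s hl (airyL2 e (s + y))
  have h1 : pair F q' = pair (resOp σ s q) (airyL2 e (s + y)) :=
    pair_mul_left hF (mul_quot hl _)
  have h2 : pair (airyL2 d (s + x)) (resOp σ s q') = pair q F' :=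
    pair_mul_left (mul_quot hl _) hF'
  rw [cKer_res_airy hσ s d e hl, cKer_airy_res hσ s d e hl, pair_quot_comm hl (resVec σ d s x),
    pair_quot_comm hl (resVec σ e s y)]
  simp only [e1, e2]
  rw [integral_pair_commutator hσ s hF hF', kerOp_resOp hσ, kerOp_resOp hσ]
  simp only [map_sub, _root_.sub_apply]
  rw [pair_mul_left hF hF', h1, ← h2, pair_comm (airyL2 d _)]
  change _ = pair q' (resOp σ s (airyL2 d (s + x))) - pair q (resOp σ s (airyL2 e (s + y)))
  linear_combination pair_resOp hσ s q' (airyL2 d (s + x)) - pair_resOp hσ s q (airyL2 e (s + y))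

/-- The kernel identity behind `N = X M`, off the contour. -/
lemma Admissible.integral_cKer_mul (hZ : Admissible σ Z) (hσ : FiniteMoments σ) (s : ℝ) (d : ℕ)
    {z : ℂ} (hz : z ∈ Z) {l : ℂ} (hl : l ∈ cutᶜ) (x : ℝ) :
    (∫ t, cKer (resFam σ s d) (airyFam s 1) l x t * airyD 0 (z + (s + t : ℝ)) ∂σ) -
        ∫ t, cKer (resFam σ s d) (airyFam s 0) l x t * airyD 1 (z + (s + t : ℝ)) ∂σ =
      (z - l) * pair (kerRow σ 0 0 s z) (quot l (resVec σ d s x)) -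
        pair (kerRow σ 0 0 s z) (resVec σ d s x) := by
  simp only [cKer_res_airy hσ s _ _ hl]
  simp only [pair_comm (quot l _)]
  exact hZ.boundary_quot hz s (mul_quot hl _)

/-- A path approaching `z` from the half plane `ε Im l ≤ 0`. -/
def approach (ε z δ : ℝ) : ℂ := z - ε * δ * Complex.I

lemma approach_im (ε z δ : ℝ) : (approach ε z δ).im = -(ε * δ) := by simp [approach]

lemma approach_re (ε z δ : ℝ) : (approach ε z δ).re = z := by simp [approach]

lemma tendsto_approach (ε z : ℝ) : Tendsto (approach ε z) (𝓝[>] 0) (𝓝 (z : ℂ)) := by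
  have : Continuous (approach ε z) := by unfold approach; fun_prop
  have h := this.tendsto 0
  simp only [approach, Complex.ofReal_zero, mul_zero, zero_mul, sub_zero] at h
  exact h.mono_left nhdsWithin_le_nhds

lemma le_norm_approach (ε : ℝ) {z : ℝ} (hz : 0 ≤ z) (δ : ℝ) : z ≤ ‖approach ε z δ‖ := by
  have := Complex.abs_re_le_norm (approach ε z δ)
  rwa [approach_re, abs_of_nonneg hz] at this

lemma approach_mem {ε : ℝ} (hε : ε = 1 ∨ ε = -1) (z : ℝ) {δ : ℝ} (hδ : 0 < δ) :
    approach ε z δ ∈ cutᶜ ∧ ε * (approach ε z δ).im < 0 := by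
  have h1 : ε ≠ 0 := by rcases hε with rfl | rfl <;> norm_num
  have h2 : ε * ε = 1 := by rcases hε with rfl | rfl <;> norm_num
  refine ⟨mem_compl_cut_of_im ?_, ?_⟩
  · rw [approach_im]; exact neg_ne_zero.mpr (mul_ne_zero h1 hδ.ne')
  · rw [approach_im]; nlinarith

/-- On the vertical approach |z - l| ≤ |w - l| for real w, so (z - l)/(w - l) is bounded by 1 and
tends to 0 for w ≠ z; dominated convergence applies. -/
lemma tendsto_quot_approach {ε : ℝ} (hε : ε = 1 ∨ ε = -1) (z s x : ℝ) (d : ℕ) :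
    Tendsto (fun δ : ℝ => (z - approach ε z δ) * pair (kerRow σ 0 0 s z)
      (quot (approach ε z δ) (resVec σ d s x))) (𝓝[>] 0) (𝓝 0) := by
  set P : ℝ → ℂ := fun w => kerRow σ 0 0 s z w * resVec σ d s x w with hP
  have hPi : Integrable P halfLine := (Lp.memLp _).integrable_mul (Lp.memLp _)
  have hε0 : ε ≠ 0 := by rcases hε with rfl | rfl <;> norm_num
  have h1 : ∀ δ : ℝ, 0 < δ → (z - approach ε z δ) * pair (kerRow σ 0 0 s z)
      (quot (approach ε z δ) (resVec σ d s x)) =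
      ∫ w in Ioi (0 : ℝ), P w * ((z - approach ε z δ) / (w - approach ε z δ)) := by
    intro δ hδ
    rw [pair_eq (ae_eq_refl _) (coeFn_quot (approach_mem hε z hδ).1 _), ← integral_const_mul]
    refine integral_congr_ae (Eventually.of_forall fun w => ?_)
    simp only [hP]
    ring
  have h2 : Tendsto (fun δ : ℝ => ∫ w in Ioi (0 : ℝ),
      P w * ((z - approach ε z δ) / (w - approach ε z δ))) (𝓝[>] 0)
      (𝓝 (∫ w in Ioi (0 : ℝ), (0 : ℂ))) := by
    refine tendsto_integral_filter_of_dominated_convergence (fun w => ‖P w‖) ?_ ?_ hPi.norm ?_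
    · exact Eventually.of_forall fun δ => hPi.aestronglyMeasurable.mul
        ((measurable_const.div (by fun_prop)).aestronglyMeasurable)
    · filter_upwards [self_mem_nhdsWithin] with δ hδ
      refine Eventually.of_forall fun w => ?_
      rw [norm_mul]
      refine mul_le_of_le_one_right (norm_nonneg _) ?_
      rw [norm_div]
      refine div_le_one_of_le₀ ?_ (norm_nonneg _)
      have e1 : (z : ℂ) - approach ε z δ = ((ε * δ : ℝ) : ℂ) * Complex.I := by
        simp [approach]
      have e2 := Complex.abs_im_le_norm ((w : ℂ) - approach ε z δ)
      rw [Complex.sub_im, approach_im, Complex.ofReal_im, zero_sub, neg_neg] at e2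
      rw [e1, norm_mul, Complex.norm_I, mul_one, Complex.norm_real, Real.norm_eq_abs]
      exact e2
    · have hne : ∀ᵐ w ∂halfLine, w ≠ z := ae_restrict_of_ae (by simp [ae_iff])
      filter_upwards [hne] with w hw
      have hwz : (w : ℂ) - z ≠ 0 := sub_ne_zero.mpr (by exact_mod_cast hw)
      have h3 := tendsto_approach ε z
      have h4 := ((h3.const_sub (z : ℂ)).div (h3.const_sub (w : ℂ)) hwz).const_mul (P w)
      simpa using h4
  rw [integral_zero] at h2
  refine h2.congr' ?_
  filter_upwards [self_mem_nhdsWithin] with δ hδ using (h1 δ hδ).symm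

lemma polyGrowth_airyFam (s : ℝ) (d : ℕ) (z : ℝ) : PolyGrowth fun t => airyD d (z + (s + t : ℝ)) := by
  have h := polyGrowth_airyD d (z + s)
  have e : (fun t : ℝ => airyD d (z + (s + t : ℝ))) = fun t : ℝ => airyD d ((z + s + t : ℝ) : ℂ) := by
    funext t; push_cast; ring_nf
  rwa [e]

/-- The kernel identity behind `N = X M`, for the boundary values on the contour. -/
lemma integral_cKerSide_mul (hσ : FiniteMoments σ) {ε : ℝ} (hε : ε = 1 ∨ ε = -1) (s : ℝ) (d : ℕ)
    {z : ℝ} (hz : 0 < z) (x : ℝ) :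
    (∫ t, cKerSide (resFam σ s d) (airyFam s 1) ε z x t * airyD 0 (z + (s + t : ℝ)) ∂σ) -
        ∫ t, cKerSide (resFam σ s d) (airyFam s 0) ε z x t * airyD 1 (z + (s + t : ℝ)) ∂σ =
      -pair (kerRow σ 0 0 s z) (resVec σ d s x) := by
  have hp := decayFamily_resFam hσ s d
  have hlim : ∀ e e' : ℕ, Tendsto (fun δ : ℝ => ∫ t, cKer (resFam σ s d) (airyFam s e)
      (approach ε z δ) x t * airyD e' (z + (s + t : ℝ)) ∂σ) (𝓝[>] 0)
      (𝓝 (∫ t, cKerSide (resFam σ s d) (airyFam s e) ε z x t * airyD e' (z + (s + t : ℝ)) ∂σ)) := by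
    intro e e'
    have hq := decayFamily_airyFam s e
    obtain ⟨c, a, hc, hb⟩ := norm_cKer_le hp hq hz
    obtain ⟨hc', C', a', hC', hb'⟩ := polyGrowth_airyFam s e' z
    refine tendsto_integral_filter_of_dominated_convergence
      (fun t => c * (1 + |x|) ^ a * C' * (1 + |t|) ^ (a + a')) ?_ ?_ ((hσ (a + a')).const_mul _) ?_
    · exact Eventually.of_forall fun δ => (((measurable_cKer hp hq _).comp
        measurable_prodMk_left).mul hc'.measurable).aestronglyMeasurable
    · filter_upwards [self_mem_nhdsWithin] with δ hδ
      refine Eventually.of_forall fun t => ?_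
      have h1 := hb _ (approach_mem hε z hδ).1 (le_norm_approach ε hz.le δ) x t
      have h2 : c / (1 + ‖approach ε z δ‖) ≤ c :=
        div_le_self hc (by linarith [norm_nonneg (approach ε z δ)])
      rw [norm_mul]
      calc _ ≤ (c * (1 + |x|) ^ a * (1 + |t|) ^ a) * (C' * (1 + |t|) ^ a') := by
            gcongr
            · exact h1.trans (by gcongr)
            · exact hb' t
        _ = _ := by rw [pow_add]; ring
    · refine Eventually.of_forall fun t => Tendsto.mul_const _ ?_
      have h1 := continuousOn_cKerSide hp hq hε x t z ⟨by exact_mod_cast hz.ne', by simp⟩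
      have h2 : Tendsto (approach ε z) (𝓝[>] 0) (𝓝[{l | l ≠ 0 ∧ ε * l.im ≤ 0}] (z : ℂ)) := by
        refine tendsto_nhdsWithin_iff.mpr ⟨tendsto_approach ε z, ?_⟩
        filter_upwards [self_mem_nhdsWithin] with δ hδ
        refine ⟨norm_pos_iff.mp (hz.trans_le (le_norm_approach ε hz.le δ)),
          (approach_mem hε z hδ).2.le⟩
      refine (h1.tendsto.comp h2).congr' ?_
      filter_upwards [self_mem_nhdsWithin] with δ hδ
      exact (cKer_eq_cKerSide hp hq hε (approach_mem hε z hδ).1 (approach_mem hε z hδ).2.le x t).symm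
  -- The identity off the contour holds along the approach to z. Its left side tends to the
  -- integrals of the boundary values, and the term with z - l tends to 0.
  have h1 := (hlim 1 0).sub (hlim 0 1)
  have h2 := (tendsto_quot_approach (σ := σ) hε z s x d).sub_const
    (pair (kerRow σ 0 0 s z) (resVec σ d s x))
  rw [zero_sub] at h2
  refine tendsto_nhds_unique h1 (h2.congr' ?_)
  filter_upwards [self_mem_nhdsWithin] with δ hδ
  exact (hσ.admissible.integral_cKer_mul hσ s d (hσ.admissible.real z) (approach_mem hε z hδ).1
    x).symm

end AiryLax
end

noncomputable section
namespace AiryLax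

variable {σ : Measure ℝ} [IsProbabilityMeasure σ] {Z : Set ℂ}

set_option linter.unusedSectionVars false

/-! ### The operators `X` and `X⁻¹` -/

lemma X₀_eq (hσ : FiniteMoments σ) (s : ℝ) (l : ℂ) (x y : ℝ) (i j : Fin 2) :
    X₀ σ s l x y i j = sgn j * cKer (resFam σ s (1 - i)) (airyFam s j) l x y := by
  change (∫ w in Ioi (0 : ℝ), sgn j * n σ s i w x * k s j w y / (w - l)) = _
  rw [cKer, cauchy, ← integral_const_mul]
  refine integral_congr_ae (Eventually.of_forall fun w => ?_)
  simp only [n_eq hσ, k_eq, prodFam, resFam, airyFam, Matrix.cons_val_zero, add_zero]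
  ring

lemma Xinv₀_eq (hσ : FiniteMoments σ) (s : ℝ) (l : ℂ) (x y : ℝ) (i j : Fin 2) :
    Xinv₀ σ s l x y i j = -sgn j * cKer (airyFam s (1 - i)) (resFam σ s j) l x y := by
  change (-∫ w in Ioi (0 : ℝ), sgn j * m s i w x * ell σ s j w y / (w - l)) = _
  rw [cKer, cauchy, neg_mul, ← integral_const_mul]
  congr 1
  refine integral_congr_ae (Eventually.of_forall fun w => ?_)
  simp only [ell_eq hσ, m_eq, prodFam, resFam, airyFam, Matrix.cons_val_zero, add_zero]
  ring

lemma polyKer_cKer {p q : ℕ → ℝ → ℝ → ℂ} (hp : DecayFamily p) (hq : DecayFamily q) {l : ℂ}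
    (hl : l ∈ cutᶜ) : PolyKer (cKer p q l) := by
  have hl0 : l ≠ 0 := by rintro rfl; exact hl ⟨by simp, by simp⟩
  obtain ⟨c, a, hc, hb⟩ := norm_cKer_le hp hq (norm_pos_iff.mpr hl0)
  exact ⟨measurable_cKer hp hq l, c / (1 + ‖l‖), a, by positivity, hb l hl le_rfl⟩

lemma polyKer_cKerSide {p q : ℕ → ℝ → ℝ → ℂ} (hp : DecayFamily p) (hq : DecayFamily q) {ε : ℝ}
    (hε : ε = 1 ∨ ε = -1) {l : ℂ} (hl : l ≠ 0) : PolyKer (cKerSide p q ε l) :=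
  ⟨measurable_cKerSide hp hq ε l, norm_cKerSide_le hp hq hε hl⟩

lemma polyKer_X₀ (hσ : FiniteMoments σ) (s : ℝ) {l : ℂ} (hl : l ∈ cutᶜ) (i j : Fin 2) :
    PolyKer fun x y => X₀ σ s l x y i j := by
  simp only [X₀_eq hσ]
  exact (polyKer_cKer (decayFamily_resFam hσ s _) (decayFamily_airyFam s _) hl).const_mul _

lemma polyKer_Xinv₀ (hσ : FiniteMoments σ) (s : ℝ) {l : ℂ} (hl : l ∈ cutᶜ) (i j : Fin 2) :
    PolyKer fun x y => Xinv₀ σ s l x y i j := by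
  simp only [Xinv₀_eq hσ]
  exact (polyKer_cKer (decayFamily_airyFam s _) (decayFamily_resFam hσ s _) hl).const_mul _

lemma polyOp_X (hσ : FiniteMoments σ) (s : ℝ) {l : ℂ} (hl : l ∈ cutᶜ) : PolyOp (X σ s l) :=
  polyOp_onePlus (polyKer_X₀ hσ s hl)

lemma polyOp_Xinv (hσ : FiniteMoments σ) (s : ℝ) {l : ℂ} (hl : l ∈ cutᶜ) : PolyOp (Xinv σ s l) :=
  polyOp_onePlus (polyKer_Xinv₀ hσ s hl)

lemma onePlus_comp_onePlus_eq {K L P : Ker} (h : ∀ x y i j, L x y i j + K x y i j +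
    (∫ t, (K x t i 0 * L t y 0 j + K x t i 1 * L t y 1 j) ∂σ) = P x y i j) :
    comp σ (onePlus K) (onePlus L) = onePlus P := by
  refine Prod.ext (funext fun x => Matrix.mul_one _) (funext fun x => funext fun y => ?_)
  rw [comp_snd]
  ext i j
  rw [← show _ = (onePlus P).2 x y i j from h x y i j]
  simp only [onePlus, one_mul, mul_one, Matrix.add_apply, matInt, Matrix.of_apply, Matrix.mul_apply,
    Fin.sum_univ_two]

lemma X_comp_Xinv (hσ : FiniteMoments σ) (s : ℝ) {l : ℂ} (hl : l ∈ cutᶜ) :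
    comp σ (X σ s l) (Xinv σ s l) = onePlus 0 := by
  refine onePlus_comp_onePlus_eq fun x y i j => ?_
  have hA := fun d => decayFamily_airyFam s d
  have hR := fun d => decayFamily_resFam hσ s d
  have hi := fun k : ℕ => ((((polyKer_cKer (hR (1 - i)) (hA k) hl).left x).mul
    ((polyKer_cKer (hA (1 - k)) (hR j) hl).right y)).integrable hσ)
  have key := integral_cKer_right_inverse hσ s (1 - i) j hl x y
  have e : ∀ t, X₀ σ s l x t i 0 * Xinv₀ σ s l t y 0 j + X₀ σ s l x t i 1 * Xinv₀ σ s l t y 1 j =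
      -sgn j * (cKer (resFam σ s (1 - i)) (airyFam s 0) l x t * cKer (airyFam s 1) (resFam σ s j) l t y -
      cKer (resFam σ s (1 - i)) (airyFam s 1) l x t * cKer (airyFam s 0) (resFam σ s j) l t y) := by
    intro t
    simp only [X₀_eq hσ, Xinv₀_eq hσ]
    simp [sgn]
    ring
  simp only [e]
  rw [integral_const_mul, integral_sub (hi 0) (hi 1), key, X₀_eq hσ, Xinv₀_eq hσ]
  simp only [Pi.zero_apply, Matrix.zero_apply]
  ring

lemma Xinv_comp_X (hσ : FiniteMoments σ) (s : ℝ) {l : ℂ} (hl : l ∈ cutᶜ) :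
    comp σ (Xinv σ s l) (X σ s l) = onePlus 0 := by
  refine onePlus_comp_onePlus_eq fun x y i j => ?_
  have hA := fun d => decayFamily_airyFam s d
  have hR := fun d => decayFamily_resFam hσ s d
  have hi := fun k : ℕ => ((((polyKer_cKer (hA (1 - i)) (hR k) hl).left x).mul
    ((polyKer_cKer (hR (1 - k)) (hA j) hl).right y)).integrable hσ)
  have key := integral_cKer_left_inverse hσ s (1 - i) j hl x y
  have e : ∀ t, Xinv₀ σ s l x t i 0 * X₀ σ s l t y 0 j + Xinv₀ σ s l x t i 1 * X₀ σ s l t y 1 j =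
      -sgn j * (cKer (airyFam s (1 - i)) (resFam σ s 0) l x t * cKer (resFam σ s 1) (airyFam s j) l t y -
      cKer (airyFam s (1 - i)) (resFam σ s 1) l x t * cKer (resFam σ s 0) (airyFam s j) l t y) := by
    intro t
    simp only [X₀_eq hσ, Xinv₀_eq hσ]
    simp [sgn]
    ring
  simp only [e]
  rw [integral_const_mul, integral_sub (hi 0) (hi 1), key, X₀_eq hσ, Xinv₀_eq hσ]
  simp only [Pi.zero_apply, Matrix.zero_apply]
  ring

/-! ### Boundary values -/

/-- The boundary values of `X₀` from the half plane `ε Im l < 0`. -/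
def XSide (σ : Measure ℝ) (s ε : ℝ) (l : ℂ) : Ker := fun x y =>
  Matrix.of fun i j => sgn j * cKerSide (resFam σ s (1 - i)) (airyFam s j) ε l x y

/-- The boundary values of `Xinv₀` from the half plane `ε Im l < 0`. -/
def XinvSide (σ : Measure ℝ) (s ε : ℝ) (l : ℂ) : Ker := fun x y =>
  Matrix.of fun i j => -sgn j * cKerSide (airyFam s (1 - i)) (resFam σ s j) ε l x y

/-- The open half plane `ε Im l < 0`. -/
def sideSet (ε : ℝ) : Set ℂ := {l | ε * l.im < 0}

lemma upper_eq : upper = sideSet (-1) := by ext l; simp [upper, sideSet]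

lemma lower_eq : lower = sideSet 1 := by ext l; simp [lower, sideSet]

lemma sideSet_subset (ε : ℝ) : sideSet ε ⊆ cutᶜ := fun l hl => by
  refine mem_compl_cut_of_im fun h => ?_
  simp [sideSet, h] at hl

lemma neBot_sideSet {ε : ℝ} (hε : ε = 1 ∨ ε = -1) (z : ℝ) : (𝓝[sideSet ε] (z : ℂ)).NeBot := by
  have h : Tendsto (approach ε z) (𝓝[>] 0) (𝓝[sideSet ε] (z : ℂ)) :=
    tendsto_nhdsWithin_iff.mpr ⟨tendsto_approach ε z, by
      filter_upwards [self_mem_nhdsWithin] with δ hδ using (approach_mem hε z hδ).2⟩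
  exact h.neBot

lemma tendsto_cKer_side {p q : ℕ → ℝ → ℝ → ℂ} (hp : DecayFamily p) (hq : DecayFamily q) {ε : ℝ}
    (hε : ε = 1 ∨ ε = -1) {z : ℝ} (hz : 0 < z) (x y : ℝ) :
    Tendsto (fun l => cKer p q l x y) (𝓝[sideSet ε] (z : ℂ)) (𝓝 (cKerSide p q ε z x y)) := by
  have h1 := continuousOn_cKerSide hp hq hε x y z ⟨by exact_mod_cast hz.ne', by simp⟩
  have hsub : sideSet ε ⊆ {l : ℂ | l ≠ 0 ∧ ε * l.im ≤ 0} := fun l hl =>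
    ⟨fun h => by rw [h] at hl; simp [sideSet] at hl, le_of_lt hl⟩
  refine (h1.tendsto.mono_left (nhdsWithin_mono _ hsub)).congr' ?_
  filter_upwards [self_mem_nhdsWithin] with l hl
  exact (cKer_eq_cKerSide hp hq hε (sideSet_subset ε hl) (le_of_lt hl) x y).symm

lemma isBoundaryValue_XSide (hσ : FiniteMoments σ) (s : ℝ) {ε : ℝ} (hε : ε = 1 ∨ ε = -1) {z : ℝ}
    (hz : 0 < z) : IsBoundaryValue (X₀ σ s) (sideSet ε) z (XSide σ s ε z) := fun x y i j => by
  simp only [X₀_eq hσ]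
  exact (tendsto_cKer_side (decayFamily_resFam hσ s _) (decayFamily_airyFam s _) hε hz x y).const_mul _

lemma isBoundaryValue_XinvSide (hσ : FiniteMoments σ) (s : ℝ) {ε : ℝ} (hε : ε = 1 ∨ ε = -1) {z : ℝ}
    (hz : 0 < z) : IsBoundaryValue (Xinv₀ σ s) (sideSet ε) z (XinvSide σ s ε z) := fun x y i j => by
  simp only [Xinv₀_eq hσ]
  exact (tendsto_cKer_side (decayFamily_airyFam s _) (decayFamily_resFam hσ s _) hε hz x y).const_mul _

lemma isBoundaryValue_unique {K : ℂ → Ker} {ε : ℝ} (hε : ε = 1 ∨ ε = -1) {z : ℝ} {A B : Ker}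
    (hA : IsBoundaryValue K (sideSet ε) z A) (hB : IsBoundaryValue K (sideSet ε) z B) : A = B := by
  have := neBot_sideSet hε z
  funext x y
  ext i j
  exact tendsto_nhds_unique (hA x y i j) (hB x y i j)

lemma polyKer_XSide (hσ : FiniteMoments σ) (s : ℝ) {ε : ℝ} (hε : ε = 1 ∨ ε = -1) {l : ℂ}
    (hl : l ≠ 0) (i j : Fin 2) : PolyKer fun x y => XSide σ s ε l x y i j :=
  (polyKer_cKerSide (decayFamily_resFam hσ s _) (decayFamily_airyFam s _) hε hl).const_mul _

lemma polyKer_XinvSide (hσ : FiniteMoments σ) (s : ℝ) {ε : ℝ} (hε : ε = 1 ∨ ε = -1) {l : ℂ}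
    (hl : l ≠ 0) (i j : Fin 2) : PolyKer fun x y => XinvSide σ s ε l x y i j :=
  (polyKer_cKerSide (decayFamily_airyFam s _) (decayFamily_resFam hσ s _) hε hl).const_mul _

/-- `X_± M = N`. -/
lemma integral_XSide_mul (hσ : FiniteMoments σ) (s : ℝ) {ε : ℝ} (hε : ε = 1 ∨ ε = -1) {z : ℝ}
    (hz : 0 < z) (x : ℝ) (i : Fin 2) :
    ∫ t, (XSide σ s ε z x t i 0 * m s 0 z t + XSide σ s ε z x t i 1 * m s 1 z t) ∂σ =
      n σ s i z x - m s i z x := by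
  have hz0 : (z : ℂ) ≠ 0 := by exact_mod_cast hz.ne'
  have hi : ∀ e e' : ℕ, Integrable (fun t => cKerSide (resFam σ s (1 - i)) (airyFam s e) ε z x t *
      airyD e' (z + (s + t : ℝ))) σ := fun e e' =>
    (((polyKer_cKerSide (decayFamily_resFam hσ s _) (decayFamily_airyFam s e) hε hz0).left x).mul
      (polyGrowth_airyFam s e' z).polyFun).integrable hσ
  have key := integral_cKerSide_mul hσ hε s (1 - i) hz x
  have e : ∀ t, XSide σ s ε z x t i 0 * m s 0 z t + XSide σ s ε z x t i 1 * m s 1 z t =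
      -(cKerSide (resFam σ s (1 - i)) (airyFam s 1) ε z x t * airyD 0 (z + (s + t : ℝ)) -
        cKerSide (resFam σ s (1 - i)) (airyFam s 0) ε z x t * airyD 1 (z + (s + t : ℝ))) := by
    intro t
    simp [XSide, m_eq, sgn]
    ring
  simp only [e]
  rw [integral_neg, integral_sub (hi 1 0) (hi 0 1), key, n_eq hσ, m_eq, resFun]
  simp

/-- `K X⁻¹_± = L`. -/
lemma integral_mul_XinvSide (hσ : FiniteMoments σ) (s : ℝ) {ε : ℝ} (hε : ε = 1 ∨ ε = -1) {z : ℝ}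
    (hz : 0 < z) (y : ℝ) (j : Fin 2) :
    ∫ t, (sgn 0 * k s 0 z t * XinvSide σ s ε z t y 0 j + sgn 1 * k s 1 z t * XinvSide σ s ε z t y 1 j) ∂σ =
      sgn j * (ell σ s j z y - k s j z y) := by
  have hz0 : (z : ℂ) ≠ 0 := by exact_mod_cast hz.ne'
  have hsymm : ∀ (e : ℕ) t, cKerSide (airyFam s e) (resFam σ s j) ε z t y =
      cKerSide (resFam σ s j) (airyFam s e) ε z y t := by
    intro e t
    have h1 := tendsto_cKer_side (decayFamily_airyFam s e) (decayFamily_resFam hσ s j) hε hz t y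
    have h2 := tendsto_cKer_side (decayFamily_resFam hσ s j) (decayFamily_airyFam s e) hε hz y t
    have := neBot_sideSet hε z
    refine tendsto_nhds_unique h1 (h2.congr fun l => ?_)
    refine integral_congr_ae (Eventually.of_forall fun w => ?_)
    simp only [prodFam, Matrix.cons_val_zero]
    ring
  have hi : ∀ e e' : ℕ, Integrable (fun t => cKerSide (resFam σ s j) (airyFam s e) ε z y t *
      airyD e' (z + (s + t : ℝ))) σ := fun e e' =>
    (((polyKer_cKerSide (decayFamily_resFam hσ s _) (decayFamily_airyFam s e) hε hz0).left y).mul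
      (polyGrowth_airyFam s e' z).polyFun).integrable hσ
  have key := integral_cKerSide_mul hσ hε s j hz y
  have e : ∀ t, sgn 0 * k s 0 z t * XinvSide σ s ε z t y 0 j +
      sgn 1 * k s 1 z t * XinvSide σ s ε z t y 1 j =
      -sgn j * (cKerSide (resFam σ s j) (airyFam s 1) ε z y t * airyD 0 (z + (s + t : ℝ)) -
        cKerSide (resFam σ s j) (airyFam s 0) ε z y t * airyD 1 (z + (s + t : ℝ))) := by
    intro t
    simp [XinvSide, k_eq, sgn, hsymm]
    ring
  simp only [e]
  rw [integral_const_mul, integral_sub (hi 1 0) (hi 0 1), key, ell_eq hσ, k_eq, resFun]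
  simp

/-- The kernel entries of G - 1 are products m_i(z|x)(± k_j(z|y)), so X₋(G - 1) only needs X₋M = N,
and the resulting 2πi n_i(z|x)(± k_j(z|y)) is the Plemelj jump of X. -/
lemma XSide_jump (hσ : FiniteMoments σ) (s : ℝ) {z : ℝ} (hz : 0 < z) :
    onePlus (XSide σ s (-1) z) = comp σ (onePlus (XSide σ s 1 z)) (onePlus (G₀ s z)) := by
  symm
  refine onePlus_comp_onePlus_eq fun x y i j => ?_
  have e : ∀ t, XSide σ s 1 z x t i 0 * G₀ s z t y 0 j + XSide σ s 1 z x t i 1 * G₀ s z t y 1 j =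
      2 * Real.pi * Complex.I * (sgn j * k s j z y) *
        (XSide σ s 1 z x t i 0 * m s 0 z t + XSide σ s 1 z x t i 1 * m s 1 z t) := by
    intro t
    simp only [G₀, Matrix.of_apply]
    ring
  simp only [e]
  rw [integral_const_mul, integral_XSide_mul hσ s (Or.inl rfl) hz]
  have key := cKerSide_sub (decayFamily_resFam hσ s (1 - i)) (decayFamily_airyFam s j) hz x y
  have h1 : resFam σ s (1 - i) 0 z x = n σ s i z x := (n_eq hσ s i z x).symm
  have h2 : airyFam s j 0 z y = k s j z y := (k_eq s j z y).symm
  rw [h1, h2] at key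
  simp only [G₀, XSide, Matrix.of_apply]
  linear_combination -sgn j * key

/-- `(1 + G₀) X⁻¹₊ = X⁻¹₋`. -/
lemma XinvSide_jump (hσ : FiniteMoments σ) (s : ℝ) {z : ℝ} (hz : 0 < z) :
    comp σ (onePlus (G₀ s z)) (onePlus (XinvSide σ s (-1) z)) = onePlus (XinvSide σ s 1 z) := by
  refine onePlus_comp_onePlus_eq fun x y i j => ?_
  have e : ∀ t, G₀ s z x t i 0 * XinvSide σ s (-1) z t y 0 j +
      G₀ s z x t i 1 * XinvSide σ s (-1) z t y 1 j =
      2 * Real.pi * Complex.I * m s i z x * (sgn 0 * k s 0 z t * XinvSide σ s (-1) z t y 0 j +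
        sgn 1 * k s 1 z t * XinvSide σ s (-1) z t y 1 j) := by
    intro t
    simp only [G₀, Matrix.of_apply]
    ring
  simp only [e]
  rw [integral_const_mul, integral_mul_XinvSide hσ s (Or.inr rfl) hz]
  have key := cKerSide_sub (decayFamily_airyFam s (1 - i)) (decayFamily_resFam hσ s j) hz x y
  have h1 : resFam σ s j 0 z y = ell σ s j z y := (ell_eq hσ s j z y).symm
  have h2 : airyFam s (1 - i) 0 z x = m s i z x := (m_eq s i z x).symm
  rw [h1, h2] at key
  simp only [G₀, XinvSide, Matrix.of_apply]
  linear_combination -sgn j * key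

lemma norm_sgn (j : Fin 2) : ‖sgn j‖ = 1 := by fin_cases j <;> simp [sgn]

lemma memLp_n (hσ : FiniteMoments σ) (s : ℝ) (i : Fin 2) (z : ℝ) : MemLp (fun x => n σ s i z x) 2 σ := by
  simp only [n_eq hσ]
  exact hσ.admissible.memLp_resFun hσ (1 - i) s (hσ.admissible.real z)

/-- `X` solves the Hilbert boundary value problem. -/
lemma solvesHilbertProblem_X₀ (hσ : FiniteMoments σ) (s : ℝ) : SolvesHilbertProblem σ s (X₀ σ s) := by
  have hA := fun j : Fin 2 => decayFamily_airyFam s j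
  have hR := fun i : Fin 2 => decayFamily_resFam hσ s (1 - i)
  refine ⟨⟨fun x i j => analyticOnNhd_const, fun x y i j => ?_, fun z hz =>
    isHS_of_polyKer hσ (polyKer_X₀ hσ s hz)⟩, ⟨fun z : ℝ => XSide σ s (-1) z, fun z : ℝ => XSide σ s 1 z,
      fun x y i j => ?_, fun z hz => ?_⟩, ⟨fun i x => n σ s i 0 x, fun i => memLp_n hσ s i 0, 1,
        one_pos, ?_⟩, fun r hr => ?_⟩
  · refine DifferentiableOn.analyticOnNhd ?_ isClosed_cut.isOpen_compl
    change DifferentiableOn ℂ (fun z => X₀ σ s z x y i j) cutᶜ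
    simp only [X₀_eq hσ]
    exact (differentiableOn_cKer (hR i) (hA j) x y).const_mul _
  · have h : ∀ ε : ℝ, ε = 1 ∨ ε = -1 → ContinuousOn (fun z : ℝ => XSide σ s ε z x y i j) (Ioi 0) := by
      intro ε hε
      have h1 : ContinuousOn (fun z : ℝ => (z : ℂ)) (Ioi 0) := Complex.continuous_ofReal.continuousOn
      exact continuousOn_const.mul ((continuousOn_cKerSide (hR i) (hA j) hε x y).comp h1
        fun z hz => ⟨by exact_mod_cast (ne_of_gt hz), by simp⟩)
    exact ⟨h _ (Or.inr rfl), h _ (Or.inl rfl)⟩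
  · have hz0 : (z : ℂ) ≠ 0 := by exact_mod_cast hz.ne'
    refine ⟨isHS_of_polyKer hσ (polyKer_XSide hσ s (Or.inr rfl) hz0),
      isHS_of_polyKer hσ (polyKer_XSide hσ s (Or.inl rfl) hz0), ?_, ?_, XSide_jump hσ s hz⟩
    · rw [upper_eq]; exact isBoundaryValue_XSide hσ s (Or.inr rfl) hz
    · rw [lower_eq]; exact isBoundaryValue_XSide hσ s (Or.inl rfl) hz
  · choose c a hc hb using fun i j => norm_cKer_add_le (hR i) (hA j)
    refine ⟨∑ i, ∑ j, c i j, ∑ i, ∑ j, a i j, fun z hz hz1 x y i j => ?_⟩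
    have h1 : resFam σ s (1 - i) 0 0 x = n σ s i 0 x := by rw [n_eq hσ]; simp [resFam]
    have h2 : airyFam s j 0 0 y = k s j 0 y := by rw [k_eq]; simp [airyFam]
    have h3 := hb i j z hz hz1 x y
    rw [h1, h2] at h3
    have e : X₀ σ s z x y i j + sgn j * n σ s i 0 x * k s j 0 y * Complex.log (-z) =
        sgn j * (cKer (resFam σ s (1 - i)) (airyFam s j) z x y +
          n σ s i 0 x * k s j 0 y * Complex.log (-z)) := by rw [X₀_eq hσ]; ring
    rw [e, norm_mul, norm_sgn, one_mul]
    refine h3.trans ?_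
    have hc' : c i j ≤ ∑ i, ∑ j, c i j :=
      (Finset.single_le_sum (f := fun j => c i j) (fun j _ => hc i j) (Finset.mem_univ j)).trans
        (Finset.single_le_sum (f := fun i => ∑ j, c i j)
          (fun i _ => Finset.sum_nonneg fun j _ => hc i j) (Finset.mem_univ i))
    have ha' : a i j ≤ ∑ i, ∑ j, a i j :=
      (Finset.single_le_sum (f := fun j => a i j) (fun j _ => Nat.zero_le _) (Finset.mem_univ j)).trans
        (Finset.single_le_sum (f := fun i => ∑ j, a i j)
          (fun i _ => Nat.zero_le _) (Finset.mem_univ i))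
    have hc0 := (hc i j).trans hc'
    gcongr
    · linarith [abs_nonneg x]
    · linarith [abs_nonneg y]
  · choose c a hc hb using fun i j => norm_cKer_le (hR i) (hA j) hr
    refine ⟨∑ i, ∑ j, c i j, ∑ i, ∑ j, a i j, fun z hz hzr x y i j => ?_⟩
    have h3 := hb i j z hz hzr x y
    rw [X₀_eq hσ, norm_mul, norm_sgn, one_mul]
    refine h3.trans ?_
    have hc' : c i j ≤ ∑ i, ∑ j, c i j :=
      (Finset.single_le_sum (f := fun j => c i j) (fun j _ => hc i j) (Finset.mem_univ j)).trans
        (Finset.single_le_sum (f := fun i => ∑ j, c i j)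
          (fun i _ => Finset.sum_nonneg fun j _ => hc i j) (Finset.mem_univ i))
    have ha' : a i j ≤ ∑ i, ∑ j, a i j :=
      (Finset.single_le_sum (f := fun j => a i j) (fun j _ => Nat.zero_le _) (Finset.mem_univ j)).trans
        (Finset.single_le_sum (f := fun i => ∑ j, a i j)
          (fun i _ => Nat.zero_le _) (Finset.mem_univ i))
    have hc0 := (hc i j).trans hc'
    gcongr
    · linarith [abs_nonneg x]
    · linarith [abs_nonneg y]

/-! ### The column `N` -/

/-- Both cases of the definition are restrictions of one function. On the half line this is `n_eq`;
off it, the kernel identity is used at l = z, where the term with z - l drops out. -/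
lemma Admissible.N_eq (hZ : Admissible σ Z) (hσ : FiniteMoments σ) (s : ℝ) {z : ℂ} (hz : z ∈ Z)
    (x : ℝ) (i : Fin 2) : N σ s z x i = resFun σ 0 (1 - i) s z x := by
  by_cases hc : z ∈ cut
  · obtain ⟨r, hr, rfl⟩ := mem_cut.mp hc
    rw [N, if_pos hc, n_eq hσ, Complex.ofReal_re]
  · rw [N, if_neg hc]
    change (1 *ᵥ M s z x) i + ∫ y, (X₀ σ s z x y *ᵥ M s z y) i ∂σ = _
    have hi : ∀ e e' : ℕ, Integrable (fun t => cKer (resFam σ s (1 - i)) (airyFam s e) z x t *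
        airyD e' (z + (s + t : ℝ))) σ := fun e e' =>
      (((polyKer_cKer (decayFamily_resFam hσ s _) (decayFamily_airyFam s e) hc).left x).memLp
        hσ).integrable_mul (hZ.memLp_airyD e' s hz)
    have key := hZ.integral_cKer_mul hσ s (1 - i) hz hc x
    have e : ∀ t, (X₀ σ s z x t *ᵥ M s z t) i =
        -(cKer (resFam σ s (1 - i)) (airyFam s 1) z x t * airyD 0 (z + (s + t : ℝ)) -
          cKer (resFam σ s (1 - i)) (airyFam s 0) z x t * airyD 1 (z + (s + t : ℝ))) := by
      intro t
      simp [Matrix.mulVec, dotProduct, Fin.sum_univ_two, X₀_eq hσ, M, m_eq, sgn]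
      ring
    simp only [e]
    rw [integral_neg, integral_sub (hi 1 0) (hi 0 1), key, Matrix.one_mulVec, M, m_eq, resFun]
    simp

lemma N_eq_apply_boundary (hσ : FiniteMoments σ) (s : ℝ) {z : ℝ} (hz : 0 < z) {Xb : Ker}
    (hb : IsBoundaryValue (X₀ σ s) upper z Xb ∨ IsBoundaryValue (X₀ σ s) lower z Xb) :
    N σ s z = AiryLax.apply σ (onePlus Xb) (M s z) := by
  obtain ⟨ε, hε, rfl⟩ : ∃ ε : ℝ, (ε = 1 ∨ ε = -1) ∧ Xb = XSide σ s ε z := by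
    rcases hb with h | h
    · rw [upper_eq] at h
      exact ⟨-1, Or.inr rfl, isBoundaryValue_unique (Or.inr rfl) h
        (isBoundaryValue_XSide hσ s (Or.inr rfl) hz)⟩
    · rw [lower_eq] at h
      exact ⟨1, Or.inl rfl, isBoundaryValue_unique (Or.inl rfl) h
        (isBoundaryValue_XSide hσ s (Or.inl rfl) hz)⟩
  funext x i
  rw [hσ.admissible.N_eq hσ s (hσ.admissible.real z), ← n_eq hσ]
  change _ = (1 *ᵥ M s z x) i + ∫ y, (XSide σ s ε z x y *ᵥ M s z y) i ∂σ
  rw [Matrix.one_mulVec]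
  have key := integral_XSide_mul hσ s hε hz x i
  simp only [Matrix.mulVec, dotProduct, Fin.sum_univ_two, M]
  rw [key]
  ring

end AiryLax
end

noncomputable section
namespace AiryLax

/-! ### Continuation across the half line -/

/-- **Morera's theorem** for a function that is holomorphic off the real line. -/
lemma differentiableOn_of_continuousOn_of_im_ne_zero {F : ℂ → ℂ} {U : Set ℂ} (hU : IsOpen U)
    (hc : ContinuousOn F U) (hd : DifferentiableOn ℂ F (U ∩ {l | l.im ≠ 0})) :
    DifferentiableOn ℂ F U := by
  refine (Complex.isConservativeOn_and_continuousOn_iff_isDifferentiableOn hU).mp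
    ⟨fun z w hzw => ?_, hc⟩
  rw [← add_eq_zero_iff_eq_neg, Complex.wedgeIntegral_add_wedgeIntegral_eq]
  have key : ∀ z' w' : ℂ, uIcc z'.re w'.re ×ℂ uIcc z'.im w'.im ⊆ U →
      (0 : ℝ) ∉ Ioo (min z'.im w'.im) (max z'.im w'.im) →
      (∫ x : ℝ in z'.re..w'.re, F (x + z'.im * Complex.I)) -
        (∫ x : ℝ in z'.re..w'.re, F (x + w'.im * Complex.I)) +
        Complex.I • (∫ y : ℝ in z'.im..w'.im, F (w'.re + y * Complex.I)) -
        Complex.I • (∫ y : ℝ in z'.im..w'.im, F (z'.re + y * Complex.I)) = 0 := by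
    intro z' w' hsub h0
    refine Complex.integral_boundary_rect_eq_zero_of_continuousOn_of_differentiableOn F z' w'
      (hc.mono hsub) (hd.mono fun l hl => ⟨hsub ?_, fun him => h0 (him ▸ hl.2)⟩)
    exact ⟨Ioo_subset_Icc_self hl.1, Ioo_subset_Icc_self hl.2⟩
  -- A rectangle crossed by the real axis is cut along it. Both halves have interiors free of real
  -- points, and the integrals over the common edge cancel.
  by_cases h0 : (0 : ℝ) ∈ Ioo (min z.im w.im) (max z.im w.im)
  · have h0' : (0 : ℝ) ∈ uIcc z.im w.im := Ioo_subset_Icc_self h0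
    have h1 := key z ⟨w.re, 0⟩ (fun l hl => hzw ⟨hl.1, uIcc_subset_uIcc_left h0' hl.2⟩)
      (by simp only [mem_Ioo, not_and, not_lt, min_lt_iff]; rintro (h | h)
          · exact max_le h.le le_rfl
          · exact absurd h (lt_irrefl _))
    have h2 := key ⟨z.re, 0⟩ w (fun l hl => hzw ⟨hl.1, uIcc_subset_uIcc_right h0' hl.2⟩)
      (by simp only [mem_Ioo, not_and, not_lt, min_lt_iff]; rintro (h | h)
          · exact absurd h (lt_irrefl _)
          · exact max_le le_rfl h.le)
    have hv : ∀ a ∈ uIcc z.re w.re, ∀ b ∈ uIcc z.im w.im,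
        IntervalIntegrable (fun y : ℝ => F (a + y * Complex.I)) volume b 0 := by
      intro a ha b hb
      refine ContinuousOn.intervalIntegrable (hc.comp (by fun_prop) fun y hy => hzw ⟨?_, ?_⟩)
      · simpa using ha
      · simpa using uIcc_subset_uIcc hb h0' hy
    dsimp only at h1 h2
    rw [← intervalIntegral.integral_add_adjacent_intervals
        (hv w.re right_mem_uIcc z.im left_mem_uIcc) (hv w.re right_mem_uIcc w.im right_mem_uIcc).symm,
      ← intervalIntegral.integral_add_adjacent_intervals
        (hv z.re left_mem_uIcc z.im left_mem_uIcc) (hv z.re left_mem_uIcc w.im right_mem_uIcc).symm,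
      smul_add, smul_add]
    linear_combination h1 + h2
  · exact key z w hzw h0

/-- A function holomorphic off `[0, ∞)` with equal boundary values from both sides, with an
integrable singularity at the origin and vanishing at infinity, is zero. -/
lemma eq_zero_of_boundary_values {W : ℂ → ℂ} (hW : DifferentiableOn ℂ W cutᶜ)
    (hb : ∀ z : ℝ, 0 < z → ∃ b, Tendsto W (𝓝[upper] (z : ℂ)) (𝓝 b) ∧
      Tendsto W (𝓝[lower] (z : ℂ)) (𝓝 b))
    {C : ℝ} (h0 : ∀ l ∈ cutᶜ, ‖l‖ < 1 → √‖l‖ * ‖W l‖ ≤ C)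
    (h1 : ∀ l ∈ cutᶜ, 1 ≤ ‖l‖ → ‖W l‖ ≤ C / (1 + ‖l‖)) {l : ℂ} (hl : l ∈ cutᶜ) : W l = 0 := by
  have hlim : ∀ z ∈ ({0}ᶜ : Set ℂ), ∃ b, Tendsto W (𝓝[cutᶜ] z) (𝓝 b) := by
    intro z hz
    by_cases hzc : z ∈ cutᶜ
    · exact ⟨W z, hW.continuousOn z hzc⟩
    obtain ⟨r, hr, rfl⟩ := mem_cut.mp (not_not.mp hzc)
    have hr : 0 < r := hr.lt_of_ne fun h => hz (by simp [← h])
    obtain ⟨b, hu, hlo⟩ := hb r hr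
    -- Near a point r > 0 the complement of the cut is covered by the upper and the lower side, so
    -- equal one-sided limits give a limit.
    refine ⟨b, (hu.sup hlo).mono_left ?_⟩
    rw [← nhdsWithin_union]
    refine nhdsWithin_le_of_mem ?_
    have hre : {l : ℂ | 0 < l.re} ∈ 𝓝 (r : ℂ) :=
      (isOpen_lt continuous_const Complex.continuous_re).mem_nhds (by simpa using hr)
    filter_upwards [mem_nhdsWithin_of_mem_nhds hre, self_mem_nhdsWithin] with v hv hvc
    rcases lt_trichotomy v.im 0 with h | h | h
    · exact Or.inr h
    · exact absurd (⟨le_of_lt hv, h⟩ : v ∈ cut) hvc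
    · exact Or.inl h
  have hclos : ∀ z : ℂ, z ∈ closure (cutᶜ : Set ℂ) := by
    intro z
    by_cases hz : z ∈ (cutᶜ : Set ℂ)
    · exact subset_closure hz
    obtain ⟨r, -, rfl⟩ := mem_cut.mp (not_not.mp hz)
    exact mem_closure_iff_nhdsWithin_neBot.mpr
      ((neBot_sideSet (Or.inl rfl) r).mono (nhdsWithin_mono _ (sideSet_subset 1)))
  set F := extendFrom cutᶜ W with hF
  have hFW : ∀ z ∈ (cutᶜ : Set ℂ), F z = W z := extendFrom_extends hW.continuousOn
  have hFlim : ∀ z ∈ ({0}ᶜ : Set ℂ), Tendsto W (𝓝[cutᶜ] z) (𝓝 (F z)) := by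
    intro z hz
    obtain ⟨b, hb⟩ := hlim z hz
    rwa [hF, extendFrom_eq (hclos z) hb]
  have hFc : ContinuousOn F {0}ᶜ := continuousOn_extendFrom (fun z _ => hclos z) hlim
  have hFd : DifferentiableOn ℂ F {0}ᶜ := by
    refine differentiableOn_of_continuousOn_of_im_ne_zero isOpen_compl_singleton hFc ?_
    exact (hW.mono fun l hl => mem_compl_cut_of_im hl.2).congr fun l hl =>
      hFW l (mem_compl_cut_of_im hl.2)
  have hFle : ∀ g : ℂ → ℝ, Continuous g → ∀ V : Set ℂ, IsOpen V → ∀ c : ℝ,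
      (∀ l ∈ cutᶜ, l ∈ V → g l * ‖W l‖ ≤ c) → ∀ l ∈ ({0}ᶜ : Set ℂ), l ∈ V → g l * ‖F l‖ ≤ c := by
    intro g hg V hV c h l hl hlV
    have := mem_closure_iff_nhdsWithin_neBot.mp (hclos l)
    refine le_of_tendsto (((hg.tendsto l).mono_left nhdsWithin_le_nhds).mul (hFlim l hl).norm) ?_
    filter_upwards [self_mem_nhdsWithin, mem_nhdsWithin_of_mem_nhds (hV.mem_nhds hlV)] with v h1 h2
    exact h v h1 h2
  have hF0 := hFle (fun l => √‖l‖) (by fun_prop) _ (isOpen_lt continuous_norm continuous_const) C h0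
  have hF1 := hFle (fun l => 1 + ‖l‖) (by fun_prop) {l : ℂ | 1 < ‖l‖}
    (isOpen_lt continuous_const continuous_norm) C (fun v hv h => by
      have := h1 v hv (le_of_lt h)
      rwa [le_div_iff₀ (by positivity), mul_comm] at this)
  -- F is O(‖z‖^(-1/2)), hence o(1/‖z‖), and the singularity at 0 is removable; the value F 0 enters
  -- only through the form of the criterion.
  have ho : (fun z => F z - F 0) =o[𝓝[≠] 0] fun z => (z - 0)⁻¹ := by
    have ht : Tendsto (fun z : ℂ => √‖z‖ * C + ‖z‖ * ‖F 0‖) (𝓝[≠] 0) (𝓝 0) := by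
      have h : Continuous fun z : ℂ => √‖z‖ * C + ‖z‖ * ‖F 0‖ := by fun_prop
      simpa using (h.tendsto 0).mono_left nhdsWithin_le_nhds
    rw [Asymptotics.isLittleO_iff]
    intro ε hε
    have hball : ∀ᶠ z : ℂ in 𝓝[≠] 0, ‖z‖ < 1 :=
      mem_nhdsWithin_of_mem_nhds ((isOpen_lt continuous_norm continuous_const).mem_nhds (by simp))
    filter_upwards [self_mem_nhdsWithin, hball, ht.eventually (gt_mem_nhds hε)] with z hz hz1 hzε
    have hzpos : 0 < ‖z‖ := norm_pos_iff.mpr hz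
    rw [sub_zero, norm_inv, ← div_eq_mul_inv, le_div_iff₀ hzpos]
    refine le_trans ?_ hzε.le
    have h2 := mul_le_mul_of_nonneg_left (hF0 z hz hz1) (Real.sqrt_nonneg ‖z‖)
    rw [← mul_assoc, Real.mul_self_sqrt hzpos.le] at h2
    have h3 := mul_le_mul_of_nonneg_left (norm_sub_le (F z) (F 0)) hzpos.le
    linarith
  have hG := Complex.differentiableOn_update_limUnder_of_isLittleO (s := univ) (c := (0 : ℂ)) (f := F)
    univ_mem (hFd.mono fun z hz => hz.2) ho
  have hl0 : l ≠ 0 := by rintro rfl; exact hl ⟨by simp, by simp⟩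
  -- Liouville: the extension is entire and tends to 0 at infinity.
  have h := Differentiable.apply_eq_of_tendsto_cocompact (differentiableOn_univ.mp hG) (c := 0) l ?_
  · rwa [Function.update_of_ne hl0, hFW l hl] at h
  · have hlarge : ∀ᶠ z : ℂ in cocompact ℂ, 1 < ‖z‖ :=
      (tendsto_norm_cocompact_atTop (E := ℂ)).eventually_gt_atTop 1
    have ht : Tendsto (fun z : ℂ => C / (1 + ‖z‖)) (cocompact ℂ) (𝓝 0) :=
      Tendsto.const_div_atTop (tendsto_atTop_add_const_left _ _ tendsto_norm_cocompact_atTop) C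
    refine squeeze_zero_norm' ?_ ht
    filter_upwards [hlarge] with z hz
    have hz0 : z ≠ 0 := norm_pos_iff.mp (by linarith)
    rw [Function.update_of_ne hz0, le_div_iff₀ (by positivity), mul_comm]
    exact hF1 z hz0 hz

end AiryLax
end

noncomputable section
namespace AiryLax

variable {σ : Measure ℝ} [IsProbabilityMeasure σ] {Z : Set ℂ}

set_option linter.unusedSectionVars false

/-! ### Uniqueness -/

/-- A weight comparable to `‖l‖ ^ (1 / 4)` at the origin and to `‖l‖` at infinity. -/
def wt (l : ℂ) : ℝ := √√(min ‖l‖ 1) * (1 + ‖l‖)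

lemma continuous_wt : Continuous wt := by unfold wt; fun_prop

lemma wt_nonneg (l : ℂ) : 0 ≤ wt l := by unfold wt; positivity

lemma wt_pos {l : ℂ} (hl : l ∈ cutᶜ) : 0 < wt l := by
  have hl0 : l ≠ 0 := by rintro rfl; exact hl ⟨by simp, by simp⟩
  have : 0 < ‖l‖ := norm_pos_iff.mpr hl0
  unfold wt
  positivity

/-- With u = ‖l‖^(1/4), the product u |log u| stays bounded on (0, 1). -/
lemma wt_mul_norm_log_le {l : ℂ} (hl : ‖l‖ < 1) : wt l * ‖Complex.log (-l)‖ ≤ 24 := by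
  set u := √√‖l‖ with hu
  have hu0 : 0 ≤ u := Real.sqrt_nonneg _
  have h1 : u ^ 2 = √‖l‖ := Real.sq_sqrt (Real.sqrt_nonneg _)
  have h4 : u ^ 4 = ‖l‖ := by
    rw [show u ^ 4 = (u ^ 2) ^ 2 by ring, h1, Real.sq_sqrt (norm_nonneg _)]
  have hu1 : u ≤ 1 := Real.sqrt_le_one.mpr (Real.sqrt_le_one.mpr hl.le)
  have hlog : ‖Complex.log (-l)‖ ≤ |Real.log ‖l‖| + Real.pi := by
    refine (Complex.norm_le_abs_re_add_abs_im _).trans ?_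
    rw [Complex.log_re, Complex.log_im, norm_neg]
    gcongr
    exact Complex.abs_arg_le_pi _
  rw [← h4, Real.log_pow, abs_mul] at hlog
  have h5 := mul_abs_log_le hu0
  have h6 : wt l ≤ u * 2 := by
    rw [wt, min_eq_left hl.le]
    gcongr
    linarith
  have h7 : u * ‖Complex.log (-l)‖ ≤ 12 := by
    have := mul_le_mul_of_nonneg_left hlog hu0
    have h8 : |((4 : ℕ) : ℝ)| = 4 := by norm_num
    rw [h8] at this
    nlinarith [Real.pi_lt_four, Real.pi_pos]
  calc _ ≤ u * 2 * ‖Complex.log (-l)‖ := by gcongr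
    _ ≤ _ := by linarith

/-- Holomorphic families of polynomially growing functions with at most a mild singularity at the
origin, decaying at infinity. -/
structure Tame (σ : Measure ℝ) (φ : ℂ → ℝ → ℂ) : Prop where
  differentiableOn : ∀ t, DifferentiableOn ℂ (fun l => φ l t) cutᶜ
  measurable : ∀ l ∈ cutᶜ, AEStronglyMeasurable (φ l) σ
  bound : ∃ (C : ℝ) (a : ℕ), 0 ≤ C ∧ ∀ l ∈ cutᶜ, ∀ t, wt l * ‖φ l t‖ ≤ C * (1 + |t|) ^ a

/-- Near 0 the weight absorbs the logarithm; for ‖l‖ at least min(ε, 1) its factor 1 + ‖l‖ cancels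
against the decay at infinity. -/
lemma tame_of_bounds {φ : ℂ → ℝ → ℂ} (hd : ∀ t, DifferentiableOn ℂ (fun l => φ l t) cutᶜ)
    (hm : ∀ l ∈ cutᶜ, AEStronglyMeasurable (φ l) σ) {f : ℝ → ℂ} (hf : PolyGrowth f) {ε : ℝ}
    (hε : 0 < ε) {c : ℝ} {a : ℕ} (h0 : ∀ l ∈ cutᶜ, ‖l‖ < ε → ∀ t,
      ‖φ l t + f t * Complex.log (-l)‖ ≤ c * (1 + |t|) ^ a)
    (h1 : ∀ r > 0, ∃ (c : ℝ) (a : ℕ), ∀ l ∈ cutᶜ, r ≤ ‖l‖ → ∀ t,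
      ‖φ l t‖ ≤ c / (1 + ‖l‖) * (1 + |t|) ^ a) : Tame σ φ := by
  obtain ⟨-, C', a', hC', hb'⟩ := hf
  obtain ⟨c₁, a₁, h1⟩ := h1 (min ε 1) (by positivity)
  refine ⟨hd, hm, 2 * |c| + 24 * C' + |c₁|, a + a' + a₁, by positivity, fun l hl t => ?_⟩
  have hp : ∀ n, n ≤ a + a' + a₁ → (1 + |t|) ^ n ≤ (1 + |t|) ^ (a + a' + a₁) := fun n hn =>
    pow_le_pow_right₀ (by linarith [abs_nonneg t]) hn
  set P := (1 + |t|) ^ (a + a' + a₁)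
  have hP : 0 ≤ P := by positivity
  rcases lt_or_ge ‖l‖ (min ε 1) with h | h
  · have hl1 : ‖l‖ < 1 := h.trans_le (min_le_right _ _)
    have hw : wt l ≤ 2 := by
      have : √√(min ‖l‖ 1) ≤ 1 := Real.sqrt_le_one.mpr (Real.sqrt_le_one.mpr (min_le_right _ _))
      calc wt l ≤ 1 * (1 + 1) := by unfold wt; gcongr
        _ = 2 := by norm_num
    have h2 : ‖φ l t‖ ≤ |c| * P + C' * P * ‖Complex.log (-l)‖ := by
      have e : φ l t = (φ l t + f t * Complex.log (-l)) - f t * Complex.log (-l) := by ring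
      rw [e]
      refine (norm_sub_le _ _).trans (add_le_add ((h0 l hl (h.trans_le (min_le_left _ _)) t).trans ?_) ?_)
      · exact mul_le_mul (le_abs_self c) (hp a (by omega)) (by positivity) (abs_nonneg c)
      · rw [norm_mul]
        gcongr
        exact (hb' t).trans (mul_le_mul_of_nonneg_left (hp a' (by omega)) hC')
    calc wt l * ‖φ l t‖ ≤ wt l * (|c| * P + C' * P * ‖Complex.log (-l)‖) :=
          mul_le_mul_of_nonneg_left h2 (wt_nonneg l)
      _ = wt l * (|c| * P) + C' * P * (wt l * ‖Complex.log (-l)‖) := by ring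
      _ ≤ 2 * (|c| * P) + C' * P * 24 := by
        gcongr
        exact wt_mul_norm_log_le hl1
      _ ≤ _ := by nlinarith [mul_nonneg (abs_nonneg c₁) hP]
  · have hw : wt l ≤ 1 + ‖l‖ := by
      have : √√(min ‖l‖ 1) ≤ 1 := Real.sqrt_le_one.mpr (Real.sqrt_le_one.mpr (min_le_right _ _))
      calc wt l ≤ 1 * (1 + ‖l‖) := by unfold wt; gcongr
        _ = _ := one_mul _
    have h2 : ‖φ l t‖ ≤ |c₁| / (1 + ‖l‖) * P := (h1 l hl h t).trans (by
      refine mul_le_mul ?_ (hp a₁ (by omega)) (by positivity) (by positivity)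
      gcongr
      exact le_abs_self c₁)
    calc wt l * ‖φ l t‖ ≤ (1 + ‖l‖) * (|c₁| / (1 + ‖l‖) * P) := by gcongr
      _ = |c₁| * P := by field_simp
      _ ≤ _ := by nlinarith [mul_nonneg (abs_nonneg c) hP, mul_nonneg hC' hP]

lemma Tame.sub {φ ψ : ℂ → ℝ → ℂ} (hφ : Tame σ φ) (hψ : Tame σ ψ) :
    Tame σ fun l t => φ l t - ψ l t := by
  obtain ⟨C, a, hC, hb⟩ := hφ.bound
  obtain ⟨C', a', hC', hb'⟩ := hψ.bound
  refine ⟨fun t => (hφ.differentiableOn t).sub (hψ.differentiableOn t), fun l hl =>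
    (hφ.measurable l hl).sub (hψ.measurable l hl), C + C', a + a', by positivity, fun l hl t => ?_⟩
  calc _ ≤ wt l * (‖φ l t‖ + ‖ψ l t‖) := by gcongr; exacts [wt_nonneg l, norm_sub_le _ _]
    _ = wt l * ‖φ l t‖ + wt l * ‖ψ l t‖ := mul_add _ _ _
    _ ≤ C * (1 + |t|) ^ a + C' * (1 + |t|) ^ a' := add_le_add (hb l hl t) (hb' l hl t)
    _ ≤ C * (1 + |t|) ^ (a + a') + C' * (1 + |t|) ^ (a + a') := by
      have : (1 : ℝ) ≤ 1 + |t| := by linarith [abs_nonneg t]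
      gcongr <;> first | exact this | omega
    _ = _ := by ring

/-- Two factors cost two weights, and the square of `wt` is comparable to √‖l‖ at the origin, the
weight allowed in `eq_zero_of_boundary_values`. This is why `wt` carries a fourth root. -/
lemma Tame.norm_mul_le {φ ψ : ℂ → ℝ → ℂ} (hφ : Tame σ φ) (hψ : Tame σ ψ) :
    ∃ (C : ℝ) (a : ℕ), 0 ≤ C ∧ ∀ l ∈ cutᶜ, ∀ t, wt l ^ 2 * ‖φ l t * ψ l t‖ ≤ C * (1 + |t|) ^ a := by
  obtain ⟨C, a, hC, hb⟩ := hφ.bound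
  obtain ⟨C', a', hC', hb'⟩ := hψ.bound
  refine ⟨C * C', a + a', by positivity, fun l hl t => ?_⟩
  calc _ = (wt l * ‖φ l t‖) * (wt l * ‖ψ l t‖) := by rw [norm_mul]; ring
    _ ≤ (C * (1 + |t|) ^ a) * (C' * (1 + |t|) ^ a') :=
      mul_le_mul (hb l hl t) (hb' l hl t) (mul_nonneg (wt_nonneg l) (norm_nonneg _)) (by positivity)
    _ = _ := by ring

lemma exists_wt_lower {z : ℂ} (hz : z ≠ 0) : ∃ w > 0, ∃ δ > 0, ∀ l, ‖l - z‖ ≤ δ → w ≤ wt l := by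
  have hpos : 0 < wt z := by
    have : 0 < ‖z‖ := norm_pos_iff.mpr hz
    unfold wt
    positivity
  obtain ⟨δ, hδ, hb⟩ := Metric.eventually_nhds_iff.mp
    (continuous_wt.continuousAt.eventually (lt_mem_nhds (half_lt_self hpos)) : ∀ᶠ l in 𝓝 z, _)
  exact ⟨wt z / 2, by positivity, δ / 2, by positivity, fun l hl =>
    (hb (by rw [dist_eq_norm]; linarith)).le⟩

/-- Away from 0 the weight is locally bounded below, which gives one σ-integrable dominating
function both for holomorphy and for the passage to boundary values. -/
lemma Tame.integral (hσ : FiniteMoments σ) {φ ψ : ℂ → ℝ → ℂ} (hφ : Tame σ φ) (hψ : Tame σ ψ) :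
    DifferentiableOn ℂ (fun l => ∫ t, φ l t * ψ l t ∂σ) cutᶜ ∧
    (∃ C, 0 ≤ C ∧ ∀ l ∈ cutᶜ, wt l ^ 2 * ‖∫ t, φ l t * ψ l t ∂σ‖ ≤ C) ∧
    ∀ (z : ℝ), 0 < z → ∀ U ⊆ cutᶜ, ∀ φb ψb : ℝ → ℂ,
      (∀ t, Tendsto (fun l : ℂ => φ l t) (𝓝[U] (z : ℂ)) (𝓝 (φb t))) →
      (∀ t, Tendsto (fun l : ℂ => ψ l t) (𝓝[U] (z : ℂ)) (𝓝 (ψb t))) →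
      Tendsto (fun l => ∫ t, φ l t * ψ l t ∂σ) (𝓝[U] (z : ℂ)) (𝓝 (∫ t, φb t * ψb t ∂σ)) := by
  obtain ⟨C, a, hC, hb⟩ := hφ.norm_mul_le hψ
  have hi : Integrable (fun t : ℝ => C * (1 + |t|) ^ a) σ := (hσ a).const_mul C
  have hloc : ∀ z : ℂ, z ≠ 0 → ∃ δ > 0, ∃ g : ℝ → ℝ, Integrable g σ ∧ ∀ t, ∀ l ∈ cutᶜ,
      ‖l - z‖ ≤ δ → ‖φ l t * ψ l t‖ ≤ g t := by
    intro z hz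
    obtain ⟨w, hw, δ, hδ, h⟩ := exists_wt_lower hz
    refine ⟨δ, hδ, fun t => (w ^ 2)⁻¹ * (C * (1 + |t|) ^ a), hi.const_mul _, fun t l hl hlz => ?_⟩
    beta_reduce
    rw [← div_eq_inv_mul, le_div_iff₀ (by positivity), mul_comm]
    refine le_trans ?_ (hb l hl t)
    have := h l hlz
    gcongr
  refine ⟨?_, ⟨∫ t, C * (1 + |t|) ^ a ∂σ, integral_nonneg fun t => by positivity, fun l hl => ?_⟩, ?_⟩
  · refine differentiableOn_integral isClosed_cut.isOpen_compl (fun l hl =>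
      (hφ.measurable l hl).mul (hψ.measurable l hl)) (Eventually.of_forall fun t =>
        (hφ.differentiableOn t).mul (hψ.differentiableOn t)) fun z hz => ?_
    obtain ⟨δ, hδ, g, hg, h⟩ := hloc z (by rintro rfl; exact hz ⟨by simp, by simp⟩)
    exact ⟨δ, hδ, g, hg, Eventually.of_forall h⟩
  · have e : wt l ^ 2 * ‖∫ t, φ l t * ψ l t ∂σ‖ = ‖∫ t, ((wt l ^ 2 : ℝ) : ℂ) * (φ l t * ψ l t) ∂σ‖ := by
      rw [integral_const_mul, norm_mul, Complex.norm_real, Real.norm_of_nonneg (by positivity)]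
    rw [e]
    refine norm_integral_le_of_norm_le hi (Eventually.of_forall fun t => ?_)
    rw [norm_mul, Complex.norm_real, Real.norm_of_nonneg (by positivity)]
    exact hb l hl t
  · intro z hz U hU φb ψb h1 h2
    obtain ⟨δ, hδ, g, hg, h⟩ := hloc z (by exact_mod_cast hz.ne')
    have hball : ∀ᶠ l : ℂ in 𝓝[U] (z : ℂ), ‖l - z‖ ≤ δ := by
      filter_upwards [mem_nhdsWithin_of_mem_nhds (Metric.closedBall_mem_nhds (z : ℂ) hδ)] with l hl
      rwa [← dist_eq_norm]
    refine tendsto_integral_filter_of_dominated_convergence g ?_ ?_ hg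
      (Eventually.of_forall fun t => (h1 t).mul (h2 t))
    · filter_upwards [self_mem_nhdsWithin] with l hl
      exact (hφ.measurable l (hU hl)).mul (hψ.measurable l (hU hl))
    · filter_upwards [self_mem_nhdsWithin, hball] with l hl hl'
      exact Eventually.of_forall fun t => h t l (hU hl) hl'

/-- Boundary values of tame families grow polynomially. -/
lemma Tame.polyFun {φ : ℂ → ℝ → ℂ} (hφ : Tame σ φ) {ε : ℝ} (hε : ε = 1 ∨ ε = -1) {z : ℝ}
    (hz : 0 < z) {φb : ℝ → ℂ} (hm : AEStronglyMeasurable φb σ)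
    (h : ∀ t, Tendsto (fun l => φ l t) (𝓝[sideSet ε] (z : ℂ)) (𝓝 (φb t))) : PolyFun σ φb := by
  obtain ⟨C, a, hC, hb⟩ := hφ.bound
  have hz0 : (z : ℂ) ≠ 0 := by exact_mod_cast hz.ne'
  obtain ⟨w, hw, δ, hδ, h'⟩ := exists_wt_lower hz0
  have hwz : 0 < wt z := hw.trans_le (h' z (by simpa using hδ.le))
  refine ⟨hm, C / wt z, a, by positivity, fun t => ?_⟩
  have := neBot_sideSet hε z
  have ht := ((continuous_wt.tendsto (z : ℂ)).mono_left nhdsWithin_le_nhds).mul (h t).norm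
  have := le_of_tendsto ht (by
    filter_upwards [self_mem_nhdsWithin] with l hl using hb l (sideSet_subset ε hl) t)
  rw [div_mul_eq_mul_div, le_div_iff₀ hwz, mul_comm]
  exact this

lemma tame_of_solves {s : ℝ} {K : ℂ → Ker} (hK : SolvesHilbertProblem σ s K) (x : ℝ) (i j : Fin 2) :
    Tame σ fun l t => K l x t i j := by
  obtain ⟨-, hd, hHS⟩ := hK.analytic
  obtain ⟨f, -, ε, hε, c, a, h0⟩ := hK.origin
  refine tame_of_bounds (fun t => (hd x t i j).differentiableOn)
    (fun l hl => ((hHS l hl i j).2.1 x).1) (f := fun t => (sgn j * f i x) * airyFam s j 0 0 t)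
    ?_ hε (c := c * (1 + |x|) ^ a) (a := a) (fun l hl hlε t => ?_) fun r hr => ?_
  · obtain ⟨hc, C, b, hC, hb⟩ := polyGrowth_airyFam s j 0
    refine ⟨continuous_const.mul hc, ‖sgn j * f i x‖ * C, b, by positivity, fun t => ?_⟩
    rw [norm_mul, mul_assoc]
    gcongr
    simpa [airyFam] using hb t
  · have := h0 l hl hlε x t i j
    rwa [k_eq] at this
  · obtain ⟨c, a, h⟩ := hK.infinity r hr
    refine ⟨c * (1 + |x|) ^ a, a, fun l hl hlr t => (h l hl hlr x t i j).trans (le_of_eq ?_)⟩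
    ring

lemma tame_Xinv₀ (hσ : FiniteMoments σ) (s y : ℝ) (i j : Fin 2) :
    Tame σ fun l t => Xinv₀ σ s l t y i j := by
  have hA := decayFamily_airyFam s (1 - i)
  have hR := decayFamily_resFam hσ s j
  obtain ⟨c, a, hc, h0⟩ := norm_cKer_add_le hA hR
  refine tame_of_bounds (fun t => ?_) (fun l hl => ((polyKer_Xinv₀ hσ s hl i j).right y).1)
    (f := fun t => (-sgn j * resFam σ s j 0 0 y) * airyFam s (1 - i) 0 0 t) ?_ one_pos
    (c := c * (1 + |y|) ^ a) (a := a) (fun l hl hlε t => ?_) fun r hr => ?_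
  · simp only [Xinv₀_eq hσ]
    exact (differentiableOn_cKer hA hR t y).const_mul _
  · obtain ⟨hc, C, b, hC, hb⟩ := polyGrowth_airyFam s (1 - i) 0
    refine ⟨continuous_const.mul hc, ‖-sgn j * resFam σ s j 0 0 y‖ * C, b, by positivity, fun t => ?_⟩
    rw [norm_mul, mul_assoc]
    gcongr
    simpa [airyFam] using hb t
  · have e : Xinv₀ σ s l t y i j + -sgn j * resFam σ s j 0 0 y * airyFam s (1 - i) 0 0 t *
        Complex.log (-l) = -sgn j * (cKer (airyFam s (1 - i)) (resFam σ s j) l t y +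
          airyFam s (1 - i) 0 0 t * resFam σ s j 0 0 y * Complex.log (-l)) := by rw [Xinv₀_eq hσ]; ring
    rw [e, norm_mul, norm_neg, norm_sgn, one_mul]
    exact (h0 l hl hlε t y).trans (le_of_eq (by ring))
  · obtain ⟨c, a, hc, h⟩ := norm_cKer_le hA hR hr
    refine ⟨c * (1 + |y|) ^ a, a, fun l hl hlr t => ?_⟩
    rw [Xinv₀_eq hσ, norm_mul, norm_neg, norm_sgn, one_mul]
    exact (h l hl hlr t y).trans (le_of_eq (by ring))

end AiryLax
end

/-! ### The difference of two solutions of the Hilbert problem. -/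

noncomputable section
namespace AiryLax

variable {σ : Measure ℝ} [IsProbabilityMeasure σ] {Z : Set ℂ}

set_option linter.unusedSectionVars false

lemma comp_add_left {S S' T : KerOp} (h : ∀ x y, MatIntegrable σ fun t => S.2 x t * T.2 t y)
    (h' : ∀ x y, MatIntegrable σ fun t => S'.2 x t * T.2 t y) :
    comp σ (S + S') T = comp σ S T + comp σ S' T := by
  refine Prod.ext (funext fun x => add_mul _ _ _) (funext fun x => funext fun y => ?_)
  have e : matInt σ (fun t => (S + S').2 x t * T.2 t y) =
      matInt σ (fun t => S.2 x t * T.2 t y) + matInt σ fun t => S'.2 x t * T.2 t y := by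
    rw [← matInt_add (h x y) (h' x y)]
    congr 1
    funext t
    exact add_mul _ _ _
  change _ = (comp σ S T).2 x y + (comp σ S' T).2 x y
  rw [comp_snd, comp_snd, comp_snd, e, Prod.fst_add, Prod.snd_add]
  simp only [Pi.add_apply]
  rw [add_mul, add_mul]
  abel

lemma zero_comp (T : KerOp) : comp σ 0 T = 0 := by
  refine Prod.ext (funext fun x => zero_mul _) (funext fun x => funext fun y => ?_)
  rw [comp_snd]
  ext i j
  simp [matInt]

lemma comp_kernel_onePlus (hσ : FiniteMoments σ) {D L : Ker} {x y : ℝ} (hD : PolyMat σ (D x))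
    (hL : PolyMat σ fun t => L t y) (i j : Fin 2) :
    (comp σ ((0, D) : KerOp) (onePlus L)).2 x y i j =
      D x y i j + (∫ t, D x t i 0 * L t y 0 j ∂σ) + ∫ t, D x t i 1 * L t y 1 j ∂σ := by
  rw [comp_snd, add_assoc (D x y i j),
    ← integral_add (((hD i 0).mul (hL 0 j)).integrable hσ) (((hD i 1).mul (hL 1 j)).integrable hσ)]
  simp [onePlus, matInt, Matrix.mul_apply, Fin.sum_univ_two]

lemma polyKer_G₀ (s z : ℝ) (i j : Fin 2) : PolyKer fun x y => G₀ s z x y i j := by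
  have h := (((PolyKer.fst (polyGrowth_airyFam s (1 - i) z)).mul
    (PolyKer.snd (polyGrowth_airyFam s j z))).const_mul (sgn j)).const_mul (2 * Real.pi * Complex.I)
  refine (congrArg PolyKer (funext fun x => funext fun y => ?_)).mpr h
  simp only [G₀, Matrix.of_apply, m_eq, k_eq]
  ring

/-- The solution of the Hilbert boundary value problem is unique. -/
lemma SolvesHilbertProblem.eq_X₀ (hσ : FiniteMoments σ) {s : ℝ} {K : ℂ → Ker}
    (hK : SolvesHilbertProblem σ s K) {l : ℂ} (hl : l ∈ cutᶜ) : K l = X₀ σ s l := by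
  have hX := solvesHilbertProblem_X₀ hσ s
  set D : ℂ → Ker := fun l => K l - X₀ σ s l with hDdef
  have hT : ∀ x i j, Tame σ fun l t => D l x t i j := fun x i j =>
    (tame_of_solves hK x i j).sub (tame_of_solves hX x i j)
  have hI := fun y i j => tame_Xinv₀ hσ s y i j
  have hDpoly : ∀ l ∈ cutᶜ, ∀ x, PolyMat σ (D l x) := by
    intro l hl x i j
    obtain ⟨C, a, hC, hb⟩ := (hT x i j).bound
    refine ⟨(hT x i j).measurable l hl, C / wt l, a, div_nonneg hC (wt_nonneg l), fun t => ?_⟩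
    rw [div_mul_eq_mul_div, le_div_iff₀ (wt_pos hl), mul_comm]
    exact hb l hl t
  -- the difference of the boundary values satisfies the jump relation
  have hjump : ∀ z : ℝ, 0 < z → ∃ Dp Dm : Ker, IsBoundaryValue D (sideSet (-1)) z Dp ∧
      IsBoundaryValue D (sideSet 1) z Dm ∧ (∀ x, PolyMat σ (Dp x)) ∧ (∀ x, PolyMat σ (Dm x)) ∧
      ((0, Dp) : KerOp) = comp σ (0, Dm) (onePlus (G₀ s z)) := by
    intro z hz
    obtain ⟨Xp, Xm, -, h⟩ := hK.jump
    obtain ⟨hp, hm, hbp, hbm, hj⟩ := h z hz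
    rw [upper_eq] at hbp
    rw [lower_eq] at hbm
    have hz0 : (z : ℂ) ≠ 0 := by exact_mod_cast hz.ne'
    have hXS := fun ε hε i j => polyKer_XSide hσ s (ε := ε) hε hz0 i j
    -- The Hilbert–Schmidt condition serves for the measurability of the boundary values; their
    -- polynomial growth is inherited from the weighted bound off the contour by `Tame.polyFun`.
    have hpoly : ∀ ε, ε = 1 ∨ ε = -1 → ∀ Xb : Ker, IsHS σ Xb →
        IsBoundaryValue K (sideSet ε) z Xb →
        IsBoundaryValue D (sideSet ε) z (Xb - XSide σ s ε z) ∧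
          ∀ x, PolyMat σ ((Xb - XSide σ s ε z) x) := by
      intro ε hε Xb hHS hb
      have h1 : IsBoundaryValue D (sideSet ε) z (Xb - XSide σ s ε z) := fun x y i j =>
        (hb x y i j).sub (isBoundaryValue_XSide hσ s hε hz x y i j)
      refine ⟨h1, fun x i j => (hT x i j).polyFun hε hz ?_ fun t => h1 x t i j⟩
      exact (((hHS i j).2.1 x).1).sub (((hXS ε hε i j).left x).1)
    obtain ⟨hp1, hp2⟩ := hpoly (-1) (Or.inr rfl) (Xp z) hp hbp
    obtain ⟨hm1, hm2⟩ := hpoly 1 (Or.inl rfl) (Xm z) hm hbm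
    refine ⟨_, _, hp1, hm1, hp2, hm2, ?_⟩
    have e : ∀ (Y : Ker) (ε : ℝ), onePlus Y = onePlus (XSide σ s ε z) + (0, Y - XSide σ s ε z) := by
      intro Y ε
      refine Prod.ext (add_zero _).symm ?_
      exact (add_sub_cancel _ _).symm
    have hG : ∀ y, PolyMat σ fun t => G₀ s z t y := fun y i j => (polyKer_G₀ s z i j).right y
    rw [e (Xp z) (-1), e (Xm z) 1, comp_add_left, ← XSide_jump hσ s hz] at hj
    · exact add_left_cancel hj
    · exact fun x y => (PolyMat.mul (fun i j => (hXS 1 (Or.inl rfl) i j).left x) (hG y)).integrable hσ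
    · exact fun x y => ((hm2 x).mul (hG y)).integrable hσ
  -- D X⁻¹ has no jump: D₊X₊⁻¹ = D₋ G X₊⁻¹ = D₋X₋⁻¹. Each entry then vanishes by
  -- `eq_zero_of_boundary_values`, and composing with X gives D = 0.
  have hW : ∀ x y i j, (comp σ ((0, D l) : KerOp) (Xinv σ s l)).2 x y i j = 0 := by
    intro x y i j
    obtain ⟨hd0, ⟨C0, hC0, hb0⟩, ht0⟩ := (hT x i 0).integral hσ (hI y 0 j)
    obtain ⟨hd1, ⟨C1, hC1, hb1⟩, ht1⟩ := (hT x i 1).integral hσ (hI y 1 j)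
    obtain ⟨C2, a, hC2, hb2⟩ := (hT x i j).bound
    set W : ℂ → ℂ := fun l => D l x y i j + (∫ t, D l x t i 0 * Xinv₀ σ s l t y 0 j ∂σ) +
      ∫ t, D l x t i 1 * Xinv₀ σ s l t y 1 j ∂σ with hWdef
    have hWl : (comp σ ((0, D l) : KerOp) (Xinv σ s l)).2 x y i j = W l :=
      comp_kernel_onePlus hσ (hDpoly l hl x) (fun i j => (polyKer_Xinv₀ hσ s hl i j).right y) i j
    rw [hWl]
    have hn : ∀ l, ‖W l‖ ≤ ‖D l x y i j‖ + ‖∫ t, D l x t i 0 * Xinv₀ σ s l t y 0 j ∂σ‖ +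
        ‖∫ t, D l x t i 1 * Xinv₀ σ s l t y 1 j ∂σ‖ := fun l => norm_add₃_le
    refine eq_zero_of_boundary_values (C := C2 * (1 + |y|) ^ a + C0 + C1)
      ((((hT x i j).differentiableOn y).add hd0).add hd1) (fun z hz => ?_)
      (fun l hl hl1 => ?_) (fun l hl hl1 => ?_) hl
    · obtain ⟨Dp, Dm, hbp, hbm, hpp, hpm, hj⟩ := hjump z hz
      have hz0 : (z : ℂ) ≠ 0 := by exact_mod_cast hz.ne'
      have hXi := fun ε hε i j => polyKer_XinvSide hσ s (ε := ε) hε hz0 i j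
      have hlim : ∀ ε, ε = 1 ∨ ε = -1 → ∀ Db : Ker, IsBoundaryValue D (sideSet ε) z Db →
          (∀ x, PolyMat σ (Db x)) → Tendsto W (𝓝[sideSet ε] (z : ℂ))
            (𝓝 ((comp σ ((0, Db) : KerOp) (onePlus (XinvSide σ s ε z))).2 x y i j)) := by
        intro ε hε Db hb hp
        rw [comp_kernel_onePlus hσ (hp x) fun i j => (hXi ε hε i j).right y]
        have hv := isBoundaryValue_XinvSide hσ s hε hz
        exact ((hb x y i j).add (ht0 z hz _ (sideSet_subset ε) (fun t => Db x t i 0)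
          (fun t => XinvSide σ s ε z t y 0 j) (fun t => hb x t i 0) fun t => hv t y 0 j)).add
            (ht1 z hz _ (sideSet_subset ε) (fun t => Db x t i 1)
              (fun t => XinvSide σ s ε z t y 1 j) (fun t => hb x t i 1) fun t => hv t y 1 j)
      have h1 := hlim (-1) (Or.inr rfl) Dp hbp hpp
      have h2 := hlim 1 (Or.inl rfl) Dm hbm hpm
      rw [hj, comp_assoc hσ hpm (polyOp_onePlus (polyKer_G₀ s z))
        (polyOp_onePlus (hXi (-1) (Or.inr rfl))), XinvSide_jump hσ s hz] at h1
      exact ⟨_, by rw [upper_eq]; exact h1, by rw [lower_eq]; exact h2⟩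
    · have hw : √√‖l‖ ≤ wt l := by
        rw [wt, min_eq_left hl1.le]
        exact le_mul_of_one_le_right (by positivity) (by linarith [norm_nonneg l])
      have hle : √√‖l‖ ≤ 1 := Real.sqrt_le_one.mpr (Real.sqrt_le_one.mpr hl1.le)
      have h2 : √‖l‖ ≤ wt l ^ 2 := by
        rw [← Real.sq_sqrt (Real.sqrt_nonneg ‖l‖)]
        gcongr
      have h3 : √‖l‖ ≤ wt l := by
        refine le_trans ?_ hw
        nlinarith [Real.sq_sqrt (Real.sqrt_nonneg ‖l‖), Real.sqrt_nonneg √‖l‖]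
      calc √‖l‖ * ‖W l‖ ≤ √‖l‖ * ‖D l x y i j‖ + √‖l‖ * ‖∫ t, D l x t i 0 * Xinv₀ σ s l t y 0 j ∂σ‖ +
            √‖l‖ * ‖∫ t, D l x t i 1 * Xinv₀ σ s l t y 1 j ∂σ‖ := by
            rw [← mul_add, ← mul_add]; gcongr; exact hn l
        _ ≤ wt l * ‖D l x y i j‖ + wt l ^ 2 * ‖∫ t, D l x t i 0 * Xinv₀ σ s l t y 0 j ∂σ‖ +
            wt l ^ 2 * ‖∫ t, D l x t i 1 * Xinv₀ σ s l t y 1 j ∂σ‖ := by gcongr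
        _ ≤ _ := add_le_add (add_le_add (hb2 l hl y) (hb0 l hl)) (hb1 l hl)
    · have hw : wt l = 1 + ‖l‖ := by rw [wt, min_eq_right hl1]; simp
      have h1 : wt l ≤ wt l ^ 2 := by
        rw [hw]; nlinarith [norm_nonneg l]
      rw [le_div_iff₀ (by positivity), ← hw, mul_comm]
      calc wt l * ‖W l‖ ≤ wt l * ‖D l x y i j‖ + wt l * ‖∫ t, D l x t i 0 * Xinv₀ σ s l t y 0 j ∂σ‖ +
            wt l * ‖∫ t, D l x t i 1 * Xinv₀ σ s l t y 1 j ∂σ‖ := by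
            rw [← mul_add, ← mul_add]; gcongr; exacts [wt_nonneg l, hn l]
        _ ≤ wt l * ‖D l x y i j‖ + wt l ^ 2 * ‖∫ t, D l x t i 0 * Xinv₀ σ s l t y 0 j ∂σ‖ +
            wt l ^ 2 * ‖∫ t, D l x t i 1 * Xinv₀ σ s l t y 1 j ∂σ‖ := by gcongr
        _ ≤ _ := add_le_add (add_le_add (hb2 l hl y) (hb0 l hl)) (hb1 l hl)
  have h0 : comp σ ((0, D l) : KerOp) (Xinv σ s l) = 0 :=
    Prod.ext (funext fun x => zero_mul _)
      (funext fun x => funext fun y => Matrix.ext fun i j => hW x y i j)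
  have h1 := comp_assoc hσ (S := (0, D l)) (hDpoly l hl) (polyOp_Xinv hσ s hl) (polyOp_X hσ s hl)
  rw [h0, zero_comp, Xinv_comp_X hσ s hl, comp_one] at h1
  exact sub_eq_zero.mp (congrArg Prod.snd h1).symm

end AiryLax
end

noncomputable section
namespace AiryLax

variable {σ : Measure ℝ} [IsProbabilityMeasure σ] {Z : Set ℂ}

set_option linter.unusedSectionVars false

/-! ### The derivative of `X` -/

lemma coeFn_resOp_airySum (hσ : FiniteMoments σ) (e : ℕ) (s : ℝ) {φ : ℝ → ℂ} (hφ : PolyGrowth φ) :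
    resOp σ s (airySum σ s e φ) =ᵐ[halfLine] fun w : ℝ => ∫ t, φ t * resFun σ 0 e s w t ∂σ := by
  filter_upwards [coeFn_resOp hσ s (integrable_airySum hσ s e hφ).2] with w hw
  rw [hw, (hσ.admissible.integral_mul_resFun hσ e s hφ (hσ.admissible.real w)).2.2]

lemma coeFn_resOp_kerRow (hσ : FiniteMoments σ) (s : ℝ) :
    resOp σ s (kerRow σ 0 0 s 0) =ᵐ[halfLine] fun w : ℝ => resKer σ s w := by
  have h0 : (0 : ℂ) ∈ range ((↑) : ℝ → ℂ) := ⟨0, by simp⟩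
  filter_upwards [coeFn_resOp hσ s (hσ.admissible.coeFn_kerRow 0 0 h0 s)] with w hw
  rw [hw, resKer, kerVal_comm]

/-- w/(w - l) = 1 + l/(w - l), read in L². -/
lemma pair_mul_quot {l : ℂ} (hl : l ∈ cutᶜ) {F XF : HalfL2} (G : HalfL2)
    (h : XF =ᵐ[halfLine] fun w : ℝ => w * F w) :
    pair XF (quot l G) = l * pair F (quot l G) + pair F G := by
  have h1 : (XF - l • F : HalfL2) =ᵐ[halfLine] fun w : ℝ => (w - l) * F w := by
    filter_upwards [h, Lp.coeFn_sub XF (l • F), Lp.coeFn_smul l F] with w h1 h2 h3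
    rw [h2, Pi.sub_apply, h3, h1, Pi.smul_apply, smul_eq_mul]
    ring
  have h2 := pair_mul_left h1 (mul_quot hl G)
  simp only [map_sub, map_smul, _root_.sub_apply, _root_.smul_apply, smul_eq_mul] at h2
  linear_combination h2

lemma pair_quot_eq (hσ : FiniteMoments σ) (s : ℝ) (d e : ℕ) {l : ℂ} (hl : l ∈ cutᶜ) (x y : ℝ) :
    pair (resVec σ d s x) (quot l (airyL2 e (s + y))) =
      cKer (resFam σ s d) (airyFam s e) l x y := by
  rw [cKer_res_airy hσ s d e hl, pair_quot_comm hl, pair_comm]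

lemma pair_airySum_quot (hσ : FiniteMoments σ) (s : ℝ) (d e : ℕ) {l : ℂ} (hl : l ∈ cutᶜ) (y : ℝ)
    {φ : ℝ → ℂ} (hφ : PolyGrowth φ) :
    pair (resOp σ s (airySum σ s d φ)) (quot l (airyL2 e (s + y))) =
      ∫ t, φ t * cKer (resFam σ s d) (airyFam s e) l t y ∂σ := by
  have := clm_airySum hσ s d hφ ((pair.flip (quot l (airyL2 e (s + y)))).comp (resOp σ s))
  simp only [ContinuousLinearMap.comp_apply, ContinuousLinearMap.flip_apply] at this
  rw [this]
  refine integral_congr_ae (Eventually.of_forall fun t => ?_)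
  simp only
  rw [← pair_quot_eq hσ s d e hl t y, resVec]

lemma airyL2_two_sub (c : ℝ) : (airyL2 2 c - (c : ℂ) • airyL2 0 c : HalfL2) =ᵐ[halfLine]
    fun w : ℝ => w * airyL2 0 c w := by
  filter_upwards [Lp.coeFn_sub (airyL2 2 c) ((c : ℂ) • airyL2 0 c),
    Lp.coeFn_smul (c : ℂ) (airyL2 0 c), coeFn_airyL2 2 c, coeFn_airyL2 0 c] with w h1 h2 h3 h4
  rw [h1, Pi.sub_apply, h2, Pi.smul_apply, h3, h4, airyD_two, smul_eq_mul]
  ring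

/-- The Airy equation in the second variable. -/
lemma cKer_res_airy_two (hσ : FiniteMoments σ) (s : ℝ) (d : ℕ) {l : ℂ} (hl : l ∈ cutᶜ) (x y : ℝ) :
    cKer (resFam σ s d) (airyFam s 2) l x y =
      (l + (s + y)) * cKer (resFam σ s d) (airyFam s 0) l x y + resPair σ d 0 s x y := by
  have h := pair_mul_quot hl (resVec σ d s x) (airyL2_two_sub (s + y))
  simp only [map_sub, map_smul, _root_.sub_apply, _root_.smul_apply, smul_eq_mul] at h
  rw [cKer_res_airy hσ s d 2 hl, cKer_res_airy hσ s d 0 hl, pair_comm, resPair,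
    pair_comm (quot l _), pair_comm (resVec _ _ _ _)]
  push_cast at h
  linear_combination h

/-- The equation in the first variable. -/
lemma cKer_res_two_airy (hσ : FiniteMoments σ) (s : ℝ) (e : ℕ) {l : ℂ} (hl : l ∈ cutᶜ) (x y : ℝ) :
    cKer (resFam σ s 2) (airyFam s e) l x y =
      (l + (s + x)) * cKer (resFam σ s 0) (airyFam s e) l x y + resPair σ 0 e s x y -
        (∫ t, resPair σ 0 1 s x t * cKer (resFam σ s 0) (airyFam s e) l t y ∂σ) +
        ∫ t, resPair σ 0 0 s x t * cKer (resFam σ s 1) (airyFam s e) l t y ∂σ := by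
  have h1 := polyGrowth_resPair (σ := σ) 0 1 s x
  have h2 := polyGrowth_resPair (σ := σ) 0 0 s x
  -- `Admissible.mul_resFun` on the half line, read as an identity in L² for w times the resolvent
  -- vector; pairing it with a quotient then uses `pair_mul_quot`.
  have h : (resVec σ 2 s x - ((s + x : ℝ) : ℂ) • resVec σ 0 s x +
      (resOp σ s (airySum σ s 0 (resPair σ 0 1 s x)) -
        resOp σ s (airySum σ s 1 (resPair σ 0 0 s x))) : HalfL2) =ᵐ[halfLine]
      fun w : ℝ => w * resVec σ 0 s x w := by
    filter_upwards [Lp.coeFn_add (resVec σ 2 s x - ((s + x : ℝ) : ℂ) • resVec σ 0 s x)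
      (resOp σ s (airySum σ s 0 (resPair σ 0 1 s x)) -
        resOp σ s (airySum σ s 1 (resPair σ 0 0 s x))),
      Lp.coeFn_sub (resVec σ 2 s x) (((s + x : ℝ) : ℂ) • resVec σ 0 s x),
      Lp.coeFn_sub (resOp σ s (airySum σ s 0 (resPair σ 0 1 s x)))
        (resOp σ s (airySum σ s 1 (resPair σ 0 0 s x))),
      Lp.coeFn_smul ((s + x : ℝ) : ℂ) (resVec σ 0 s x), coeFn_resVec hσ 2 s x,
      coeFn_resVec hσ 0 s x, coeFn_resOp_airySum hσ 0 s h1, coeFn_resOp_airySum hσ 1 s h2]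
      with w e1 e2 e3 e4 e5 e6 e7 e8
    rw [e1, Pi.add_apply, e2, e3, Pi.sub_apply, Pi.sub_apply, e4, Pi.smul_apply, e5, e6, e7, e8,
      smul_eq_mul, hσ.admissible.mul_resFun hσ (hσ.admissible.real w)]
    push_cast
    ring
  have h' := pair_mul_quot hl (airyL2 e (s + y)) h
  simp only [map_add, map_sub, map_smul, _root_.sub_apply, _root_.add_apply, _root_.smul_apply,
    smul_eq_mul, pair_quot_eq hσ s _ e hl, pair_airySum_quot hσ s _ e hl y h1,
    pair_airySum_quot hσ s _ e hl y h2] at h'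
  rw [resPair]
  push_cast at h'
  linear_combination h'

lemma polyGrowth_resFun_zero (hσ : FiniteMoments σ) (d : ℕ) (s : ℝ) :
    PolyGrowth fun t => resFun σ 0 d s 0 t := by
  obtain ⟨C, a, hC, hb⟩ := norm_resFun_le hσ 0 d 0 s
  refine ⟨?_, C, a, hC, fun t => by simpa using hb t 0 le_rfl⟩
  have h := (decayFamily_resFam hσ s d).continuous_right 0 0
  simpa only [resFam, Complex.ofReal_zero] using h

/-- The derivative in the first variable. -/
lemma cKer_res_tail (hσ : FiniteMoments σ) (s : ℝ) (d e : ℕ) {l : ℂ} (hl : l ∈ cutᶜ) (x y : ℝ) :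
    l * cKer (fun n => resFam σ s d (n + 1)) (airyFam s e) l x y =
      l * (cKer (resFam σ s (d + 1)) (airyFam s e) l x y -
        ∫ t, resPair σ d 0 s x t * cKer (resFam σ s 0) (airyFam s e) l t y ∂σ) +
      resFun σ 0 d s 0 x *
        ((∫ t, resFun σ 0 1 s 0 t * cKer (resFam σ s 0) (airyFam s e) l t y ∂σ) -
          (∫ t, resFun σ 0 0 s 0 t * cKer (resFam σ s 1) (airyFam s e) l t y ∂σ) -
          (resFun σ 0 e s 0 y - airyD e (s + y : ℝ))) := by
  have h0 := polyGrowth_resPair (σ := σ) d 0 s x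
  have hg := fun d => polyGrowth_resFun_zero hσ d s
  set Rk := resOp σ s (kerRow σ 0 0 s 0) with hRk
  -- the derivative as an element of `L²`
  have h1 : (fun w : ℝ => resFun σ 1 d s w x) =ᵐ[halfLine] (resVec σ (d + 1) s x -
      resOp σ s (airySum σ s 0 (resPair σ d 0 s x)) + resFun σ 0 d s 0 x • Rk : HalfL2) := by
    filter_upwards [Lp.coeFn_add (resVec σ (d + 1) s x -
        resOp σ s (airySum σ s 0 (resPair σ d 0 s x))) (resFun σ 0 d s 0 x • Rk),
      Lp.coeFn_sub (resVec σ (d + 1) s x) (resOp σ s (airySum σ s 0 (resPair σ d 0 s x))),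
      Lp.coeFn_smul (resFun σ 0 d s 0 x) Rk, coeFn_resVec hσ (d + 1) s x,
      coeFn_resOp_airySum hσ 0 s h0, coeFn_resOp_kerRow hσ s] with w e1 e2 e3 e4 e5 e6
    rw [e1, Pi.add_apply, e2, Pi.sub_apply, e3, Pi.smul_apply, e4, e5, e6, smul_eq_mul,
      hσ.admissible.resFun_one hσ d s x (hσ.admissible.real w)]
  have h2 : cKer (fun n => resFam σ s d (n + 1)) (airyFam s e) l x y =
      pair (resVec σ (d + 1) s x - resOp σ s (airySum σ s 0 (resPair σ d 0 s x)) +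
        resFun σ 0 d s 0 x • Rk) (quot l (airyL2 e (s + y))) := by
    have hq : quot l (airyL2 e (s + y)) =ᵐ[halfLine]
        fun w : ℝ => airyD e (w + (s + y : ℝ)) / (w - l) := by
      filter_upwards [coeFn_quot hl (airyL2 e (s + y)), coeFn_airyL2 e (s + y)] with w h1 h2
      rw [h1, h2]
    rw [pair_eq h1.symm hq]
    refine integral_congr_ae (Eventually.of_forall fun w => ?_)
    simp only [prodFam, resFam, airyFam, Matrix.cons_val_zero, add_zero, zero_add]
    ring
  -- The term R K(·,0) of the derivative becomes explicit after multiplication by w, by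
  -- `Admissible.mul_resKer`. This is the reason for the factor l in the statement and the source of
  -- the 1/l in A.
  have h3 : (resOp σ s (airySum σ s 0 fun t => resFun σ 0 1 s 0 t) -
      resOp σ s (airySum σ s 1 fun t => resFun σ 0 0 s 0 t) : HalfL2) =ᵐ[halfLine]
      fun w : ℝ => w * Rk w := by
    filter_upwards [Lp.coeFn_sub (resOp σ s (airySum σ s 0 fun t => resFun σ 0 1 s 0 t))
      (resOp σ s (airySum σ s 1 fun t => resFun σ 0 0 s 0 t)),
      coeFn_resOp_airySum hσ 0 s (hg 1), coeFn_resOp_airySum hσ 1 s (hg 0),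
      coeFn_resOp_kerRow hσ s] with w e1 e2 e3 e4
    rw [e1, Pi.sub_apply, e2, e3, e4, hσ.admissible.mul_resKer hσ (hσ.admissible.real w)]
  have h4 := pair_mul_quot hl (airyL2 e (s + y)) h3
  have h5 : pair Rk (airyL2 e (s + y)) = resFun σ 0 e s 0 y - airyD e (s + y : ℝ) := by
    rw [hRk, pair_resOp hσ, resFun, zero_add, add_zero, add_sub_cancel_left]; rfl
  rw [h2]
  simp only [map_add, map_sub, map_smul, _root_.sub_apply, _root_.add_apply, _root_.smul_apply,
    smul_eq_mul, pair_quot_eq hσ s _ e hl, pair_airySum_quot hσ s _ e hl y h0,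
    pair_airySum_quot hσ s _ e hl y (hg 0), pair_airySum_quot hσ s _ e hl y (hg 1), h5] at h4 ⊢
  linear_combination -resFun σ 0 d s 0 x * h4

lemma cKer_airy_tail (s : ℝ) (p : ℕ → ℝ → ℝ → ℂ) (e : ℕ) (l : ℂ) (x y : ℝ) :
    cKer p (fun n => airyFam s e (n + 1)) l x y = cKer p (airyFam s (e + 1)) l x y := by
  simp only [cKer, prodFam, airyFam, Matrix.cons_val_zero, add_zero, zero_add]

end AiryLax
end

noncomputable section
namespace AiryLax

variable {σ : Measure ℝ} [IsProbabilityMeasure σ] {Z : Set ℂ}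

set_option linter.unusedSectionVars false

/-! ### The operators `A₀`, `A₋₁` and `Y` -/

lemma integral_n_mul_k (hσ : FiniteMoments σ) (s : ℝ) (i j : Fin 2) (x y : ℝ) :
    IntegrableOn (fun w : ℝ => n σ s i w x * k s j w y) (Ioi 0) ∧
    ∫ w in Ioi (0 : ℝ), n σ s i w x * k s j w y = resPair σ (1 - i) j s x y := by
  simp only [n_eq hσ, k_eq]
  exact ⟨(memLp_resFun hσ 0 _ s x).integrable_mul (memLp_airyD _ (s + y : ℝ)),
    (pair_eq (coeFn_resVec hσ _ s x) (coeFn_airyL2 _ (s + y))).symm⟩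

lemma A₀_snd (hσ : FiniteMoments σ) (s x y : ℝ) : (A₀ σ s).2 x y =
    !![resPair σ 0 0 s x y, -(resPair σ 0 1 s x y + resPair σ 1 0 s x y); 0, -resPair σ 0 0 s x y] := by
  have h := fun i j => integral_n_mul_k hσ s i j x y
  have h1 := integral_add (h 1 1).1 (h 0 0).1
  rw [(h 1 1).2, (h 0 0).2] at h1
  have h2 := (h 1 0).2
  simp only [A₀]
  rw [h1, h2]
  simp

lemma Am₁_snd (hσ : FiniteMoments σ) (s x y : ℝ) (i j : Fin 2) : (Am₁ σ s).2 x y i j =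
    -sgn j * (resFun σ 0 (1 - i) s 0 x * resFun σ 0 j s 0 y) := by
  simp only [Am₁, Matrix.of_apply, n_eq hσ, ell_eq hσ, Complex.ofReal_zero]
  ring

lemma polyKer_resPair (d e : ℕ) (s : ℝ) : PolyKer (resPair σ d e s) := by
  obtain ⟨C, a, hC, hb⟩ := norm_clm_resVec_le (σ := σ) d s
  obtain ⟨C', a', hC', hb'⟩ := norm_airyL2_add_le e s
  have hc : Continuous fun p : ℝ × ℝ => resPair σ d e s p.1 p.2 := by
    have h1 : Continuous fun p : ℝ × ℝ => pair (resVec σ d s p.1) :=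
      pair.continuous.comp ((continuous_resVec d s).comp continuous_fst)
    exact h1.clm_apply ((continuous_airyL2 e).comp (by fun_prop))
  refine ⟨hc.measurable, ‖pair‖ * C * C', a + a', by positivity, fun x y => ?_⟩
  refine (norm_pair_le _ _).trans ?_
  calc _ ≤ ‖pair‖ * (C * (1 + |x|) ^ a) * (C' * (1 + |y|) ^ a') := by
        gcongr; exacts [hb x, hb' y]
    _ ≤ ‖pair‖ * (C * (1 + |x|) ^ (a + a')) * (C' * (1 + |y|) ^ (a + a')) := by
        have h1 : (1 : ℝ) ≤ 1 + |x| := by linarith [abs_nonneg x]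
        have h2 : (1 : ℝ) ≤ 1 + |y| := by linarith [abs_nonneg y]
        gcongr <;> first | exact h1 | exact h2 | omega
    _ = _ := by ring

lemma polyKer_A₀ (hσ : FiniteMoments σ) (s : ℝ) (i j : Fin 2) :
    PolyKer fun x y => (A₀ σ s).2 x y i j := by
  have h := fun d e => polyKer_resPair (σ := σ) d e s
  have h0 : PolyKer fun _ _ => (0 : ℂ) := PolyKer.const 0
  have hn : PolyKer fun x y => -resPair σ 0 0 s x y := by simpa using (h 0 0).const_mul (-1)
  have hn' : PolyKer fun x y => -(resPair σ 0 1 s x y + resPair σ 1 0 s x y) := by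
    simpa using ((h 0 1).add (h 1 0)).const_mul (-1)
  simp only [A₀_snd hσ]
  fin_cases i <;> fin_cases j
  exacts [h 0 0, hn', h0, hn]

lemma polyKer_Am₁ (hσ : FiniteMoments σ) (s : ℝ) (i j : Fin 2) :
    PolyKer fun x y => (Am₁ σ s).2 x y i j := by
  simp only [Am₁_snd hσ]
  exact ((PolyKer.fst (polyGrowth_resFun_zero hσ _ s)).mul
    (PolyKer.snd (polyGrowth_resFun_zero hσ _ s))).const_mul _

lemma A_snd (s : ℝ) (z : ℂ) (x y : ℝ) :
    (A σ s z).2 x y = (A₀ σ s).2 x y + z⁻¹ • (Am₁ σ s).2 x y := by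
  simp [A, A₁]

lemma A_fst (s : ℝ) (z : ℂ) (x : ℝ) : (A σ s z).1 x = !![0, z + (s + x); 1, 0] := by
  ext i j
  fin_cases i <;> fin_cases j <;> simp [A, A₀, A₁, Am₁]

lemma polyKer_A (hσ : FiniteMoments σ) (s : ℝ) (z : ℂ) (i j : Fin 2) :
    PolyKer fun x y => (A σ s z).2 x y i j := by
  simp only [A_snd]
  exact (polyKer_A₀ hσ s i j).add ((polyKer_Am₁ hσ s i j).const_mul _)

lemma polyOp_spectral (s : ℝ) (z : ℂ) : PolyOp (z • A₁ + A₂ s) := by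
  refine ⟨fun i j => ?_, fun i j => ?_⟩
  · have h0 : ∀ c : ℂ, PolyKer fun _ _ => c := PolyKer.const
    have h1 : PolyKer fun x _ => z + (s + x : ℂ) := by
      refine (h0 z).add ((h0 s).add (PolyKer.fst ⟨Complex.continuous_ofReal, 1, 1, zero_le_one,
        fun t => ?_⟩))
      simp
    fin_cases i <;> fin_cases j <;> simp [A₁, A₂, h0, h1]
  · have : (fun x y => (z • A₁ + A₂ s).2 x y i j) = fun _ _ => 0 := by
      funext x y; simp [A₁, A₂]
    rw [this]
    exact PolyKer.const 0

lemma spectral_fst (s : ℝ) (z : ℂ) (x : ℝ) : (z • A₁ + A₂ s).1 x = !![0, z + (s + x); 1, 0] := by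
  ext i j
  fin_cases i <;> fin_cases j <;> simp [A₁, A₂]

lemma spectral_snd (s : ℝ) (z : ℂ) : (z • A₁ + A₂ s).2 = 0 := by simp [A₁, A₂]

lemma hasDerivAt_X₀ (hσ : FiniteMoments σ) (s : ℝ) {l : ℂ} (hl : l ∈ cutᶜ) (x y : ℝ) (i j : Fin 2) :
    HasDerivAt (fun l => X₀ σ s l x y i j)
      (sgn j * (-(resFun σ 0 (1 - i) s 0 x * airyD j (s + y : ℝ) / l) +
        (cKer (fun n => resFam σ s (1 - i) (n + 1)) (airyFam s j) l x y +
          cKer (resFam σ s (1 - i)) (airyFam s (j + 1)) l x y))) l := by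
  simp only [X₀_eq hσ]
  have h := (hasDerivAt_cKer (decayFamily_resFam hσ s (1 - i)) (decayFamily_airyFam s j) hl x y).const_mul
    (sgn j)
  rw [cKer_airy_tail] at h
  simpa only [resFam, airyFam, Complex.ofReal_zero, zero_add, add_zero] using h

lemma Xz_snd (hσ : FiniteMoments σ) (s : ℝ) {l : ℂ} (hl : l ∈ cutᶜ) (x y : ℝ) (i j : Fin 2) :
    (Xz σ s l).2 x y i j =
      sgn j * (-(resFun σ 0 (1 - i) s 0 x * airyD j (s + y : ℝ) / l) +
        (cKer (fun n => resFam σ s (1 - i) (n + 1)) (airyFam s j) l x y +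
          cKer (resFam σ s (1 - i)) (airyFam s (j + 1)) l x y)) :=
  (hasDerivAt_X₀ hσ s hl x y i j).deriv

lemma polyOp_Xz (hσ : FiniteMoments σ) (s : ℝ) {l : ℂ} (hl : l ∈ cutᶜ) : PolyOp (Xz σ s l) := by
  refine ⟨fun i j => PolyKer.const 0, fun i j => ?_⟩
  simp only [Xz_snd hσ s hl]
  have h := (((PolyKer.fst (polyGrowth_resFun_zero hσ (1 - i) s)).mul
    (PolyKer.snd (polyGrowth_airyD j s))).const_mul (-l⁻¹)).add
    ((polyKer_cKer (decayFamily_resFam hσ s (1 - i)).tail (decayFamily_airyFam s j) hl).add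
      (polyKer_cKer (decayFamily_resFam hσ s (1 - i)) (decayFamily_airyFam s (j + 1)) hl))
  refine (congrArg PolyKer (funext fun x => funext fun y => ?_)).mpr (h.const_mul (sgn j))
  ring

lemma integral_A_mul_X₀ (hσ : FiniteMoments σ) (s : ℝ) {l : ℂ} (hl : l ∈ cutᶜ) (x y : ℝ)
    (i j : Fin 2) : ∫ t, ((A σ s l).2 x t * X₀ σ s l t y) i j ∂σ =
      sgn j * (((∫ t, (A₀ σ s).2 x t i 0 * cKer (resFam σ s 1) (airyFam s j) l t y ∂σ) +
        ∫ t, (A₀ σ s).2 x t i 1 * cKer (resFam σ s 0) (airyFam s j) l t y ∂σ) +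
        l⁻¹ * resFun σ 0 (1 - i) s 0 x *
          ((∫ t, resFun σ 0 1 s 0 t * cKer (resFam σ s 0) (airyFam s j) l t y ∂σ) -
            ∫ t, resFun σ 0 0 s 0 t * cKer (resFam σ s 1) (airyFam s j) l t y ∂σ)) := by
  have hc := fun d => (polyKer_cKer (decayFamily_resFam hσ s d) (decayFamily_airyFam s j) hl).right
    (σ := σ) y
  have hA := fun k => (polyKer_A₀ hσ s i k).left (σ := σ) x
  have hg := fun d => (polyGrowth_resFun_zero hσ d s).polyFun (σ := σ)
  have e : ∀ t, ((A σ s l).2 x t * X₀ σ s l t y) i j = sgn j *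
      (((A₀ σ s).2 x t i 0 * cKer (resFam σ s 1) (airyFam s j) l t y +
        (A₀ σ s).2 x t i 1 * cKer (resFam σ s 0) (airyFam s j) l t y) +
      ((l⁻¹ * resFun σ 0 (1 - i) s 0 x) *
          (resFun σ 0 1 s 0 t * cKer (resFam σ s 0) (airyFam s j) l t y) +
        (-(l⁻¹ * resFun σ 0 (1 - i) s 0 x)) *
          (resFun σ 0 0 s 0 t * cKer (resFam σ s 1) (airyFam s j) l t y))) := by
    intro t
    simp only [Matrix.mul_apply, Fin.sum_univ_two, A_snd, Matrix.add_apply, Matrix.smul_apply,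
      Am₁_snd hσ, X₀_eq hσ, smul_eq_mul]
    simp [sgn]
    ring
  simp only [e]
  rw [integral_const_mul, integral_add_four (((hA 0).mul (hc 1)).integrable hσ)
    (((hA 1).mul (hc 0)).integrable hσ) ((((hg 1).mul (hc 0)).const_mul _).integrable hσ)
    ((((hg 0).mul (hc 1)).const_mul _).integrable hσ), integral_const_mul, integral_const_mul]
  ring

/-- The differential equation satisfied by `X`. -/
lemma Xz_add_eq (hσ : FiniteMoments σ) (s : ℝ) {l : ℂ} (hl : l ∈ cutᶜ) :
    Xz σ s l + comp σ (X σ s l) (l • A₁ + A₂ s) = comp σ (A σ s l) (X σ s l) := by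
  have hl0 : l ≠ 0 := by rintro rfl; exact hl ⟨by simp, by simp⟩
  refine Prod.ext (funext fun x => ?_) (funext fun x => funext fun y => ?_)
  · change 0 + 1 * (l • A₁ + A₂ s).1 x = (A σ s l).1 x * 1
    rw [spectral_fst, A_fst, zero_add, one_mul, mul_one]
  change (Xz σ s l).2 x y + (comp σ (X σ s l) (l • A₁ + A₂ s)).2 x y = _
  rw [comp_snd, comp_snd, spectral_snd, spectral_fst, A_fst, A_snd]
  have e1 : (matInt σ fun t => (X σ s l).2 x t * (0 : Ker) t y) = 0 := by
    ext i j; simp [matInt]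
  rw [e1]
  change _ + (1 * 0 + X₀ σ s l x y * _ + 0) = _ * X₀ σ s l x y + _ * 1 + matInt σ fun t =>
    (A σ s l).2 x t * X₀ σ s l t y
  rw [mul_zero, zero_add, add_zero, mul_one]
  have hc := fun d (j : Fin 2) => (polyKer_cKer (decayFamily_resFam hσ s d)
    (decayFamily_airyFam s j) hl).right (σ := σ) y
  have hr := fun d e => (polyGrowth_resPair (σ := σ) d e s x).polyFun (σ := σ)
  have h2 := fun e => cKer_res_two_airy hσ s e hl x y
  have ha := fun d => cKer_res_airy_two hσ s d hl x y
  have ht := fun d e => cKer_res_tail hσ s d e hl x y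
  have e01 : ∀ j : Fin 2, ∫ t, (A₀ σ s).2 x t 0 1 * cKer (resFam σ s 0) (airyFam s j) l t y ∂σ =
      -((∫ t, resPair σ 0 1 s x t * cKer (resFam σ s 0) (airyFam s j) l t y ∂σ) +
        ∫ t, resPair σ 1 0 s x t * cKer (resFam σ s 0) (airyFam s j) l t y ∂σ) := by
    intro j
    rw [← integral_add (((hr 0 1).mul (hc 0 j)).integrable hσ) (((hr 1 0).mul (hc 0 j)).integrable hσ),
      ← integral_neg]
    refine integral_congr_ae (Eventually.of_forall fun t => ?_)
    simp only [A₀_snd hσ]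
    simp
    ring
  have hrow : ∀ i j : Fin 2, (∫ t, (A₀ σ s).2 x t i 0 * cKer (resFam σ s 1) (airyFam s j) l t y ∂σ) +
      ∫ t, (A₀ σ s).2 x t i 1 * cKer (resFam σ s 0) (airyFam s j) l t y ∂σ =
      ![(∫ t, resPair σ 0 0 s x t * cKer (resFam σ s 1) (airyFam s j) l t y ∂σ) -
          ((∫ t, resPair σ 0 1 s x t * cKer (resFam σ s 0) (airyFam s j) l t y ∂σ) +
          ∫ t, resPair σ 1 0 s x t * cKer (resFam σ s 0) (airyFam s j) l t y ∂σ),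
        -∫ t, resPair σ 0 0 s x t * cKer (resFam σ s 0) (airyFam s j) l t y ∂σ] i := by
    refine Fin.forall_fin_two.mpr ⟨fun j => ?_, fun j => ?_⟩
    · rw [e01]
      simp only [A₀_snd hσ]
      simp [sub_eq_add_neg]
    · simp only [A₀_snd hσ]
      simp [integral_neg]
  ext i j
  have h3 := integral_A_mul_X₀ hσ s hl x y i j
  rw [hrow] at h3
  have ht' := ht (1 - i) j
  simp only [Matrix.add_apply, matInt, Matrix.of_apply, Matrix.smul_apply, Am₁_snd hσ, Xz_snd hσ s hl,
    h3, smul_eq_mul]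
  have ht'' : cKer (fun n => resFam σ s (1 - i) (n + 1)) (airyFam s j) l x y = _ :=
    eq_div_of_mul_eq hl0 ((mul_comm _ _).trans ht')
  rw [ht'']
  simp only [Matrix.mul_apply, Fin.sum_univ_two, X₀_eq hσ]
  revert i j
  -- Entries containing Ai'' or its resolvent are reduced by `ha` and `h2`, the forms of the Airy
  -- equation in the two variables; the rest is algebra.
  refine Fin.forall_fin_two.mpr ⟨Fin.forall_fin_two.mpr ⟨?_, ?_⟩, Fin.forall_fin_two.mpr ⟨?_, ?_⟩⟩ <;>
    intro _ _ _ <;>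
    simp only [A₀_snd hσ] <;>
    simp [sgn, h2, ha] <;>
    field_simp <;>
    ring

/-- `Y = A`. -/
lemma Y_eq_A (hσ : FiniteMoments σ) (s : ℝ) {l : ℂ} (hl : l ∈ cutᶜ) : Y σ s l = A σ s l := by
  have hX := polyOp_X hσ s hl
  have hI := polyOp_Xinv hσ s hl
  have hQ := polyOp_spectral s l
  have hint : ∀ {S : KerOp}, PolyOp S → ∀ x y, MatIntegrable σ fun t => S.2 x t * (Xinv σ s l).2 t y :=
    fun hS x y => (PolyMat.mul (fun i j => (hS.ker i j).left x)
      fun i j => (hI.ker i j).right y).integrable hσ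
  have hA : ∀ x, PolyMat σ fun t => (A σ s l).2 x t := fun x i j => (polyKer_A hσ s l i j).left x
  -- Y is (X_z + X(zA₁ + A₂))X⁻¹, which the differential equation for X turns into A X X⁻¹.
  rw [Y, ← comp_assoc hσ (fun x i j => (hX.ker i j).left x) hQ hI,
    ← comp_add_left (hint (polyOp_Xz hσ s hl)) (hint (hX.comp hσ hQ)), Xz_add_eq hσ s hl,
    comp_assoc hσ hA hX hI, X_comp_Xinv hσ s hl, comp_one]

lemma isAnalyticFamily_A (hσ : FiniteMoments σ) (s : ℝ) : IsAnalyticFamily σ {0}ᶜ (A σ s) := by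
  refine ⟨fun x i j => ?_, fun x y i j => ?_, fun z _ => isHS_of_polyKer hσ (polyKer_A hσ s z)⟩
  · simp only [A_fst]
    have h : AnalyticOnNhd ℂ (fun z : ℂ => z + (s + x)) {0}ᶜ := analyticOnNhd_id.add analyticOnNhd_const
    fin_cases i <;> fin_cases j
    exacts [analyticOnNhd_const, h, analyticOnNhd_const, analyticOnNhd_const]
  · simp only [A_snd, Matrix.add_apply, Matrix.smul_apply, smul_eq_mul]
    exact analyticOnNhd_const.add ((analyticOnNhd_id.inv fun z hz => hz).mul analyticOnNhd_const)

/-- n₁ and ℓ₂ coincide, as do n₂ and ℓ₁, so the product of the kernels cancels pointwise, before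
integration. -/
lemma Am₁_comp_Am₁ (hσ : FiniteMoments σ) (s : ℝ) : comp σ (Am₁ σ s) (Am₁ σ s) = 0 := by
  refine Prod.ext (funext fun x => zero_mul _) (funext fun x => funext fun y => ?_)
  have h : ∀ t, (Am₁ σ s).2 x t * (Am₁ σ s).2 t y = 0 := by
    intro t
    ext i j
    simp only [Matrix.mul_apply, Fin.sum_univ_two, Am₁_snd hσ]
    simp [sgn]
    ring
  rw [comp_snd]
  simp only [h]
  ext i j
  simp [matInt, Am₁]

/-- By the same coincidence the two diagonal entries agree on the diagonal up to sign. -/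
lemma trace_Am₁ (hσ : FiniteMoments σ) (s : ℝ) : trace σ (Am₁ σ s).2 = 0 := by
  simp only [trace, Fin.sum_univ_two, Am₁_snd hσ]
  simp [sgn, integral_neg, mul_comm]

end AiryLax
end

noncomputable section
namespace AiryLax

variable {σ : Measure ℝ} [IsProbabilityMeasure σ] {Z : Set ℂ}

set_option linter.unusedSectionVars false

/-! ### The Lax pair -/

lemma Admissible.integral_A₀_mulVec (hZ : Admissible σ Z) (hσ : FiniteMoments σ) (s : ℝ) {z : ℂ}
    (hz : z ∈ Z) (x : ℝ) (i : Fin 2) :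
    Integrable (fun t => ((A₀ σ s).2 x t *ᵥ N σ s z t) i) σ ∧
    ∫ t, ((A₀ σ s).2 x t *ᵥ N σ s z t) i ∂σ =
      ![(∫ t, resPair σ 0 0 s x t * resFun σ 0 1 s z t ∂σ) -
          (∫ t, resPair σ 0 1 s x t * resFun σ 0 0 s z t ∂σ) -
          ∫ t, resPair σ 1 0 s x t * resFun σ 0 0 s z t ∂σ,
        -∫ t, resPair σ 0 0 s x t * resFun σ 0 0 s z t ∂σ] i := by
  have h := fun d e k => (hZ.integral_mul_resFun hσ k s (polyGrowth_resPair (σ := σ) d e s x) hz).2.1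
  simp only [Matrix.mulVec, dotProduct, Fin.sum_univ_two, hZ.N_eq hσ s hz, A₀_snd hσ]
  revert i
  refine Fin.forall_fin_two.mpr ⟨?_, ?_⟩
  · have e : ∀ t, resPair σ 0 0 s x t * resFun σ 0 1 s z t +
        -(resPair σ 0 1 s x t + resPair σ 1 0 s x t) * resFun σ 0 0 s z t =
        resPair σ 0 0 s x t * resFun σ 0 1 s z t - resPair σ 0 1 s x t * resFun σ 0 0 s z t -
          resPair σ 1 0 s x t * resFun σ 0 0 s z t := fun t => by ring
    have h1 := integral_sub ((h 0 0 1).sub (h 0 1 0)) (h 1 0 0)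
    have h2 := integral_sub (h 0 0 1) (h 0 1 0)
    simp only [Pi.sub_apply] at h1
    rw [h2] at h1
    simp only [Matrix.of_apply, Matrix.cons_val_zero, Matrix.cons_val_one, Fin.val_zero, Fin.val_one,
      Nat.sub_zero, Nat.sub_self, e]
    exact ⟨((h 0 0 1).sub (h 0 1 0)).sub (h 1 0 0), h1⟩
  · have e : ∀ t, 0 * resFun σ 0 1 s z t + -resPair σ 0 0 s x t * resFun σ 0 0 s z t =
        -(resPair σ 0 0 s x t * resFun σ 0 0 s z t) := fun t => by ring
    simp only [Matrix.of_apply, Matrix.cons_val_zero, Matrix.cons_val_one, Fin.val_zero, Fin.val_one,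
      Nat.sub_zero, Nat.sub_self, e]
    exact ⟨(h 0 0 0).neg, integral_neg _⟩

lemma Admissible.integral_Am₁_mulVec (hZ : Admissible σ Z) (hσ : FiniteMoments σ) (s : ℝ) {z : ℂ}
    (hz : z ∈ Z) (x : ℝ) (i : Fin 2) :
    Integrable (fun t => ((Am₁ σ s).2 x t *ᵥ N σ s z t) i) σ ∧
    ∫ t, ((Am₁ σ s).2 x t *ᵥ N σ s z t) i ∂σ =
      resFun σ 0 (1 - i) s 0 x * (z * resKer σ s z) := by
  have h := fun d e => (hZ.integral_mul_resFun hσ e s (polyGrowth_resFun_zero hσ d s) hz).2.1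
  have e : ∀ t, ((Am₁ σ s).2 x t *ᵥ N σ s z t) i = resFun σ 0 (1 - i) s 0 x *
      (resFun σ 0 1 s 0 t * resFun σ 0 0 s z t - resFun σ 0 0 s 0 t * resFun σ 0 1 s z t) := by
    intro t
    simp only [Matrix.mulVec, dotProduct, Fin.sum_univ_two, hZ.N_eq hσ s hz, Am₁_snd hσ]
    simp [sgn]
    ring
  simp only [e]
  refine ⟨((h 1 0).sub (h 0 1)).const_mul _, ?_⟩
  rw [integral_const_mul, integral_sub (h 1 0) (h 0 1), hZ.mul_resKer hσ hz]

/-- The second component is immediate. In the first, the factor z + s + x of the multiplication part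
is removed by `Admissible.mul_resFun`, which brings in the resolvent of Ai''. Both components then
have the form of the s-derivative in `Admissible.hasDerivAt_resFun_param`. -/
lemma Admissible.apply_B (hZ : Admissible σ Z) (hσ : FiniteMoments σ) (s : ℝ) {z : ℂ}
    (hz : z ∈ Z) (x : ℝ) (i : Fin 2) : AiryLax.apply σ (B σ s z) (N σ s z) x i =
      resFun σ 0 (1 - i + 1) s z x - ∫ t, resPair σ (1 - i) 0 s x t * resFun σ 0 0 s z t ∂σ := by
  have h1 := (hZ.integral_A₀_mulVec hσ s hz x i).2
  have h2 := hZ.mul_resFun hσ hz s x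
  have e1 : ∀ y, (B σ s z).2 x y = (A₀ σ s).2 x y := fun y => by simp [B, A₁]
  have e2 : (B σ s z).1 x = !![0, z + (s + x); 1, 0] := by
    ext i j
    fin_cases i <;> fin_cases j <;> simp [B, A₀, A₁]
  simp only [AiryLax.apply, e1, e2]
  rw [h1]
  simp only [Matrix.mulVec, dotProduct, Fin.sum_univ_two, hZ.N_eq hσ s hz]
  clear h1
  revert i
  refine Fin.forall_fin_two.mpr ⟨?_, ?_⟩
  · simp
    linear_combination h2
  · simp
    ring

/-- A - B is A₋₁/z. By `Admissible.mul_resKer` it acts on N as n_i(0|x) times `resKer`, exactly the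
term by which the z-derivative in `Admissible.resFun_one` exceeds the s-derivative. -/
lemma Admissible.apply_A (hZ : Admissible σ Z) (hσ : FiniteMoments σ) (s : ℝ) {z : ℂ}
    (hz : z ∈ Z) (hz0 : z ≠ 0) (x : ℝ) (i : Fin 2) :
    AiryLax.apply σ (A σ s z) (N σ s z) x i = resFun σ 1 (1 - i) s z x := by
  obtain ⟨hi1, -⟩ := hZ.integral_A₀_mulVec hσ s hz x i
  obtain ⟨hi2, h2⟩ := hZ.integral_Am₁_mulVec hσ s hz x i
  have h3 : AiryLax.apply σ (A σ s z) (N σ s z) x i =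
      AiryLax.apply σ (B σ s z) (N σ s z) x i + resFun σ 0 (1 - i) s 0 x * resKer σ s z := by
    have e : ∀ y, ((A σ s z).2 x y *ᵥ N σ s z y) i =
        ((A₀ σ s).2 x y *ᵥ N σ s z y) i + z⁻¹ * ((Am₁ σ s).2 x y *ᵥ N σ s z y) i := fun y => by
      rw [A_snd, Matrix.add_mulVec, Matrix.smul_mulVec, Pi.add_apply, Pi.smul_apply, smul_eq_mul]
    have e1 : ∀ y, (B σ s z).2 x y = (A₀ σ s).2 x y := fun y => by simp [B, A₁]
    have e2 : (A σ s z).1 x = (B σ s z).1 x := by simp [A, B, Am₁]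
    simp only [AiryLax.apply, e, e1, e2]
    rw [integral_add hi1 (hi2.const_mul _), integral_const_mul, h2]
    field_simp
    ring
  rw [h3, hZ.apply_B hσ s hz, hZ.resFun_one hσ _ s x hz]

/-- A complex derivative needs the weights on a full neighbourhood of z, hence admissibility of the
whole plane. -/
lemma hasDerivAt_resFun (hZ : Admissible σ univ) (d : ℕ) (s x : ℝ) (z : ℂ) :
    HasDerivAt (fun z => resFun σ 0 d s z x) (resFun σ 1 d s z x) z := by
  have hk : HasDerivAt (fun z => kerRow σ 0 0 s z) (kerRow σ 1 0 s z) z := by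
    obtain ⟨h, hh, h0, hb⟩ := hZ.bound_airyL2 1 0 (max |s| (‖z‖ + 1))
    refine (hasDerivAt_integral_of_dominated_loc_of_deriv_le (μ := σ.prod halfLine)
      (s := Metric.ball z 1)
      (F := fun (q : ℂ) (p : ℝ × ℝ) =>
        airyD 0 (q + (s + p.1 + p.2 : ℝ)) • airyL2 0 (s + p.1 + p.2))
      (F' := fun (q : ℂ) (p : ℝ × ℝ) =>
        airyD 1 (q + (s + p.1 + p.2 : ℝ)) • airyL2 0 (s + p.1 + p.2))
      (bound := fun p => h p.1 * ((1 + p.2) ^ 2)⁻¹) (Metric.ball_mem_nhds z one_pos)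
      (Eventually.of_forall fun q => (hZ.integrable_smul 0 0 (mem_univ q) s).1)
      (hZ.integrable_smul 0 0 (mem_univ z) s) (hZ.integrable_smul 1 0 (mem_univ z) s).1 ?_
      (hh.mul_prod integrable_one_add_inv_sq) ?_).2
    · refine ae_prod_halfLine fun t u hu q hq => ?_
      refine hb _ (mem_univ q) (le_trans ?_ (le_max_right _ _)) s t u (le_max_left _ _) hu.le
      rw [Metric.mem_ball, dist_eq_norm] at hq
      have := norm_add_le (q - z) z
      rw [sub_add_cancel] at this
      linarith
    · exact Eventually.of_forall fun p q _ =>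
        ((hasDerivAt_airyD 0 (q + (s + p.1 + p.2 : ℝ))).comp_add_const q _).smul_const _
  exact ((hasDerivAt_airyD (d + 0) (z + (s + x : ℝ))).comp_add_const z _).add
    ((pair.flip (resVec σ d s x)).hasFDerivAt.comp_hasDerivAt z hk)

lemma Admissible.memLp_M_N (hZ : Admissible σ Z) (hσ : FiniteMoments σ) (s : ℝ) {z : ℂ}
    (hz : z ∈ Z) (i : Fin 2) :
    MemLp (fun x => M s z x i) 2 σ ∧ MemLp (fun x => N σ s z x i) 2 σ := by
  simp only [M, m_eq, hZ.N_eq hσ s hz]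
  exact ⟨hZ.memLp_airyD _ s hz, hZ.memLp_resFun hσ _ s hz⟩

lemma Admissible.hasDerivAt_N_param (hZ : Admissible σ Z) (hσ : FiniteMoments σ) (s : ℝ) {z : ℂ}
    (hz : z ∈ Z) (x : ℝ) (i : Fin 2) :
    HasDerivAt (fun r : ℝ => N σ r z x i) (AiryLax.apply σ (B σ s z) (N σ s z) x i) s := by
  rw [hZ.apply_B hσ s hz]
  simp only [hZ.N_eq hσ _ hz]
  exact hZ.hasDerivAt_resFun_param hσ (1 - i) s x hz

end AiryLax
end

/-! ### The main theorem. -/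

theorem mainTheorem5 (σ : Measure ℝ) [IsProbabilityMeasure σ] (hac : σ ≪ volume)
    (hmom : ∀ p : ℕ, Integrable (fun t : ℝ => |t| ^ p) σ) :
    -- for every `s`:
    (∀ s : ℝ,
      -- `n_i(·|x)` and `ℓ_j(·|y)` are the unique solutions of their integral equations
      (∀ i x, IsTheSolution σ s (fun w : ℝ => m s i w x) (fun w => n σ s i w x)) ∧
      (∀ j y, IsTheSolution σ s (fun w : ℝ => k s j w y) (fun w => ell σ s j w y)) ∧
      -- `X` is the unique solution of the Hilbert boundary value problem
      SolvesHilbertProblem σ s (X₀ σ s) ∧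
      (∀ X₀', SolvesHilbertProblem σ s X₀' → ∀ z ∈ cutᶜ, X₀' z = X₀ σ s z) ∧
      -- `Xinv` is its two-sided inverse, and all operators composed in `Y` are well defined
      (∀ z ∈ cutᶜ, comp σ (X σ s z) (Xinv σ s z) = onePlus 0 ∧
        comp σ (Xinv σ s z) (X σ s z) = onePlus 0 ∧
        IsHS σ (Xinv₀ σ s z) ∧ IsHS σ (Xz σ s z).2 ∧
        IsHS σ (comp σ (z • A₁ + A₂ s) (Xinv σ s z)).2) ∧
      -- `N(z) = X(z) M(z)` in `L²(σ) ⊕ L²(σ)`, for both boundary values of `X` on `(0, ∞)`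
      (∀ (z : ℝ) i, MemLp (fun x => M s z x i) 2 σ ∧ MemLp (fun x => N σ s z x i) 2 σ) ∧
      (∀ z : ℝ, 0 < z → ∀ Xb : Ker,
        IsBoundaryValue (X₀ σ s) upper z Xb ∨ IsBoundaryValue (X₀ σ s) lower z Xb →
        N σ s z = apply σ (onePlus Xb) (M s z)) ∧
      -- `Y` is (the restriction of) an analytic family on `ℂ ∖ {0}`, equal to `A`
      IsAnalyticFamily σ {0}ᶜ (A σ s) ∧
      (∀ z ∈ cutᶜ, Y σ s z = A σ s z) ∧
      IsHS σ (A₀ σ s).2 ∧ IsHS σ (Am₁ σ s).2 ∧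
      -- `A₋₁` is nilpotent and traceless
      comp σ (Am₁ σ s) (Am₁ σ s) = 0 ∧ trace σ (Am₁ σ s).2 = 0 ∧
      -- the Lax pair on the real line
      (∀ z : ℝ, z ≠ 0 → ∀ x i,
        HasDerivAt (fun r : ℝ => N σ s r x i) (apply σ (A σ s z) (N σ s z) x i) z) ∧
      (∀ (z : ℝ) x i,
        HasDerivAt (fun r : ℝ => N σ r z x i) (apply σ (B σ s z) (N σ s z) x i) s)) ∧
    -- the Lax pair in the complex plane, once `M(z)` lies in `L²(σ) ⊕ L²(σ)` for complex `z`
    ((∀ R : ℝ, Integrable (fun t : ℝ => Real.exp (R * √|t|)) σ) → ∀ s : ℝ,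
      (∀ (z : ℂ) i, MemLp (fun x => M s z x i) 2 σ ∧ MemLp (fun x => N σ s z x i) 2 σ) ∧
      (∀ z : ℂ, z ≠ 0 → ∀ x i,
        HasDerivAt (fun l : ℂ => N σ s l x i) (apply σ (A σ s z) (N σ s z) x i) z) ∧
      (∀ (z : ℂ) x i,
        HasDerivAt (fun r : ℝ => N σ r z x i) (apply σ (B σ s z) (N σ s z) x i) s)) := by
  have hσ := FiniteMoments.of_integrable hmom
  have hZ := hσ.admissible
  refine ⟨fun s => ⟨fun i x => ?_, fun j y => ?_, solvesHilbertProblem_X₀ hσ s,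
    fun K hK z hz => hK.eq_X₀ hσ hz, fun z hz => ⟨X_comp_Xinv hσ s hz, Xinv_comp_X hσ s hz,
      isHS_of_polyKer hσ (polyKer_Xinv₀ hσ s hz), isHS_of_polyKer hσ (polyOp_Xz hσ s hz).ker,
      isHS_of_polyKer hσ ((polyOp_spectral s z).comp hσ (polyOp_Xinv hσ s hz)).ker⟩,
    fun z i => hZ.memLp_M_N hσ s (hZ.real z) i, fun z hz Xb hb => N_eq_apply_boundary hσ s hz hb,
    isAnalyticFamily_A hσ s, fun z hz => Y_eq_A hσ s hz, isHS_of_polyKer hσ (polyKer_A₀ hσ s),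
    isHS_of_polyKer hσ (polyKer_Am₁ hσ s), Am₁_comp_Am₁ hσ s, trace_Am₁ hσ s,
    fun z hz x i => ?_, fun z x i => hZ.hasDerivAt_N_param hσ s (hZ.real z) x i⟩,
    fun he s => ?_⟩
  · simp only [m_eq, n_eq hσ]
    exact isTheSolution_resolve hσ _ s x
  · simp only [k_eq, ell_eq hσ]
    exact isTheSolution_resolve hσ _ s y
  · rw [hZ.apply_A hσ s (hZ.real z) (by exact_mod_cast hz)]
    simp only [hZ.N_eq hσ s (hZ.real _)]
    exact hasDerivAt_resFun_ofReal hσ 0 (1 - i) s x z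
  -- The exponential moments make all of ℂ admissible, and the lemmas used on the real line apply
  -- again.
  · have hU := hσ.admissible_univ he
    refine ⟨fun z i => hU.memLp_M_N hσ s (mem_univ z) i, fun z hz x i => ?_,
      fun z x i => hU.hasDerivAt_N_param hσ s (mem_univ z) x i⟩
    rw [hU.apply_A hσ s (mem_univ z) hz]
    simp only [hU.N_eq hσ s (mem_univ _)]
    exact hasDerivAt_resFun hU (1 - i) s x z
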